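/- **Setting.** Let $n\ge 2$ and consider the difference equation $w(z+n)+\sum_{k=0}^{n-1}f_k(z)w(z+k)=0$ with polynomial coefficients $f_k(z)=\sum_{m=0}^{n-k}f_{m,k}\,\Gamma(z+1)/\Gamma(z-n+k+m+1)$, $f_{0,0}\neq0$, and put $f_{0,n}=1$. Suppose that the roots $\lambda_1,\dots,\lambda_n$ of $\sum_{k=0}^n f_{0,n-k}\lambda^k=0$ are pairwise distinct, and that none of the numbers $$\mu_j=1-n+\frac{\sum_{k=1}^n f_{1,n-k}\lambda_j^k}{\sum_{k=0}^n k f_{0,n-k}\lambda_j^k}$$ is an integer. Fix a value of $\log\lambda_j$ for every $j$. Let $a_{0,j}\ne0$ and let $a_{s,j}$ be the coefficients of the formal solution $\lambda_j^{-z}\sum_{s\ge0}a_{s,j}\Gamma(z+\mu_j-s)$, that is, for $s\ge1$, $$s\prod_{\ell\ne j}\Big(1-\frac{\lambda_j}{\lambda_\ell}\Big)a_{s,j}=\sum_{m=2}^{\min(n,s+1)}a_{s-m+1,j}\sum_{k=1}^n\lambda_j^k\sum_{r=\max(0,m-k)}^m(-1)^r\frac{(-n-\mu_j+s-r+2)_r(m-k-r)_r}{r!}f_{m-r,n-k}.$$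 Let $a$ be the largest real part of a root of $f_0$. Let $\eta\in\mathbb R$ be admissible: $\eta\ne\arg(\lambda_\ell-\lambda_j)\bmod 2\pi$ for all $\ell\neq j$. Put $\lambda_{\ell,j}=\lambda_\ell-\lambda_j$ and $\arg\lambda_{\ell,j}=\theta_{j,\ell}\in(\eta-2\pi,\eta)$. *Borel transforms.* For $t$ near $\lambda_j$ put $y_j(t)=\sum_{s\ge0}a_{s,j}\Gamma(\mu_j-s)(1-t/\lambda_j)^{s-\mu_j}$, where $\log(1-t/\lambda_j)=\log(t-\lambda_j)+\pi\mathrm i-\log\lambda_j$. This function of $\log(t-\lambda_j)$ is continued analytically along the rays that start at $\lambda_j$, up to the first $\lambda_\ell$ on the ray. For $u\neq 0$ with $\frac\pi2-\eta<\arg u<\frac{3\pi}2-\eta$ let $$Y_j(u,\eta)=\frac1{2\pi\mathrm i}\int_{\gamma_j(\eta)}\mathrm e^{ut}y_j(t)\,\mathrm dt,$$ where $\gamma_j(\eta)$ comes in from infinity along $\arg(t-\lambda_j)=\eta-2\pi$, encircles $\lambda_j$ (but no other $\lambda_\ell$) once counter-clockwise, and returns to infinity along $\arg(t-\lambda_j)=\eta$.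 *Connection coefficients.* For $\ell\ne j$ let $K_{\ell,j}$ be the constant such that, near $t=\lambda_\ell$, $$y_j(t)=K_{\ell,j}\frac{2\pi\mathrm i}{\mathrm e^{2\pi\mathrm i\mu_j}-1}\,y_\ell(t)+(\text{a function analytic at }\lambda_\ell),$$ where $y_j$ is continued along the straight segment from $\lambda_j$ to $\lambda_\ell$, in the direction $\arg(t-\lambda_j)=\theta_{j,\ell}$ (any other $\lambda_p$ on the segment being passed on its right), and $y_\ell$ is taken on the branch $\theta_{j,\ell}-2\pi<\arg(t-\lambda_\ell)<\theta_{j,\ell}$. *Further notation.* Let $2\pi\mathrm i\,\Delta_{\lambda_\ell}y_\ell(t)=y_\ell(\lambda_\ell+t)-y_\ell(\lambda_\ell+t\mathrm e^{-2\pi\mathrm i})$; the values $\Delta_{\lambda_\ell}y_\ell(\lambda_{\ell,j}t)$, $t>0$, are obtained by continuation along the ray $\arg=\theta_{j,\ell}$ (a singularity on the ray, if there is one, being passed on its left). Let $F^{(1)}(z;M,1)=\int_0^{[\pi]}\frac{\mathrm e^{\tau}\tau^{M-1}}{z-\tau}\,\mathrm d\tau$ (integration along $\arg\tau=\pi$)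 for $|\arg z|<\pi$, $\operatorname{Re}M>1$, continued analytically to $|\arg z|<\frac{3\pi}2$. Define $\mathsf R_j(u,\eta;N)$, $N\ge0$, by $$Y_j(u,\eta)=\mathrm e^{\lambda_ju}u^{-1}\sum_{s=0}^{N-1}a_{s,j}(\lambda_ju\mathrm e^{-\pi\mathrm i})^{\mu_j-s}+\mathsf R_j(u,\eta;N).$$ **Statement.** Assume that $\theta_{j,\ell_1}\ne\theta_{j,\ell_2}$ whenever $\ell_1\neq\ell_2$ and $K_{\ell_1,j},K_{\ell_2,j}\ne0$, that $N-\operatorname{Re}\mu_j>\max(0,a)$, that $\operatorname{Re}\mu_\ell<1$ for all $\ell\neq j$ with $K_{\ell,j}\ne0$, and that $\frac\pi2-\eta<\arg u<\frac{3\pi}2-\eta$. Then: (i) with $(\lambda_{\ell,j}u)^{\mu_j-N}$ formed with the phase $\theta_{j,\ell}+\arg u$, $$|\mathsf R_j(u,\eta;N)|\le\left|\mathrm e^{\lambda_ju}u^{-1}\right|\sum_{\ell\ne j}|K_{\ell,j}|\left|(\lambda_{\ell,j}u)^{\mu_j-N}\right|\int_0^{+\infty}\frac{|\Delta_{\lambda_\ell}y_\ell(\lambda_{\ell,j}t)|}{(1+t)^{N-\operatorname{Re}\mu_j+1}}\,\mathrm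 dt\;\sup_{r>0}r\left|F^{(1)}\big(r\mathrm e^{\mathrm i(\theta_{j,\ell}+\arg u)};N-\mu_j+1,1\big)\right|$$ (an inequality in $[0,+\infty]$, in which terms with $K_{\ell,j}=0$ are zero); (ii) for every $\ell\neq j$ with $K_{\ell,j}\ne0$ the supremum is finite, and so is the integral if $\operatorname{Re}\mu_p<1$ for every $\lambda_p$ that lies beyond $\lambda_\ell$ on the ray from $\lambda_j$ through $\lambda_\ell$ (in particular, if there is no such $\lambda_p$); (iii) $K_{\ell,j}$ is related as follows to the plane $\mathcal P_\eta$, which is cut from every $\lambda_i$ to infinity in the direction $\eta$. Let $y_i(t,\eta)$ be the analytic continuation of $y_i$ to $\mathcal P_\eta$ that starts near $\lambda_i$ with $\eta-2\pi<\arg(t-\lambda_i)<\eta$. If the open segment from $\lambda_j$ to $\lambda_\ell$ meets no cut, then $$y_j(t,\eta)=\kappa\,\frac{2\pi\mathrm i}{\mathrm e^{2\pi\mathrm i\mu_j}-1}\,y_\ell(t,\eta)+(\text{a function analytic at }\lambda_\ell)$$ in $\mathcal P_\eta$ near $\lambda_\ell$, with $\kappa=K_{\ell,j}$ if $\eta-\pi<\theta_{j,\ell}$,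 and $\kappa=\mathrm e^{2\pi\mathrm i\mu_\ell}K_{\ell,j}$ if $\theta_{j,\ell}<\eta-\pi$. -/

import Mathlib

open Set Filter Topology MeasureTheory
open scoped ENNReal

noncomputable section

open Classical in
/-- The analytic continuation to `V` of a function `f` given on `U ⊆ V`. (It is only used for a
connected open `V` and a nonempty open `U`, where it is unique on `V`.) -/
def analyticContinuation (U V : Set ℂ) (f : ℂ → ℂ) : ℂ → ℂ :=
  if h : ∃ g : ℂ → ℂ, AnalyticOnNhd ℂ g V ∧ EqOn g f U then h.choose else 0

/-- The constant `μ_j` that belongs to the characteristic root `lam j`. -/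
def muOf (n : ℕ) (f : ℕ → ℕ → ℂ) (lam : Fin n → ℂ) (j : Fin n) : ℂ :=
  1 - (n : ℂ) +
    (∑ k ∈ Finset.Icc 1 n, f 1 (n - k) * lam j ^ k) /
      (∑ k ∈ Finset.range (n + 1), (k : ℂ) * f 0 (n - k) * lam j ^ k)

/-- The right-hand side of the recurrence for the coefficients `a_{s,j}`; here `a` is the sequence
`s ↦ a_{s,j}`, `l = λ_j`, `mu = μ_j`, and the Pochhammer symbols are rising factorials. -/
def recurrenceRHS (n : ℕ) (f : ℕ → ℕ → ℂ) (l mu : ℂ) (a : ℕ → ℂ) (s : ℕ) : ℂ :=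
  ∑ m ∈ Finset.Icc 2 (min n (s + 1)), a (s + 1 - m) *
    ∑ k ∈ Finset.Icc 1 n, l ^ k *
      ∑ r ∈ Finset.Icc (m - k) m,
        (-1) ^ r *
          ((ascPochhammer ℂ r).eval (-(n : ℂ) - mu + s - r + 2) *
            (ascPochhammer ℂ r).eval ((m : ℂ) - k - r)) / (r.factorial : ℂ) *
          f (m - r) (n - k)

/-- A difference equation `w(z+n) + ∑_{k<n} f_k(z) w(z+k) = 0` with polynomial coefficients
`f_k(z) = ∑_{m ≤ n-k} f m k · z(z-1)⋯(z-n+k+m+1)`, together with its characteristic roots `lam j`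
(pairwise distinct; `logLam j` is the chosen value of `log λ_j`), and the coefficients
`coeff j s = a_{s,j}` of its formal inverse factorial series solutions
`λ_j^{-z} ∑_s a_{s,j} Γ(z + μ_j - s)`. -/
structure InverseFactorialData (n : ℕ) where
  f : ℕ → ℕ → ℂ
  f_zero_zero : f 0 0 ≠ 0
  f_zero_top : f 0 n = 1
  lam : Fin n → ℂ
  lam_root : ∀ j, ∑ k ∈ Finset.range (n + 1), f 0 (n - k) * lam j ^ k = 0
  lam_injective : Function.Injective lam
  logLam : Fin n → ℂ
  exp_logLam : ∀ j, Complex.exp (logLam j) = lam j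
  mu_not_int : ∀ j, ∀ m : ℤ, muOf n f lam j ≠ m
  coeff : Fin n → ℕ → ℂ
  coeff_zero : ∀ j, coeff j 0 ≠ 0
  coeff_rec : ∀ j, ∀ s : ℕ, 1 ≤ s →
    (s : ℂ) * (∏ l ∈ Finset.univ.erase j, (1 - lam j / lam l)) * coeff j s =
      recurrenceRHS n f (lam j) (muOf n f lam j) (coeff j) s

namespace InverseFactorialData

variable {n : ℕ} (D : InverseFactorialData n)

/-- `μ_j`. -/
def mu (j : Fin n) : ℂ := muOf n D.f D.lam j

/-- The coefficient polynomial `f_0(z)` of the difference equation. -/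
def f0 (z : ℂ) : ℂ :=
  ∑ m ∈ Finset.range (n + 1), D.f m 0 * ∏ i ∈ Finset.range (n - m), (z - i)

/-- The number `a`: the largest real part of a root of `f_0`. -/
def growth : ℝ := sSup (Complex.re '' {z : ℂ | D.f0 z = 0})

/-- `η` is admissible: `η ≠ arg (λ_l - λ_i) mod 2π` for all `i ≠ l`. -/
def Admissible (η : ℝ) : Prop :=
  ∀ i l : Fin n, l ≠ i → ∀ k : ℤ, η ≠ Complex.arg (D.lam l - D.lam i) + 2 * Real.pi * k

/-- `θ_{j,l}`: the value of `arg (λ_l - λ_j)` in `(η - 2π, η]`; for an admissible `η` it lies in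
`(η - 2π, η)`. -/
def theta (η : ℝ) (j l : Fin n) : ℝ :=
  toIocMod Real.two_pi_pos (η - 2 * Real.pi) (Complex.arg (D.lam l - D.lam j))

/-- `log λ_{l,j} = log (λ_l - λ_j)` with `arg λ_{l,j} = θ_{j,l}`. -/
def logDiff (η : ℝ) (l j : Fin n) : ℂ :=
  (Real.log ‖D.lam l - D.lam j‖ : ℂ) + (D.theta η j l : ℂ) * Complex.I

/-! Multivalued functions of `t` near `λ_j` are written as functions of `w = log (t - λ_j)`, that
is, `t = λ_j + exp w` and `arg (t - λ_j) = Im w`. -/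

/-- The disc `|t - λ_j| < min_{l ≠ j} |λ_l - λ_j|`, in the variable `w`. -/
def disc (j : Fin n) : Set ℂ :=
  {w | ∀ l, l ≠ j → ‖Complex.exp w‖ < ‖D.lam l - D.lam j‖}

/-- The points `t` that are joined to `λ_j` by a straight segment that meets no other `λ_l`, in the
variable `w`: the cuts run from `λ_l`, `l ≠ j`, to infinity in the direction `λ_l - λ_j`. -/
def star (j : Fin n) : Set ℂ :=
  {w | ∀ l, l ≠ j → ∀ s : ℝ, 1 ≤ s → Complex.exp w ≠ (s : ℂ) * (D.lam l - D.lam j)}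

/-- The series `∑_s a_{s,j} Γ(μ_j - s) (1 - t/λ_j)^{s - μ_j}` that defines the Borel transform,
with `log (1 - t/λ_j) = log (t - λ_j) + π i - log λ_j`. -/
def borelSeries (j : Fin n) (w : ℂ) : ℂ :=
  ∑' s : ℕ, D.coeff j s * Complex.Gamma (D.mu j - s) *
    Complex.exp ((s - D.mu j) * (w + Real.pi * Complex.I - D.logLam j))

/-- The Borel transform `y_j(t)`, continued analytically from `λ_j` along straight segments, as a
function of `w = log (t - λ_j)`. -/
def borel (j : Fin n) : ℂ → ℂ :=
  analyticContinuation (D.disc j) (D.star j) (D.borelSeries j)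

/-- `Δ_{λ_j} y_j`, where `2π i Δ_{λ_j} y_j(t) = y_j(t + λ_j) - y_j((t + λ_j) e^{-2π i})` and the
rotation is about `λ_j`; a function of `w = log t`. -/
def delta (j : Fin n) (w : ℂ) : ℂ :=
  (D.borel j w - D.borel j (w - 2 * Real.pi * Complex.I)) / (2 * Real.pi * Complex.I)

/-- `Δ_{λ_l} y_l (λ_{l,j} t)` for `t > 0`, continued along the ray `arg = θ_{j,l}`; a singularity
on the ray, if there is one, is passed on its left. -/
def deltaRay (η : ℝ) (l j : Fin n) (t : ℝ) : ℂ :=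
  limUnder (𝓝[>] (0 : ℝ)) fun ε : ℝ =>
    D.delta l (D.logDiff η l j + (Real.log t : ℂ) + (ε : ℂ) * Complex.I)

/-- `K` is the coefficient in
`y_j(t) = K · 2π i / (e^{2π i μ_j} - 1) · y_l(t) + reg (t - λ_l)` near `t = λ_l`. Here `y_j` is
continued from `λ_j` along the segment to `λ_l` (another `λ_p` on the segment is passed on its
right), and `y_l` has the branch `θ_{j,l} - 2π < arg (t - λ_l) < θ_{j,l}`. The relation is stated on
the half disc to the right of the segment, with `w = log (t - λ_l)`; there
`log (t - λ_j) = log λ_{l,j} + log (1 + (t - λ_l) / λ_{l,j})`. -/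
def IsConnectionCoeff (η : ℝ) (l j : Fin n) (K : ℂ) : Prop :=
  ∃ reg : ℂ → ℂ, AnalyticAt ℂ reg 0 ∧ ∃ x₀ : ℝ, ∀ w : ℂ, w.re < x₀ →
    D.theta η j l - Real.pi < w.im → w.im < D.theta η j l →
      D.borel j (D.logDiff η l j + Complex.log (1 + Complex.exp (w - D.logDiff η l j))) =
        K * (2 * Real.pi * Complex.I /
            (Complex.exp (2 * Real.pi * Complex.I * D.mu j) - 1)) * D.borel l w +
          reg (Complex.exp w)

open Classical in
/-- The connection coefficient (Stokes multiplier) `K_{l,j}`. -/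
def connectionCoeff (η : ℝ) (l j : Fin n) : ℂ :=
  if h : ∃ K : ℂ, D.IsConnectionCoeff η l j K then h.choose else 0

/-- The plane `P_η`: it is cut from every `λ_i` to infinity in the direction `η`. -/
def cutPlane (η : ℝ) : Set ℂ :=
  {t | ∀ i : Fin n, ∀ s : ℝ, 0 ≤ s → t ≠ D.lam i + s * Complex.exp (η * Complex.I)}

/-- `y` is the Borel transform `y_j(t, η)` on `P_η`: it is analytic there, and near `λ_j` it is given
by its defining series with `η - 2π < arg (t - λ_j) < η`. -/
def IsBorelOnCutPlane (η : ℝ) (j : Fin n) (y : ℂ → ℂ) : Prop :=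
  AnalyticOnNhd ℂ y (D.cutPlane η) ∧
    ∀ᶠ t in 𝓝 (D.lam j), t ∈ D.cutPlane η →
      y t = D.borelSeries j ((Real.log ‖t - D.lam j‖ : ℂ) +
        ((toIocMod Real.two_pi_pos (η - 2 * Real.pi) (Complex.arg (t - D.lam j)) : ℝ) : ℂ) *
          Complex.I)

/-- `K` is the coefficient in
`y_j(t, η) = K · 2π i / (e^{2π i μ_j} - 1) · y_l(t, η) + reg (t - λ_l)` on `P_η` near `λ_l`. -/
def IsCutPlaneConnectionCoeff (η : ℝ) (l j : Fin n) (K : ℂ) : Prop :=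
  ∀ yj yl : ℂ → ℂ, D.IsBorelOnCutPlane η j yj → D.IsBorelOnCutPlane η l yl →
    ∃ reg : ℂ → ℂ, AnalyticAt ℂ reg (D.lam l) ∧
      ∀ᶠ t in 𝓝 (D.lam l), t ∈ D.cutPlane η →
        yj t = K * (2 * Real.pi * Complex.I /
          (Complex.exp (2 * Real.pi * Complex.I * D.mu j) - 1)) * yl t + reg t

/-- `Y_j(u, η) = (2π i)⁻¹ ∫_{γ_j(η)} e^{ut} y_j(t, η) dt`. The contour comes in from infinity along
`arg (t - λ_j) = η - 2π`, follows the circle `|t - λ_j| = ρ` counter-clockwise, and goes back to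
infinity along `arg (t - λ_j) = η`. -/
def Y (j : Fin n) (η ρ : ℝ) (u : ℂ) : ℂ :=
  let integrand : ℝ → ℝ → ℂ := fun x α =>
    Complex.exp (u * (D.lam j + x * Complex.exp (α * Complex.I))) *
      D.borel j ((Real.log x : ℂ) + α * Complex.I)
  (2 * Real.pi * Complex.I)⁻¹ *
    (-(∫ x in Ioi ρ, integrand x (η - 2 * Real.pi) *
        Complex.exp (((η - 2 * Real.pi : ℝ) : ℂ) * Complex.I)) +
      (∫ α in (η - 2 * Real.pi)..η, integrand ρ α *
        (Complex.I * ρ * Complex.exp (α * Complex.I))) +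
      ∫ x in Ioi ρ, integrand x η * Complex.exp (η * Complex.I))

/-- The remainder `R_j(u, η; N)` after `N` terms of the large-`u` expansion of `Y_j(u, η)`, where
`logu = log u` carries the phase of `u`. -/
def remainder (j : Fin n) (η ρ : ℝ) (N : ℕ) (logu : ℂ) : ℂ :=
  D.Y j η ρ (Complex.exp logu) -
    Complex.exp (D.lam j * Complex.exp logu) * (Complex.exp logu)⁻¹ *
      ∑ s ∈ Finset.range N, D.coeff j s *
        Complex.exp ((D.mu j - s) * (D.logLam j + logu - Real.pi * Complex.I))

/-- `∫_0^∞ |Δ_{λ_l} y_l(λ_{l,j} t)| / (1 + t)^{N - Re μ_j + 1} dt`. -/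
def deltaIntegral (η : ℝ) (N : ℕ) (l j : Fin n) : ℝ≥0∞ :=
  ∫⁻ t in Ioi (0 : ℝ),
    ‖D.deltaRay η l j t‖ₑ / ENNReal.ofReal ((1 + t) ^ ((N : ℝ) - (D.mu j).re + 1))

end InverseFactorialData

/-- The integral `∫_0^{[π]} e^τ τ^{M-1} / (z - τ) dτ` along `arg τ = π` (so `τ = x e^{π i}`,
`x > 0`), as a function of `w = log z`. -/
def hyperterminantIntegral (M w : ℂ) : ℂ :=
  ∫ x in Ioi (0 : ℝ),
    Complex.exp (-(x : ℂ)) * Complex.exp ((M - 1) * ((Real.log x : ℂ) + Real.pi * Complex.I)) /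
      (Complex.exp w + x) * (-1)

/-- The level-one hyperterminant `F^{(1)}(z; M, 1)`, as a function of `w = log z`: the integral for
`|arg z| < π`, and its analytic continuation for other phases, here up to `|arg z| < 3π/2`. -/
def hyperterminant (M : ℂ) : ℂ → ℂ :=
  analyticContinuation {w | |w.im| < Real.pi} {w | |w.im| < 3 * Real.pi / 2}
    (hyperterminantIntegral M)

/-- `sup_{r > 0} r |F^{(1)}(r e^{iφ}; M, 1)|`. -/
def hyperterminantSup (M : ℂ) (φ : ℝ) : ℝ≥0∞ :=
  ⨆ (r : ℝ) (_ : 0 < r),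
    ENNReal.ofReal r * ‖hyperterminant M ((Real.log r : ℂ) + φ * Complex.I)‖ₑ

end

open Complex Metric
open Real (exp_pos pi_pos two_pi_pos exp_le_exp log_lt_iff_lt_exp lt_log_iff_exp_lt)
open Finset (range sum_congr mul_sum sum_mul sum_nonneg sum_eq_zero)
open scoped Real

section LinearODE

variable {E : Type*} [NormedAddCommGroup E] [NormedSpace ℂ E]

/-- `Y` solves the linear differential equation `Y' = B Y` on `S`. -/
def SolvesLinear (B : ℂ → E →L[ℂ] E) (S : Set ℂ) (Y : ℂ → E) : Prop :=
  ∀ w ∈ S, HasDerivAt Y (B w (Y w)) w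

theorem SolvesLinear.mono {B : ℂ → E →L[ℂ] E} {S T : Set ℂ} {Y : ℂ → E}
    (h : SolvesLinear B T Y) (hST : S ⊆ T) : SolvesLinear B S Y := fun w hw => h w (hST hw)

theorem SolvesLinear.add {B : ℂ → E →L[ℂ] E} {S : Set ℂ} {Y Z : ℂ → E}
    (h : SolvesLinear B S Y) (h' : SolvesLinear B S Z) :
    SolvesLinear B S (fun w => Y w + Z w) := fun w hw => by
  rw [map_add]; exact (h w hw).add (h' w hw)

theorem SolvesLinear.sub {B : ℂ → E →L[ℂ] E} {S : Set ℂ} {Y Z : ℂ → E}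
    (h : SolvesLinear B S Y) (h' : SolvesLinear B S Z) :
    SolvesLinear B S (fun w => Y w - Z w) := fun w hw => by
  rw [map_sub]; exact (h w hw).sub (h' w hw)

theorem SolvesLinear.smul {B : ℂ → E →L[ℂ] E} {S : Set ℂ} {Y : ℂ → E} (c : ℂ)
    (h : SolvesLinear B S Y) : SolvesLinear B S (fun w => c • Y w) := fun w hw => by
  rw [map_smul]; exact (h w hw).const_smul c

theorem SolvesLinear.zero {B : ℂ → E →L[ℂ] E} {S : Set ℂ} :
    SolvesLinear B S (fun _ => (0 : E)) := fun w _ => by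
  simpa using hasDerivAt_const w (0 : E)

theorem SolvesLinear.sum {ι : Type*} {B : ℂ → E →L[ℂ] E} {S : Set ℂ} {Y : ι → ℂ → E}
    (s : Finset ι) (h : ∀ i ∈ s, SolvesLinear B S (Y i)) :
    SolvesLinear B S (fun w => ∑ i ∈ s, Y i w) := fun w hw => by
  have := HasDerivAt.fun_sum (u := s) (fun i hi => h i hi w hw)
  simpa [map_sum] using this

theorem SolvesLinear.differentiableOn {B : ℂ → E →L[ℂ] E} {S : Set ℂ} {Y : ℂ → E}
    (h : SolvesLinear B S Y) : DifferentiableOn ℂ Y S :=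
  fun w hw => (h w hw).differentiableAt.differentiableWithinAt

theorem hasDerivAt_comp_segment {f : ℂ → E} {f' : E} {w₀ w₁ : ℂ} {s : ℝ}
    (h : HasDerivAt f f' (w₀ + s * (w₁ - w₀))) :
    HasDerivAt (fun s : ℝ => f (w₀ + s * (w₁ - w₀))) ((w₁ - w₀) • f') s := by
  have h1 : HasDerivAt (fun s : ℝ => w₀ + s * (w₁ - w₀)) (w₁ - w₀) s := by
    simpa using ((ofRealCLM.hasDerivAt (x := s)).mul_const (w₁ - w₀)).const_add w₀
  exact HasDerivAt.scomp s h h1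

theorem segment_point_mem {U : Set ℂ} (hU : Convex ℝ U) {w₀ w₁ : ℂ} (h₀ : w₀ ∈ U) (h₁ : w₁ ∈ U)
    {s : ℝ} (hs : s ∈ Icc (0 : ℝ) 1) : w₀ + s * (w₁ - w₀) ∈ U := by
  have := hU.add_smul_sub_mem h₀ h₁ hs
  simpa [real_smul] using this

theorem SolvesLinear.eq_zero {B : ℂ → E →L[ℂ] E} {U : Set ℂ} (hU : Convex ℝ U)
    (hB : ContinuousOn B U) {Y : ℂ → E} (hY : SolvesLinear B U Y) {w₀ : ℂ} (h₀ : w₀ ∈ U)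
    (h : Y w₀ = 0) {w : ℂ} (hw : w ∈ U) : Y w = 0 := by
  have hseg : ContinuousOn (fun s : ℝ => B (w₀ + s * (w - w₀))) (Icc 0 1) :=
    hB.comp (by fun_prop) fun s hs => segment_point_mem hU h₀ hw hs
  obtain ⟨M, hM⟩ := isCompact_Icc.exists_bound_of_continuousOn hseg
  have key := eq_zero_of_abs_deriv_le_mul_abs_self_of_eq_zero_right
    (f := fun s : ℝ => Y (w₀ + s * (w - w₀)))
    (f' := fun s : ℝ => (w - w₀) • B (w₀ + s * (w - w₀)) (Y (w₀ + s * (w - w₀))))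
    (K := ‖w - w₀‖ * M) (a := 0) (b := 1)
    (fun s hs => ((hasDerivAt_comp_segment
      (hY _ (segment_point_mem hU h₀ hw hs))).continuousAt).continuousWithinAt)
    (fun s hs => (hasDerivAt_comp_segment
      (hY _ (segment_point_mem hU h₀ hw ⟨hs.1, hs.2.le⟩))).hasDerivWithinAt)
    (by simpa using h)
    (fun s hs => by
      rw [norm_smul, mul_assoc]
      gcongr
      exact (ContinuousLinearMap.le_opNorm _ _).trans (by gcongr; exact hM s ⟨hs.1, hs.2.le⟩))
  simpa using key 1 ⟨zero_le_one, le_rfl⟩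

theorem SolvesLinear.eqOn {B : ℂ → E →L[ℂ] E} {U : Set ℂ} (hU : Convex ℝ U)
    (hB : ContinuousOn B U) {Y Z : ℂ → E} (hY : SolvesLinear B U Y) (hZ : SolvesLinear B U Z)
    {w₀ : ℂ} (h₀ : w₀ ∈ U) (h : Y w₀ = Z w₀) : EqOn Y Z U := fun _ hw =>
  sub_eq_zero.1 ((hY.sub hZ).eq_zero hU hB h₀ (sub_eq_zero.2 h) hw)

variable [CompleteSpace E]

theorem exists_primitive_vanishing {U : Set ℂ} (hU : Convex ℝ U) (hUo : IsOpen U) {f : ℂ → E}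
    (hf : DifferentiableOn ℂ f U) (w₀ : ℂ) :
    ∃ g : ℂ → E, g w₀ = 0 ∧ ∀ w ∈ U, HasDerivAt g (f w) w := by
  obtain ⟨g, hg⟩ := hU.exists_forall_hasDerivWithinAt hf
  exact ⟨fun w => g w - g w₀, sub_self _, fun _ hw =>
    ((hg _ hw).hasDerivAt (hUo.mem_nhds hw)).sub_const _⟩

theorem exists_picard_sequence {U : Set ℂ} (hU : Convex ℝ U) (hUo : IsOpen U)
    {B : ℂ → E →L[ℂ] E} (hB : DifferentiableOn ℂ B U) (w₀ : ℂ) (v : E) :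
    ∃ u : ℕ → ℂ → E, (u 0 = fun _ => v) ∧ (∀ k, u (k + 1) w₀ = 0) ∧
      ∀ k, ∀ w ∈ U, HasDerivAt (u (k + 1)) (B w (u k w)) w := by
  have step : ∀ f : {f : ℂ → E // DifferentiableOn ℂ f U},
      ∃ g : {f : ℂ → E // DifferentiableOn ℂ f U},
        g.1 w₀ = 0 ∧ ∀ w ∈ U, HasDerivAt g.1 (B w (f.1 w)) w := by
    rintro ⟨f, hf⟩
    obtain ⟨g, hg0, hg⟩ := exists_primitive_vanishing hU hUo (hB.clm_apply hf) w₀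
    exact ⟨⟨g, fun w hw => (hg w hw).differentiableAt.differentiableWithinAt⟩, hg0, hg⟩
  choose nxt hn0 hn using step
  let u : ℕ → {f : ℂ → E // DifferentiableOn ℂ f U} := fun k =>
    Nat.rec ⟨fun _ => v, differentiableOn_const v⟩ (fun _ f => nxt f) k
  exact ⟨fun k => (u k).1, rfl, fun k => hn0 _, fun k => hn _⟩

theorem picard_sequence_bound {U : Set ℂ} (hU : Convex ℝ U)
    {B : ℂ → E →L[ℂ] E} {w₀ : ℂ} (h₀ : w₀ ∈ U) {v : E} {u : ℕ → ℂ → E}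
    (hu0 : u 0 = fun _ => v) (hu1 : ∀ k, u (k + 1) w₀ = 0)
    (hu : ∀ k, ∀ w ∈ U, HasDerivAt (u (k + 1)) (B w (u k w)) w) {w : ℂ} (hw : w ∈ U) {M : ℝ}
    (hM : ∀ s ∈ Icc (0 : ℝ) 1, ‖B (w₀ + s * (w - w₀))‖ ≤ M) (k : ℕ) :
    ∀ s ∈ Icc (0 : ℝ) 1, ‖u k (w₀ + s * (w - w₀))‖ ≤
      ‖v‖ * ((M * ‖w - w₀‖) ^ k / k.factorial) * s ^ k := by
  have hM0 : 0 ≤ M := (norm_nonneg _).trans (hM 0 ⟨le_rfl, zero_le_one⟩)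
  induction k with
  | zero => intro s _; simp [hu0]
  | succ k ih =>
    refine fun s hs => image_norm_le_of_norm_deriv_right_le_deriv_boundary
      (f := fun s : ℝ => u (k + 1) (w₀ + s * (w - w₀)))
      (B := fun s => ‖v‖ * ((M * ‖w - w₀‖) ^ (k + 1) / (k + 1).factorial) * s ^ (k + 1))
      (f' := fun s : ℝ => (w - w₀) • B (w₀ + s * (w - w₀)) (u k (w₀ + s * (w - w₀))))
      (B' := fun s => ‖v‖ * ((M * ‖w - w₀‖) ^ (k + 1) / (k + 1).factorial) * ((k + 1 : ℕ) * s ^ k))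
      ?_ ?_ ?_ ?_ ?_ hs
    · exact fun s hs => ((hasDerivAt_comp_segment
        (hu k _ (segment_point_mem hU h₀ hw hs))).continuousAt).continuousWithinAt
    · exact fun s hs => (hasDerivAt_comp_segment
        (hu k _ (segment_point_mem hU h₀ hw ⟨hs.1, hs.2.le⟩))).hasDerivWithinAt
    · simp [hu1]
    · intro s
      simpa using (hasDerivAt_pow (k + 1) s).const_mul
        (‖v‖ * ((M * ‖w - w₀‖) ^ (k + 1) / (k + 1).factorial))
    · intro s hs
      have hs' : s ∈ Icc (0 : ℝ) 1 := ⟨hs.1, hs.2.le⟩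
      have h1 := ih s hs'
      have h2 : ‖B (w₀ + s * (w - w₀)) (u k (w₀ + s * (w - w₀)))‖ ≤
          M * (‖v‖ * ((M * ‖w - w₀‖) ^ k / k.factorial) * s ^ k) :=
        (ContinuousLinearMap.le_opNorm _ _).trans (mul_le_mul (hM s hs') h1 (norm_nonneg _) hM0)
      rw [norm_smul]
      refine (mul_le_mul_of_nonneg_left h2 (norm_nonneg _)).trans (le_of_eq ?_)
      rw [Nat.factorial_succ]
      push_cast
      have : (k.factorial : ℝ) ≠ 0 := by positivity
      field_simp
      ring

/-- Existence for linear equations on a convex open set. -/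
theorem exists_solvesLinear {U : Set ℂ} (hU : Convex ℝ U) (hUo : IsOpen U)
    {B : ℂ → E →L[ℂ] E} (hB : DifferentiableOn ℂ B U) {w₀ : ℂ} (h₀ : w₀ ∈ U) (v : E) :
    ∃ Y : ℂ → E, Y w₀ = v ∧ SolvesLinear B U Y := by
  obtain ⟨u, hu0, hu1, hu⟩ := exists_picard_sequence hU hUo hB w₀ v
  refine ⟨fun w => ∑' k, u k w, ?_, fun w₁ hw₁ => ?_⟩
  · change ∑' k, u k w₀ = v
    rw [tsum_eq_single 0 (fun k hk => ?_)]
    · simp [hu0]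
    · obtain ⟨m, rfl⟩ := Nat.exists_eq_succ_of_ne_zero hk
      exact hu1 m
  obtain ⟨ε, hε, hball⟩ := isOpen_iff.1 hUo w₁ hw₁
  have hball' : closedBall w₁ (ε / 2) ⊆ U := (closedBall_subset_ball (by linarith)).trans hball
  have hcont : ContinuousOn (fun p : ℝ × ℂ => B (w₀ + p.1 * (p.2 - w₀)))
      (Icc (0 : ℝ) 1 ×ˢ closedBall w₁ (ε / 2)) :=
    hB.continuousOn.comp (by fun_prop) fun p hp => segment_point_mem hU h₀ (hball' hp.2) hp.1
  obtain ⟨M, hM⟩ := (isCompact_Icc.prod (isCompact_closedBall w₁ (ε / 2))).exists_bound_of_continuousOn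
    hcont
  have hM0 : 0 ≤ M := (norm_nonneg _).trans
    (hM (0, w₁) ⟨⟨le_rfl, zero_le_one⟩, mem_closedBall_self (by linarith)⟩)
  set R : ℝ := ‖w₁ - w₀‖ + ε with hR
  have hbd : ∀ k, ∀ w ∈ ball w₁ (ε / 2), ‖u k w‖ ≤ ‖v‖ * ((M * R) ^ k / k.factorial) := by
    intro k w hw
    have hwc := ball_subset_closedBall hw
    have h1 := picard_sequence_bound hU h₀ hu0 hu1 hu (hball' hwc)
      (fun s hs => hM (s, w) ⟨hs, hwc⟩) k 1 ⟨zero_le_one, le_rfl⟩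
    have h2 : ‖w - w₀‖ ≤ R := by
      have : ‖w - w₁‖ < ε / 2 := by simpa [dist_eq_norm] using hw
      calc ‖w - w₀‖ = ‖(w - w₁) + (w₁ - w₀)‖ := by congr 1; ring
        _ ≤ ‖w - w₁‖ + ‖w₁ - w₀‖ := norm_add_le _ _
        _ ≤ R := by rw [hR]; linarith
    simp only [ofReal_one, one_mul, add_sub_cancel, one_pow, mul_one] at h1
    refine h1.trans ?_
    gcongr
  have hsum : Summable fun k : ℕ => ‖v‖ * ((M * R) ^ k / k.factorial) :=
    (Real.summable_pow_div_factorial (M * R)).mul_left _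
  have hMB : ∀ w ∈ ball w₁ (ε / 2), ‖B w‖ ≤ M := fun w hw => by
    simpa using hM (1, w) ⟨⟨zero_le_one, le_rfl⟩, ball_subset_closedBall hw⟩
  have hmem : w₁ ∈ ball w₁ (ε / 2) := mem_ball_self (by linarith)
  have hsumm : ∀ w ∈ ball w₁ (ε / 2), Summable fun k => u k w := fun w hw =>
    Summable.of_norm_bounded hsum fun k => hbd k w hw
  have hder : HasDerivAt (fun w => ∑' k, u (k + 1) w) (∑' k, B w₁ (u k w₁)) w₁ := by
    refine hasDerivAt_tsum_of_isPreconnected (hsum.mul_left M) isOpen_ball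
      (convex_ball w₁ (ε / 2)).isPreconnected (fun k _ hw => hu k _
        (hball' (ball_subset_closedBall hw))) (fun k w hw => ?_) hmem
      ((summable_nat_add_iff 1).2 (hsumm w₁ hmem)) hmem
    exact (ContinuousLinearMap.le_opNorm _ _).trans
      (mul_le_mul (hMB w hw) (hbd k w hw) (norm_nonneg _) hM0)
  have hB1 : (∑' k, B w₁ (u k w₁)) = B w₁ (∑' k, u k w₁) := ((B w₁).map_tsum (hsumm w₁ hmem)).symm
  rw [hB1] at hder
  refine (hder.const_add v).congr_of_eventuallyEq ?_
  filter_upwards [isOpen_ball.mem_nhds hmem] with w hw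
  rw [(hsumm w hw).tsum_eq_zero_add, hu0]

/-- Solutions on a left half-plane extend to open sets that are closed under translation to the
left. -/
theorem exists_solvesLinear_of_leftClosed {U : Set ℂ} (hUo : IsOpen U)
    (hleft : ∀ w ∈ U, ∀ s : ℝ, 0 ≤ s → w - s ∈ U) {B : ℂ → E →L[ℂ] E}
    (hB : DifferentiableOn ℂ B U) {x₀ : ℝ} (hx₀ : {w : ℂ | w.re < x₀} ⊆ U) {Y₀ : ℂ → E}
    (hY₀ : SolvesLinear B {w : ℂ | w.re < x₀} Y₀) :
    ∃ Y : ℂ → E, SolvesLinear B U Y ∧ ∀ w : ℂ, w.re < x₀ → Y w = Y₀ w := by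
  let R : ℂ → ℝ → Set ℂ := fun w ε => {z | z.re < w.re + ε ∧ w.im - ε < z.im ∧ z.im < w.im + ε}
  have hRo : ∀ w ε, IsOpen (R w ε) := fun w ε =>
    (isOpen_lt continuous_re continuous_const).inter
      ((isOpen_lt continuous_const continuous_im).inter
        (isOpen_lt continuous_im continuous_const))
  have hRc : ∀ w ε, Convex ℝ (R w ε) := fun w ε =>
    (convex_halfSpace_re_lt _).inter ((convex_halfSpace_im_gt _).inter (convex_halfSpace_im_lt _))
  have hHc : Convex ℝ {w : ℂ | w.re < x₀} := convex_halfSpace_re_lt _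
  have hbox : ∀ w : U, ∃ ε : ℝ, 0 < ε ∧ R w ε ⊆ U := by
    rintro ⟨w, hw⟩
    obtain ⟨δ, hδ, hball⟩ := isOpen_iff.1 hUo w hw
    refine ⟨δ / 2, by linarith, ?_⟩
    rintro z ⟨h1, h2, h3⟩
    have key : z + (max (w.re - z.re) 0 : ℝ) ∈ U := by
      apply hball
      rw [mem_ball, dist_eq_norm]
      have hre : |(z + (max (w.re - z.re) 0 : ℝ) - w).re| < δ / 2 := by
        simp only [sub_re, add_re, ofReal_re]
        rw [abs_lt]
        rcases le_total (w.re - z.re) 0 with h | h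
        · rw [max_eq_right h]; constructor <;> linarith
        · rw [max_eq_left h]; constructor <;> linarith
      have him : |(z + (max (w.re - z.re) 0 : ℝ) - w).im| < δ / 2 := by
        simp only [sub_im, add_im, ofReal_im, abs_lt]
        constructor <;> linarith
      exact (norm_le_abs_re_add_abs_im _).trans_lt (by linarith)
    have := hleft _ key (max (w.re - z.re) 0) (le_max_right _ _)
    simpa using this
  choose ε hε hεU using hbox
  let c : U → ℂ := fun w => ((min w.1.re x₀ - 1 : ℝ) : ℂ) + w.1.im * I
  have hc : ∀ w : U, c w ∈ R w (ε w) ∩ {w : ℂ | w.re < x₀} := fun w => by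
    have h1 := min_le_left w.1.re x₀
    have h2 := min_le_right w.1.re x₀
    have := hε w
    refine ⟨⟨?_, ?_, ?_⟩, ?_⟩ <;> simp [c] <;> linarith
  have hex : ∀ w : U, ∃ Z : ℂ → E, Z (c w) = Y₀ (c w) ∧ SolvesLinear B (R w (ε w)) Z := fun w =>
    exists_solvesLinear (hRc _ _) (hRo _ _) (hB.mono (hεU w)) (hc w).1 _
  choose Z hZ0 hZ using hex
  have hZY : ∀ w : U, EqOn (Z w) Y₀ (R w (ε w) ∩ {w : ℂ | w.re < x₀}) := fun w =>
    SolvesLinear.eqOn ((hRc _ _).inter hHc) (hB.continuousOn.mono (inter_subset_left.trans (hεU w)))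
      ((hZ w).mono inter_subset_left) (hY₀.mono inter_subset_right) (hc w) (hZ0 w)
  have hself : ∀ w : U, w.1 ∈ R w (ε w) := fun w => by
    have := hε w
    refine ⟨?_, ?_, ?_⟩ <;> linarith
  have hZZ : ∀ (w z : U), z.1 ∈ R w (ε w) → Z z z = Z w z := fun w z hz => by
    have hmem : c z ∈ R z (ε z) ∩ R w (ε w) := ⟨(hc z).1, by
      have h1 := min_le_left z.1.re x₀
      refine ⟨?_, ?_, ?_⟩
      · have := hz.1; simp [c]; linarith
      · have := hz.2.1; simpa [c] using this
      · have := hz.2.2; simpa [c] using this⟩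
    refine SolvesLinear.eqOn ((hRc _ _).inter (hRc _ _))
      (hB.continuousOn.mono (inter_subset_left.trans (hεU z)))
      ((hZ z).mono inter_subset_left) ((hZ w).mono inter_subset_right) hmem ?_ ⟨hself z, hz⟩
    rw [hZY z ⟨hmem.1, (hc z).2⟩, hZY w ⟨hmem.2, (hc z).2⟩]
  classical
  refine ⟨fun w => if h : w ∈ U then Z ⟨w, h⟩ w else 0, fun w hw => ?_, fun w hw => ?_⟩
  · have hev : (fun w => if h : w ∈ U then Z ⟨w, h⟩ w else 0) =ᶠ[𝓝 w] Z ⟨w, hw⟩ := by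
      filter_upwards [(hRo w (ε ⟨w, hw⟩)).mem_nhds (hself ⟨w, hw⟩)] with z hz
      rw [dif_pos (hεU ⟨w, hw⟩ hz)]
      exact hZZ ⟨w, hw⟩ ⟨z, _⟩ hz
    have hval := hev.eq_of_nhds
    beta_reduce at hval ⊢
    rw [hval]
    exact (hZ ⟨w, hw⟩ w (hself ⟨w, hw⟩)).congr_of_eventuallyEq hev
  · simp only [dif_pos (hx₀ hw)]
    exact hZY ⟨w, hx₀ hw⟩ ⟨hself ⟨w, hx₀ hw⟩, hw⟩

end LinearODE

section ContourShift

theorem integrable_exp_neg_mul_abs {δ : ℝ} (hδ : 0 < δ) :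
    Integrable fun x : ℝ => Real.exp (-δ * |x|) := by
  rw [← integrableOn_univ, ← Iic_union_Ioi (a := (0 : ℝ))]
  refine IntegrableOn.union ?_ ?_
  · refine ((integrableOn_exp_mul_Iic hδ 0)).congr_fun (fun x hx => ?_) measurableSet_Iic
    simp only [abs_of_nonpos (mem_Iic.1 hx)]; ring_nf
  · refine ((integrableOn_exp_mul_Ioi (neg_lt_zero.2 hδ) 0)).congr_fun (fun x hx => ?_)
      measurableSet_Ioi
    simp only [abs_of_pos (mem_Ioi.1 hx)]

theorem integrable_of_exp_bound {f : ℝ → ℂ} (hf : AEStronglyMeasurable f) {C δ : ℝ} (hδ : 0 < δ)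
    (hb : ∀ x, ‖f x‖ ≤ C * Real.exp (-δ * |x|)) : Integrable f :=
  ((integrable_exp_neg_mul_abs hδ).const_mul C).mono' hf (ae_of_all _ hb)

theorem exists_global_exp_bound {Φ : ℂ → ℂ} {a b C δ X : ℝ}
    (hΦ : ContinuousOn Φ {w | a ≤ w.im ∧ w.im ≤ b})
    (hb : ∀ w : ℂ, a ≤ w.im → w.im ≤ b → X ≤ |w.re| → ‖Φ w‖ ≤ C * Real.exp (-δ * |w.re|)) :
    ∃ C', 0 ≤ C' ∧ ∀ w : ℂ, a ≤ w.im → w.im ≤ b → ‖Φ w‖ ≤ C' * Real.exp (-δ * |w.re|) := by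
  have hK : IsCompact (Icc (-X) X ×ℂ Icc a b) := isCompact_Icc.reProdIm isCompact_Icc
  have hc : ContinuousOn (fun w : ℂ => ‖Φ w‖ * Real.exp (δ * |w.re|)) (Icc (-X) X ×ℂ Icc a b) :=
    ((hΦ.mono fun w hw => (mem_reProdIm.1 hw).2).norm).mul (by fun_prop)
  obtain ⟨M, hM⟩ := hK.exists_bound_of_continuousOn hc
  refine ⟨max (max C M) 0, le_max_right _ _, fun w h1 h2 => ?_⟩
  rcases le_or_gt X |w.re| with h | h
  · refine (hb w h1 h2 h).trans ?_
    gcongr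
    exact (le_max_left _ _).trans (le_max_left _ _)
  · have h3 := hM w (mem_reProdIm.2 ⟨abs_le.1 h.le, h1, h2⟩)
    rw [Real.norm_of_nonneg (by positivity)] at h3
    have : ‖Φ w‖ ≤ M * Real.exp (-δ * |w.re|) := by
      rw [neg_mul, Real.exp_neg, ← div_eq_mul_inv, le_div_iff₀ (exp_pos _)]
      exact h3
    refine this.trans ?_
    gcongr
    exact (le_max_right _ _).trans (le_max_left _ _)

theorem continuous_horizontal_line {Φ : ℂ → ℂ} {S : Set ℂ} (hΦ : ContinuousOn Φ S) {α : ℝ}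
    (hS : ∀ x : ℝ, (x + α * I : ℂ) ∈ S) : Continuous fun x : ℝ => Φ (x + α * I) :=
  hΦ.comp_continuous (by fun_prop) hS

/-- A horizontal line of integration may be moved through a strip of analyticity in which the
integrand decays exponentially at both ends. -/
theorem integral_horizontal_line_eq {Φ : ℂ → ℂ} {a b C δ X : ℝ} (hab : a ≤ b) (hδ : 0 < δ)
    (hd : DifferentiableOn ℂ Φ {w | a ≤ w.im ∧ w.im ≤ b})
    (hb : ∀ w : ℂ, a ≤ w.im → w.im ≤ b → X ≤ |w.re| → ‖Φ w‖ ≤ C * Real.exp (-δ * |w.re|)) :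
    ∫ x : ℝ, Φ (x + a * I) = ∫ x : ℝ, Φ (x + b * I) := by
  obtain ⟨C', hC', hb'⟩ := exists_global_exp_bound hd.continuousOn hb
  have hint : ∀ α ∈ Icc a b, Integrable fun x : ℝ => Φ (x + α * I) := fun α hα =>
    integrable_of_exp_bound (continuous_horizontal_line hd.continuousOn
      (fun x => by simpa using hα)).aestronglyMeasurable hδ
      (fun x => by simpa using hb' (x + α * I) (by simpa using hα.1) (by simpa using hα.2))
  have hlim : ∀ α ∈ Icc a b, Tendsto (fun R : ℝ => ∫ x in (-R)..R, Φ (x + α * I)) atTop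
      (𝓝 (∫ x : ℝ, Φ (x + α * I))) := fun α hα =>
    intervalIntegral_tendsto_integral (hint α hα) tendsto_neg_atTop_atBot tendsto_id
  have hside : ∀ s : ℝ, |s| = 1 → Tendsto (fun R : ℝ => ∫ y in a..b, Φ ((s * R : ℝ) + y * I))
      atTop (𝓝 0) := fun s hs => by
    have h0 : Tendsto (fun R : ℝ => C' * Real.exp (-δ * R) * |b - a|) atTop (𝓝 0) := by
      have : Tendsto (fun R : ℝ => Real.exp (-δ * R)) atTop (𝓝 0) :=
        Real.tendsto_exp_atBot.comp (tendsto_id.const_mul_atTop_of_neg (neg_lt_zero.2 hδ))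
      simpa using (this.const_mul C').mul_const |b - a|
    refine squeeze_zero_norm' ?_ h0
    filter_upwards [eventually_ge_atTop 0] with R hR
    refine intervalIntegral.norm_integral_le_of_norm_le_const fun y hy => ?_
    rw [uIoc_of_le hab] at hy
    have := hb' ((s * R : ℝ) + y * I) (by simpa using hy.1.le) (by simpa using hy.2)
    simpa [abs_mul, hs, abs_of_nonneg hR] using this
  have hrect : ∀ᶠ R : ℝ in atTop, (∫ x in (-R)..R, Φ (x + a * I)) -
      (∫ x in (-R)..R, Φ (x + b * I)) +
      I * (∫ y in a..b, Φ (((1 : ℝ) * R : ℝ) + y * I)) -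
      I * (∫ y in a..b, Φ (((-1 : ℝ) * R : ℝ) + y * I)) = 0 := by
    filter_upwards [eventually_ge_atTop 0] with R hR
    have := integral_boundary_rect_eq_zero_of_differentiableOn Φ
      ((-R : ℝ) + a * I) ((R : ℝ) + b * I) (hd.mono fun w hw => ?_)
    · simpa using this
    · have := (mem_reProdIm.1 hw).2
      rw [uIcc_of_le (by simpa using hab)] at this
      simpa using this
  have hL := (((hlim a ⟨le_rfl, hab⟩).sub (hlim b ⟨hab, le_rfl⟩)).add
    ((hside 1 (by simp)).const_mul I)).sub ((hside (-1) (by simp)).const_mul I)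
  have := tendsto_nhds_unique (hL.congr' hrect) tendsto_const_nhds
  simpa [sub_eq_zero] using this

end ContourShift

section GeometricBounds

/-- The sequence `b` grows at most geometrically with ratio `r`. -/
def GeomBounded (b : ℕ → ℂ) (r : ℝ) : Prop := ∃ C : ℝ, ∀ s, ‖b s‖ ≤ C * r ^ s

theorem GeomBounded.mono {b : ℕ → ℂ} {r r' : ℝ} (h : GeomBounded b r) (hr : 0 ≤ r) (hrr : r ≤ r') :
    GeomBounded b r' := by
  obtain ⟨C, hC⟩ := h
  have hC0 : 0 ≤ C := by simpa using (norm_nonneg _).trans (hC 0)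
  exact ⟨C, fun s => (hC s).trans (by gcongr)⟩

theorem GeomBounded.mul_linear {b : ℕ → ℂ} {r : ℝ} (h : GeomBounded b r) (z : ℂ) :
    GeomBounded (fun s => b s * (s + z)) (2 * r) := by
  obtain ⟨C, hC⟩ := h
  refine ⟨C * (1 + ‖z‖), fun s => ?_⟩
  have h1 : ‖(s : ℂ) + z‖ ≤ (1 + ‖z‖) * 2 ^ s := by
    have h2 : (s : ℝ) ≤ 2 ^ s := by exact_mod_cast Nat.lt_two_pow_self.le
    have h3 : (1 : ℝ) ≤ 2 ^ s := one_le_pow₀ one_le_two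
    calc ‖(s : ℂ) + z‖ ≤ s + ‖z‖ := by simpa using norm_add_le (s : ℂ) z
      _ ≤ 2 ^ s + ‖z‖ * 2 ^ s := add_le_add h2 (le_mul_of_one_le_right (norm_nonneg _) h3)
      _ = _ := by ring
  rw [norm_mul, mul_pow]
  calc ‖b s‖ * ‖(s : ℂ) + z‖ ≤ (C * r ^ s) * ((1 + ‖z‖) * 2 ^ s) :=
        mul_le_mul (hC s) h1 (norm_nonneg _) ((norm_nonneg _).trans (hC s))
    _ = _ := by ring

theorem GeomBounded.mul_falling {c : ℕ → ℂ} {r : ℝ} (h : GeomBounded c r) (e : ℂ) (N : ℕ) :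
    GeomBounded (fun s => c s * (descPochhammer ℂ N).eval (s + e)) (2 ^ N * r) := by
  induction N with
  | zero => simpa using h
  | succ N ih =>
    have := ih.mul_linear (e - N)
    rw [← mul_assoc, ← pow_succ'] at this
    refine Exists.imp (fun C hC s => ?_) this
    beta_reduce
    rw [descPochhammer_succ_eval, ← mul_assoc]
    convert hC s using 3
    ring

/-- `∑ b_s e^{s ω}`. -/
noncomputable def expSum (b : ℕ → ℂ) (ω : ℂ) : ℂ := ∑' s, b s * exp (s * ω)

theorem norm_exp_nat_mul (s : ℕ) (ω : ℂ) : ‖exp (s * ω)‖ = Real.exp ω.re ^ s := by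
  rw [norm_exp, ← Real.exp_nat_mul]; simp

theorem GeomBounded.summable {b : ℕ → ℂ} {r : ℝ} (h : GeomBounded b r) (hr : 0 ≤ r) {ω : ℂ}
    (hω : r * Real.exp ω.re < 1) : Summable fun s => b s * exp (s * ω) := by
  obtain ⟨C, hC⟩ := h
  refine Summable.of_norm_bounded
    ((summable_geometric_of_lt_one (by positivity) hω).mul_left C) fun s => ?_
  rw [norm_mul, norm_exp_nat_mul, mul_pow, ← mul_assoc]
  gcongr
  exact hC s

theorem GeomBounded.norm_expSum_le {b : ℕ → ℂ} {r : ℝ} (h : GeomBounded b r) (hr : 0 ≤ r) {x : ℝ}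
    (hx : r * Real.exp x < 1) : ∃ M, ∀ ω : ℂ, ω.re ≤ x → ‖expSum b ω‖ ≤ M := by
  obtain ⟨C, hC⟩ := h
  have hC0 : 0 ≤ C := by simpa using (norm_nonneg _).trans (hC 0)
  refine ⟨∑' s : ℕ, C * (r * Real.exp x) ^ s, fun ω hω => ?_⟩
  refine tsum_of_norm_bounded
    ((summable_geometric_of_lt_one (by positivity) hx).mul_left C).hasSum fun s => ?_
  rw [norm_mul, norm_exp_nat_mul, mul_pow, ← mul_assoc]
  have := hC s
  gcongr

theorem GeomBounded.hasDerivAt_expSum {b : ℕ → ℂ} {r : ℝ} (h : GeomBounded b r) (hr : 0 < r)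
    {ω : ℂ} (hω : 2 * r * Real.exp ω.re < 1) :
    HasDerivAt (expSum b) (expSum (fun s => b s * s) ω) ω := by
  have h' : GeomBounded (fun s => b s * s) (2 * r) := by simpa using h.mul_linear 0
  obtain ⟨x, hx1, hx2⟩ : ∃ x : ℝ, ω.re < x ∧ 2 * r * Real.exp x < 1 := by
    have : ∀ᶠ x in 𝓝[>] ω.re, 2 * r * Real.exp x < 1 :=
      ((continuous_const.mul Real.continuous_exp).tendsto ω.re).eventually_lt_const hω
        |>.filter_mono nhdsWithin_le_nhds
    obtain ⟨x, hx, hx'⟩ := (this.and self_mem_nhdsWithin).exists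
    exact ⟨x, hx', hx⟩
  obtain ⟨C, hC⟩ := h'
  have hsum : Summable fun s : ℕ => C * (2 * r * Real.exp x) ^ s :=
    (summable_geometric_of_lt_one (by positivity) hx2).mul_left C
  have := hasDerivAt_tsum_of_isPreconnected (𝕜 := ℂ) hsum
    (isOpen_lt continuous_re continuous_const)
    (convex_halfSpace_re_lt x).isPreconnected (g := fun s ω => b s * exp (s * ω))
    (g' := fun s ω => b s * s * exp (s * ω)) (y₀ := ω) (y := ω)
    (fun s y _ => ?_) (fun s y hy => ?_) hx1 (h.summable hr.le ?_) hx1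
  · exact this
  · have := ((hasDerivAt_id y).const_mul (s : ℂ)).cexp.const_mul (b s)
    refine HasDerivAt.congr_deriv this ?_
    simp only [id_eq]; ring
  · rw [norm_mul, norm_exp_nat_mul, mul_pow, ← mul_assoc]
    have hy' : y.re ≤ x := le_of_lt hy
    have := hC s
    have h0 := (norm_nonneg _).trans this
    gcongr
  · have := exp_pos ω.re
    nlinarith [mul_pos hr this]

/-- `X^{e-N} ∑ c_s (s+e)(s+e-1)⋯(s+e-N+1) X^s` with `X = e^ω`: the `N`-th derivative with respect
to `X` of the series `∑ c_s X^{s+e}`. -/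
noncomputable def frobSeries (e : ℂ) (c : ℕ → ℂ) (N : ℕ) (ω : ℂ) : ℂ :=
  exp ((e - N) * ω) * expSum (fun s => c s * (descPochhammer ℂ N).eval (s + e)) ω

theorem hasDerivAt_frobSeries {e : ℂ} {c : ℕ → ℂ} {r : ℝ} (hr : 0 < r) (h : GeomBounded c r)
    {N : ℕ} {ω : ℂ} (hω : 2 ^ (N + 1) * r * Real.exp ω.re < 1) :
    HasDerivAt (frobSeries e c N) (exp ω * frobSeries e c (N + 1) ω) ω := by
  set b : ℕ → ℂ := fun s => c s * (descPochhammer ℂ N).eval (s + e) with hb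
  have hbr : GeomBounded b (2 ^ N * r) := h.mul_falling e N
  have hω' : 2 * (2 ^ N * r) * Real.exp ω.re < 1 := by rwa [← mul_assoc, ← pow_succ']
  have hpos := exp_pos ω.re
  have hω2 : 2 ^ N * r * Real.exp ω.re < 1 := by
    have : 0 < 2 ^ N * r * Real.exp ω.re := by positivity
    linarith
  have h1 := hbr.hasDerivAt_expSum (by positivity) hω'
  have h2 : HasDerivAt (fun ω : ℂ => exp ((e - N) * ω))
      (exp ((e - N) * ω) * (e - N)) ω := by
    simpa using ((hasDerivAt_id ω).const_mul (e - N)).cexp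
  have h3 := h2.mul h1
  have key : expSum (fun s => c s * (descPochhammer ℂ (N + 1)).eval (s + e)) ω =
      (e - N) * expSum b ω + expSum (fun s => b s * s) ω := by
    have s1 := hbr.summable (by positivity) hω2
    have s2 : Summable fun s => b s * s * exp (s * ω) := by
      have := hbr.mul_linear 0
      simp only [add_zero] at this
      exact this.summable (by positivity) hω'
    rw [expSum, expSum, expSum, ← tsum_mul_left, ← (s1.mul_left _).tsum_add s2]
    refine tsum_congr fun s => ?_
    rw [descPochhammer_succ_eval]
    simp only [hb]; ring
  have hval : exp ω * frobSeries e c (N + 1) ω = exp ((e - N) * ω) * (e - N) * expSum b ω +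
        exp ((e - N) * ω) * expSum (fun s => b s * s) ω := by
    rw [frobSeries, key]
    have : exp ω * exp ((e - (N + 1 : ℕ)) * ω) = exp ((e - N) * ω) := by
      rw [← exp_add]; congr 1; push_cast; ring
    rw [← mul_assoc, this]; ring
  rw [hval]
  exact h3

end GeometricBounds

namespace InverseFactorialData

variable {n : ℕ} (D : InverseFactorialData n)

/-- The coefficient `∑_{k ≥ m} f_{m,n-k} t^{k-m}` of `y^{(n-m)}` in the differential equation of the
Borel transforms. -/
noncomputable def odeCoeff (m : ℕ) (t : ℂ) : ℂ := ∑ k ∈ Finset.Icc m n, D.f m (n - k) * t ^ (k - m)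

/-- The companion matrix of the differential equation. -/
noncomputable def odeMat (t : ℂ) (i k : Fin n) : ℂ :=
  if (i : ℕ) + 1 < n then (if (k : ℕ) = i + 1 then 1 else 0)
  else -(D.odeCoeff (n - k) t / D.odeCoeff 0 t)

/-- The companion matrix as a linear map. -/
noncomputable def odeField (t : ℂ) : (Fin n → ℂ) →L[ℂ] (Fin n → ℂ) := ∑ i, ∑ k, D.odeMat t i k •
    (ContinuousLinearMap.proj (R := ℂ) (φ := fun _ : Fin n => ℂ) k).smulRight
      (Pi.single i (1 : ℂ) : Fin n → ℂ)

theorem odeField_apply (t : ℂ) (v : Fin n → ℂ) (i : Fin n) :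
    D.odeField t v i = ∑ k, D.odeMat t i k * v k := by
  simp only [odeField, _root_.sum_apply, Finset.sum_apply,
    _root_.smul_apply, ContinuousLinearMap.smulRight_apply,
    ContinuousLinearMap.proj_apply, Pi.smul_apply, smul_eq_mul, Pi.single_apply]
  rw [Finset.sum_eq_single i]
  · simp
  · intro b _ hb; simp [Ne.symm hb]
  · simp

theorem odeField_apply_of_lt (t : ℂ) (v : Fin n → ℂ) (i : Fin n) (hi : (i : ℕ) + 1 < n) :
    D.odeField t v i = v ⟨i + 1, hi⟩ := by
  rw [odeField_apply, Finset.sum_eq_single ⟨(i : ℕ) + 1, hi⟩]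
  · simp [odeMat, hi]
  · intro b _ hb
    have : (b : ℕ) ≠ i + 1 := fun h => hb (Fin.ext h)
    simp [odeMat, hi, this]
  · simp

theorem odeField_apply_last (t : ℂ) (v : Fin n → ℂ) (i : Fin n) (hi : ¬ (i : ℕ) + 1 < n) :
    D.odeField t v i = -∑ k : Fin n, D.odeCoeff (n - k) t / D.odeCoeff 0 t * v k := by
  rw [odeField_apply, ← Finset.sum_neg_distrib]
  simp [odeMat, hi]

theorem differentiable_odeCoeff (m : ℕ) : Differentiable ℂ (D.odeCoeff m) := by
  unfold odeCoeff; fun_prop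

theorem differentiableOn_odeField {S : Set ℂ} (hS : ∀ t ∈ S, D.odeCoeff 0 t ≠ 0) :
    DifferentiableOn ℂ D.odeField S := by
  have hm : ∀ i k, DifferentiableOn ℂ (fun t => D.odeMat t i k) S := fun i k => by
    unfold odeMat
    split_ifs
    · exact differentiableOn_const _
    · exact differentiableOn_const _
    · exact ((D.differentiable_odeCoeff _).differentiableOn.div
        (D.differentiable_odeCoeff _).differentiableOn hS).neg
  unfold odeField
  exact DifferentiableOn.fun_sum fun i _ => DifferentiableOn.fun_sum fun k _ =>
    (hm i k).smul_const _

/-! ### The characteristic polynomial -/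

theorem odeCoeff_zero_eq (t : ℂ) : D.odeCoeff 0 t = D.f 0 0 * ∏ l : Fin n, (t - D.lam l) := by
  open Polynomial in
  let p : ℂ[X] := ∑ k ∈ range (n + 1), C (D.f 0 (n - k)) * X ^ k
  let q : ℂ[X] := C (D.f 0 0) * ∏ l : Fin n, (X - C (D.lam l))
  have hpe : ∀ t, p.eval t = D.odeCoeff 0 t := fun t => by
    simp only [p, odeCoeff, eval_finsetSum, eval_mul, eval_C, eval_pow, eval_X, Nat.sub_zero]
    congr 1
    ext k; simp
  have hqd : q.degree = n := by
    rw [degree_C_mul D.f_zero_zero, degree_prod_of_monic _ _ fun i _ => monic_X_sub_C _]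
    simp
  have hql : q.leadingCoeff = D.f 0 0 := by
    rw [leadingCoeff_C_mul_of_isUnit (isUnit_iff_ne_zero.2 D.f_zero_zero),
      (monic_prod_of_monic _ _ fun i _ => monic_X_sub_C _).leadingCoeff, mul_one]
  have hpn : p = C (D.f 0 0) * X ^ n + ∑ k ∈ range n, C (D.f 0 (n - k)) * X ^ k := by
    simp only [p, Finset.sum_range_succ, Nat.sub_self]; ring
  have hlow : (∑ k ∈ range n, C (D.f 0 (n - k)) * X ^ k : ℂ[X]).degree < n := by
    refine (degree_sum_le _ _).trans_lt ((Finset.sup_lt_iff (WithBot.bot_lt_coe n)).2 fun k hk => ?_)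
    refine (degree_C_mul_X_pow_le k _).trans_lt ?_
    exact WithBot.coe_lt_coe.2 (Finset.mem_range.1 hk)
  have hpd : p.degree = n := by
    rw [hpn, degree_add_eq_left_of_degree_lt, degree_C_mul_X_pow _ D.f_zero_zero]
    rwa [degree_C_mul_X_pow _ D.f_zero_zero]
  have hpl : p.leadingCoeff = D.f 0 0 := by
    rw [hpn, leadingCoeff_add_of_degree_lt', leadingCoeff_C_mul_X_pow]
    rwa [degree_C_mul_X_pow _ D.f_zero_zero]
  have hp0 : p ≠ 0 := fun h => by simp [h] at hpd
  have hlt : (p - q).degree < (Finset.univ : Finset (Fin n)).card := by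
    have := degree_sub_lt_left (hpd.trans hqd.symm) hp0 (hpl.trans hql.symm)
    rw [hpd] at this
    simpa using this
  have hpq : p = q := Polynomial.eq_of_degree_sub_lt_of_eval_index_eq Finset.univ
    (v := D.lam) D.lam_injective.injOn hlt fun i _ => by
      have h1 : p.eval (D.lam i) = 0 := by rw [← D.lam_root i]; simp [p, eval_finsetSum]
      have h2 : q.eval (D.lam i) = 0 := by
        simp only [q, eval_mul, eval_C, eval_prod, eval_sub, eval_X]
        rw [Finset.prod_eq_zero (Finset.mem_univ i) (sub_self _), mul_zero]
      rw [h1, h2]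
  rw [← hpe, hpq]
  simp [q, eval_prod]

theorem odeCoeff_zero_ne {t : ℂ} (ht : ∀ l, t ≠ D.lam l) : D.odeCoeff 0 t ≠ 0 := by
  rw [odeCoeff_zero_eq]
  exact mul_ne_zero D.f_zero_zero (Finset.prod_ne_zero_iff.2 fun l _ => sub_ne_zero.2 (ht l))

theorem lam_ne_zero (j : Fin n) : D.lam j ≠ 0 := by
  rw [← D.exp_logLam j]; exact exp_ne_zero _

/-- `∑ k f_{0,n-k} λ_j^k`. -/
noncomputable def lamDeriv (j : Fin n) : ℂ := ∑ k ∈ range (n + 1), (k : ℂ) * D.f 0 (n - k) * D.lam j ^ k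

theorem lamDeriv_eq (j : Fin n) :
    D.lamDeriv j = -∏ l ∈ Finset.univ.erase j, (1 - D.lam j / D.lam l) := by
  have hd : HasDerivAt (D.odeCoeff 0)
      (D.f 0 0 * ∏ l ∈ Finset.univ.erase j, (D.lam j - D.lam l)) (D.lam j) := by
    have h1 : D.odeCoeff 0 = fun t => (t - D.lam j) *
        (D.f 0 0 * ∏ l ∈ Finset.univ.erase j, (t - D.lam l)) := by
      ext t
      rw [odeCoeff_zero_eq, ← Finset.mul_prod_erase _ _ (Finset.mem_univ j)]; ring
    have h2 : DifferentiableAt ℂ (fun t => D.f 0 0 * ∏ l ∈ Finset.univ.erase j, (t - D.lam l))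
        (D.lam j) := by fun_prop
    have := ((hasDerivAt_id (D.lam j)).sub_const (D.lam j)).mul h2.hasDerivAt
    rw [h1]
    refine HasDerivAt.congr_deriv this ?_
    simp
  have hd' : HasDerivAt (D.odeCoeff 0)
      (∑ k ∈ range (n + 1), D.f 0 (n - k) * (k * D.lam j ^ (k - 1))) (D.lam j) := by
    have h1 : D.odeCoeff 0 = fun t => ∑ k ∈ range (n + 1), D.f 0 (n - k) * t ^ k := by
      ext t; unfold odeCoeff
      simp only [Nat.sub_zero]
      congr 1
      ext k; simp
    rw [h1]
    exact HasDerivAt.fun_sum fun k _ => (hasDerivAt_pow k _).const_mul _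
  have h0 : D.f 0 0 * ∏ l, (-D.lam l) = 1 := by
    have h1 := D.odeCoeff_zero_eq 0
    simp only [zero_sub] at h1
    rw [← h1, odeCoeff, Finset.sum_eq_single 0]
    · simp [D.f_zero_top]
    · intro k _ hk; simp [hk]
    · simp
  have h2 : D.lamDeriv j = D.lam j * (D.f 0 0 * ∏ l ∈ Finset.univ.erase j, (D.lam j - D.lam l)) := by
    rw [hd.unique hd', lamDeriv, mul_sum]
    refine sum_congr rfl fun k _ => ?_
    rcases Nat.eq_zero_or_pos k with rfl | hk
    · simp
    · obtain ⟨m, rfl⟩ := Nat.exists_eq_succ_of_ne_zero hk.ne'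
      simp [pow_succ]; ring
  have h3 : ∏ l ∈ Finset.univ.erase j, (1 - D.lam j / D.lam l) =
      (∏ l ∈ Finset.univ.erase j, (D.lam j - D.lam l)) / ∏ l ∈ Finset.univ.erase j, (-D.lam l) := by
    rw [← Finset.prod_div_distrib]
    refine Finset.prod_congr rfl fun l _ => ?_
    have := D.lam_ne_zero l
    field_simp; ring
  have h4 : (∏ l ∈ Finset.univ.erase j, (-D.lam l)) ≠ 0 :=
    Finset.prod_ne_zero_iff.2 fun l _ => neg_ne_zero.2 (D.lam_ne_zero l)
  rw [← Finset.mul_prod_erase _ _ (Finset.mem_univ j)] at h0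
  rw [h2, h3, eq_neg_iff_add_eq_zero]
  field_simp
  linear_combination (∏ l ∈ Finset.univ.erase j, (D.lam j - D.lam l)) * (-h0)

theorem lamDeriv_ne_zero (j : Fin n) : D.lamDeriv j ≠ 0 := by
  rw [lamDeriv_eq, neg_ne_zero, Finset.prod_ne_zero_iff]
  intro l hl h
  have h1 : D.lam j = D.lam l := by
    have := D.lam_ne_zero l
    rw [sub_eq_zero, eq_comm, div_eq_one_iff_eq this] at h
    exact h
  exact (Finset.mem_erase.1 hl).1 (D.lam_injective h1).symm

theorem sum_f_one (j : Fin n) :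
    ∑ k ∈ Finset.Icc 1 n, D.f 1 (n - k) * D.lam j ^ k = (D.mu j + n - 1) * D.lamDeriv j := by
  have : D.mu j + n - 1 = (∑ k ∈ Finset.Icc 1 n, D.f 1 (n - k) * D.lam j ^ k) / D.lamDeriv j := by
    simp only [mu, muOf, lamDeriv]; ring
  rw [this, div_mul_cancel₀ _ (D.lamDeriv_ne_zero j)]

end InverseFactorialData

/-- The coefficient of `X^q` in `(1 - X)^{k-m} X^m`. -/
noncomputable def frobWeight (m k q : ℕ) : ℂ :=
  if m ≤ q then (-1) ^ (q - m) * ((k - m).choose (q - m) : ℂ) else 0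

theorem sum_frobWeight {m k n : ℕ} (hmk : m ≤ k) (hkn : k ≤ n) (X : ℂ) :
    ∑ q ∈ range (n + 1), frobWeight m k q * X ^ q = (1 - X) ^ (k - m) * X ^ m := by
  have hn : n + 1 = m + (n + 1 - m) := by omega
  rw [hn, Finset.sum_range_add, sum_eq_zero (s := range m), zero_add]
  · have h1 : (1 - X) ^ (k - m) = ∑ i ∈ range (n + 1 - m),
        (-1) ^ i * ((k - m).choose i : ℂ) * X ^ i := by
      rw [sub_eq_neg_add, add_pow]
      rw [← Finset.sum_subset (Finset.range_mono (show k - m + 1 ≤ n + 1 - m by omega))]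
      · refine sum_congr rfl fun i _ => ?_
        rw [neg_pow]; ring
      · intro i _ hi
        rw [Nat.choose_eq_zero_of_lt (by simpa using hi)]; simp
    rw [h1, sum_mul]
    refine sum_congr rfl fun i _ => ?_
    simp only [frobWeight, Nat.le_add_right, if_true, Nat.add_sub_cancel_left]
    ring
  · intro q hq
    simp [frobWeight, Finset.mem_range.1 hq]

theorem exists_norm_falling_le (e : ℂ) (N : ℕ) :
    ∃ K : ℝ, 0 ≤ K ∧ ∀ s : ℕ, ‖(descPochhammer ℂ N).eval (s + e)‖ ≤ K * (s + 1) ^ N := by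
  induction N with
  | zero => exact ⟨1, zero_le_one, fun s => by simp⟩
  | succ N ih =>
    obtain ⟨K, hK, h⟩ := ih
    refine ⟨K * (1 + ‖e - N‖), by positivity, fun s => ?_⟩
    rw [descPochhammer_succ_eval, norm_mul, pow_succ]
    have h1 : ‖(s : ℂ) + e - N‖ ≤ (1 + ‖e - N‖) * (s + 1) := by
      calc ‖(s : ℂ) + e - N‖ ≤ s + ‖e - N‖ := by
            rw [add_sub_assoc]; simpa using norm_add_le (s : ℂ) (e - N)
        _ ≤ _ := by nlinarith [norm_nonneg (e - (N : ℂ)), Nat.cast_nonneg (α := ℝ) s]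
    calc _ ≤ (K * (s + 1) ^ N) * ((1 + ‖e - N‖) * (s + 1)) :=
          mul_le_mul (h s) h1 (norm_nonneg _) (by positivity)
      _ = _ := by ring

theorem exists_le_norm_linear (z : ℂ) : ∃ s₀ : ℕ, ∀ s : ℕ, s₀ ≤ s → ((s : ℝ) + 1) / 2 ≤ ‖(s : ℂ) + z‖ := by
  obtain ⟨s₀, hs₀⟩ := exists_nat_ge (2 * ‖z‖ + 1)
  refine ⟨s₀, fun s hs => ?_⟩
  have h1 : (s₀ : ℝ) ≤ s := by exact_mod_cast hs
  have h2 : (s : ℝ) - ‖z‖ ≤ ‖(s : ℂ) + z‖ := by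
    have := norm_sub_norm_le (s : ℂ) (-z)
    simpa using this
  linarith

theorem exists_le_norm_falling (e : ℂ) (N : ℕ) : ∃ s₀ : ℕ, ∀ s : ℕ, s₀ ≤ s →
    (((s : ℝ) + 1) / 2) ^ N ≤ ‖(descPochhammer ℂ N).eval (s + e)‖ := by
  induction N with
  | zero => exact ⟨0, fun s _ => by simp⟩
  | succ N ih =>
    obtain ⟨s₁, h₁⟩ := ih
    obtain ⟨s₂, h₂⟩ := exists_le_norm_linear (e - N)
    refine ⟨max s₁ s₂, fun s hs => ?_⟩
    rw [descPochhammer_succ_eval, norm_mul, pow_succ]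
    have := h₂ s ((le_max_right _ _).trans hs)
    rw [← add_sub_assoc] at this
    exact mul_le_mul (h₁ s ((le_max_left _ _).trans hs)) this (by positivity) (norm_nonneg _)

namespace InverseFactorialData

variable {n : ℕ} (D : InverseFactorialData n)

/-- The coefficient of `c_s X^{s+q+e-n}` that results from inserting `∑ c_s X^{s+e}`,
`X = 1 - t/l`, into the differential equation; here `z = s + e`. -/
noncomputable def frobCoeff (l : ℂ) (q : ℕ) (z : ℂ) : ℂ :=
  ∑ k ∈ range (n + 1), l ^ k * ∑ m ∈ range (k + 1),
    (-1) ^ (n - m) * D.f m (n - k) * frobWeight m k q * (descPochhammer ℂ (n - m)).eval z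

/-- The series `∑ c_s X^{s+e}`, `X = 1 - t/l`, satisfies the differential equation formally. -/
def FormalSolution (l e : ℂ) (c : ℕ → ℂ) : Prop := ∀ σ : ℕ, ∑ q ∈ range (n + 1),
    (if q ≤ σ then D.frobCoeff l q ((σ - q : ℕ) + e) * c (σ - q) else 0) = 0

theorem FormalSolution.ode {D : InverseFactorialData n} {l e : ℂ} {c : ℕ → ℂ} (hl : l ≠ 0)
    (hc : D.FormalSolution l e c) {r : ℝ} (hr : 0 < r) (hb : GeomBounded c r) {ω : ℂ}
    (hω : 2 ^ (n + 1) * r * Real.exp ω.re < 1) :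
    ∑ m ∈ range (n + 1), D.odeCoeff m (l * (1 - exp ω)) *
      ((-1 / l) ^ (n - m) * frobSeries e c (n - m) ω) = 0 := by
  set X := exp ω with hX
  set S : ℕ → ℂ := fun m => expSum (fun s => c s * (descPochhammer ℂ (n - m)).eval (s + e)) ω with hS
  have hpow : ∀ s : ℕ, exp (s * ω) = X ^ s := fun s => by rw [hX, ← exp_nat_mul]
  have hsum : ∀ m, HasSum (fun s : ℕ => c s * (descPochhammer ℂ (n - m)).eval (s + e) * X ^ s)
      (S m) := fun m => by
    have h2 : (2 : ℝ) ^ (n - m) ≤ 2 ^ (n + 1) := pow_le_pow_right₀ one_le_two (by omega)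
    have := (hb.mul_falling e (n - m)).summable (ω := ω) (by positivity)
      (lt_of_le_of_lt (by gcongr) hω)
    have hSm : S m = ∑' s : ℕ, c s * (descPochhammer ℂ (n - m)).eval (s + e) * X ^ s := by
      simp only [hS, expSum, hpow]
    rw [hSm]
    simpa only [hpow] using this.hasSum
  have hU : ∀ q, HasSum (fun s : ℕ => D.frobCoeff l q (s + e) * c s * X ^ s)
      (∑ k ∈ range (n + 1), l ^ k * ∑ m ∈ range (k + 1),
        (-1) ^ (n - m) * D.f m (n - k) * frobWeight m k q * S m) := fun q => by
    have := hasSum_sum (s := range (n + 1)) (fun k _ =>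
      (hasSum_sum (s := range (k + 1)) (fun m _ =>
        (hsum m).mul_left ((-1) ^ (n - m) * D.f m (n - k) * frobWeight m k q))).mul_left (l ^ k))
    refine (funext fun s => ?_ : (fun s : ℕ => D.frobCoeff l q (s + e) * c s * X ^ s) = _) ▸ this
    simp only [frobCoeff, sum_mul, mul_sum]
    refine sum_congr rfl fun k _ => sum_congr rfl fun m _ => ?_
    ring
  have hshift : ∀ q, HasSum (fun σ : ℕ =>
      (if q ≤ σ then D.frobCoeff l q ((σ - q : ℕ) + e) * c (σ - q) else 0) * X ^ σ)
      (X ^ q * ∑ k ∈ range (n + 1), l ^ k * ∑ m ∈ range (k + 1),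
        (-1) ^ (n - m) * D.f m (n - k) * frobWeight m k q * S m) := fun q => by
    have h1 := (hU q).mul_left (X ^ q)
    have h0 : ∑ σ ∈ range q, (if q ≤ σ then D.frobCoeff l q ((σ - q : ℕ) + e) * c (σ - q)
        else 0) * X ^ σ = 0 := sum_eq_zero fun σ hσ => by
      rw [if_neg (by simpa using hσ), zero_mul]
    have hfun : (fun s : ℕ => (if q ≤ s + q then D.frobCoeff l q ((s + q - q : ℕ) + e) *
        c (s + q - q) else 0) * X ^ (s + q)) =
        fun s : ℕ => X ^ q * (D.frobCoeff l q (s + e) * c s * X ^ s) := by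
      ext s
      simp only [Nat.le_add_left, if_true, Nat.add_sub_cancel, pow_add]; ring
    have h2 := (hasSum_nat_add_iff (f := fun σ : ℕ =>
      (if q ≤ σ then D.frobCoeff l q ((σ - q : ℕ) + e) * c (σ - q) else 0) * X ^ σ) q).1
      (by rw [hfun]; exact h1)
    rwa [h0, add_zero] at h2
  have htot := hasSum_sum (s := range (n + 1)) fun q _ => hshift q
  have hzero : (fun σ : ℕ => ∑ q ∈ range (n + 1),
      (if q ≤ σ then D.frobCoeff l q ((σ - q : ℕ) + e) * c (σ - q) else 0) * X ^ σ) = fun _ => 0 := by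
    ext σ
    rw [← sum_mul, hc σ, zero_mul]
  rw [hzero] at htot
  have hT := htot.unique hasSum_zero
  have hT' : ∑ k ∈ range (n + 1), ∑ m ∈ range (k + 1),
      (-1) ^ (n - m) * D.f m (n - k) * l ^ k * ((1 - X) ^ (k - m) * X ^ m) * S m = 0 := by
    rw [← hT]
    simp only [mul_sum]
    rw [Finset.sum_comm]
    refine sum_congr rfl fun k hk => ?_
    rw [Finset.sum_comm]
    refine sum_congr rfl fun m hm => ?_
    rw [← sum_frobWeight (n := n) (by simpa [Nat.lt_succ_iff] using hm)
      (by simpa [Nat.lt_succ_iff] using hk), mul_sum, sum_mul]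
    exact sum_congr rfl fun q _ => by ring
  have hfin : ∀ m ∈ range (n + 1), D.odeCoeff m (l * (1 - X)) *
      ((-1 / l) ^ (n - m) * frobSeries e c (n - m) ω) =
      (exp ((e - n) * ω) / l ^ n) * ∑ k ∈ Finset.Icc m n,
        (-1) ^ (n - m) * D.f m (n - k) * l ^ k * ((1 - X) ^ (k - m) * X ^ m) * S m := fun m hm => by
    have hmn : m ≤ n := by simpa [Nat.lt_succ_iff] using hm
    have h1 : exp ((e - (n - m : ℕ)) * ω) = exp ((e - n) * ω) * X ^ m := by
      rw [← hpow, ← exp_add, Nat.cast_sub hmn]; ring_nf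
    rw [frobSeries, h1, odeCoeff, mul_sum, sum_mul]
    refine sum_congr rfl fun k hk => ?_
    have hk := Finset.mem_Icc.1 hk
    have h2 : l ^ k * l ^ (n - m) = l ^ (k - m) * l ^ n := by
      rw [← pow_add, ← pow_add]; congr 1; omega
    rw [mul_pow, div_pow]
    simp only [hS]
    field_simp
    linear_combination (-(D.f m (n - k) * (1 - X) ^ (k - m) * X ^ m *
      expSum (fun s => c s * (descPochhammer ℂ (n - m)).eval (s + e)) ω)) * h2
  rw [sum_congr rfl hfin, ← mul_sum,
    Finset.sum_comm' (t' := range (n + 1)) (s' := fun k => range (k + 1)), hT', mul_zero]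
  intro m k
  simp only [Finset.mem_range, Finset.mem_Icc]
  omega

theorem frobCoeff_zero (j : Fin n) (z : ℂ) : D.frobCoeff (D.lam j) 0 z = 0 := by
  have : D.frobCoeff (D.lam j) 0 z = (-1) ^ n * (descPochhammer ℂ n).eval z *
      ∑ k ∈ range (n + 1), D.f 0 (n - k) * D.lam j ^ k := by
    rw [frobCoeff, mul_sum]
    refine sum_congr rfl fun k _ => ?_
    rw [Finset.sum_eq_single 0]
    · simp [frobWeight]; ring
    · intro m _ hm; simp [frobWeight, hm]
    · simp
  rw [this, D.lam_root, mul_zero]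

theorem frobCoeff_one (hn : 1 ≤ n) (j : Fin n) (z : ℂ) : D.frobCoeff (D.lam j) 1 z =
    (-1) ^ (n - 1) * D.lamDeriv j * (descPochhammer ℂ (n - 1)).eval z * (z + D.mu j) := by
  obtain ⟨N, rfl⟩ : ∃ N, n = N + 1 := ⟨n - 1, by omega⟩
  have h1 : ∀ k ∈ range (N + 1 + 1), D.lam j ^ k * ∑ m ∈ range (k + 1),
      (-1) ^ (N + 1 - m) * D.f m (N + 1 - k) * frobWeight m k 1 *
        (descPochhammer ℂ (N + 1 - m)).eval z =
      (-1) ^ N * (descPochhammer ℂ (N + 1)).eval z * (k * D.f 0 (N + 1 - k) * D.lam j ^ k) +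
      (-1) ^ N * (descPochhammer ℂ N).eval z *
        (if 1 ≤ k then D.f 1 (N + 1 - k) * D.lam j ^ k else 0) := fun k _ => by
    rcases Nat.eq_zero_or_pos k with rfl | hk
    · simp [frobWeight]
    · obtain ⟨k, rfl⟩ : ∃ k', k = k' + 1 := ⟨k - 1, by omega⟩
      rw [Finset.sum_eq_add_of_mem 0 1 (by simp) (by simp) zero_ne_one]
      · simp [frobWeight, pow_succ]; ring
      · intro m _ hm
        have : ¬ m ≤ 1 := by omega
        simp [frobWeight, this]
  rw [frobCoeff, sum_congr rfl h1, Finset.sum_add_distrib, ← mul_sum,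
    ← mul_sum, ← Finset.sum_filter]
  have h2 : (range (N + 1 + 1)).filter (fun k => 1 ≤ k) = Finset.Icc 1 (N + 1) := by
    ext k; simp; omega
  have h3 := D.sum_f_one j
  rw [h2, h3, descPochhammer_succ_eval]
  simp only [lamDeriv, Nat.add_sub_cancel]
  push_cast
  ring

theorem exists_norm_frobCoeff_le (l e : ℂ) (q : ℕ) :
    ∃ K : ℝ, 0 ≤ K ∧ ∀ s : ℕ, ‖D.frobCoeff l q (s + e)‖ ≤ K * (s + 1) ^ n := by
  choose K hK0 hK using fun m : ℕ => exists_norm_falling_le e (n - m)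
  refine ⟨∑ k ∈ range (n + 1), ‖l ^ k‖ * ∑ m ∈ range (k + 1),
    ‖(-1) ^ (n - m) * D.f m (n - k) * frobWeight m k q‖ * K m, ?_, fun s => ?_⟩
  · exact sum_nonneg fun k _ => mul_nonneg (norm_nonneg _)
      (sum_nonneg fun m _ => mul_nonneg (norm_nonneg _) (hK0 m))
  · rw [frobCoeff, sum_mul]
    refine norm_sum_le_of_le _ fun k _ => ?_
    rw [norm_mul, mul_assoc, sum_mul]
    gcongr
    refine norm_sum_le_of_le _ fun m _ => ?_
    rw [norm_mul, mul_assoc ‖_‖ (K m)]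
    refine mul_le_mul_of_nonneg_left ((hK m s).trans ?_) (norm_nonneg _)
    have := hK0 m
    have : (1 : ℝ) ≤ s + 1 := by simp
    gcongr
    exact Nat.sub_le _ _

theorem exists_le_norm_frobCoeff_one (hn : 1 ≤ n) (j : Fin n) (e : ℂ) : ∃ δ : ℝ, 0 < δ ∧
    ∃ s₀ : ℕ, ∀ s : ℕ, s₀ ≤ s → δ * (s + 1) ^ n ≤ ‖D.frobCoeff (D.lam j) 1 (s + e)‖ := by
  obtain ⟨s₁, h₁⟩ := exists_le_norm_falling e (n - 1)
  obtain ⟨s₂, h₂⟩ := exists_le_norm_linear (e + D.mu j)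
  have hΛ : 0 < ‖D.lamDeriv j‖ := norm_pos_iff.2 (D.lamDeriv_ne_zero j)
  refine ⟨‖D.lamDeriv j‖ / 2 ^ n, by positivity, max s₁ s₂, fun s hs => ?_⟩
  have e1 := h₁ s ((le_max_left _ _).trans hs)
  have e2 := h₂ s ((le_max_right _ _).trans hs)
  rw [D.frobCoeff_one hn, norm_mul, norm_mul, norm_mul, norm_pow, norm_neg, norm_one, one_pow,
    one_mul, add_assoc, mul_assoc ‖D.lamDeriv j‖]
  have h3 : ‖D.lamDeriv j‖ / 2 ^ n * ((s : ℝ) + 1) ^ n =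
      ‖D.lamDeriv j‖ * ((((s : ℝ) + 1) / 2) ^ (n - 1) * (((s : ℝ) + 1) / 2)) := by
    rw [← pow_succ, Nat.sub_add_cancel hn, div_pow]; ring
  rw [h3]
  gcongr

theorem FormalSolution.geomBounded {D : InverseFactorialData n} (hn : 1 ≤ n) {j : Fin n} {e : ℂ}
    {c : ℕ → ℂ} (hc : D.FormalSolution (D.lam j) e c) : ∃ r : ℝ, 0 < r ∧ GeomBounded c r := by
  choose K hK0 hK using fun q : ℕ => D.exists_norm_frobCoeff_le (D.lam j) e q
  obtain ⟨δ, hδ, s₀, hs₀⟩ := D.exists_le_norm_frobCoeff_one hn j e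
  set A := ∑ q ∈ range (n + 1), K q with hA
  set ρ := max 1 (A / δ) with hρ
  have hρ1 : 1 ≤ ρ := le_max_left _ _
  have hAρ : A ≤ ρ * δ := (div_le_iff₀ hδ).1 (le_max_right _ _)
  set C := ∑ i ∈ range s₀, ‖c i‖ with hC
  have hC0 : 0 ≤ C := sum_nonneg fun _ _ => norm_nonneg _
  refine ⟨ρ, by positivity, C, fun s => ?_⟩
  induction s using Nat.strong_induction_on with
  | _ s ih =>
    rcases lt_or_ge s s₀ with h | h
    · calc ‖c s‖ ≤ C := Finset.single_le_sum (f := fun i => ‖c i‖) (fun _ _ => norm_nonneg _)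
            (Finset.mem_range.2 h)
        _ ≤ C * ρ ^ s := le_mul_of_one_le_right hC0 (one_le_pow₀ hρ1)
    · have hrec := hc (s + 1)
      rw [← Finset.add_sum_erase _ _ (show 1 ∈ range (n + 1) by simp; omega),
        if_pos (by omega), Nat.add_sub_cancel] at hrec
      have hrest : ‖∑ q ∈ (range (n + 1)).erase 1, (if q ≤ s + 1 then
          D.frobCoeff (D.lam j) q ((s + 1 - q : ℕ) + e) * c (s + 1 - q) else 0)‖ * ρ ≤
          A * ((s + 1) ^ n * (C * ρ ^ s)) := by
        have h1 : A * ((s + 1) ^ n * (C * ρ ^ s)) ≥ ∑ q ∈ (range (n + 1)).erase 1,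
            K q * ((s + 1) ^ n * (C * ρ ^ s)) := by
          rw [hA, sum_mul]
          exact Finset.sum_le_sum_of_subset_of_nonneg (Finset.erase_subset _ _)
            fun q _ _ => mul_nonneg (hK0 q) (by positivity)
        refine le_trans ?_ h1
        refine (mul_le_mul_of_nonneg_right (norm_sum_le _ _) (by positivity)).trans ?_
        rw [sum_mul]
        refine Finset.sum_le_sum fun q hq => ?_
        have hq1 : q ≠ 1 := (Finset.mem_erase.1 hq).1
        have hnn : 0 ≤ K q * ((s + 1) ^ n * (C * ρ ^ s)) := mul_nonneg (hK0 q) (by positivity)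
        split_ifs with hqs
        · rcases Nat.eq_zero_or_pos q with rfl | hq0
          · rw [frobCoeff_zero]; simpa using hnn
          · have h2 := ih (s + 1 - q) (by omega)
            rw [norm_mul]
            have h3 : ((s + 1 - q : ℕ) : ℝ) + 1 ≤ s + 1 := by
              have : s + 1 - q ≤ s := by omega
              have : ((s + 1 - q : ℕ) : ℝ) ≤ s := by exact_mod_cast this
              linarith
            have h4 : ρ ^ (s + 1 - q) * ρ ≤ ρ ^ s := by
              rw [← pow_succ]; exact pow_le_pow_right₀ hρ1 (by omega)
            calc _ ≤ (K q * (((s + 1 - q : ℕ) : ℝ) + 1) ^ n) * (C * ρ ^ (s + 1 - q)) * ρ := by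
                  gcongr
                  · exact mul_nonneg (hK0 q) (by positivity)
                  · exact hK q _
              _ = K q * ((((s + 1 - q : ℕ) : ℝ) + 1) ^ n * (C * (ρ ^ (s + 1 - q) * ρ))) := by ring
              _ ≤ _ := by
                  have := hK0 q
                  gcongr
        · simpa using hnn
      have hmain : ‖D.frobCoeff (D.lam j) 1 (s + e)‖ * ‖c s‖ * ρ ≤
          A * ((s + 1) ^ n * (C * ρ ^ s)) := by
        rw [← norm_mul, eq_neg_of_add_eq_zero_left hrec, norm_neg]
        exact hrest
      have h5 : δ * (s + 1) ^ n * ‖c s‖ * ρ ≤ ρ * δ * ((s + 1) ^ n * (C * ρ ^ s)) := by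
        refine le_trans ?_ (hmain.trans ?_)
        · gcongr; exact hs₀ s h
        · gcongr
      have hpos : 0 < δ * ((s : ℝ) + 1) ^ n * ρ := by positivity
      refine le_of_mul_le_mul_left ?_ hpos
      linarith

end InverseFactorialData

theorem Gamma_add_nat_eq {z : ℂ} (hz : ∀ m : ℤ, z ≠ m) (k : ℕ) :
    Gamma (z + k) = (ascPochhammer ℂ k).eval z * Gamma z := by
  induction k with
  | zero => simp
  | succ k ih =>
    have : z + k ≠ 0 := fun h => hz (-k) (by push_cast; linear_combination h)
    rw [Nat.cast_succ, ← add_assoc, Gamma_add_one _ this, ih, ascPochhammer_succ_eval]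
    ring

theorem ascPochhammer_eval_neg_natCast (p r : ℕ) :
    (ascPochhammer ℂ r).eval (-(p : ℂ)) = (-1) ^ r * (r.factorial * p.choose r) := by
  rw [ascPochhammer_eval_neg_eq_descPochhammer, descPochhammer_eval_eq_descFactorial,
    Nat.descFactorial_eq_factorial_mul_choose]
  push_cast; ring

namespace InverseFactorialData

variable {n : ℕ} (D : InverseFactorialData n)

/-! ### The two kinds of local solutions -/

/-- The coefficients `a_{s,j} Γ(μ_j - s)` of the Borel transform. -/
noncomputable def borelCoeff (j : Fin n) (s : ℕ) : ℂ := D.coeff j s * Gamma (D.mu j - s)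

theorem mu_ne_int (j : Fin n) (m : ℤ) : D.mu j ≠ m := D.mu_not_int j m

theorem Gamma_mu_sub_ne_zero (j : Fin n) (s : ℕ) : Gamma (D.mu j - s) ≠ 0 :=
  Gamma_ne_zero fun m h => D.mu_ne_int j (s - m) (by push_cast; linear_combination h)

theorem borelCoeff_zero_ne (j : Fin n) : D.borelCoeff j 0 ≠ 0 :=
  mul_ne_zero (D.coeff_zero j) (D.Gamma_mu_sub_ne_zero j 0)

theorem borelCoeff_mul_falling (j : Fin n) (s N : ℕ) :
    (descPochhammer ℂ N).eval (s + -D.mu j) * D.borelCoeff j s =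
      (-1) ^ N * D.coeff j s * Gamma (D.mu j - s + N) := by
  rw [Gamma_add_nat_eq (fun m h => D.mu_ne_int j (m + s) (by push_cast; linear_combination h)),
    borelCoeff]
  have h := ascPochhammer_eval_neg_eq_descPochhammer ℂ (s + -D.mu j) N
  have h2 : -(s + -D.mu j) = D.mu j - s := by ring
  rw [h2] at h
  rw [h]
  have : ((-1 : ℂ) ^ N) * (-1) ^ N = 1 := by rw [← mul_pow]; simp
  linear_combination (-(descPochhammer ℂ N).eval (s + -D.mu j) * D.coeff j s *
    Gamma (D.mu j - s)) * this

theorem frobCoeff_mul_borelCoeff (j : Fin n) {q σ : ℕ} (hq : 2 ≤ q) (hqn : q ≤ n) (hqσ : q ≤ σ) :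
    D.frobCoeff (D.lam j) q ((σ - q : ℕ) + -D.mu j) * D.borelCoeff j (σ - q) =
      Gamma (D.mu j - σ + n) * (D.coeff j (σ - q) *
        ∑ k ∈ Finset.Icc 1 n, D.lam j ^ k * ∑ r ∈ Finset.Icc (q - k) q,
          (-1) ^ r * ((ascPochhammer ℂ r).eval (-(n : ℂ) - D.mu j + (σ - 1 : ℕ) - r + 2) *
            (ascPochhammer ℂ r).eval ((q : ℂ) - k - r)) / (r.factorial : ℂ) *
            D.f (q - r) (n - k)) := by
  have h0 : ∀ k ∈ range (n + 1), k ∉ Finset.Icc 1 n → D.lam j ^ k * (∑ m ∈ range (k + 1),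
      (-1) ^ (n - m) * D.f m (n - k) * frobWeight m k q *
        (descPochhammer ℂ (n - m)).eval ((σ - q : ℕ) + -D.mu j)) = 0 := fun k hk hk' => by
    have : k = 0 := by simp at hk hk'; omega
    subst this
    have : 0 < q := by omega
    simp [frobWeight, Nat.choose_eq_zero_of_lt this]
  rw [frobCoeff, ← Finset.sum_subset (s₁ := Finset.Icc 1 n)
    (fun k hk => by simp at hk ⊢; omega) h0, sum_mul]
  simp only [mul_sum]
  refine sum_congr rfl fun k hk => ?_
  have hk := Finset.mem_Icc.1 hk
  rw [sum_mul, ← Finset.sum_subset (s₁ := (range (k + 1)).filter (· ≤ q))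
    (Finset.filter_subset _ _)]
  swap
  · intro m hm hm'
    have : ¬ m ≤ q := fun h => hm' (Finset.mem_filter.2 ⟨hm, h⟩)
    simp [frobWeight, this]
  refine Finset.sum_bij' (fun m _ => q - m) (fun r _ => q - r) ?_ ?_ ?_ ?_ ?_
  · intro m hm; simp at hm ⊢; omega
  · intro r hr; simp at hr ⊢; omega
  · intro m hm; simp at hm; omega
  · intro r hr; simp at hr; omega
  intro m hm
  simp only [Finset.mem_filter, Finset.mem_range] at hm
  obtain ⟨r, rfl⟩ : ∃ r, q = m + r := ⟨q - m, by omega⟩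
  obtain ⟨p, rfl⟩ : ∃ p, k = m + p := ⟨k - m, by omega⟩
  have e1 : m + r - m = r := by omega
  have e2 : m + p - m = p := by omega
  have e3 : m + r - r = m := by omega
  simp only [e1, e3]
  have hW : frobWeight m (m + p) (m + r) = (-1) ^ r * (p.choose r : ℂ) := by
    simp [frobWeight, e1, e2]
  have hG := D.borelCoeff_mul_falling j (σ - (m + r)) (n - m)
  have hG2 : D.mu j - ((σ - (m + r) : ℕ) : ℂ) + ((n - m : ℕ) : ℂ) = (D.mu j - σ + n) + (r : ℂ) := by
    rw [Nat.cast_sub hqσ, Nat.cast_sub (by omega)]; push_cast; ring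
  rw [hG2, Gamma_add_nat_eq (fun i h => D.mu_ne_int j (i + σ - n) (by
    push_cast; linear_combination h))] at hG
  have hA : (ascPochhammer ℂ r).eval (-(n : ℂ) - D.mu j + (σ - 1 : ℕ) - r + 2) =
      (-1) ^ r * (ascPochhammer ℂ r).eval (D.mu j - σ + n) := by
    have : -(n : ℂ) - D.mu j + (σ - 1 : ℕ) - r + 2 = -(D.mu j - σ + n + r - 1) := by
      rw [Nat.cast_sub (by omega)]; push_cast; ring
    rw [this, ascPochhammer_eval_neg_eq_descPochhammer, descPochhammer_eval_eq_ascPochhammer]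
    congr 2; ring
  have hB : (ascPochhammer ℂ r).eval (((m + r : ℕ) : ℂ) - (m + p : ℕ) - r) =
      (-1) ^ r * (r.factorial * p.choose r) := by
    rw [← ascPochhammer_eval_neg_natCast]; congr 1; push_cast; ring
  rw [hW, hA, hB]
  have hs : ((-1 : ℂ) ^ r) * (-1) ^ r = 1 := by rw [← mul_pow]; simp
  have hs' : ((-1 : ℂ) ^ (n - m)) * (-1) ^ (n - m) = 1 := by rw [← mul_pow]; simp
  have hf : (r.factorial : ℂ) ≠ 0 := by exact_mod_cast r.factorial_ne_zero
  have hR : (-1 : ℂ) ^ r * ((-1) ^ r * (ascPochhammer ℂ r).eval (D.mu j - σ + n) *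
      ((-1) ^ r * (r.factorial * p.choose r))) / r.factorial =
      (-1) ^ r * (p.choose r) * (ascPochhammer ℂ r).eval (D.mu j - σ + n) := by
    rw [div_eq_iff hf]
    linear_combination ((-1) ^ r * (ascPochhammer ℂ r).eval (D.mu j - σ + n) * r.factorial *
      p.choose r) * hs
  rw [hR]
  linear_combination (D.lam j ^ (m + p) * (-1) ^ (n - m) * D.f m (n - (m + p)) * (-1) ^ r *
    p.choose r) * hG + (D.lam j ^ (m + p) * D.f m (n - (m + p)) * (-1) ^ r * p.choose r *
    D.coeff j (σ - (m + r)) * (ascPochhammer ℂ r).eval (D.mu j - σ + n) *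
    Gamma (D.mu j - σ + n)) * hs'

theorem formalSolution_borelCoeff (hn : 2 ≤ n) (j : Fin n) :
    D.FormalSolution (D.lam j) (-D.mu j) (D.borelCoeff j) := by
  intro σ
  rcases Nat.eq_zero_or_pos σ with rfl | hσ
  · refine sum_eq_zero fun q _ => ?_
    split_ifs with h
    · obtain rfl : q = 0 := by omega
      rw [frobCoeff_zero, zero_mul]
    · rfl
  obtain ⟨s, rfl⟩ : ∃ s, σ = s + 1 := ⟨σ - 1, by omega⟩
  have hsplit : range (n + 1) = insert 0 (insert 1 (Finset.Icc 2 n)) := by ext q; simp; omega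
  rw [hsplit, Finset.sum_insert (by simp), Finset.sum_insert (by simp), frobCoeff_zero, zero_mul,
    ite_self, zero_add, if_pos (by omega), ← Finset.sum_filter]
  have hfilt : (Finset.Icc 2 n).filter (fun q => q ≤ s + 1) = Finset.Icc 2 (min n (s + 1)) := by
    ext q; simp; omega
  rw [hfilt, sum_congr rfl fun q hq => by
    have hq := Finset.mem_Icc.1 hq
    exact D.frobCoeff_mul_borelCoeff j hq.1 (hq.2.trans (min_le_left _ _))
      (hq.2.trans (min_le_right _ _)), ← mul_sum]
  have hrec : ∑ q ∈ Finset.Icc 2 (min n (s + 1)), (D.coeff j (s + 1 - q) *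
        ∑ k ∈ Finset.Icc 1 n, D.lam j ^ k * ∑ r ∈ Finset.Icc (q - k) q,
          (-1) ^ r * ((ascPochhammer ℂ r).eval (-(n : ℂ) - D.mu j + (s + 1 - 1 : ℕ) - r + 2) *
            (ascPochhammer ℂ r).eval ((q : ℂ) - k - r)) / (r.factorial : ℂ) *
            D.f (q - r) (n - k)) =
      (s : ℂ) * (-D.lamDeriv j) * D.coeff j s := by
    rw [lamDeriv_eq, neg_neg]
    rcases Nat.eq_zero_or_pos s with rfl | hs
    · have : Finset.Icc 2 (min n (0 + 1)) = ∅ := by ext q; simp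
      rw [this]; simp
    · exact (D.coeff_rec j s hs).symm
  rw [hrec, Nat.add_sub_cancel, D.frobCoeff_one (by omega)]
  have hG := D.borelCoeff_mul_falling j s (n - 1)
  have hG2 : D.mu j - (s : ℂ) + ((n - 1 : ℕ) : ℂ) = D.mu j - ((s + 1 : ℕ) : ℂ) + n := by
    rw [Nat.cast_sub (by omega)]; push_cast; ring
  rw [hG2] at hG
  have hs' : ((-1 : ℂ) ^ (n - 1)) * (-1) ^ (n - 1) = 1 := by rw [← mul_pow]; simp
  linear_combination ((-1) ^ (n - 1) * D.lamDeriv j * s) * hG +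
    (D.lamDeriv j * s * D.coeff j s * Gamma (D.mu j - ((s + 1 : ℕ) : ℂ) + n)) * hs'

/-- The coefficients of the solution that is analytic at `λ_j` and whose first `n - 1` coefficients
are given by `v`. -/
noncomputable def regCoeff (j : Fin n) (v : ℕ → ℂ) (s : ℕ) : ℂ := if s + 1 < n then v s
  else -(∑ q : Fin (n + 1), if h : 2 ≤ (q : ℕ) ∧ (q : ℕ) ≤ s + 1 then
    D.frobCoeff (D.lam j) q ((s + 1 - q : ℕ) + 0) * regCoeff j v (s + 1 - q) else 0) /
      D.frobCoeff (D.lam j) 1 (s + 0)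
termination_by s
decreasing_by omega

theorem descPochhammer_eval_natCast_of_lt {s N : ℕ} (h : s < N) :
    (descPochhammer ℂ N).eval (s : ℂ) = 0 := by
  rw [descPochhammer_eval_eq_descFactorial, Nat.descFactorial_of_lt h, Nat.cast_zero]

theorem frobCoeff_one_natCast_ne_zero (hn : 2 ≤ n) (j : Fin n) {s : ℕ} (hs : n ≤ s + 1) :
    D.frobCoeff (D.lam j) 1 (s + 0) ≠ 0 := by
  rw [D.frobCoeff_one (by omega), add_zero]
  refine mul_ne_zero (mul_ne_zero (mul_ne_zero (pow_ne_zero _ (by simp)) (D.lamDeriv_ne_zero j)) ?_) ?_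
  · rw [descPochhammer_eval_eq_descFactorial, Nat.cast_ne_zero]
    exact (Nat.descFactorial_pos.2 (by omega)).ne'
  · exact fun h => D.mu_ne_int j (-s) (by push_cast; linear_combination h)

theorem formalSolution_regCoeff (hn : 2 ≤ n) (j : Fin n) (v : ℕ → ℂ) :
    D.FormalSolution (D.lam j) 0 (D.regCoeff j v) := by
  intro σ
  rcases lt_or_ge σ n with hσ | hσ
  · refine sum_eq_zero fun q _ => ?_
    split_ifs with h
    swap; · rfl
    rcases Nat.eq_zero_or_pos q with rfl | hq
    · rw [frobCoeff_zero, zero_mul]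
    · rw [frobCoeff, sum_eq_zero, zero_mul]
      intro k _
      rw [sum_eq_zero, mul_zero]
      intro m hm
      rcases le_or_gt m q with hmq | hmq
      · rw [add_zero, descPochhammer_eval_natCast_of_lt (by omega), mul_zero]
      · simp [frobWeight, not_le.2 hmq]
  · obtain ⟨s, rfl⟩ : ∃ s, σ = s + 1 := ⟨σ - 1, by omega⟩
    have hne := D.frobCoeff_one_natCast_ne_zero hn j hσ
    have hdef : D.frobCoeff (D.lam j) 1 (s + 0) * D.regCoeff j v s =
        -(∑ q ∈ range (n + 1), if 2 ≤ q ∧ q ≤ s + 1 then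
          D.frobCoeff (D.lam j) q ((s + 1 - q : ℕ) + 0) * D.regCoeff j v (s + 1 - q) else 0) := by
      rw [regCoeff, if_neg (by omega), mul_div_cancel₀ _ hne, Finset.sum_range]
      simp
    rw [← Finset.add_sum_erase _ _ (show 1 ∈ range (n + 1) by simp; omega),
      if_pos (by omega), Nat.add_sub_cancel, hdef, neg_add_eq_zero,
      ← Finset.add_sum_erase _ _ (show 1 ∈ range (n + 1) by simp; omega), if_neg (by omega),
      zero_add]
    refine sum_congr rfl fun q hq => ?_
    have hq1 := (Finset.mem_erase.1 hq).1
    rcases Nat.eq_zero_or_pos q with rfl | hq0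
    · simp [frobCoeff_zero]
    · have : 2 ≤ q := by omega
      simp [this]

end InverseFactorialData

theorem GeomBounded.shift {b : ℕ → ℂ} {r : ℝ} (h : GeomBounded b r) (k : ℕ) :
    GeomBounded (fun s => b (s + k)) r := by
  obtain ⟨C, hC⟩ := h
  exact ⟨C * r ^ k, fun s => (hC (s + k)).trans (le_of_eq (by ring))⟩

theorem GeomBounded.expSum_eq {b : ℕ → ℂ} {r : ℝ} (h : GeomBounded b r) (hr : 0 ≤ r) {ω : ℂ}
    (hω : r * Real.exp ω.re < 1) (k : ℕ) :
    expSum b ω = ∑ s ∈ range k, b s * exp (s * ω) +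
      exp (k * ω) * expSum (fun s => b (s + k)) ω := by
  rw [expSum, ← (h.summable hr hω).sum_add_tsum_nat_add k, expSum, ← tsum_mul_left]
  congr 1
  refine tsum_congr fun s => ?_
  rw [Nat.cast_add, add_mul, exp_add]; ring

theorem exists_mul_exp_lt (r C : ℝ) (hC : 0 < C) : ∃ x₀ : ℝ, ∀ x ≤ x₀, r * Real.exp x < C := by
  have : Tendsto (fun x => r * Real.exp x) atBot (𝓝 0) := by
    simpa using Real.tendsto_exp_atBot.const_mul r
  exact (eventually_atBot.1 (this.eventually_lt_const hC))

/-- A sum `∑ b_s e^{s ω}` determines its coefficients. -/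
theorem GeomBounded.coeff_eq_zero {b : ℕ → ℂ} {r : ℝ} (h : GeomBounded b r) (hr : 0 ≤ r) {x₀ : ℝ}
    (h0 : ∀ ω : ℂ, ω.re < x₀ → expSum b ω = 0) (k : ℕ) : b k = 0 := by
  induction k using Nat.strong_induction_on with
  | _ k ih =>
    obtain ⟨x₁, hx₁⟩ := exists_mul_exp_lt r 1 one_pos
    obtain ⟨M, hM⟩ := (h.shift (k + 1)).norm_expSum_le hr (hx₁ x₁ le_rfl)
    have key : ∀ ω : ℂ, ω.re < x₀ → ω.re ≤ x₁ → ‖b k‖ ≤ M * Real.exp ω.re := fun ω h1 h2 => by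
      have h3 := h.expSum_eq hr (hx₁ _ h2) (k + 1)
      rw [h0 ω h1, Finset.sum_range_succ, sum_eq_zero fun s hs => by
        rw [ih s (Finset.mem_range.1 hs), zero_mul], zero_add, Nat.cast_succ, add_mul, one_mul,
        exp_add, mul_assoc, mul_comm (b k), ← mul_add] at h3
      have h4 := (mul_eq_zero.1 h3.symm).resolve_left (exp_ne_zero _)
      rw [eq_neg_of_add_eq_zero_left h4, norm_neg, norm_mul, norm_exp, mul_comm]
      gcongr
      exact hM ω h2
    by_contra hb
    obtain ⟨x₂, hx₂⟩ := exists_mul_exp_lt M ‖b k‖ (norm_pos_iff.2 hb)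
    set x := min (x₀ - 1) (min x₁ x₂)
    have h1 : x ≤ x₀ - 1 := min_le_left _ _
    have h2 : x ≤ x₁ := (min_le_right _ _).trans (min_le_left _ _)
    have h3 : x ≤ x₂ := (min_le_right _ _).trans (min_le_right _ _)
    have := key (x : ℂ) (by simp; linarith) (by simpa using h2)
    exact absurd (hx₂ x h3) (not_lt.2 (by simpa using this))

theorem GeomBounded.exists_expSum_eq_comp_exp {b : ℕ → ℂ} {r : ℝ} (h : GeomBounded b r)
    (hr : 0 < r) : DifferentiableOn ℂ (fun X : ℂ => ∑' s, b s * X ^ s) (ball 0 (1 / (2 * r))) := by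
  obtain ⟨C, hC⟩ := h
  refine differentiableOn_tsum_of_summable_norm (u := fun s : ℕ => C * (1 / 2) ^ s)
    (summable_geometric_two.mul_left C) (fun s => by fun_prop) isOpen_ball fun s X hX => ?_
  rw [norm_mul, norm_pow]
  have hX' : ‖X‖ ≤ 1 / (2 * r) := by simpa using (mem_ball_zero_iff.1 hX).le
  calc ‖b s‖ * ‖X‖ ^ s ≤ (C * r ^ s) * (1 / (2 * r)) ^ s := by
        have := hC s
        have h0 := (norm_nonneg _).trans this
        gcongr
    _ = C * (1 / 2) ^ s := by rw [mul_assoc, ← mul_pow]; congr 2; field_simp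

theorem expSum_eq_tsum (b : ℕ → ℂ) (ω : ℂ) : expSum b ω = ∑' s, b s * exp ω ^ s := by
  simp only [expSum, exp_nat_mul]

theorem expSum_sub_two_pi (b : ℕ → ℂ) (ω : ℂ) : expSum b (ω - 2 * π * I) = expSum b ω := by
  rw [expSum_eq_tsum, expSum_eq_tsum, exp_periodic.sub_eq]

theorem frobSeries_sub_two_pi (e : ℂ) (c : ℕ → ℂ) (N : ℕ) (ω : ℂ) :
    frobSeries e c N (ω - 2 * π * I) = exp (-(2 * π * I * e)) * frobSeries e c N ω := by
  have : exp ((e - N) * (ω - 2 * π * I)) = exp (-(2 * π * I * e)) * exp ((e - N) * ω) := by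
    rw [← exp_add, exp_eq_exp_iff_exists_int]
    exact ⟨N, by push_cast; ring⟩
  rw [frobSeries, frobSeries, this, expSum_sub_two_pi]; ring

theorem neZero_of_fact_two_le {n : ℕ} [h : Fact (2 ≤ n)] : NeZero n := ⟨by have := h.out; omega⟩

attribute [instance] neZero_of_fact_two_le

namespace InverseFactorialData

variable {n : ℕ} (D : InverseFactorialData n)

/-- `log (1 - t/λ_j) - log (t - λ_j)`. -/
noncomputable def baseLog (j : Fin n) : ℂ := π * I - D.logLam j

theorem exp_add_baseLog (j : Fin n) (w : ℂ) : exp (w + D.baseLog j) = -exp w / D.lam j := by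
  rw [baseLog, exp_add, exp_sub, D.exp_logLam, exp_pi_mul_I]; ring

/-- The vector field of the differential equation in the variable `w = log (t - c)`. -/
noncomputable def logField (c : ℂ) (w : ℂ) : (Fin n → ℂ) →L[ℂ] (Fin n → ℂ) :=
  exp w • D.odeField (c + exp w)

theorem differentiableOn_logField {c : ℂ} {S : Set ℂ}
    (hS : ∀ w ∈ S, ∀ l, c + exp w ≠ D.lam l) : DifferentiableOn ℂ (D.logField c) S := by
  have h1 : DifferentiableOn ℂ D.odeField {t | ∀ l, t ≠ D.lam l} :=
    D.differentiableOn_odeField fun t ht => D.odeCoeff_zero_ne ht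
  exact differentiable_exp.differentiableOn.smul
    (h1.comp (differentiable_exp.const_add c).differentiableOn fun w hw => hS w hw)

/-- The vector `(y, y', …, y^{(n-1)})` for the series `y = ∑ c_s X^{s+e}`, `X = 1 - t/λ_j`, as a
function of `w = log (t - λ_j)`. -/
noncomputable def frobJet (j : Fin n) (e : ℂ) (c : ℕ → ℂ) (w : ℂ) : Fin n → ℂ := fun N =>
  (-1 / D.lam j) ^ (N : ℕ) * frobSeries e c N (w + D.baseLog j)

theorem frobJet_sub_two_pi (j : Fin n) (e : ℂ) (c : ℕ → ℂ) (w : ℂ) :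
    D.frobJet j e c (w - 2 * π * I) = exp (-(2 * π * I * e)) • D.frobJet j e c w := by
  ext N
  simp only [frobJet, Pi.smul_apply, smul_eq_mul, sub_add_eq_add_sub, frobSeries_sub_two_pi]
  ring

theorem FormalSolution.solvesLinear {D : InverseFactorialData n} {j : Fin n} {e : ℂ} {c : ℕ → ℂ}
    (hc : D.FormalSolution (D.lam j) e c) {r : ℝ} (hr : 0 < r) (hb : GeomBounded c r) {S : Set ℂ}
    (hS : ∀ w ∈ S, ∀ l, D.lam j + exp w ≠ D.lam l)
    (hω : ∀ w ∈ S, 2 ^ (n + 1) * r * Real.exp (w + D.baseLog j).re < 1) :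
    SolvesLinear (D.logField (D.lam j)) S (D.frobJet j e c) := by
  intro w hw
  have hl := D.lam_ne_zero j
  rw [hasDerivAt_pi]
  intro N
  have hN : (2 : ℝ) ^ ((N : ℕ) + 1) ≤ 2 ^ (n + 1) :=
    pow_le_pow_right₀ one_le_two (by have := N.2; omega)
  have hd : HasDerivAt (frobSeries e c N) _ (w + D.baseLog j) :=
    hasDerivAt_frobSeries hr hb (lt_of_le_of_lt (by gcongr) (hω w hw))
  have hd2 := (HasDerivAt.comp_add_const w (D.baseLog j) hd).const_mul ((-1 / D.lam j) ^ (N : ℕ))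
  refine hd2.congr_deriv ?_
  rw [D.exp_add_baseLog]
  simp only [logField, _root_.smul_apply, Pi.smul_apply, smul_eq_mul]
  by_cases hlt : (N : ℕ) + 1 < n
  · rw [odeField_apply_of_lt _ _ _ _ hlt, frobJet]
    simp only [pow_succ]; ring
  · have hNn : (N : ℕ) + 1 = n := by have := N.2; omega
    rw [odeField_apply_last _ _ _ _ hlt]
    have hode := hc.ode hl hr hb (hω w hw)
    have ht : D.lam j * (1 - exp (w + D.baseLog j)) = D.lam j + exp w := by
      rw [D.exp_add_baseLog]; field_simp; ring
    rw [ht, Finset.sum_range_succ', Nat.sub_zero] at hode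
    have hsum : ∑ k : Fin n, D.odeCoeff (n - k) (D.lam j + exp w) /
        D.odeCoeff 0 (D.lam j + exp w) * D.frobJet j e c w k =
        (∑ m ∈ range n, D.odeCoeff (m + 1) (D.lam j + exp w) *
          ((-1 / D.lam j) ^ (n - (m + 1)) * frobSeries e c (n - (m + 1)) (w + D.baseLog j))) /
          D.odeCoeff 0 (D.lam j + exp w) := by
      rw [Finset.sum_div, ← Finset.sum_range_reflect, Finset.sum_range]
      refine sum_congr rfl fun k _ => ?_
      have h1 : n - 1 - (k : ℕ) + 1 = n - k := by have := k.2; omega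
      have h2 : n - (n - (k : ℕ)) = k := by have := k.2; omega
      rw [h1, h2, frobJet]; ring
    have h0 := D.odeCoeff_zero_ne (hS w hw)
    have hcancel : ∀ Z : ℂ, -(-(D.odeCoeff 0 (D.lam j + exp w) * Z) /
        D.odeCoeff 0 (D.lam j + exp w)) = Z := fun Z => by field_simp
    rw [hsum, eq_neg_of_add_eq_zero_left hode, hcancel]
    have hpow : (-1 / D.lam j) ^ n = (-1 / D.lam j) ^ (N : ℕ) * (-1 / D.lam j) := by
      rw [← pow_succ]; congr 1; exact hNn.symm
    have hfs : frobSeries e c n = frobSeries e c (N + 1) := by congr 1; exact hNn.symm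
    rw [hpow, hfs]; ring

theorem exists_gap (j : Fin n) : ∃ x₀ : ℝ, ∀ l, l ≠ j → Real.exp x₀ < ‖D.lam l - D.lam j‖ := by
  have : ∀ᶠ x : ℝ in atBot, ∀ l, l ≠ j → Real.exp x < ‖D.lam l - D.lam j‖ := by
    refine eventually_all.2 fun l => ?_
    by_cases h : l = j
    · simp [h]
    · filter_upwards [Real.tendsto_exp_atBot.eventually_lt_const
        (norm_pos_iff.2 (sub_ne_zero.2 fun h' => h (D.lam_injective h')))] with x hx _ using hx
  exact this.exists

theorem add_exp_ne_lam {j : Fin n} {x₀ : ℝ} (h : ∀ l, l ≠ j → Real.exp x₀ < ‖D.lam l - D.lam j‖)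
    {w : ℂ} (hw : w.re < x₀) (l : Fin n) : D.lam j + exp w ≠ D.lam l := by
  intro heq
  by_cases hl : l = j
  · subst hl; exact exp_ne_zero w (by linear_combination heq)
  · have h1 := h l hl
    rw [← heq, add_sub_cancel_left, norm_exp] at h1
    exact absurd (Real.exp_lt_exp.1 h1) (not_lt.2 hw.le)

/-- The jet of the Borel transform near `λ_j`. -/
noncomputable def borelJet (j : Fin n) : ℂ → Fin n → ℂ := D.frobJet j (-D.mu j) (D.borelCoeff j)

theorem borelJet_sub_two_pi (j : Fin n) (w : ℂ) : D.borelJet j (w - 2 * π * I) =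
      exp (2 * π * I * D.mu j) • D.borelJet j w := by
  rw [borelJet, frobJet_sub_two_pi, mul_neg, neg_neg]

theorem exp_two_pi_mu_ne_one (j : Fin n) : exp (2 * π * I * D.mu j) ≠ 1 := by
  rw [Ne, exp_eq_one_iff]
  rintro ⟨m, hm⟩
  refine D.mu_ne_int j m (mul_left_cancel₀ two_pi_I_ne_zero ?_)
  linear_combination hm

variable [Fact (2 ≤ n)]

/-- `R` is a solution near `λ_p`, written in the variable `w = log (t - λ_p)`, that is analytic at
`λ_p`. -/
def IsRegularSolution (p : Fin n) (x₀ : ℝ) (R : ℂ → Fin n → ℂ) : Prop :=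
  SolvesLinear (D.logField (D.lam p)) {w | w.re < x₀} R ∧
    (∀ w : ℂ, w.re < x₀ → R (w - 2 * π * I) = R w) ∧
    ∃ ρ : ℂ → ℂ, DifferentiableOn ℂ ρ (ball 0 (Real.exp x₀)) ∧
      ∀ w : ℂ, w.re < x₀ → R w 0 = ρ (exp w)

variable {D}

theorem IsRegularSolution.add {p : Fin n} {x₀ : ℝ} {R S : ℂ → Fin n → ℂ}
    (hR : D.IsRegularSolution p x₀ R) (hS : D.IsRegularSolution p x₀ S) :
    D.IsRegularSolution p x₀ (fun w => R w + S w) := by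
  obtain ⟨h1, h2, ρ, h3, h4⟩ := hR
  obtain ⟨h1', h2', ρ', h3', h4'⟩ := hS
  refine ⟨h1.add h1', fun w hw => by beta_reduce; rw [h2 w hw, h2' w hw], fun z => ρ z + ρ' z, h3.add h3',
    fun w hw => ?_⟩
  beta_reduce; rw [Pi.add_apply, h4 w hw, h4' w hw]

theorem IsRegularSolution.smul {p : Fin n} {x₀ : ℝ} {R : ℂ → Fin n → ℂ} (c : ℂ)
    (hR : D.IsRegularSolution p x₀ R) : D.IsRegularSolution p x₀ (fun w => c • R w) := by
  obtain ⟨h1, h2, ρ, h3, h4⟩ := hR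
  refine ⟨h1.smul c, fun w hw => by beta_reduce; rw [h2 w hw], fun z => c * ρ z, h3.const_mul c, fun w hw => ?_⟩
  beta_reduce; rw [Pi.smul_apply, h4 w hw, smul_eq_mul]

theorem IsRegularSolution.zero {p : Fin n} {x₀ : ℝ} : D.IsRegularSolution p x₀ (fun _ => 0) :=
  ⟨SolvesLinear.zero, fun _ _ => rfl, fun _ => 0, differentiableOn_const _, fun _ _ => rfl⟩

theorem IsRegularSolution.sum {ι : Type*} (s : Finset ι) {p : Fin n} {x₀ : ℝ}
    {R : ι → ℂ → Fin n → ℂ} (hR : ∀ i ∈ s, D.IsRegularSolution p x₀ (R i)) :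
    D.IsRegularSolution p x₀ (fun w => ∑ i ∈ s, R i w) := by
  classical
  induction s using Finset.induction_on with
  | empty => simpa using IsRegularSolution.zero
  | insert a s ha ih =>
    simp only [Finset.sum_insert ha]
    exact (hR a (Finset.mem_insert_self _ _)).add
      (ih fun i hi => hR i (Finset.mem_insert_of_mem hi))

theorem IsRegularSolution.mono {p : Fin n} {x₀ x₁ : ℝ} (h : x₁ ≤ x₀) {R : ℂ → Fin n → ℂ}
    (hR : D.IsRegularSolution p x₀ R) : D.IsRegularSolution p x₁ R := by
  obtain ⟨h1, h2, ρ, h3, h4⟩ := hR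
  exact ⟨h1.mono fun w (hw : w.re < x₁) => lt_of_lt_of_le hw h, fun w hw => h2 w (hw.trans_le h), ρ,
    h3.mono (ball_subset_ball (exp_le_exp.2 h)), fun w hw => h4 w (hw.trans_le h)⟩

variable (D)

theorem borelCoeff_geomBounded (p : Fin n) : ∃ r > 0, GeomBounded (D.borelCoeff p) r := by
  have h2 : 2 ≤ n := Fact.out
  exact (D.formalSolution_borelCoeff h2 p).geomBounded (by omega)

theorem borelJet_zero_eq (p : Fin n) (w : ℂ) : D.borelJet p w 0 =
    exp (-D.mu p * (w + D.baseLog p)) * expSum (D.borelCoeff p) (w + D.baseLog p) := by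
  simp [borelJet, frobJet, frobSeries]

theorem exists_borelJet_zero_ne (p : Fin n) (x₀ : ℝ) :
    ∃ w : ℂ, w.re < x₀ ∧ D.borelJet p w 0 ≠ 0 := by
  by_contra! h
  obtain ⟨r, hr, hb⟩ := D.borelCoeff_geomBounded p
  refine D.borelCoeff_zero_ne p (hb.coeff_eq_zero hr.le (x₀ := x₀ + (D.baseLog p).re)
    (fun ω hω => ?_) 0)
  have h1 := h (ω - D.baseLog p) (by simp; linarith)
  rw [borelJet_zero_eq, sub_add_cancel] at h1
  exact (mul_eq_zero.1 h1).resolve_left (exp_ne_zero _)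

/-- The Borel transform does not vanish identically near `λ_p`. -/
theorem exists_borelJet_ne_zero (p : Fin n) (x₀ : ℝ) : ∃ w : ℂ, w.re < x₀ ∧ D.borelJet p w ≠ 0 := by
  obtain ⟨w, hw, h⟩ := D.exists_borelJet_zero_ne p x₀
  exact ⟨w, hw, fun h' => h (by rw [h']; rfl)⟩

theorem continuousOn_logField {p : Fin n} {x₀ : ℝ}
    (h : ∀ l, l ≠ p → Real.exp x₀ < ‖D.lam l - D.lam p‖) :
    ContinuousOn (D.logField (D.lam p)) {w | w.re < x₀} :=
  (D.differentiableOn_logField fun _ hw => D.add_exp_ne_lam h hw).continuousOn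

theorem eq_zero_of_smul_borelJet_add_eq_zero {p : Fin n} {x₀ : ℝ}
    (h : ∀ l, l ≠ p → Real.exp x₀ < ‖D.lam l - D.lam p‖)
    (hY : SolvesLinear (D.logField (D.lam p)) {w | w.re < x₀} (D.borelJet p))
    {R : ℂ → Fin n → ℂ} (hR : SolvesLinear (D.logField (D.lam p)) {w | w.re < x₀} R)
    (hper : ∀ w : ℂ, w.re < x₀ → R (w - 2 * π * I) = R w) {d : ℂ} {w₁ : ℂ}
    (hw₁ : w₁.re < x₀) (h0 : d • D.borelJet p w₁ + R w₁ = 0) :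
    d = 0 ∧ ∀ w : ℂ, w.re < x₀ → R w = 0 := by
  have hz : ∀ w : ℂ, w.re < x₀ → d • D.borelJet p w + R w = 0 :=
    SolvesLinear.eqOn (convex_halfSpace_re_lt _) (D.continuousOn_logField h) ((hY.smul d).add hR)
      SolvesLinear.zero hw₁ h0
  have hd : d = 0 := by
    obtain ⟨w, hw, hne⟩ := D.exists_borelJet_ne_zero p x₀
    have h2 := hz (w - 2 * π * I) (by simpa using hw)
    rw [hper w hw, borelJet_sub_two_pi] at h2
    have h3 : (d * (exp (2 * π * I * D.mu p) - 1)) • D.borelJet p w = 0 := by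
      have := sub_eq_zero.2 (h2.trans (hz w hw).symm)
      rw [add_sub_add_right_eq_sub, smul_smul, ← sub_smul] at this
      rw [← this]; ring_nf
    rcases smul_eq_zero.1 h3 with h4 | h4
    · exact (mul_eq_zero.1 h4).resolve_right (sub_ne_zero.2 (D.exp_two_pi_mu_ne_one p))
    · exact absurd h4 hne
  refine ⟨hd, fun w hw => ?_⟩
  simpa [hd] using hz w hw

/-- Solutions near `λ_p` are combinations of the Borel transform and of solutions that are analytic
at `λ_p`. -/
theorem exists_decomposition (p : Fin n) : ∃ x₀ : ℝ,
    (∀ l, l ≠ p → Real.exp x₀ < ‖D.lam l - D.lam p‖) ∧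
    SolvesLinear (D.logField (D.lam p)) {w | w.re < x₀} (D.borelJet p) ∧
    ∀ w₁ : ℂ, w₁.re < x₀ → ∀ v : Fin n → ℂ, ∃ (c : ℂ) (R : ℂ → Fin n → ℂ),
      D.IsRegularSolution p x₀ R ∧ v = c • D.borelJet p w₁ + R w₁ := by
  have h2 : 2 ≤ n := Fact.out
  let rc : Fin n → ℕ → ℂ := fun k => D.regCoeff p (Pi.single (k : ℕ) 1)
  obtain ⟨r, hr, hb, hrb⟩ : ∃ r > 0, GeomBounded (D.borelCoeff p) r ∧ ∀ k, GeomBounded (rc k) r := by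
    obtain ⟨r0, hr0, hb0⟩ := D.borelCoeff_geomBounded p
    have := fun k : Fin n => (D.formalSolution_regCoeff h2 p (Pi.single (k : ℕ) 1)).geomBounded
      (by omega)
    choose r1 hr1 hb1 using this
    have hsum : 0 ≤ ∑ k, r1 k := sum_nonneg fun k _ => (hr1 k).le
    exact ⟨r0 + ∑ k, r1 k, by linarith, hb0.mono hr0.le (by linarith), fun k =>
      (hb1 k).mono (hr1 k).le (by
        have := Finset.single_le_sum (fun k _ => (hr1 k).le) (Finset.mem_univ k)
        linarith)⟩
  obtain ⟨x₁, hx₁⟩ := D.exists_gap p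
  obtain ⟨x₂, hx₂⟩ := exists_mul_exp_lt (2 ^ (n + 1) * r) 1 one_pos
  set x₀ := min x₁ (x₂ - (D.baseLog p).re) with hx₀
  have hx01 : x₀ ≤ x₁ := min_le_left _ _
  have hx02 : x₀ ≤ x₂ - (D.baseLog p).re := min_le_right _ _
  have hgap : ∀ l, l ≠ p → Real.exp x₀ < ‖D.lam l - D.lam p‖ := fun l hl =>
    (exp_le_exp.2 hx01).trans_lt (hx₁ l hl)
  have hω : ∀ w ∈ {w : ℂ | w.re < x₀}, 2 ^ (n + 1) * r * Real.exp (w + D.baseLog p).re < 1 :=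
    fun w hw => hx₂ _ (by have : w.re < x₀ := hw; simp; linarith)
  have hY : SolvesLinear (D.logField (D.lam p)) {w | w.re < x₀} (D.borelJet p) :=
    (D.formalSolution_borelCoeff h2 p).solvesLinear hr hb (fun w hw => D.add_exp_ne_lam hgap hw) hω
  have hreg : ∀ k, D.IsRegularSolution p x₀ (D.frobJet p 0 (rc k)) := fun k => by
    refine ⟨(D.formalSolution_regCoeff h2 p _).solvesLinear hr (hrb k)
      (fun w hw => D.add_exp_ne_lam hgap hw) hω, fun w _ => by simp [frobJet_sub_two_pi],
      fun z => ∑' s, rc k s * (-z / D.lam p) ^ s, ?_, fun w _ => ?_⟩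
    · refine ((hrb k).exists_expSum_eq_comp_exp hr).comp (by fun_prop) fun z hz => ?_
      rw [mem_ball_zero_iff, norm_div, norm_neg]
      have hz' := mem_ball_zero_iff.1 hz
      obtain ⟨b, hb'⟩ : ∃ b, b = D.baseLog p := ⟨_, rfl⟩
      have hlam : ‖D.lam p‖⁻¹ = Real.exp (D.baseLog p).re := by
        have := congrArg norm (D.exp_add_baseLog p 0)
        rw [zero_add, norm_exp, norm_div, norm_neg, exp_zero, norm_one, one_div] at this
        exact this.symm
      rw [div_eq_mul_inv, hlam]
      have h3 : ‖z‖ * Real.exp (D.baseLog p).re < Real.exp x₂ :=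
        calc ‖z‖ * Real.exp (D.baseLog p).re < Real.exp x₀ * Real.exp (D.baseLog p).re := by gcongr
          _ ≤ Real.exp x₂ := by rw [← Real.exp_add]; gcongr; linarith
      refine h3.trans ?_
      rw [lt_div_iff₀ (by positivity)]
      have h4 := hx₂ x₂ le_rfl
      have h5 : (2 : ℝ) ^ 1 ≤ 2 ^ (n + 1) := pow_le_pow_right₀ one_le_two (by omega)
      have h6 : 0 < Real.exp x₂ := exp_pos _
      have h7 : Real.exp x₂ * (2 * r) ≤ 2 ^ (n + 1) * r * Real.exp x₂ := by
        have := mul_le_mul_of_nonneg_right h5 (mul_pos hr h6).le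
        linarith
      linarith
    · simp only [frobJet, Fin.val_zero, pow_zero, one_mul, frobSeries, Nat.cast_zero, sub_zero,
        zero_mul, exp_zero, descPochhammer_zero, Polynomial.eval_one, mul_one]
      rw [expSum_eq_tsum, D.exp_add_baseLog]
  refine ⟨x₀, hgap, hY, fun w₁ hw₁ v => ?_⟩
  let Ψ : Fin n → ℂ → Fin n → ℂ := fun k =>
    if (k : ℕ) + 1 < n then D.frobJet p 0 (rc k) else D.borelJet p
  let last : Fin n := ⟨n - 1, by omega⟩
  have hlast : Ψ last = D.borelJet p := if_neg (by simp [last]; omega)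
  have hΨ : ∀ k ∈ Finset.univ.erase last, Ψ k = D.frobJet p 0 (rc k) := fun k hk => by
    refine if_pos ?_
    have h3 : (k : ℕ) ≠ n - 1 := fun h => (Finset.mem_erase.1 hk).1 (Fin.ext h)
    have := k.2
    omega
  let R : (Fin n → ℂ) → ℂ → Fin n → ℂ := fun a w =>
    ∑ k ∈ Finset.univ.erase last, a k • D.frobJet p 0 (rc k) w
  have hR : ∀ a, D.IsRegularSolution p x₀ (R a) := fun a =>
    IsRegularSolution.sum _ fun k _ => (hreg k).smul (a k)
  let L : (Fin n → ℂ) →ₗ[ℂ] (Fin n → ℂ) := Fintype.linearCombination ℂ fun k => Ψ k w₁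
  have hL : ∀ a, L a = a last • D.borelJet p w₁ + R a w₁ := fun a => by
    simp only [L, Fintype.linearCombination_apply]
    rw [← Finset.add_sum_erase _ _ (Finset.mem_univ last), hlast]
    congr 1
    exact sum_congr rfl fun k hk => by rw [hΨ k hk]
  have hinj : Function.Injective L := by
    refine (injective_iff_map_eq_zero L).2 fun a ha => ?_
    rw [hL] at ha
    obtain ⟨hd, h0⟩ := D.eq_zero_of_smul_borelJet_add_eq_zero hgap hY (hR a).1 (hR a).2.1 hw₁ ha
    let b : ℕ → ℂ := fun s => ∑ k ∈ Finset.univ.erase last, a k * rc k s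
    have hbb : GeomBounded b r := by
      choose C hC using hrb
      refine ⟨∑ k ∈ Finset.univ.erase last, ‖a k‖ * C k, fun s => ?_⟩
      rw [sum_mul]
      refine norm_sum_le_of_le _ fun k _ => ?_
      rw [norm_mul, mul_assoc]
      exact mul_le_mul_of_nonneg_left (hC k s) (norm_nonneg _)
    have hb0 := hbb.coeff_eq_zero hr.le (x₀ := x₀ + (D.baseLog p).re) fun ω hω' => by
      have h3 := congrFun (h0 (ω - D.baseLog p) (by simp; linarith)) 0
      have hr1 : r * Real.exp ω.re < 1 := by
        have h4 := hω (ω - D.baseLog p) (by simp; linarith)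
        rw [sub_add_cancel] at h4
        have h5 : (1 : ℝ) ≤ 2 ^ (n + 1) := one_le_pow₀ one_le_two
        have h6 := mul_pos hr (exp_pos ω.re)
        nlinarith
      refine Eq.trans ?_ h3
      simp only [R, Finset.sum_apply, Pi.smul_apply, frobJet, Fin.val_zero, pow_zero, one_mul,
        frobSeries, Nat.cast_zero, sub_zero, zero_mul, exp_zero, descPochhammer_zero,
        Polynomial.eval_one, mul_one, sub_add_cancel, smul_eq_mul, expSum, b, sum_mul,
        ← tsum_mul_left]
      rw [Summable.tsum_finsetSum fun k _ => ?_]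
      · simp only [mul_assoc]
      · simpa only [mul_assoc] using ((hrb k).summable hr.le hr1).mul_left (a k)
    ext k
    by_cases hk : k = last
    · rw [hk, hd]; rfl
    · have hk' : (k : ℕ) + 1 < n := by
        have h3 : (k : ℕ) ≠ n - 1 := fun h => hk (Fin.ext h)
        have := k.2
        omega
      have h3 := hb0 k
      simp only [b] at h3
      rw [Finset.sum_eq_single k] at h3
      · simpa [rc, regCoeff, hk'] using h3
      · intro i _ hik
        have : (k : ℕ) ≠ i := fun h => hik (Fin.ext h.symm)
        simp [rc, regCoeff, hk', this]
      · intro h; exact absurd (Finset.mem_erase.2 ⟨hk, Finset.mem_univ _⟩) h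
  obtain ⟨a, ha⟩ := LinearMap.injective_iff_surjective.1 hinj v
  exact ⟨a last, R a, hR a, by rw [← ha, hL]⟩

end InverseFactorialData

theorem periodic_int_of_left {α : Type*} {H : ℂ → α} {x₀ : ℝ}
    (hper : ∀ w : ℂ, w.re < x₀ → H (w - 2 * π * I) = H w) {w w' : ℂ} (hw : w.re < x₀)
    (h : exp w = exp w') : H w = H w' := by
  have hn : ∀ k : ℕ, ∀ w : ℂ, w.re < x₀ → H (w - k * (2 * π * I)) = H w := by
    intro k
    induction k with
    | zero => simp
    | succ k ih =>
      intro w hw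
      have := hper (w - k * (2 * π * I)) (by simpa using hw)
      rw [ih w hw] at this
      rw [← this]; congr 1; push_cast; ring
  obtain ⟨m, hm⟩ := exp_eq_exp_iff_exists_int.1 h
  have hw' : w'.re < x₀ := by rw [hm] at hw; simpa using hw
  rcases Int.eq_nat_or_neg m with ⟨k, rfl | rfl⟩
  · rw [← hn k w hw, hm]; congr 1; push_cast; ring
  · rw [← hn k w' hw', hm]; congr 1; push_cast; ring

/-- A `2πi`-periodic function that is given by a power series in `e^w` far to the left is given by
that series wherever it is analytic. -/
theorem hasSum_of_periodic {H : ℂ → ℂ} {x₀ x₁ : ℝ} (hH : DifferentiableOn ℂ H {w | w.re < x₁})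
    (hper : ∀ w : ℂ, w.re < x₁ → H (w - 2 * π * I) = H w) {b : ℕ → ℂ} {r : ℝ}
    (hr : 0 < r) (hb : GeomBounded b r) (hHb : ∀ w : ℂ, w.re < x₀ → H w = expSum b w) {w : ℂ}
    (hw : w.re < x₁) : HasSum (fun s => b s * exp w ^ s) (H w) := by
  let G : ℂ → ℂ := fun z => if z = 0 then b 0 else H (log z)
  have hG : ∀ w : ℂ, w.re < x₁ → G (exp w) = H w := fun w hw => by
    simp only [G, if_neg (exp_ne_zero w)]
    exact (periodic_int_of_left hper hw (exp_log (exp_ne_zero w)).symm).symm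
  have hre : ∀ {z : ℂ} {x : ℝ}, z ≠ 0 → z ∈ ball (0 : ℂ) (Real.exp x) →
      (log z).re < x := fun {z x} hz hzx => by
    rw [log_re, log_lt_iff_lt_exp (norm_pos_iff.2 hz)]
    exact mem_ball_zero_iff.1 hzx
  have hGsum : ∀ z ∈ ball (0 : ℂ) (Real.exp x₀), G z = ∑' s, b s * z ^ s := fun z hz => by
    by_cases hz0 : z = 0
    · rw [tsum_eq_single 0 fun s hs => by simp [hz0, hs]]
      simp [G, hz0]
    · simp only [G, if_neg hz0]
      rw [hHb _ (hre hz0 hz), expSum_eq_tsum, exp_log hz0]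
  have hGd : DifferentiableOn ℂ G (ball 0 (Real.exp x₁)) := fun z hz => by
    apply DifferentiableAt.differentiableWithinAt
    by_cases hz0 : z = 0
    · have h1 := hb.exists_expSum_eq_comp_exp hr
      have hball : ∀ ρ : ℝ, 0 < ρ → ball (0 : ℂ) ρ ∈ 𝓝 z := fun ρ hρ =>
        isOpen_ball.mem_nhds (by rw [hz0]; exact mem_ball_self hρ)
      refine (h1.differentiableAt (hball _ (by positivity))).congr_of_eventuallyEq ?_
      filter_upwards [hball _ (exp_pos x₀)] with ζ hζ using hGsum ζ hζ
    · let L : ℂ → ℂ := fun ζ => log (ζ / z) + log z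
      have hL : DifferentiableAt ℂ L z := by
        refine (DifferentiableAt.clog (differentiableAt_id.div_const z) ?_).add_const _
        simp [div_self hz0]
      have hLz : L z = log z := by simp [L, div_self hz0]
      have hHd : DifferentiableAt ℂ H (L z) := by
        rw [hLz]
        exact hH.differentiableAt ((isOpen_lt continuous_re continuous_const).mem_nhds
          (hre hz0 hz))
      refine (hHd.comp z hL).congr_of_eventuallyEq ?_
      filter_upwards [isOpen_ne.mem_nhds hz0, isOpen_ball.mem_nhds hz] with ζ hζ hζ1
      simp only [G, if_neg hζ, Function.comp]
      refine periodic_int_of_left hper (hre hζ hζ1) ?_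
      rw [exp_add, exp_log hζ, exp_log (div_ne_zero hζ hz0), exp_log hz0, div_mul_cancel₀ _ hz0]
  let c : ℕ → ℂ := fun s => (s.factorial : ℂ)⁻¹ * iteratedDeriv s G 0
  have hc : ∀ z ∈ ball (0 : ℂ) (Real.exp x₁), HasSum (fun s => c s * z ^ s) (G z) := fun z hz => by
      have := hasSum_taylorSeries_on_ball hGd hz
      simp only [sub_zero, smul_eq_mul] at this
      have hfun : (fun s => c s * z ^ s) =
          fun s => (s.factorial : ℂ)⁻¹ * (z ^ s * iteratedDeriv s G 0) := by
        funext s; simp only [c]; ring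
      rwa [hfun]
  have hcb : c = b := by
    obtain ⟨x₂, hx₂⟩ := exists_mul_exp_lt r 1 one_pos
    set y := min (min x₀ x₁) x₂ - 1 with hy
    have hy0 : y < x₀ := by have := (min_le_left (min x₀ x₁) x₂).trans (min_le_left _ _); linarith
    have hy1 : y < x₁ := by have := (min_le_left (min x₀ x₁) x₂).trans (min_le_right _ _); linarith
    have hy2 : y < x₂ := by have := min_le_right (min x₀ x₁) x₂; linarith
    obtain ⟨C', hC'⟩ : ∃ C', ∀ s, ‖c s‖ ≤ C' * (Real.exp (-y)) ^ s := by
      have h1 := (hc (Real.exp y) (by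
        rw [mem_ball_zero_iff]; simpa using hy1)).summable.tendsto_atTop_zero.norm
      obtain ⟨C', hC'⟩ := h1.bddAbove_range
      refine ⟨C', fun s => ?_⟩
      have h2 := hC' ⟨s, rfl⟩
      simp only [norm_mul, norm_pow, norm_real, Real.norm_eq_abs, Real.abs_exp] at h2
      have h3 : Real.exp y ^ s * Real.exp (-y) ^ s = 1 := by rw [← mul_pow, ← Real.exp_add]; simp
      calc ‖c s‖ = ‖c s‖ * Real.exp y ^ s * Real.exp (-y) ^ s := by rw [mul_assoc, h3, mul_one]
        _ ≤ _ := by gcongr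
    set r' := max r (Real.exp (-y)) with hr'
    have hr'0 : 0 ≤ r' := hr.le.trans (le_max_left _ _)
    have hcr : GeomBounded c r' := GeomBounded.mono ⟨C', hC'⟩ (exp_pos _).le (le_max_right _ _)
    have hbr : GeomBounded b r' := hb.mono hr.le (le_max_left _ _)
    have hd : GeomBounded (fun s => c s - b s) r' := by
      obtain ⟨C1, h1⟩ := hcr
      obtain ⟨C2, h2⟩ := hbr
      exact ⟨C1 + C2, fun s => (norm_sub_le _ _).trans (by
        have := h1 s; have := h2 s; linarith)⟩
    funext s
    refine sub_eq_zero.1 (hd.coeff_eq_zero hr'0 (x₀ := y) (fun ω hω => ?_) s)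
    have hω0 : exp ω ∈ ball (0 : ℂ) (Real.exp x₀) := by
      rw [mem_ball_zero_iff, norm_exp]; gcongr; linarith
    have hω1 : exp ω ∈ ball (0 : ℂ) (Real.exp x₁) := by
      rw [mem_ball_zero_iff, norm_exp]; gcongr; linarith
    have h1 := hc _ hω1
    rw [expSum_eq_tsum]
    simp only [sub_mul]
    have hsb : Summable fun s => b s * exp ω ^ s := by
      simpa only [exp_nat_mul] using hb.summable hr.le (hx₂ ω.re (by linarith))
    rw [h1.summable.tsum_sub hsb, h1.tsum_eq, hGsum _ hω0, sub_self]
  have := hc (exp w) (by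
    rw [mem_ball_zero_iff, norm_exp]; exact Real.exp_lt_exp.2 hw)
  rwa [hG w hw, hcb] at this

namespace InverseFactorialData

variable {n : ℕ} (D : InverseFactorialData n)

theorem eq_smul_iff {z v : ℂ} (hv : v ≠ 0) :
    (∃ s : ℝ, 1 ≤ s ∧ z = s * v) ↔ (z / v).im = 0 ∧ 1 ≤ (z / v).re := by
  constructor
  · rintro ⟨s, hs, rfl⟩
    rw [mul_div_cancel_right₀ _ hv]; simpa using hs
  · rintro ⟨h1, h2⟩
    refine ⟨(z / v).re, h2, ?_⟩
    have : ((z / v).re : ℂ) = z / v := Complex.ext (by simp) (by simp [h1])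
    rw [this, div_mul_cancel₀ _ hv]

theorem lam_sub_ne_zero {l j : Fin n} (h : l ≠ j) : D.lam l - D.lam j ≠ 0 :=
  sub_ne_zero.2 fun h' => h (D.lam_injective h')

theorem norm_lam_sub_pos {l j : Fin n} (h : l ≠ j) : 0 < ‖D.lam l - D.lam j‖ :=
  norm_pos_iff.2 (D.lam_sub_ne_zero h)

theorem isOpen_star (j : Fin n) : IsOpen (D.star j) := by
  have : D.star j = ⋂ l : Fin n, {w | l ≠ j → ¬ ((exp w / (D.lam l - D.lam j)).im = 0 ∧
        1 ≤ (exp w / (D.lam l - D.lam j)).re)} := by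
    ext w
    simp only [star, mem_ofPred_eq, mem_iInter]
    refine forall_congr' fun l => forall_congr' fun hl => ?_
    rw [← eq_smul_iff (D.lam_sub_ne_zero hl)]
    push Not
    rfl
  rw [this]
  refine isOpen_iInter_of_finite fun l => ?_
  by_cases hl : l = j
  · simp [hl]
  · simp only [ne_eq, hl, not_false_eq_true, true_imp_iff]
    have h1 : Continuous fun w : ℂ => exp w / (D.lam l - D.lam j) := by fun_prop
    have hc : IsClosed {w : ℂ | (exp w / (D.lam l - D.lam j)).im = 0 ∧
        1 ≤ (exp w / (D.lam l - D.lam j)).re} :=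
      (isClosed_eq (continuous_im.comp h1) continuous_const).inter
        (isClosed_le continuous_const (continuous_re.comp h1))
    exact hc.isOpen_compl

theorem sub_mem_star {j : Fin n} {w : ℂ} (hw : w ∈ D.star j) {s : ℝ} (hs : 0 ≤ s) :
    w - s ∈ D.star j := by
  intro l hl σ hσ h
  refine hw l hl (Real.exp s * σ) ?_ ?_
  · have := Real.one_le_exp hs; nlinarith
  · rw [exp_sub, div_eq_iff (exp_ne_zero _)] at h
    rw [h]; push_cast; ring

theorem add_exp_ne_lam_of_mem_star {j : Fin n} {w : ℂ} (hw : w ∈ D.star j) (l : Fin n) :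
    D.lam j + exp w ≠ D.lam l := by
  intro h
  by_cases hl : l = j
  · subst hl; exact exp_ne_zero w (by linear_combination h)
  · exact hw l hl 1 le_rfl (by rw [← h]; simp)

theorem disc_subset_star (j : Fin n) : D.disc j ⊆ D.star j := by
  intro w hw l hl s hs h
  have := hw l hl
  rw [h, norm_mul, norm_real, Real.norm_of_nonneg (by linarith)] at this
  have h2 := norm_nonneg (D.lam l - D.lam j)
  nlinarith

theorem mem_disc_of_gap {j : Fin n} {x₀ : ℝ}
    (h : ∀ l, l ≠ j → Real.exp x₀ < ‖D.lam l - D.lam j‖) {w : ℂ} (hw : w.re ≤ x₀) : w ∈ D.disc j :=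
  fun l hl => by
    rw [norm_exp]
    exact (exp_le_exp.2 hw).trans_lt (h l hl)

theorem star_sub_two_pi {j : Fin n} {w : ℂ} : w - 2 * π * I ∈ D.star j ↔ w ∈ D.star j := by
  simp only [star, mem_ofPred_eq, exp_periodic.sub_eq]

theorem logField_sub_two_pi (c w : ℂ) : D.logField c (w - 2 * π * I) = D.logField c w := by
  rw [logField, logField, exp_periodic.sub_eq]

theorem differentiableOn_logField_star (j : Fin n) :
    DifferentiableOn ℂ (D.logField (D.lam j)) (D.star j) :=
  D.differentiableOn_logField fun _ hw => D.add_exp_ne_lam_of_mem_star hw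

/-- The part of a horizontal line to the left of `w`. -/
theorem leftRay_subset_star {j : Fin n} {w : ℂ} (hw : w ∈ D.star j) :
    {z : ℂ | z.im = w.im ∧ z.re ≤ w.re} ⊆ D.star j := by
  rintro z ⟨h1, h2⟩
  have := D.sub_mem_star hw (s := w.re - z.re) (by linarith)
  convert this using 1
  apply Complex.ext <;> simp [h1]

theorem convex_leftRay (w : ℂ) : Convex ℝ {z : ℂ | z.im = w.im ∧ z.re ≤ w.re} := by
  have : {z : ℂ | z.im = w.im ∧ z.re ≤ w.re} =
      ({z : ℂ | z.im ≤ w.im} ∩ {z : ℂ | w.im ≤ z.im}) ∩ {z : ℂ | z.re ≤ w.re} := by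
    ext z; simp [le_antisymm_iff]
  rw [this]
  exact ((convex_halfSpace_im_le _).inter (convex_halfSpace_im_ge _)).inter
    (convex_halfSpace_re_le _)

variable [Fact (2 ≤ n)]

theorem exists_borelSol (j : Fin n) : ∃ Y : ℂ → Fin n → ℂ,
    SolvesLinear (D.logField (D.lam j)) (D.star j) Y ∧
    ∃ x₀ : ℝ, (∀ l, l ≠ j → Real.exp x₀ < ‖D.lam l - D.lam j‖) ∧
      ∀ w : ℂ, w.re < x₀ → Y w = D.borelJet j w := by
  obtain ⟨x₀, h1, h2, -⟩ := D.exists_decomposition j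
  obtain ⟨Y, hY, hY'⟩ := exists_solvesLinear_of_leftClosed (D.isOpen_star j)
    (fun w hw s hs => D.sub_mem_star hw hs) (D.differentiableOn_logField_star j)
    (fun w hw => D.disc_subset_star j (D.mem_disc_of_gap h1 (le_of_lt hw))) h2
  exact ⟨Y, hY, x₀, h1, hY'⟩

/-- The jet of the Borel transform, continued along rays that start at `λ_j`. -/
noncomputable def borelSol (j : Fin n) : ℂ → Fin n → ℂ := (D.exists_borelSol j).choose

theorem solvesLinear_borelSol (j : Fin n) :
    SolvesLinear (D.logField (D.lam j)) (D.star j) (D.borelSol j) :=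
  (D.exists_borelSol j).choose_spec.1

theorem exists_borelSol_eq (j : Fin n) : ∃ x₀ : ℝ,
    (∀ l, l ≠ j → Real.exp x₀ < ‖D.lam l - D.lam j‖) ∧
      ∀ w : ℂ, w.re < x₀ → D.borelSol j w = D.borelJet j w :=
  (D.exists_borelSol j).choose_spec.2

theorem borelSol_sub_two_pi {j : Fin n} {w : ℂ} (hw : w ∈ D.star j) : D.borelSol j (w - 2 * π * I) =
      exp (2 * π * I * D.mu j) • D.borelSol j w := by
  obtain ⟨x₀, -, hx₀⟩ := D.exists_borelSol_eq j
  have h1 : SolvesLinear (D.logField (D.lam j)) (D.star j)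
      (fun w => D.borelSol j (w - 2 * π * I)) := fun z hz => by
    have := D.solvesLinear_borelSol j (z - 2 * π * I) (D.star_sub_two_pi.2 hz)
    rw [logField_sub_two_pi] at this
    exact HasDerivAt.comp_sub_const z _ this
  set L := {z : ℂ | z.im = w.im ∧ z.re ≤ w.re} with hL
  set w₀ : ℂ := (min w.re (x₀ - 1) : ℝ) + w.im * I
  have hw₀ : w₀.re < x₀ := by
    have := min_le_right w.re (x₀ - 1)
    simp only [w₀, add_re, ofReal_re, mul_re, I_re, I_im, ofReal_im]
    linarith
  refine SolvesLinear.eqOn (convex_leftRay w)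
    ((D.differentiableOn_logField_star j).continuousOn.mono (D.leftRay_subset_star hw))
    (h1.mono (D.leftRay_subset_star hw))
    (((D.solvesLinear_borelSol j).smul _).mono (D.leftRay_subset_star hw)) (w₀ := w₀) ?_ ?_ ?_
  · simp [w₀]
  · rw [hx₀ _ (by simpa using hw₀), hx₀ _ hw₀, borelJet_sub_two_pi]
  · exact ⟨rfl, le_rfl⟩

theorem exists_minDist (j : Fin n) : ∃ d : ℝ, (∀ l, l ≠ j → d ≤ ‖D.lam l - D.lam j‖) ∧
    ∃ l, l ≠ j ∧ d = ‖D.lam l - D.lam j‖ := by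
  have h2 : 2 ≤ n := Fact.out
  have hne : (Finset.univ.erase j).Nonempty := by
    rw [← Finset.card_pos, Finset.card_erase_of_mem (Finset.mem_univ _)]
    simp; omega
  obtain ⟨l, hl, hmin⟩ := Finset.exists_min_image _ (fun l => ‖D.lam l - D.lam j‖) hne
  exact ⟨_, fun l' hl' => hmin l' (Finset.mem_erase.2 ⟨hl', Finset.mem_univ _⟩), l,
    (Finset.mem_erase.1 hl).1, rfl⟩

theorem borelSol_zero_eq_borelSeries {j : Fin n} {w : ℂ} (hw : w ∈ D.disc j) :
    D.borelSol j w 0 = D.borelSeries j w := by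
  obtain ⟨d, hd, l₀, hl₀, hd'⟩ := D.exists_minDist j
  have hd0 : 0 < d := by rw [hd']; exact D.norm_lam_sub_pos hl₀
  obtain ⟨x₀, hx₀, hY⟩ := D.exists_borelSol_eq j
  obtain ⟨r, hr, hb⟩ := D.borelCoeff_geomBounded j
  set β := D.baseLog j with hβ
  have hmem : ∀ w : ℂ, w.re < Real.log d → w ∈ D.disc j := fun w hw l hl => by
    rw [norm_exp]
    exact ((lt_log_iff_exp_lt hd0).1 hw).trans_le (hd l hl)
  have hmem' : ∀ w ∈ D.disc j, w.re < Real.log d := fun w hw => by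
    have := hw l₀ hl₀
    rw [← hd', norm_exp] at this
    exact (lt_log_iff_exp_lt hd0).2 this
  let H : ℂ → ℂ := fun ω => exp (D.mu j * ω) * D.borelSol j (ω - β) 0
  have hH := hasSum_of_periodic (H := H) (x₀ := x₀ + β.re) (x₁ := Real.log d + β.re) (b := D.borelCoeff j)
    (w := w + β) ?_ ?_ hr hb ?_ (by simpa using hmem' w hw)
  · have h1 := hH.mul_left (exp (-D.mu j * (w + β)))
    simp only [H, add_sub_cancel_right] at h1
    rw [← mul_assoc, ← exp_add, neg_mul, neg_add_cancel, exp_zero, one_mul] at h1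
    rw [← h1.tsum_eq, borelSeries]
    refine tsum_congr fun s => ?_
    rw [borelCoeff, mul_left_comm, ← exp_nat_mul, ← exp_add, hβ, baseLog]
    congr 2; ring
  · intro ω hω
    have hstar := D.disc_subset_star j (hmem (ω - β) (by
      have : ω.re < Real.log d + β.re := hω
      simp; linarith))
    have h1 : DifferentiableAt ℂ (fun ω => D.borelSol j (ω - β) 0) ω := by
      have h2 := (HasDerivAt.comp_sub_const ω β (D.solvesLinear_borelSol j _ hstar))
      exact (hasDerivAt_pi.1 h2 0).differentiableAt
    exact ((by fun_prop : DifferentiableAt ℂ (fun ω => exp (D.mu j * ω)) ω).mul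
      h1).differentiableWithinAt
  · intro ω hω
    have hstar := D.disc_subset_star j (hmem (ω - β) (by simp; linarith))
    simp only [H]
    rw [sub_right_comm, D.borelSol_sub_two_pi hstar, Pi.smul_apply, smul_eq_mul, ← mul_assoc,
      ← exp_add]
    congr 2; ring
  · intro ω hω
    simp only [H]
    rw [hY _ (by simp; linarith), borelJet_zero_eq, sub_add_cancel, ← mul_assoc, ← exp_add]
    simp

theorem analyticOnNhd_borelSol_zero (j : Fin n) :
    AnalyticOnNhd ℂ (fun w => D.borelSol j w 0) (D.star j) := by
  refine DifferentiableOn.analyticOnNhd (fun w hw => ?_) (D.isOpen_star j)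
  exact (hasDerivAt_pi.1 (D.solvesLinear_borelSol j w hw) 0).differentiableAt.differentiableWithinAt

theorem borel_eq {j : Fin n} {w : ℂ} (hw : w ∈ D.star j) : D.borel j w = D.borelSol j w 0 := by
  have hex : ∃ g : ℂ → ℂ, AnalyticOnNhd ℂ g (D.star j) ∧ EqOn g (D.borelSeries j) (D.disc j) :=
    ⟨_, D.analyticOnNhd_borelSol_zero j, fun w hw => D.borelSol_zero_eq_borelSeries hw⟩
  rw [borel, analyticContinuation, dif_pos hex]
  obtain ⟨h1, h2⟩ := hex.choose_spec
  obtain ⟨x₀, hx₀, -⟩ := D.exists_borelSol_eq j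
  set w₀ : ℂ := (min w.re (x₀ - 1) : ℝ) + w.im * I
  have hw₀ : w₀.re < x₀ := by
    have := min_le_right w.re (x₀ - 1)
    simp only [w₀, add_re, ofReal_re, mul_re, I_re, I_im, ofReal_im]
    linarith
  refine (h1.mono (D.leftRay_subset_star hw)).eqOn_of_preconnected_of_eventuallyEq
    ((D.analyticOnNhd_borelSol_zero j).mono (D.leftRay_subset_star hw))
    (convex_leftRay w).isPreconnected (z₀ := w₀) (by simp [w₀]) ?_ ⟨rfl, le_rfl⟩
  filter_upwards [(isOpen_lt continuous_re continuous_const).mem_nhds hw₀] with z hz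
  have hz' := D.mem_disc_of_gap hx₀ (le_of_lt hz)
  rw [h2 hz', D.borelSol_zero_eq_borelSeries hz']

end InverseFactorialData

section Growth

/-- The coefficients of `∏_{k < i} (z - ρ_k)` in the basis of falling factorials. -/
noncomputable def fallingCoeff (ρ : ℕ → ℂ) : ℕ → ℕ → ℂ
  | 0, k => if k = 0 then 1 else 0
  | i + 1, 0 => (-ρ i) * fallingCoeff ρ i 0
  | i + 1, k + 1 => ((k : ℂ) + 1 - ρ i) * fallingCoeff ρ i (k + 1) + fallingCoeff ρ i k

theorem fallingCoeff_of_lt (ρ : ℕ → ℂ) : ∀ {i k : ℕ}, i < k → fallingCoeff ρ i k = 0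
  | 0, k, h => by rw [fallingCoeff, if_neg (by omega)]
  | i + 1, 0, h => absurd h (by omega)
  | i + 1, k + 1, h => by
    rw [fallingCoeff, fallingCoeff_of_lt ρ (by omega), fallingCoeff_of_lt ρ (by omega), mul_zero,
      zero_add]

theorem fallingCoeff_self (ρ : ℕ → ℂ) : ∀ i : ℕ, fallingCoeff ρ i i = 1
  | 0 => by rw [fallingCoeff, if_pos rfl]
  | i + 1 => by
    rw [fallingCoeff, fallingCoeff_of_lt ρ (by omega), fallingCoeff_self ρ i, mul_zero, zero_add]

/-- If `v_k' = k v_k + v_{k+1}`, then the combinations `U_i` satisfy `U_i' = ρ_i U_i + U_{i+1}`. -/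
theorem sum_fallingCoeff_succ (ρ v : ℕ → ℂ) (i : ℕ) :
    ∑ k ∈ range (i + 1), fallingCoeff ρ i k * (k * v k + v (k + 1)) =
      ρ i * ∑ k ∈ range (i + 1), fallingCoeff ρ i k * v k +
        ∑ k ∈ range (i + 2), fallingCoeff ρ (i + 1) k * v k := by
  have h1 : ∑ k ∈ range (i + 2), fallingCoeff ρ (i + 1) k * v k =
      ∑ k ∈ range (i + 1), fallingCoeff ρ i k * v (k + 1) +
      ∑ k ∈ range (i + 2), ((k : ℂ) - ρ i) * fallingCoeff ρ i k * v k := by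
    rw [Finset.sum_range_succ', Finset.sum_range_succ' _ (i + 1), ← add_assoc,
      ← Finset.sum_add_distrib]
    congr 1
    · refine sum_congr rfl fun k _ => ?_
      rw [fallingCoeff]; push_cast; ring
    · rw [fallingCoeff]; simp
  rw [h1, Finset.sum_range_succ _ (i + 1), fallingCoeff_of_lt ρ (Nat.lt_succ_self i), mul_sum,
    mul_zero, zero_mul, add_zero, ← Finset.sum_add_distrib, ← Finset.sum_add_distrib]
  refine sum_congr rfl fun k _ => ?_
  ring

theorem sum_fallingCoeff_eval (ρ : ℕ → ℂ) (z : ℂ) (i : ℕ) :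
    ∑ k ∈ range (i + 1), fallingCoeff ρ i k * ∏ m ∈ range k, (z - m) =
      ∏ m ∈ range i, (z - ρ m) := by
  induction i with
  | zero => simp [fallingCoeff]
  | succ i ih =>
    have h := sum_fallingCoeff_succ ρ (fun k => ∏ m ∈ range k, (z - m)) i
    have h1 : ∑ k ∈ range (i + 1), fallingCoeff ρ i k * (k * (∏ m ∈ range k, (z - m)) +
        ∏ m ∈ range (k + 1), (z - m)) = z * ∏ m ∈ range i, (z - ρ m) := by
      rw [← ih, mul_sum]
      refine sum_congr rfl fun k _ => ?_
      rw [Finset.prod_range_succ]; ring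
    rw [h1, ih] at h
    rw [Finset.prod_range_succ]
    linear_combination -h

theorem falling_coeff_unique {N : ℕ} {b c : ℕ → ℂ}
    (h : ∀ z : ℂ, ∑ k ∈ range N, b k * ∏ m ∈ range k, (z - m) =
      ∑ k ∈ range N, c k * ∏ m ∈ range k, (z - m)) {k : ℕ} (hk : k < N) : b k = c k := by
  induction k using Nat.strong_induction_on with
  | _ k ih =>
    have hz := h k
    rw [← sub_eq_zero, ← Finset.sum_sub_distrib, Finset.sum_eq_single k] at hz
    · rw [← sub_mul] at hz
      refine sub_eq_zero.1 ((mul_eq_zero.1 hz).resolve_right (Finset.prod_ne_zero_iff.2 fun m hm => ?_))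
      rw [sub_ne_zero, Ne, Nat.cast_inj]
      exact (Finset.mem_range.1 hm).ne'
    · intro i hi hik
      rcases lt_or_gt_of_ne hik with h1 | h1
      · rw [ih i h1 (Finset.mem_range.1 hi), sub_self]
      · rw [Finset.prod_eq_zero (Finset.mem_range.2 h1) (sub_self _), mul_zero, mul_zero, sub_self]
    · intro h1; exact absurd (Finset.mem_range.2 hk) h1

theorem exists_le_sum_fallingCoeff (ρ : ℕ → ℂ) (k : ℕ) : ∃ C : ℝ, 0 ≤ C ∧ ∀ v : ℕ → ℂ, ∀ m ≤ k,
    ‖v m‖ ≤ C * ∑ i ∈ range (k + 1), ‖∑ l ∈ range (i + 1), fallingCoeff ρ i l * v l‖ := by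
  induction k with
  | zero => exact ⟨1, zero_le_one, fun v m hm => by
      obtain rfl : m = 0 := by omega
      simp [fallingCoeff]⟩
  | succ k ih =>
    obtain ⟨C, hC, h⟩ := ih
    set A := ∑ l ∈ range (k + 1), ‖fallingCoeff ρ (k + 1) l‖
    have hA : 0 ≤ A := sum_nonneg fun _ _ => norm_nonneg _
    refine ⟨1 + C + A * C, by positivity, fun v m hm => ?_⟩
    rw [Finset.sum_range_succ _ (k + 1)]
    set S := ∑ i ∈ range (k + 1), ‖∑ l ∈ range (i + 1), fallingCoeff ρ i l * v l‖
    have hS : 0 ≤ S := sum_nonneg fun _ _ => norm_nonneg _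
    set T := ‖∑ l ∈ range (k + 1 + 1), fallingCoeff ρ (k + 1) l * v l‖ with hT
    have hT0 : 0 ≤ T := norm_nonneg _
    have hAC := mul_nonneg hA hC
    rcases Nat.lt_or_ge m (k + 1) with hm' | hm'
    · have h1 := h v m (by omega)
      nlinarith [mul_nonneg hC hT0, mul_nonneg hAC hT0, mul_nonneg hAC hS]
    · obtain rfl : m = k + 1 := by omega
      have h2 : v (k + 1) = ∑ l ∈ range (k + 1 + 1), fallingCoeff ρ (k + 1) l * v l -
          ∑ l ∈ range (k + 1), fallingCoeff ρ (k + 1) l * v l := by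
        rw [Finset.sum_range_succ _ (k + 1), fallingCoeff_self]; ring
      have h3 : ‖∑ l ∈ range (k + 1), fallingCoeff ρ (k + 1) l * v l‖ ≤ A * (C * S) := by
        rw [sum_mul]
        refine norm_sum_le_of_le _ fun l hl => ?_
        rw [norm_mul]
        exact mul_le_mul_of_nonneg_left (h v l (by have := Finset.mem_range.1 hl; omega))
          (norm_nonneg _)
      have h4 : ‖v (k + 1)‖ ≤ T + A * (C * S) := by
        rw [h2]; exact (norm_sub_le _ _).trans (add_le_add le_rfl h3)
      nlinarith [mul_nonneg hC hT0, mul_nonneg hAC hT0, mul_nonneg hC hS]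

/-- A Gronwall estimate for triangular systems `U_i' = ρ_i U_i + U_{i+1}` with small `U_n`. -/
theorem triangular_growth {n : ℕ} {ρ : ℕ → ℂ} {a ε X : ℝ} (hρ : ∀ i < n, (ρ i).re ≤ a)
    (hε : 0 < ε) (hε1 : ε ≤ 1) {U : ℕ → ℝ → ℂ}
    (hU : ∀ i < n, ∀ x ≥ X, HasDerivAt (U i) (ρ i * U i x + U (i + 1) x) x)
    (hUn : ∀ x ≥ X, ‖U n x‖ ≤ ε ^ n * ∑ i ∈ range n, ‖U i x‖) {x : ℝ} (hx : X ≤ x) :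
    ∑ i ∈ range n, (‖U i x‖ / ε ^ i) ^ 2 ≤ Real.exp (2 * (a + ε * n ^ 2) * (x - X)) *
        ∑ i ∈ range n, (‖U i X‖ / ε ^ i) ^ 2 := by
  set g : ℝ → ℝ := fun x => ∑ i ∈ range n, (‖U i x‖ / ε ^ i) ^ 2 with hg
  set g' : ℝ → ℝ := fun x => ∑ i ∈ range n,
    2 * ((starRingEnd ℂ) (U i x) * (ρ i * U i x + U (i + 1) x)).re / (ε ^ i) ^ 2 with hg'
  have hder : ∀ x ≥ X, HasDerivAt g (g' x) x := fun x hx => by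
    have h1 : ∀ i ∈ range n, HasDerivAt (fun x => (‖U i x‖ / ε ^ i) ^ 2)
        (2 * ((starRingEnd ℂ) (U i x) * (ρ i * U i x + U (i + 1) x)).re / (ε ^ i) ^ 2) x :=
      fun i hi => by
        have h2 := (hU i (Finset.mem_range.1 hi) x hx).norm_sq
        have h3 := h2.div_const ((ε ^ i) ^ 2)
        refine (h3.congr_deriv ?_).congr_of_eventuallyEq (Eventually.of_forall fun y => ?_)
        · rw [Complex.inner, mul_comm ((starRingEnd ℂ) (U i x))]
        · beta_reduce; rw [div_pow]
    exact HasDerivAt.fun_sum h1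
  have hbound : ∀ x ≥ X, g' x ≤ 2 * (a + ε * n ^ 2) * g x := fun x hx => by
    set W : ℕ → ℝ := fun i => ‖U i x‖ / ε ^ i with hW
    have hW0 : ∀ i, 0 ≤ W i := fun i => by positivity
    have hWg : ∀ i < n, W i ^ 2 ≤ g x := fun i hi =>
      Finset.single_le_sum (f := fun i => (‖U i x‖ / ε ^ i) ^ 2) (fun _ _ => sq_nonneg _)
        (Finset.mem_range.2 hi)
    have hg0 : 0 ≤ g x := sum_nonneg fun _ _ => sq_nonneg _
    have hWW : ∀ i < n, ∀ k < n, W i * W k ≤ g x := fun i hi k hk => by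
      nlinarith [hWg i hi, hWg k hk, sq_nonneg (W i - W k)]
    have hWn : W n ≤ ∑ i ∈ range n, W i := by
      simp only [hW]
      rw [div_le_iff₀ (by positivity), mul_comm]
      refine (hUn x hx).trans (mul_le_mul_of_nonneg_left (Finset.sum_le_sum fun i _ => ?_)
        (by positivity))
      rw [le_div_iff₀ (by positivity)]
      exact mul_le_of_le_one_right (norm_nonneg _) (pow_le_one₀ hε.le hε1)
    have hstep : ∀ i < n, W i * W (i + 1) ≤ n * g x := fun i hi => by
      have hn1 : (1 : ℝ) ≤ n := by exact_mod_cast (by omega : 1 ≤ n)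
      rcases Nat.lt_or_ge (i + 1) n with h | h
      · exact (hWW i hi _ h).trans (le_mul_of_one_le_left hg0 hn1)
      · obtain rfl : n = i + 1 := by omega
        calc W i * W (i + 1) ≤ W i * ∑ k ∈ range (i + 1), W k :=
              mul_le_mul_of_nonneg_left hWn (hW0 i)
          _ = ∑ k ∈ range (i + 1), W i * W k := mul_sum _ _ _
          _ ≤ ∑ k ∈ range (i + 1), g x :=
              Finset.sum_le_sum fun k hk => hWW i hi k (Finset.mem_range.1 hk)
          _ = _ := by simp
    have hterm : ∀ i ∈ range n,
        2 * ((starRingEnd ℂ) (U i x) * (ρ i * U i x + U (i + 1) x)).re / (ε ^ i) ^ 2 ≤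
          2 * a * W i ^ 2 + 2 * (ε * (n * g x)) := fun i hi => by
      have hi' := Finset.mem_range.1 hi
      have h1 : ((starRingEnd ℂ) (U i x) * (ρ i * U i x + U (i + 1) x)).re ≤
          a * ‖U i x‖ ^ 2 + ‖U i x‖ * ‖U (i + 1) x‖ := by
        have e1 : (starRingEnd ℂ) (U i x) * (ρ i * U i x + U (i + 1) x) =
            ρ i * ((starRingEnd ℂ) (U i x) * U i x) + (starRingEnd ℂ) (U i x) * U (i + 1) x := by ring
        rw [e1, mul_comm _ (U i x), mul_conj, add_re, re_mul_ofReal, normSq_eq_norm_sq]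
        refine add_le_add (mul_le_mul_of_nonneg_right (hρ i hi') (sq_nonneg _)) ?_
        refine (re_le_norm _).trans ?_
        rw [norm_mul, norm_conj]
      have h2 : (a * ‖U i x‖ ^ 2 + ‖U i x‖ * ‖U (i + 1) x‖) / (ε ^ i) ^ 2 =
          a * W i ^ 2 + ε * (W i * W (i + 1)) := by
        simp only [hW, pow_succ]; field_simp
      calc 2 * ((starRingEnd ℂ) (U i x) * (ρ i * U i x + U (i + 1) x)).re / (ε ^ i) ^ 2
          ≤ 2 * (a * ‖U i x‖ ^ 2 + ‖U i x‖ * ‖U (i + 1) x‖) / (ε ^ i) ^ 2 := by gcongr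
        _ = 2 * (a * W i ^ 2 + ε * (W i * W (i + 1))) := by rw [mul_div_assoc, h2]
        _ ≤ _ := by
          have := mul_le_mul_of_nonneg_left (hstep i hi') hε.le
          linarith
    calc g' x ≤ ∑ i ∈ range n, (2 * a * W i ^ 2 + 2 * (ε * (n * g x))) := Finset.sum_le_sum hterm
      _ = 2 * (a + ε * n ^ 2) * g x := by
          rw [Finset.sum_add_distrib, ← mul_sum]
          simp only [Finset.sum_const, Finset.card_range, nsmul_eq_mul]
          change 2 * a * g x + _ = _
          ring
  set β := 2 * (a + ε * n ^ 2) with hβ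
  have hanti : AntitoneOn (fun x => Real.exp (-β * x) * g x) (Ici X) := by
    have hd : ∀ x ≥ X, HasDerivAt (fun x => Real.exp (-β * x) * g x)
        (Real.exp (-β * x) * (-β) * g x + Real.exp (-β * x) * g' x) x := fun x hx => by
      have h1 : HasDerivAt (fun x : ℝ => Real.exp (-β * x)) (Real.exp (-β * x) * (-β)) x := by
        simpa using ((hasDerivAt_id x).const_mul (-β)).exp
      exact h1.mul (hder x hx)
    refine antitoneOn_of_deriv_nonpos (convex_Ici X)
      (fun x hx => (hd x hx).continuousAt.continuousWithinAt)
      (fun x hx => ?_) fun x hx => ?_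
    · exact (hd x (interior_subset hx)).differentiableAt.differentiableWithinAt
    · rw [(hd x (interior_subset hx)).deriv]
      have := mul_le_mul_of_nonneg_left (hbound x (interior_subset hx)) (exp_pos (-β * x)).le
      nlinarith
  have h1 := hanti (mem_Ici.2 le_rfl) hx hx
  beta_reduce at h1
  have h2 : Real.exp (β * (x - X)) = Real.exp (β * x) * Real.exp (-β * X) := by
    rw [← Real.exp_add]; ring_nf
  have h3 : Real.exp (β * x) * Real.exp (-β * x) = 1 := by rw [← Real.exp_add]; simp
  calc g x = Real.exp (β * x) * (Real.exp (-β * x) * g x) := by rw [← mul_assoc, h3, one_mul]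
    _ ≤ Real.exp (β * x) * (Real.exp (-β * X) * g X) := mul_le_mul_of_nonneg_left h1 (exp_pos _).le
    _ = _ := by rw [h2]; ring

end Growth

namespace InverseFactorialData

variable {n : ℕ} (D : InverseFactorialData n)

theorem exists_f0_roots : ∃ ρ : ℕ → ℂ, (∀ i < n, (ρ i).re ≤ D.growth) ∧
    ∀ z, D.f0 z = D.f 0 0 * ∏ i ∈ range n, (z - ρ i) := by
  let q : Polynomial ℂ := ∑ m ∈ range n, Polynomial.C (D.f (m + 1) 0) *
    descPochhammer ℂ (n - (m + 1))
  let p : Polynomial ℂ := q + Polynomial.C (D.f 0 0) * descPochhammer ℂ n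
  have hpe : ∀ z, p.eval z = D.f0 z := fun z => by
    simp only [p, q, f0, Polynomial.eval_add, Polynomial.eval_finsetSum, Polynomial.eval_mul,
      Polynomial.eval_C, descPochhammer_eval_eq_prod_range]
    rw [Finset.sum_range_succ' _ n, Nat.sub_zero]
  have hdn : (Polynomial.C (D.f 0 0) * descPochhammer ℂ n).degree = n := by
    rw [Polynomial.degree_C_mul D.f_zero_zero,
      Polynomial.degree_eq_natDegree (monic_descPochhammer ℂ n).ne_zero, descPochhammer_natDegree]
  have hq : q.degree < (Polynomial.C (D.f 0 0) * descPochhammer ℂ n).degree := by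
    rw [hdn]
    refine (Polynomial.degree_sum_le _ _).trans_lt ?_
    rw [Finset.sup_lt_iff (by simp)]
    intro m hm
    refine (Polynomial.degree_mul_le _ _).trans_lt ?_
    refine (add_le_add Polynomial.degree_C_le le_rfl).trans_lt ?_
    rw [zero_add, Polynomial.degree_eq_natDegree (monic_descPochhammer ℂ _).ne_zero, descPochhammer_natDegree]
    have := Finset.mem_range.1 hm
    exact_mod_cast (by omega : n - (m + 1) < n)
  have hlead : p.leadingCoeff = D.f 0 0 := by
    rw [Polynomial.leadingCoeff_add_of_degree_lt hq, Polynomial.leadingCoeff_mul, Polynomial.leadingCoeff_C,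
      (monic_descPochhammer ℂ n).leadingCoeff, mul_one]
  have hnat : p.natDegree = n := by
    rw [Polynomial.natDegree, Polynomial.degree_add_eq_right_of_degree_lt hq, hdn]; rfl
  have hp0 : p ≠ 0 := fun h => D.f_zero_zero (by rw [← hlead, h, Polynomial.leadingCoeff_zero])
  have hsplit := (IsAlgClosed.splits p)
  have hcard : p.roots.card = n := by rw [← hnat]; exact hsplit.natDegree_eq_card_roots.symm
  set L := p.roots.toList with hL
  have hLlen : L.length = n := by rw [hL, Multiset.length_toList, hcard]
  have hbdd : BddAbove (Complex.re '' {z : ℂ | D.f0 z = 0}) := by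
    refine Set.Finite.bddAbove (Set.Finite.image _ ((p.roots.toFinset.finite_toSet).subset ?_))
    intro z hz
    simp only [Finset.mem_coe, Multiset.mem_toFinset, Polynomial.mem_roots hp0, Polynomial.IsRoot]
    rw [hpe]; exact hz
  refine ⟨fun i => L.getD i 0, fun i hi => ?_, fun z => ?_⟩
  · refine le_csSup hbdd ⟨_, ?_, rfl⟩
    have hmem : L.getD i 0 ∈ p.roots := by
      rw [List.getD_eq_getElem _ _ (by omega), ← Multiset.mem_toList]
      exact List.getElem_mem _
    have := (Polynomial.mem_roots hp0).1 hmem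
    change D.f0 _ = 0
    rw [← hpe]; exact this
  · rw [← hpe]
    conv_lhs => rw [hsplit.eq_prod_roots, hlead, ← Multiset.coe_toList p.roots, ← hL]
    rw [Polynomial.eval_mul, Polynomial.eval_C, Multiset.map_coe, Multiset.prod_coe,
      Polynomial.eval_list_prod, List.map_map]
    congr 1
    rw [← hLlen, Finset.prod_range, ← Fin.prod_univ_fun_getElem]
    refine Finset.prod_congr rfl fun i _ => ?_
    simp

theorem fallingCoeff_eq {ρ : ℕ → ℂ}
    (hρ : ∀ z, D.f0 z = D.f 0 0 * ∏ i ∈ range n, (z - ρ i)) {k : ℕ} (hk : k ≤ n) :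
    fallingCoeff ρ n k = D.f (n - k) 0 / D.f 0 0 := by
  refine falling_coeff_unique (N := n + 1) (c := fun k => D.f (n - k) 0 / D.f 0 0) (fun z => ?_)
    (Nat.lt_succ_of_le hk)
  rw [sum_fallingCoeff_eval]
  have h1 := hρ z
  have h2 : D.f0 z = ∑ k ∈ range (n + 1), D.f (n - k) 0 * ∏ m ∈ range k, (z - m) := by
    rw [f0, ← Finset.sum_range_reflect]
    refine sum_congr rfl fun m hm => ?_
    have := Finset.mem_range.1 hm
    congr 2
    congr 1
    omega
  rw [h2] at h1
  have h0 := D.f_zero_zero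
  rw [eq_comm, ← mul_right_inj' h0, ← h1, mul_sum]
  refine sum_congr rfl fun k _ => ?_
  field_simp

theorem tendsto_odeCoeff {m : ℕ} (hm : m ≤ n) (c : ℂ) :
    Tendsto (fun z : ℂ => z ^ m * D.odeCoeff m (c + z) / z ^ n) (Bornology.cobounded ℂ)
      (𝓝 (D.f m 0)) := by
  have hne : ∀ᶠ z : ℂ in Bornology.cobounded ℂ, z ≠ 0 := by
    filter_upwards [tendsto_norm_cobounded_atTop.eventually_gt_atTop (0 : ℝ)] with z hz
    exact norm_pos_iff.1 hz
  have hinv : Tendsto (fun z : ℂ => z⁻¹) (Bornology.cobounded ℂ) (𝓝 0) := tendsto_inv₀_cobounded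
  have hone : Tendsto (fun z : ℂ => 1 + c * z⁻¹) (Bornology.cobounded ℂ) (𝓝 1) := by
    simpa using (hinv.const_mul c).const_add 1
  have hterm : ∀ k ∈ Finset.Icc m n, Tendsto
      (fun z : ℂ => D.f m (n - k) * (1 + c * z⁻¹) ^ (k - m) * (z⁻¹) ^ (n - k))
      (Bornology.cobounded ℂ) (𝓝 (if k = n then D.f m 0 else 0)) := fun k hk => by
    have h1 := ((hone.pow (k - m)).const_mul (D.f m (n - k))).mul (hinv.pow (n - k))
    refine h1.trans (le_of_eq ?_)
    congr 1
    by_cases hkn : k = n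
    · simp [hkn]
    · have : n - k ≠ 0 := by have := (Finset.mem_Icc.1 hk).2; omega
      simp [hkn, this]
  have hsum := tendsto_finsetSum _ hterm
  rw [Finset.sum_ite_eq' , if_pos (Finset.mem_Icc.2 ⟨hm, le_rfl⟩)] at hsum
  refine hsum.congr' ?_
  filter_upwards [hne] with z hz
  rw [odeCoeff, mul_sum, Finset.sum_div]
  refine sum_congr rfl fun k hk => ?_
  obtain ⟨h1, h2⟩ := Finset.mem_Icc.1 hk
  have e1 : c + z = z * (1 + c * z⁻¹) := by field_simp; ring
  have e2 : z ^ n = z ^ m * z ^ (k - m) * z ^ (n - k) := by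
    rw [← pow_add, ← pow_add]; congr 1; omega
  rw [e1, e2, mul_pow, inv_pow]
  field_simp

theorem tendsto_odeCoeff_ratio {m : ℕ} (hm : m ≤ n) (c : ℂ) :
    Tendsto (fun w : ℂ => exp (m * w) * (D.odeCoeff m (c + exp w) /
      D.odeCoeff 0 (c + exp w))) (comap Complex.re atTop) (𝓝 (D.f m 0 / D.f 0 0)) := by
  have h1 := (D.tendsto_odeCoeff hm c).div (D.tendsto_odeCoeff (Nat.zero_le n) c) D.f_zero_zero
  have h2 := h1.comp tendsto_exp_comap_re_atTop
  refine h2.congr fun w => ?_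
  have := exp_ne_zero w
  simp only [Function.comp, Pi.div_apply, pow_zero, one_mul, ← exp_nat_mul]
  rw [div_div_div_cancel_right₀ (exp_ne_zero _), mul_div_assoc]

variable [Fact (2 ≤ n)]

/-- Growth of the solutions of the differential equation at infinity. -/
theorem exists_growth_bound (c : ℂ) {ε : ℝ} (hε : 0 < ε) (x₁ : ℝ) : ∃ X > x₁,
    ∀ Z : ℂ → Fin n → ℂ, SolvesLinear (D.logField c) {w | x₁ < w.re} Z → ∀ θ : ℝ,
      ∃ C : ℝ, ∀ w : ℂ, X ≤ w.re → |w.im - θ| ≤ 1 →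
        ‖Z w 0‖ ≤ C * Real.exp ((D.growth + ε) * w.re) := by
  have h2 : 2 ≤ n := Fact.out
  obtain ⟨ρ, hρre, hρ⟩ := D.exists_f0_roots
  obtain ⟨C₁, hC₁, hV⟩ := exists_le_sum_fallingCoeff ρ (n - 1)
  rw [Nat.sub_add_cancel (by omega)] at hV
  obtain ⟨e, he, he1, hen⟩ : ∃ e : ℝ, 0 < e ∧ e ≤ 1 ∧ e * n ^ 2 ≤ ε := by
    have hn : (0 : ℝ) < n ^ 2 := by positivity
    refine ⟨min 1 (ε / n ^ 2), by positivity, min_le_left _ _, ?_⟩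
    calc min 1 (ε / n ^ 2) * (n : ℝ) ^ 2 ≤ ε / n ^ 2 * n ^ 2 := by gcongr; exact min_le_right _ _
      _ = ε := by field_simp
  set κ : ℝ := e ^ n / (n * C₁ + 1) with hκ
  have hκ0 : 0 < κ := by positivity
  have hev : ∀ᶠ w : ℂ in comap Complex.re atTop, ∀ k : Fin n,
      ‖D.f (n - k) 0 / D.f 0 0 - exp ((n - k : ℕ) * w) *
        (D.odeCoeff (n - k) (c + exp w) / D.odeCoeff 0 (c + exp w))‖ < κ := by
    refine eventually_all.2 fun k => ?_
    have := (D.tendsto_odeCoeff_ratio (Nat.sub_le n k) c).const_sub (D.f (n - k) 0 / D.f 0 0)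
    rw [sub_self] at this
    have h3 := this.norm
    rw [norm_zero] at h3
    exact h3.eventually_lt_const hκ0
  obtain ⟨X₀, -, hX₀⟩ := (atTop_basis.comap Complex.re).eventually_iff.1 hev
  refine ⟨max X₀ (x₁ + 1), by
    have := le_max_right X₀ (x₁ + 1); linarith, fun Z hZ θ => ?_⟩
  set X := max X₀ (x₁ + 1) with hX
  have hXx : x₁ < X := by have := le_max_right X₀ (x₁ + 1); linarith
  let last : Fin n := ⟨n - 1, by omega⟩
  let V : ℕ → ℂ → ℂ := fun k w => if h : k < n then exp (k * w) * Z w ⟨k, h⟩ else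
    exp (n * w) * D.odeField (c + exp w) (Z w) last
  have hVder : ∀ k < n, ∀ w : ℂ, x₁ < w.re → HasDerivAt (V k) (k * V k w + V (k + 1) w) w := by
    intro k hk w hw
    have h3 := hasDerivAt_pi.1 (hZ w hw) ⟨k, hk⟩
    have h4 : HasDerivAt (fun w : ℂ => exp (k * w)) (exp (k * w) * k) w := by
      simpa using ((hasDerivAt_id w).const_mul (k : ℂ)).cexp
    have h5 := h4.mul h3
    have hVk : V k = fun w => exp (k * w) * Z w ⟨k, hk⟩ := by funext w; simp only [V, dif_pos hk]
    rw [hVk]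
    refine HasDerivAt.congr_deriv h5 ?_
    beta_reduce
    simp only [logField, _root_.smul_apply, Pi.smul_apply, smul_eq_mul]
    by_cases hk1 : k + 1 < n
    · rw [D.odeField_apply_of_lt _ _ _ hk1]
      simp only [V, dif_pos hk1]
      push_cast
      rw [add_mul (k : ℂ), one_mul, exp_add]; ring
    · have hkn : k + 1 = n := by omega
      have hl : (⟨k, hk⟩ : Fin n) = last := Fin.ext (by simp [last]; omega)
      simp only [V, dif_neg hk1, hl]
      have : (n : ℂ) = k + 1 := by exact_mod_cast hkn.symm
      rw [this, add_mul (k : ℂ), one_mul, exp_add]; ring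
  let U : ℕ → ℂ → ℂ := fun i w => ∑ l ∈ range (i + 1), fallingCoeff ρ i l * V l w
  have hUder : ∀ i < n, ∀ w : ℂ, x₁ < w.re → HasDerivAt (U i) (ρ i * U i w + U (i + 1) w) w := by
    intro i hi w hw
    have h3 : HasDerivAt (U i) (∑ l ∈ range (i + 1), fallingCoeff ρ i l *
        (l * V l w + V (l + 1) w)) w :=
      HasDerivAt.fun_sum fun l hl => (hVder l (by
        have := Finset.mem_range.1 hl; omega) w hw).const_mul _
    exact h3.congr_deriv (sum_fallingCoeff_succ ρ (fun l => V l w) i)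
  have hUn : ∀ w : ℂ, X ≤ w.re → ‖U n w‖ ≤ e ^ n * ∑ i ∈ range n, ‖U i w‖ := by
    intro w hw
    set S := ∑ i ∈ range n, ‖U i w‖ with hS
    have hS0 : 0 ≤ S := sum_nonneg fun _ _ => norm_nonneg _
    have hVS : ∀ k < n, ‖V k w‖ ≤ C₁ * S := fun k hk => hV (fun l => V l w) k (by omega)
    have h3 : U n w = ∑ k : Fin n, (D.f (n - k) 0 / D.f 0 0 - exp ((n - k : ℕ) * w) *
        (D.odeCoeff (n - k) (c + exp w) / D.odeCoeff 0 (c + exp w))) * V k w := by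
      have hl : ¬ (last : ℕ) + 1 < n := by simp [last]; omega
      simp only [U]
      rw [Finset.sum_range_succ, fallingCoeff_self, one_mul, Finset.sum_range]
      have h4 : V n w = -∑ k : Fin n, exp ((n - k : ℕ) * w) *
          (D.odeCoeff (n - k) (c + exp w) / D.odeCoeff 0 (c + exp w)) * V k w := by
        simp only [V, lt_irrefl, dif_neg, not_false_eq_true]
        rw [D.odeField_apply_last _ _ _ hl, mul_neg, mul_sum]
        congr 1
        refine sum_congr rfl fun k _ => ?_
        have h5 : exp (n * w) = exp ((n - k : ℕ) * w) * exp (k * w) := by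
          rw [← exp_add, ← add_mul, ← Nat.cast_add, Nat.sub_add_cancel k.2.le]
        rw [h5, dif_pos k.2]; ring
      rw [h4, ← sub_eq_add_neg, ← Finset.sum_sub_distrib]
      refine sum_congr rfl fun k _ => ?_
      rw [D.fallingCoeff_eq hρ k.2.le]; ring
    have h4 : ‖U n w‖ ≤ ∑ k : Fin n, κ * (C₁ * S) := by
      rw [h3]
      refine norm_sum_le_of_le _ fun k _ => ?_
      rw [norm_mul]
      exact mul_le_mul (hX₀ (show w.re ∈ Ici X₀ from (le_max_left _ _).trans hw) k).le
        (hVS k k.2) (norm_nonneg _) hκ0.le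
    rw [Finset.sum_const, Finset.card_univ, Fintype.card_fin, nsmul_eq_mul] at h4
    refine h4.trans ?_
    have h5 : (n : ℝ) * (κ * (C₁ * S)) = κ * (n * C₁) * S := by ring
    rw [h5]
    refine mul_le_mul_of_nonneg_right ?_ hS0
    calc κ * (n * C₁) ≤ κ * (n * C₁ + 1) := by gcongr; linarith
      _ = e ^ n := by rw [hκ]; field_simp
  have hgX : ContinuousOn (fun α : ℝ => ∑ i ∈ range n,
      (‖U i (X + α * I)‖ / e ^ i) ^ 2) (Icc (θ - 1) (θ + 1)) := by
    refine continuousOn_finsetSum _ fun i hi α _ => ContinuousAt.continuousWithinAt ?_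
    have h3 : ContinuousAt (U i) (X + α * I) :=
      (hUder i (Finset.mem_range.1 hi) _ (by simpa using hXx)).continuousAt
    have h4 : ContinuousAt (fun α : ℝ => U i (X + α * I)) α :=
      ContinuousAt.comp (f := fun α : ℝ => (X + α * I : ℂ)) h3 (by fun_prop)
    exact (h4.norm.div_const _).pow 2
  obtain ⟨G, hG⟩ := isCompact_Icc.exists_bound_of_continuousOn hgX
  refine ⟨Real.sqrt (Real.exp (-2 * (D.growth + ε) * X) * G), fun w hw hwθ => ?_⟩
  have hw' : w = w.re + w.im * I := (re_add_im w).symm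
  have hgr := triangular_growth (n := n) (ρ := ρ) (a := D.growth) (ε := e) (X := X)
    (U := fun i x => U i (x + w.im * I)) hρre he he1 (fun i hi x hx => ?_) (fun x hx => ?_) hw
  · have hG' := hG w.im (by rw [abs_le] at hwθ; exact ⟨by linarith, by linarith⟩)
    rw [Real.norm_of_nonneg (sum_nonneg fun _ _ => sq_nonneg _)] at hG'
    have hfirst : ‖Z w 0‖ ^ 2 ≤ ∑ i ∈ range n, (‖U i (w.re + w.im * I)‖ / e ^ i) ^ 2 := by
      have h3 := Finset.single_le_sum
        (f := fun i => (‖U i (w.re + w.im * I)‖ / e ^ i) ^ 2) (fun _ _ => sq_nonneg _)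
        (Finset.mem_range.2 (show 0 < n by omega))
      refine le_trans (le_of_eq ?_) h3
      rw [← hw']
      have h0 : (0 : ℕ) < n := by omega
      simp only [U, V, zero_add, Finset.sum_range_one, fallingCoeff, if_true, one_mul, dif_pos h0,
        Nat.cast_zero, zero_mul, exp_zero, pow_zero, div_one]
      rfl
    have hmain : ‖Z w 0‖ ^ 2 ≤ Real.exp (-2 * (D.growth + ε) * X) * G *
        Real.exp ((D.growth + ε) * w.re) ^ 2 := by
      refine (hfirst.trans hgr).trans ?_
      have h3 : Real.exp (2 * (D.growth + e * n ^ 2) * (w.re - X)) ≤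
          Real.exp (2 * (D.growth + ε) * (w.re - X)) := by
        refine exp_le_exp.2 (mul_le_mul_of_nonneg_right ?_ (by linarith)); linarith
      have h4 : Real.exp (2 * (D.growth + ε) * (w.re - X)) =
          Real.exp (-2 * (D.growth + ε) * X) * Real.exp ((D.growth + ε) * w.re) ^ 2 := by
        rw [← Real.exp_nat_mul, ← Real.exp_add]; congr 1; push_cast; ring
      calc _ ≤ Real.exp (2 * (D.growth + ε) * (w.re - X)) * G :=
            mul_le_mul h3 hG' (sum_nonneg fun _ _ => sq_nonneg _) (exp_pos _).le
        _ = _ := by rw [h4]; ring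
    have hG0 : 0 ≤ G := (sum_nonneg fun _ _ => sq_nonneg _).trans hG'
    refine (sq_le_sq₀ (norm_nonneg _) (by positivity)).1 ?_
    rwa [mul_pow, Real.sq_sqrt (by positivity)]
  · have := hUder i hi (x + w.im * I) (by simp; linarith)
    have h3 := (HasDerivAt.comp_add_const (x : ℂ) (w.im * I) this).comp_ofReal
    exact h3
  · exact hUn _ (by simpa using hx)

end InverseFactorialData

namespace InverseFactorialData

variable {n : ℕ} (D : InverseFactorialData n)

/-- The direction `α` is a cut of `star j`. -/
def IsCutAngle (j : Fin n) (α : ℝ) : Prop :=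
  ∃ l, l ≠ j ∧ exp (α * I) = (D.lam l - D.lam j) / ‖D.lam l - D.lam j‖

theorem exp_eq_norm_mul (w : ℂ) : exp w = Real.exp w.re * exp (w.im * I) := by
  rw [ofReal_exp, ← exp_add, re_add_im]

variable {D}

theorem IsCutAngle.exists_eq {j : Fin n} {w : ℂ} (h : D.IsCutAngle j w.im) : ∃ l, l ≠ j ∧
    exp w = ((Real.exp w.re / ‖D.lam l - D.lam j‖ : ℝ) : ℂ) * (D.lam l - D.lam j) := by
  obtain ⟨l, hl, h⟩ := h
  refine ⟨l, hl, ?_⟩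
  rw [exp_eq_norm_mul, h]
  push_cast; ring

theorem IsCutAngle.of_exp_eq {j l : Fin n} (hl : l ≠ j) {w : ℂ} {s : ℝ} (hs : 0 < s)
    (h : exp w = s * (D.lam l - D.lam j)) : D.IsCutAngle j w.im := by
  refine ⟨l, hl, ?_⟩
  have hv := D.lam_sub_ne_zero hl
  have h1 : Real.exp w.re = s * ‖D.lam l - D.lam j‖ := by
    rw [← norm_exp, h, norm_mul, norm_real, Real.norm_of_nonneg hs.le]
  have h2 := exp_eq_norm_mul w
  rw [h, h1] at h2
  have h3 : (‖D.lam l - D.lam j‖ : ℂ) ≠ 0 := by exact_mod_cast norm_ne_zero_iff.2 hv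
  have h4 : (s : ℂ) ≠ 0 := by exact_mod_cast hs.ne'
  rw [eq_div_iff h3]
  push_cast at h2
  refine mul_left_cancel₀ h4 ?_
  rw [h2]; ring

variable (D)

theorem mem_star_of_not_isCutAngle {j : Fin n} {w : ℂ} (h : ¬ D.IsCutAngle j w.im) :
    w ∈ D.star j := fun _ hl _ hs h' => h (IsCutAngle.of_exp_eq hl (by linarith) h')

theorem not_isCutAngle_of_mem_star {j : Fin n} {w : ℂ} (hw : w ∈ D.star j)
    (h : ∀ l, l ≠ j → ‖D.lam l - D.lam j‖ ≤ Real.exp w.re) : ¬ D.IsCutAngle j w.im := fun hc => by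
  obtain ⟨l, hl, h'⟩ := hc.exists_eq
  refine hw l hl _ ?_ h'
  rw [le_div_iff₀ (D.norm_lam_sub_pos hl), one_mul]
  exact h l hl

theorem eventually_not_isCutAngle (j : Fin n) (θ : ℝ) : ∀ᶠ α in 𝓝[≠] θ, ¬ D.IsCutAngle j α := by
  have : ∀ l, ∀ᶠ α : ℝ in 𝓝[≠] θ, ¬ (l ≠ j ∧
      exp (α * I) = (D.lam l - D.lam j) / ‖D.lam l - D.lam j‖) := fun l => by
    by_cases h : exp (θ * I) = (D.lam l - D.lam j) / ‖D.lam l - D.lam j‖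
    · filter_upwards [self_mem_nhdsWithin, mem_nhdsWithin_of_mem_nhds
        (ball_mem_nhds θ pi_pos)] with α h1 h2
      rintro ⟨-, h3⟩
      rw [← h, exp_eq_exp_iff_exists_int] at h3
      obtain ⟨m, hm⟩ := h3
      have h4 : α = θ + m * (2 * π) := by
        have := congrArg Complex.im hm
        simpa using this
      rw [mem_ball, Real.dist_eq, h4, add_sub_cancel_left, abs_mul, abs_of_pos
        two_pi_pos] at h2
      have hm0 : m ≠ 0 := fun h5 => h1 (by rw [h4, h5]; simp)
      have : (1 : ℝ) ≤ |(m : ℝ)| := by exact_mod_cast Int.one_le_abs hm0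
      nlinarith [pi_pos]
    · have hc : ContinuousAt (fun α : ℝ => exp (α * I)) θ := by fun_prop
      filter_upwards [mem_nhdsWithin_of_mem_nhds (hc.eventually_ne h)] with α hα h1 using hα h1.2
  filter_upwards [eventually_all.2 this] with α hα
  rintro ⟨l, hl⟩
  exact hα l hl

theorem exists_strip (j : Fin n) (θ : ℝ) : ∃ δ > 0, ∀ α : ℝ, α ≠ θ → |α - θ| < δ →
    ¬ D.IsCutAngle j α := by
  obtain ⟨δ, hδ, h⟩ := mem_nhdsWithin_iff.1 (D.eventually_not_isCutAngle j θ)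
  exact ⟨δ, hδ, fun α h1 h2 => h ⟨by rwa [mem_ball, Real.dist_eq], h1⟩⟩

theorem exists_maxDist (j : Fin n) : ∃ x₁ : ℝ, ∀ l, l ≠ j → ‖D.lam l - D.lam j‖ < Real.exp x₁ := by
  have : ∀ᶠ x : ℝ in atTop, ∀ l, l ≠ j → ‖D.lam l - D.lam j‖ < Real.exp x := by
    refine eventually_all.2 fun l => ?_
    filter_upwards [Real.tendsto_exp_atTop.eventually_gt_atTop ‖D.lam l - D.lam j‖] with x hx _ using hx
  exact this.exists

theorem add_exp_ne_lam_of_large {j : Fin n} {x₁ : ℝ}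
    (h : ∀ l, l ≠ j → ‖D.lam l - D.lam j‖ < Real.exp x₁) {w : ℂ} (hw : x₁ < w.re) (l : Fin n) :
    D.lam j + exp w ≠ D.lam l := by
  intro heq
  by_cases hl : l = j
  · subst hl; exact exp_ne_zero w (by linear_combination heq)
  · have h1 := h l hl
    rw [← heq, add_sub_cancel_left, norm_exp] at h1
    exact absurd (Real.exp_lt_exp.1 h1) (not_lt.2 hw.le)

variable [Fact (2 ≤ n)]

/-- Growth of the Borel transforms at infinity, near the direction `θ`. -/
theorem exists_borel_growth (j : Fin n) {ε : ℝ} (hε : 0 < ε) (θ : ℝ) : ∃ δ > 0, ∃ X C : ℝ,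
    ∀ w ∈ D.star j, |w.im - θ| < δ → X ≤ w.re →
      ‖D.borel j w‖ ≤ C * Real.exp ((D.growth + ε) * w.re) := by
  obtain ⟨δ, hδ, hstrip⟩ := D.exists_strip j θ
  obtain ⟨x₁, hx₁⟩ := D.exists_maxDist j
  have hne := fun (w : ℂ) (hw : x₁ < w.re) => D.add_exp_ne_lam_of_large hx₁ hw
  have hHo : IsOpen {w : ℂ | x₁ < w.re} := isOpen_lt continuous_const continuous_re
  have hBd : DifferentiableOn ℂ (D.logField (D.lam j)) {w : ℂ | x₁ < w.re} :=
    D.differentiableOn_logField hne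
  obtain ⟨X, hX, hgr⟩ := D.exists_growth_bound (D.lam j) hε x₁
  have key : ∀ T : Set ℂ, Convex ℝ T → T ⊆ D.star j ∩ {w | x₁ < w.re} → T ⊆ {w | |w.im - θ| ≤ 1} →
      ∃ C : ℝ, ∀ w ∈ T, X ≤ w.re → ‖D.borel j w‖ ≤ C * Real.exp ((D.growth + ε) * w.re) := by
    intro T hTc hT hT'
    rcases T.eq_empty_or_nonempty with rfl | ⟨w₀, hw₀⟩
    · exact ⟨0, fun w hw => absurd hw (notMem_empty w)⟩
    obtain ⟨Z, hZ0, hZ⟩ := exists_solvesLinear (convex_halfSpace_re_gt _) hHo hBd (hT hw₀).2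
      (D.borelSol j w₀)
    have heq : EqOn (D.borelSol j) Z T := SolvesLinear.eqOn hTc
      (hBd.continuousOn.mono fun w hw => (hT hw).2)
      ((D.solvesLinear_borelSol j).mono fun w hw => (hT hw).1) (hZ.mono fun w hw => (hT hw).2)
      hw₀ hZ0.symm
    obtain ⟨C, hC⟩ := hgr Z hZ θ
    refine ⟨C, fun w hw hXw => ?_⟩
    rw [D.borel_eq (hT hw).1, heq hw]
    exact hC w hXw (hT' hw)
  set δ' := min δ 1
  have hδ' : 0 < δ' := lt_min hδ one_pos
  have hδ1 : δ' ≤ δ := min_le_left _ _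
  have hδ2 : δ' ≤ 1 := min_le_right _ _
  obtain ⟨C₁, h₁⟩ := key ({w | x₁ < w.re} ∩ ({w | θ < w.im} ∩ {w | w.im < θ + δ'}))
    ((convex_halfSpace_re_gt _).inter ((convex_halfSpace_im_gt _).inter (convex_halfSpace_im_lt _)))
    (fun w hw => ⟨D.mem_star_of_not_isCutAngle (hstrip _ (ne_of_gt hw.2.1) (by
      have h1 : θ < w.im := hw.2.1
      have h2 : w.im < θ + δ' := hw.2.2
      rw [abs_lt]; constructor <;> linarith)), hw.1⟩) (fun w hw => by
      have h1 : θ < w.im := hw.2.1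
      have h2 : w.im < θ + δ' := hw.2.2
      change |w.im - θ| ≤ 1
      rw [abs_le]; constructor <;> linarith)
  obtain ⟨C₂, h₂⟩ := key ({w | x₁ < w.re} ∩ ({w | θ - δ' < w.im} ∩ {w | w.im < θ}))
    ((convex_halfSpace_re_gt _).inter ((convex_halfSpace_im_gt _).inter (convex_halfSpace_im_lt _)))
    (fun w hw => ⟨D.mem_star_of_not_isCutAngle (hstrip _ (ne_of_lt hw.2.2) (by
      have h1 : θ - δ' < w.im := hw.2.1
      have h2 : w.im < θ := hw.2.2
      rw [abs_lt]; constructor <;> linarith)), hw.1⟩) (fun w hw => by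
      have h1 : θ - δ' < w.im := hw.2.1
      have h2 : w.im < θ := hw.2.2
      change |w.im - θ| ≤ 1
      rw [abs_le]; constructor <;> linarith)
  obtain ⟨C₃, h₃⟩ : ∃ C : ℝ, ∀ w ∈ D.star j, w.im = θ → X ≤ w.re →
      ‖D.borel j w‖ ≤ C * Real.exp ((D.growth + ε) * w.re) := by
    by_cases hcut : D.IsCutAngle j θ
    · refine ⟨0, fun w hw hwθ hXw => absurd (hwθ ▸ hcut) (D.not_isCutAngle_of_mem_star hw
        fun l hl => (hx₁ l hl).le.trans (exp_le_exp.2 (by linarith)))⟩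
    · obtain ⟨C, hC⟩ := key ({w | x₁ < w.re} ∩ ({w | θ ≤ w.im} ∩ {w | w.im ≤ θ}))
        ((convex_halfSpace_re_gt _).inter
          ((convex_halfSpace_im_ge _).inter (convex_halfSpace_im_le _)))
        (fun w hw => ⟨D.mem_star_of_not_isCutAngle (by
          have h1 : w.im ≤ θ := hw.2.2
          have h2 : θ ≤ w.im := hw.2.1
          rwa [le_antisymm h1 h2]), hw.1⟩) (fun w hw => by
          have h1 : w.im ≤ θ := hw.2.2
          have h2 : θ ≤ w.im := hw.2.1
          change |w.im - θ| ≤ 1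
          rw [le_antisymm h1 h2]; simp)
      exact ⟨C, fun w _ hwθ hXw => hC w ⟨show x₁ < w.re by linarith, hwθ.ge, hwθ.le⟩ hXw⟩
  refine ⟨δ', hδ', X, max C₁ (max C₂ C₃), fun w hw hwθ hXw => ?_⟩
  have hx : x₁ < w.re := by linarith
  rw [abs_lt] at hwθ
  have hle : ∀ C : ℝ, ‖D.borel j w‖ ≤ C * Real.exp ((D.growth + ε) * w.re) →
      C ≤ max C₁ (max C₂ C₃) →
      ‖D.borel j w‖ ≤ max C₁ (max C₂ C₃) * Real.exp ((D.growth + ε) * w.re) := fun C h1 h2 =>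
    h1.trans (mul_le_mul_of_nonneg_right h2 (exp_pos _).le)
  rcases lt_trichotomy w.im θ with h | h | h
  · exact hle C₂ (h₂ w ⟨hx, show θ - δ' < w.im by linarith, h⟩ hXw)
      ((le_max_left _ _).trans (le_max_right _ _))
  · exact hle C₃ (h₃ w hw h hXw) ((le_max_right _ _).trans (le_max_right _ _))
  · exact hle C₁ (h₁ w ⟨hx, h, show w.im < θ + δ' by linarith⟩ hXw) (le_max_left _ _)

end InverseFactorialData

section Hyperterminant

theorem norm_exp_sub_sq_ge (w ω : ℂ) : (1 - Real.cos (w.im - ω.im)) / 2 *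
    (Real.exp w.re + Real.exp ω.re) ^ 2 ≤ ‖exp w - exp ω‖ ^ 2 := by
  have h1 : ‖exp w - exp ω‖ ^ 2 = Real.exp w.re ^ 2 + Real.exp ω.re ^ 2 -
      2 * Real.exp w.re * Real.exp ω.re * Real.cos (w.im - ω.im) := by
    rw [← normSq_eq_norm_sq, normSq_apply, sub_re, sub_im,
      exp_re, exp_re, exp_im, exp_im, Real.cos_sub]
    nlinarith [Real.sin_sq_add_cos_sq w.im, Real.sin_sq_add_cos_sq ω.im]
  rw [h1]
  nlinarith [Real.neg_one_le_cos (w.im - ω.im), sq_nonneg (Real.exp w.re - Real.exp ω.re)]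

theorem exists_le_norm_exp_sub {a b : ℝ} (ha : -(2 * π) < a) (hb : b < 0) : ∃ c > 0,
    ∀ w ω : ℂ, a ≤ w.im - ω.im → w.im - ω.im ≤ b →
      c * (Real.exp w.re + Real.exp ω.re) ≤ ‖exp w - exp ω‖ := by
  rcases lt_or_ge b a with hab | hab
  · exact ⟨1, one_pos, fun w ω h1 h2 => by linarith⟩
  obtain ⟨ψ, hψ, hmin⟩ := (isCompact_Icc (a := a) (b := b)).exists_isMinOn ⟨a, le_rfl, hab⟩
    (f := fun ψ => (1 - Real.cos ψ) / 2) (by fun_prop)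
  have hpos : 0 < (1 - Real.cos ψ) / 2 := by
    have h1 : Real.cos ψ ≠ 1 := fun h => by
      rw [Real.cos_eq_one_iff_of_lt_of_lt (by linarith [hψ.1]) (by linarith [hψ.2, pi_pos])] at h
      linarith [hψ.2]
    have := lt_of_le_of_ne (Real.cos_le_one ψ) h1
    linarith
  refine ⟨Real.sqrt ((1 - Real.cos ψ) / 2), Real.sqrt_pos.2 hpos, fun w ω h1 h2 => ?_⟩
  refine (sq_le_sq₀ (by positivity) (norm_nonneg _)).1 ?_
  rw [mul_pow, Real.sq_sqrt hpos.le]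
  refine le_trans ?_ (norm_exp_sub_sq_ge w ω)
  exact mul_le_mul_of_nonneg_right (hmin ⟨h1, h2⟩) (sq_nonneg _)

/-- Decay of `exp (e^ω) e^{Mω}` in strips on which `Re e^ω < 0`. -/
theorem exists_norm_exp_exp_mul_le {M : ℂ} (hM : 0 < M.re) {a b : ℝ} (ha : π / 2 < a)
    (hb : b < 3 * π / 2) : ∃ C : ℝ, 0 ≤ C ∧ ∀ ω : ℂ, a ≤ ω.im → ω.im ≤ b →
      ‖exp (exp ω) * exp (M * ω)‖ ≤ C * Real.exp (-M.re * |ω.re|) := by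
  rcases lt_or_ge b a with hab | hab
  · exact ⟨1, zero_le_one, fun ω h1 h2 => by linarith⟩
  obtain ⟨ψ, hψ, hmax⟩ := (isCompact_Icc (a := a) (b := b)).exists_isMaxOn ⟨a, le_rfl, hab⟩
    (f := fun ψ => Real.cos ψ) (by fun_prop)
  set c := -Real.cos ψ with hc
  have hc0 : 0 < c := by
    have := Real.cos_neg_of_pi_div_two_lt_of_lt (x := ψ) (by linarith [hψ.1]) (by linarith [hψ.2])
    linarith
  set m := 2 * M.re with hm
  have hm0 : 0 < m := by positivity
  set K := m * (Real.log (m / c) - 1) with hK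
  have hgrow : ∀ x : ℝ, -c * Real.exp x + m * x ≤ K := fun x => by
    have h1 := Real.add_one_le_exp (x - Real.log (m / c))
    rw [Real.exp_sub, Real.exp_log (by positivity), le_div_iff₀ (by positivity)] at h1
    have h2 : (x - Real.log (m / c) + 1) * (m / c) * c = (x - Real.log (m / c) + 1) * m := by
      field_simp
    have h3 := mul_le_mul_of_nonneg_right h1 hc0.le
    rw [h2] at h3
    rw [hK]; nlinarith
  obtain ⟨L, hL⟩ := (isCompact_Icc (a := a) (b := b)).exists_bound_of_continuousOn
    (f := fun β : ℝ => M.im * β) (by fun_prop)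
  refine ⟨Real.exp (L + |K|), (exp_pos _).le, fun ω h1 h2 => ?_⟩
  have hcos : Real.cos ω.im ≤ -c := by rw [hc, neg_neg]; exact hmax ⟨h1, h2⟩
  rw [norm_mul, norm_exp, norm_exp, ← Real.exp_add, ← Real.exp_add]
  refine exp_le_exp.2 ?_
  have h3 := hL ω.im ⟨h1, h2⟩
  rw [Real.norm_eq_abs, abs_le] at h3
  rw [exp_re, mul_re]
  have h4 : Real.exp ω.re * Real.cos ω.im ≤ -c * Real.exp ω.re := by
    have := mul_le_mul_of_nonneg_left hcos (exp_pos ω.re).le; linarith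
  have h6 := exp_pos ω.re
  rcases le_total 0 ω.re with h5 | h5
  · rw [abs_of_nonneg h5]
    have := hgrow ω.re
    have := le_abs_self K
    have : m * ω.re = 2 * (M.re * ω.re) := by rw [hm]; ring
    linarith
  · rw [abs_of_nonpos h5]
    have := abs_nonneg K
    have : 0 ≤ c * Real.exp ω.re := by positivity
    linarith

theorem re_ofReal_add_mul_I (x y : ℝ) : (x + y * I : ℂ).re = x := by simp

/-- The integrand of the hyperterminant after the substitutions `z = e^w`, `τ = e^ω`. -/
noncomputable def hyperKernel (M w ω : ℂ) : ℂ := exp (exp ω) * exp (M * ω) / (exp w - exp ω)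

/-- The hyperterminant, with the direction of integration `arg τ = β`. -/
noncomputable def hyperLine (M : ℂ) (β : ℝ) (w : ℂ) : ℂ := ∫ x : ℝ, hyperKernel M w (x + β * I)

theorem exp_ne_exp_of_im {w ω : ℂ} (h1 : -(2 * π) < w.im - ω.im) (h2 : w.im - ω.im < 2 * π)
    (h : w.im - ω.im ≠ 0) : exp w - exp ω ≠ 0 := by
  rw [sub_ne_zero, Ne, exp_eq_exp_iff_exists_int]
  rintro ⟨m, hm⟩
  have h3 : w.im - ω.im = m * (2 * π) := by rw [hm]; simp
  have hp := two_pi_pos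
  have h4 : (m : ℝ) < 1 := by by_contra! h5; nlinarith
  have h5 : (-1 : ℝ) < m := by by_contra! h6; nlinarith
  have h6 : m = 0 := by
    have h7 : m < 1 := by exact_mod_cast h4
    have h8 : -1 < m := by exact_mod_cast h5
    omega
  rw [h6] at h3; simp at h3; exact h h3

theorem differentiableAt_hyperKernel (M : ℂ) {w ω : ℂ} (h : exp w - exp ω ≠ 0) :
    DifferentiableAt ℂ (hyperKernel M w) ω := by
  unfold hyperKernel
  exact DifferentiableAt.div (by fun_prop) (by fun_prop) h

theorem continuous_hyperKernel_line (M : ℂ) {β : ℝ} {w : ℂ} (h1 : β - 2 * π < w.im)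
    (h2 : w.im < β) : Continuous fun x : ℝ => hyperKernel M w (x + β * I) := by
  have hp := two_pi_pos
  refine continuous_horizontal_line (S := {ω | exp w - exp ω ≠ 0})
    (fun ω hω => (differentiableAt_hyperKernel M hω).continuousAt.continuousWithinAt) fun x => ?_
  refine exp_ne_exp_of_im ?_ ?_ ?_
  · simp; linarith
  · simp; linarith
  · simp; linarith

theorem hyperLine_eq {M : ℂ} (hM : 0 < M.re) {β₁ β₂ : ℝ} (h₁₂ : β₁ ≤ β₂) (h₁ : π / 2 < β₁)
    (h₂ : β₂ < 3 * π / 2) {w : ℂ} (hw₁ : w.im < β₁) (hw₂ : β₂ - 2 * π < w.im) :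
    hyperLine M β₁ w = hyperLine M β₂ w := by
  obtain ⟨C, hC0, hC⟩ := exists_norm_exp_exp_mul_le hM h₁ h₂
  obtain ⟨c, hc, hcb⟩ := exists_le_norm_exp_sub (a := w.im - β₂) (b := w.im - β₁) (by linarith)
    (by linarith)
  refine integral_horizontal_line_eq (C := C / (c * Real.exp w.re)) (X := 0) h₁₂ hM
    (fun ω hω => ?_) (fun ω h3 h4 _ => ?_)
  · have h3 : β₁ ≤ ω.im := hω.1
    have h4 : ω.im ≤ β₂ := hω.2
    exact (differentiableAt_hyperKernel M (exp_ne_exp_of_im (by linarith) (by linarith [pi_pos])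
      (by linarith))).differentiableWithinAt
  · have h5 := hcb w ω (by linarith) (by linarith)
    have h6 : c * Real.exp w.re ≤ ‖exp w - exp ω‖ :=
      le_trans (by gcongr; linarith [exp_pos ω.re]) h5
    rw [hyperKernel, norm_div, div_mul_eq_mul_div]
    have := hC ω h3 h4
    gcongr

theorem exists_hyperLine_bounds {M : ℂ} (hM : 1 < M.re) {β : ℝ} (h₁ : π / 2 < β)
    (h₂ : β < 3 * π / 2) {a b : ℝ} (ha : β - 2 * π < a) (hb : b < β) :
    ∃ C : ℝ, ∀ w : ℂ, a ≤ w.im → w.im ≤ b →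
      ‖hyperLine M β w‖ ≤ C ∧ ‖exp w * hyperLine M β w‖ ≤ C := by
  obtain ⟨C, hC0, hC⟩ := exists_norm_exp_exp_mul_le (M := M) (by linarith) h₁ h₂
  obtain ⟨C', hC0', hC'⟩ := exists_norm_exp_exp_mul_le (M := M - 1) (by simp; linarith) h₁ h₂
  obtain ⟨c, hc, hcb⟩ := exists_le_norm_exp_sub (a := a - β) (b := b - β) (by linarith) (by linarith)
  set I₁ := ∫ x : ℝ, C / c * Real.exp (-M.re * |x|) with hI₁
  set I₂ := ∫ x : ℝ, C' / c * Real.exp (-(M - 1).re * |x|) with hI₂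
  refine ⟨max I₁ I₂, fun w hwa hwb => ?_⟩
  have hlow : ∀ x : ℝ, c * (Real.exp w.re + Real.exp x) ≤ ‖exp w - exp (x + β * I)‖ := fun x => by
    have := hcb w (x + β * I) (by simp; linarith) (by simp; linarith)
    simpa using this
  constructor
  · refine le_trans ?_ (le_max_right _ _)
    refine norm_integral_le_of_norm_le
      ((integrable_exp_neg_mul_abs (by simp; linarith)).const_mul _)
      (Eventually.of_forall fun x => ?_)
    have h1 := hC' (x + β * I) (by simp) (by simp)
    have h2 : c * Real.exp x ≤ ‖exp w - exp (x + β * I)‖ :=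
      le_trans (by gcongr; linarith [exp_pos w.re]) (hlow x)
    have h3 : exp (M * (x + β * I)) = exp ((M - 1) * (x + β * I)) * exp (x + β * I) := by
      rw [← exp_add]; ring_nf
    have h4 : ‖exp (x + β * I)‖ = Real.exp x := by rw [norm_exp]; simp
    rw [hyperKernel, h3, ← mul_assoc, norm_div, norm_mul, h4,
      div_le_iff₀ (lt_of_lt_of_le (by positivity) h2)]
    simp only [re_ofReal_add_mul_I] at h1
    have h6 := exp_pos x
    have h7 : 0 ≤ C' / c * Real.exp (-(M - 1).re * |x|) := by positivity
    calc _ ≤ C' * Real.exp (-(M - 1).re * |x|) * Real.exp x := by gcongr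
      _ = C' / c * Real.exp (-(M - 1).re * |x|) * (c * Real.exp x) := by field_simp
      _ ≤ _ := mul_le_mul_of_nonneg_left h2 h7
  · refine le_trans ?_ (le_max_left _ _)
    rw [hyperLine, ← integral_const_mul]
    refine norm_integral_le_of_norm_le
      ((integrable_exp_neg_mul_abs (by linarith)).const_mul _)
      (Eventually.of_forall fun x => ?_)
    have h1 := hC (x + β * I) (by simp) (by simp)
    have h2 : c * Real.exp w.re ≤ ‖exp w - exp (x + β * I)‖ :=
      le_trans (by gcongr; linarith [exp_pos x]) (hlow x)
    rw [hyperKernel, ← mul_div_assoc, norm_div, norm_mul, norm_exp w,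
      div_le_iff₀ (lt_of_lt_of_le (by positivity) h2)]
    simp only [re_ofReal_add_mul_I] at h1
    have h6 := exp_pos w.re
    have h7 : 0 ≤ C / c * Real.exp (-M.re * |x|) := by positivity
    calc _ ≤ Real.exp w.re * (C * Real.exp (-M.re * |x|)) := by gcongr
      _ = C / c * Real.exp (-M.re * |x|) * (c * Real.exp w.re) := by field_simp
      _ ≤ _ := mul_le_mul_of_nonneg_left h2 h7

theorem differentiableAt_hyperLine {M : ℂ} (hM : 0 < M.re) {β : ℝ} (h₁ : π / 2 < β)
    (h₂ : β < 3 * π / 2) {w : ℂ} (hw₁ : w.im < β) (hw₂ : β - 2 * π < w.im) :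
    DifferentiableAt ℂ (hyperLine M β) w := by
  obtain ⟨C, hC0, hC⟩ := exists_norm_exp_exp_mul_le (M := M) hM h₁ h₂
  obtain ⟨ε, hε, hε1, hε2⟩ : ∃ ε > 0, w.im + ε < β ∧ β - 2 * π < w.im - ε := by
    refine ⟨min (β - w.im) (w.im - (β - 2 * π)) / 2, ?_, ?_, ?_⟩
    · have := lt_min (sub_pos.2 hw₁) (sub_pos.2 hw₂); linarith
    · have := min_le_left (β - w.im) (w.im - (β - 2 * π)); linarith
    · have := min_le_right (β - w.im) (w.im - (β - 2 * π)); linarith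
  obtain ⟨c, hc, hcb⟩ := exists_le_norm_exp_sub (a := w.im - ε - β) (b := w.im + ε - β)
    (by linarith) (by linarith)
  have hball : ∀ w' ∈ ball w ε, w.im - ε < w'.im ∧ w'.im < w.im + ε ∧ w.re - ε < w'.re := by
    intro w' hw'
    rw [mem_ball, dist_eq_norm] at hw'
    have h3 := (abs_im_le_norm (w' - w)).trans_lt hw'
    have h4 := (abs_re_le_norm (w' - w)).trans_lt hw'
    rw [sub_im, abs_lt] at h3
    rw [sub_re, abs_lt] at h4
    exact ⟨by linarith, by linarith, by linarith⟩
  have hne : ∀ w' ∈ ball w ε, ∀ x : ℝ, exp w' - exp (x + β * I) ≠ 0 := fun w' hw' x => by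
    obtain ⟨h3, h4, -⟩ := hball w' hw'
    refine exp_ne_exp_of_im ?_ ?_ ?_ <;> simp <;> linarith [pi_pos]
  have hcont : ∀ w' ∈ ball w ε, Continuous fun x : ℝ => hyperKernel M w' (x + β * I) :=
    fun w' hw' => by
      obtain ⟨h3, h4, -⟩ := hball w' hw'
      exact continuous_hyperKernel_line M (by linarith) (by linarith)
  have hmem := mem_ball_self (x := w) hε
  refine (hasDerivAt_integral_of_dominated_loc_of_deriv_le (μ := volume)
    (F := fun w' (x : ℝ) => hyperKernel M w' (x + β * I))
    (F' := fun w' (x : ℝ) => -(exp w' / (exp w' - exp (x + β * I))) * hyperKernel M w' (x + β * I))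
    (bound := fun x => 1 / c * (C / (c * Real.exp (w.re - ε))) * Real.exp (-M.re * |x|))
    (ball_mem_nhds w hε) ?_ ?_ ?_ ?_ ?_ ?_).2.differentiableAt
  · filter_upwards [ball_mem_nhds w hε] with w' hw'
    exact (hcont w' hw').aestronglyMeasurable
  · refine integrable_of_exp_bound (C := C / (c * Real.exp w.re)) (δ := M.re)
      (hcont w hmem).aestronglyMeasurable hM fun x => ?_
    have h3 := hcb w (x + β * I) (by simp; linarith) (by simp; linarith)
    have h5 := hC (x + β * I) (by simp) (by simp)
    simp only [re_ofReal_add_mul_I] at h3 h5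
    have h4 : c * Real.exp w.re ≤ ‖exp w - exp (x + β * I)‖ :=
      le_trans (by gcongr; linarith [exp_pos x]) h3
    rw [hyperKernel, norm_div, div_mul_eq_mul_div]
    gcongr
  · refine Continuous.aestronglyMeasurable (Continuous.mul (Continuous.neg ?_) (hcont w hmem))
    exact Continuous.div (by fun_prop) (by fun_prop) (hne w hmem)
  · refine Eventually.of_forall fun x w' hw' => ?_
    obtain ⟨h6, h7, h8⟩ := hball w' hw'
    have h3 := hcb w' (x + β * I) (by simp; linarith) (by simp; linarith)
    have h5 := hC (x + β * I) (by simp) (by simp)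
    simp only [re_ofReal_add_mul_I] at h3 h5
    have h4 : c * Real.exp w'.re ≤ ‖exp w' - exp (x + β * I)‖ :=
      le_trans (by gcongr; linarith [exp_pos x]) h3
    have h9 : c * Real.exp (w.re - ε) ≤ ‖exp w' - exp (x + β * I)‖ := le_trans (by gcongr) h4
    rw [norm_mul, norm_neg, hyperKernel, norm_div, norm_div, norm_exp w', mul_assoc,
      div_mul_eq_mul_div C]
    refine mul_le_mul ?_ (by gcongr) (by positivity) (by positivity)
    rw [div_le_div_iff₀ (lt_of_lt_of_le (by positivity) h4) hc]
    linarith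
  · exact (integrable_exp_neg_mul_abs hM).const_mul _
  · refine Eventually.of_forall fun x w' hw' => ?_
    have h3 := hne w' hw' x
    have h4 := ((hasDerivAt_exp w').sub_const (exp (x + β * I))).inv h3
    have h5 := h4.const_mul (exp (exp (x + β * I)) * exp (M * (x + β * I)))
    refine (h5.congr_deriv ?_).congr_of_eventuallyEq (Eventually.of_forall fun z => ?_)
    · rw [hyperKernel]; field_simp
    · exact div_eq_mul_inv _ _

/-- The hyperterminant in `|arg z| < 3π/2`, as a function of `w = log z`. -/
noncomputable def hyperF (M w : ℂ) : ℂ := hyperLine M (π + w.im / 3) w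

theorem hyperF_eq {M : ℂ} (hM : 0 < M.re) {β : ℝ} (h₁ : π / 2 < β) (h₂ : β < 3 * π / 2)
    {w : ℂ} (hw₁ : w.im < β) (hw₂ : β - 2 * π < w.im) : hyperF M w = hyperLine M β w := by
  rcases le_total β (π + w.im / 3) with h | h
  · exact (hyperLine_eq hM h h₁ (by linarith) hw₁ (by linarith)).symm
  · exact hyperLine_eq hM h (by linarith) h₂ (by linarith) hw₂

theorem differentiableAt_hyperF {M : ℂ} (hM : 0 < M.re) {w : ℂ} (hw : |w.im| < 3 * π / 2) :
    DifferentiableAt ℂ (hyperF M) w := by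
  rw [abs_lt] at hw
  set β := π + w.im / 3 with hβ
  refine (differentiableAt_hyperLine hM (β := β) (by linarith) (by linarith) (by linarith)
    (by linarith)).congr_of_eventuallyEq ?_
  have h1 : ∀ᶠ z : ℂ in 𝓝 w, z.im < β :=
    continuous_im.continuousAt.eventually_lt continuousAt_const (by linarith)
  have h2 : ∀ᶠ z : ℂ in 𝓝 w, β - 2 * π < z.im :=
    continuousAt_const.eventually_lt continuous_im.continuousAt (by linarith)
  filter_upwards [h1, h2] with z hz1 hz2
  exact hyperF_eq hM (by linarith) (by linarith) hz1 hz2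

theorem exists_hyperF_bounds {M : ℂ} (hM : 1 < M.re) {a b : ℝ} (ha : -(3 * π / 2) < a)
    (hb : b < 3 * π / 2) : ∃ C : ℝ, ∀ w : ℂ, a ≤ w.im → w.im ≤ b →
      ‖hyperF M w‖ ≤ C ∧ ‖exp w * hyperF M w‖ ≤ C := by
  have hp := pi_pos
  obtain ⟨β₁, h1, h1'⟩ := exists_between (max_lt hb (by linarith : π / 2 < 3 * π / 2))
  obtain ⟨β₂, h2, h2'⟩ := exists_between (lt_min (by linarith : π / 2 < a + 2 * π)
    (by linarith : π / 2 < 3 * π / 2))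
  rw [max_lt_iff] at h1
  rw [lt_min_iff] at h2'
  obtain ⟨C₁, hC₁⟩ := exists_hyperLine_bounds hM h1.2 h1' (a := 0) (b := b) (by linarith) h1.1
  obtain ⟨C₂, hC₂⟩ := exists_hyperLine_bounds hM h2 h2'.2 (a := a) (b := 0) (by linarith)
    (by linarith)
  refine ⟨max C₁ C₂, fun w hwa hwb => ?_⟩
  rcases le_total 0 w.im with h | h
  · rw [hyperF_eq (by linarith) h1.2 h1' (by linarith) (by linarith)]
    obtain ⟨h3, h4⟩ := hC₁ w h hwb
    exact ⟨h3.trans (le_max_left _ _), h4.trans (le_max_left _ _)⟩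
  · rw [hyperF_eq (by linarith) h2 h2'.2 (by linarith) (by linarith)]
    obtain ⟨h3, h4⟩ := hC₂ w hwa h
    exact ⟨h3.trans (le_max_right _ _), h4.trans (le_max_right _ _)⟩

theorem hyperterminantIntegral_eq (M w : ℂ) : hyperterminantIntegral M w = hyperLine M π w := by
  have himg : Real.exp '' univ = Ioi 0 := by rw [image_univ, Real.range_exp]
  rw [hyperterminantIntegral, ← himg, integral_image_eq_integral_abs_deriv_smul MeasurableSet.univ
    (fun x _ => (Real.hasDerivAt_exp x).hasDerivWithinAt) Real.exp_injective.injOn, setIntegral_univ,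
    hyperLine]
  refine integral_congr_ae (Eventually.of_forall fun x => ?_)
  have h1 : exp (x + π * I) = -exp x := by rw [exp_add, exp_pi_mul_I]; ring
  have h2 : exp (M * (x + π * I)) = exp ((M - 1) * (x + π * I)) * -exp x := by
    rw [← h1, ← exp_add]; ring_nf
  beta_reduce
  rw [hyperKernel, h1, h2, Real.log_exp, abs_of_pos (exp_pos x), real_smul,
    ofReal_exp, sub_neg_eq_add]
  ring

theorem hyperterminant_eq {M : ℂ} (hM : 0 < M.re) {w : ℂ} (hw : |w.im| < 3 * π / 2) :
    hyperterminant M w = hyperF M w := by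
  have hp := pi_pos
  have hopen : ∀ c : ℝ, IsOpen {w : ℂ | |w.im| < c} := fun c =>
    isOpen_lt (continuous_abs.comp continuous_im) continuous_const
  have hconv : Convex ℝ {w : ℂ | |w.im| < 3 * π / 2} := by
    have : {w : ℂ | |w.im| < 3 * π / 2} =
        {w : ℂ | -(3 * π / 2) < w.im} ∩ {w : ℂ | w.im < 3 * π / 2} := by
      ext z; simp [abs_lt]
    rw [this]
    exact (convex_halfSpace_im_gt _).inter (convex_halfSpace_im_lt _)
  have hF : AnalyticOnNhd ℂ (hyperF M) {w | |w.im| < 3 * π / 2} := DifferentiableOn.analyticOnNhd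
      (fun z hz => (differentiableAt_hyperF hM hz).differentiableWithinAt) (hopen _)
  have hFI : EqOn (hyperF M) (hyperterminantIntegral M) {w | |w.im| < π} := fun z hz => by
    have hz' : |z.im| < π := hz
    rw [abs_lt] at hz'
    rw [hyperterminantIntegral_eq, hyperF_eq hM (by linarith) (by linarith) hz'.2 (by linarith)]
  have hex : ∃ g : ℂ → ℂ, AnalyticOnNhd ℂ g {w | |w.im| < 3 * π / 2} ∧
      EqOn g (hyperterminantIntegral M) {w | |w.im| < π} := ⟨_, hF, hFI⟩
  rw [hyperterminant, analyticContinuation, dif_pos hex]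
  obtain ⟨h1, h2⟩ := hex.choose_spec
  refine h1.eqOn_of_preconnected_of_eventuallyEq hF hconv.isPreconnected (z₀ := 0)
    (by simp; linarith) ?_ hw
  filter_upwards [(hopen π).mem_nhds (show (0 : ℂ) ∈ {w : ℂ | |w.im| < π} by simpa)]
    with z hz
  rw [h2 hz, hFI hz]

theorem norm_sinh_ge (ω : ℂ) : (Real.exp |ω.re| - Real.exp (-|ω.re|)) / 2 ≤ ‖sinh ω‖ := by
  have h1 : sinh ω = (exp ω - exp (-ω)) / 2 := rfl
  rw [h1, norm_div, norm_ofNat]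
  gcongr
  have h2 := abs_norm_sub_norm_le (exp ω) (exp (-ω))
  rw [norm_exp, norm_exp, neg_re] at h2
  refine le_trans ?_ h2
  rcases le_total 0 ω.re with h | h
  · rw [abs_of_nonneg h]; exact le_abs_self _
  · rw [abs_of_nonpos h, neg_neg, abs_sub_comm]; exact le_abs_self _

theorem norm_inv_sinh_le {ω : ℂ} (h : 1 ≤ |ω.re|) : ‖(sinh ω)⁻¹‖ ≤ 4 * Real.exp (-1 * |ω.re|) := by
  have h1 := norm_sinh_ge ω
  have h2 : Real.exp (-|ω.re|) ≤ Real.exp |ω.re| / 2 := by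
    have h3 : Real.exp |ω.re| = Real.exp (-|ω.re|) * Real.exp (2 * |ω.re|) := by
      rw [← Real.exp_add]; ring_nf
    have h4 := Real.add_one_le_exp (2 * |ω.re|)
    have h5 := exp_pos (-|ω.re|)
    rw [h3]; nlinarith
  have h6 : Real.exp |ω.re| / 4 ≤ ‖sinh ω‖ := by linarith
  rw [norm_inv, neg_one_mul, Real.exp_neg]
  have h7 := exp_pos |ω.re|
  rw [inv_le_comm₀ (by linarith) (by positivity)]
  refine le_trans (le_of_eq ?_) h6
  field_simp

theorem sinh_ne_zero {ω : ℂ} (h1 : |ω.im| < π) (h2 : ω ≠ 0) : sinh ω ≠ 0 := by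
  intro h
  have h3 : exp ω = exp (-ω) := by
    have : (exp ω - exp (-ω)) / 2 = 0 := h
    linear_combination 2 * this
  rw [exp_eq_exp_iff_exists_int] at h3
  obtain ⟨m, hm⟩ := h3
  have h4 : ω = m * (π * I) := by linear_combination hm / 2
  rw [abs_lt] at h1
  have h5 : ω.im = m * π := by rw [h4]; simp
  have hp := pi_pos
  have h6 : (m : ℝ) < 1 := by by_contra! h7; nlinarith
  have h7 : (-1 : ℝ) < m := by by_contra! h8; nlinarith
  have h8 : m = 0 := by
    have h9 : m < 1 := by exact_mod_cast h6
    have h10 : -1 < m := by exact_mod_cast h7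
    omega
  rw [h8] at h4; simp at h4; exact h2 h4

theorem hasDerivAt_arctan_exp (x : ℝ) :
    HasDerivAt (fun x => 2 * Real.arctan (Real.exp x)) (Real.cosh x)⁻¹ x := by
  have h1 := ((Real.hasDerivAt_exp x).arctan).const_mul 2
  refine h1.congr_deriv ?_
  have h2 : Real.exp x * Real.exp (-x) = 1 := by rw [← Real.exp_add]; simp
  have h3 := exp_pos x
  have h4 := exp_pos (-x)
  rw [Real.cosh_eq]
  field_simp
  nlinarith

theorem integral_inv_sinh {c : ℝ} (hc : 0 < c) (hc' : c ≤ π / 2) :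
    ∫ x : ℝ, (sinh (x + c * I))⁻¹ = -(π * I) := by
  have hp := pi_pos
  have hd : DifferentiableOn ℂ (fun ω => (sinh ω)⁻¹) {w | c ≤ w.im ∧ w.im ≤ π / 2} := fun ω hω => by
      have h1 : c ≤ ω.im := hω.1
      have h2 : ω.im ≤ π / 2 := hω.2
      have hne : ω ≠ 0 := fun h => by rw [h] at h1; simp at h1; linarith
      exact (differentiable_sinh.differentiableAt.inv (sinh_ne_zero (by
        rw [abs_lt]; constructor <;> linarith) hne)).differentiableWithinAt
  rw [integral_horizontal_line_eq (Φ := fun ω => (sinh ω)⁻¹) hc' one_pos hd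
    (fun w _ _ hw => norm_inv_sinh_le hw)]
  have h1 : ∀ x : ℝ, (sinh (x + (π / 2 : ℝ) * I))⁻¹ = -I * ((Real.cosh x)⁻¹ : ℝ) := fun x => by
    rw [sinh_add, cosh_mul_I, sinh_mul_I, ← ofReal_cos,
      ← ofReal_sin, Real.cos_pi_div_two, Real.sin_pi_div_two]
    simp [mul_comm]
  have hline : Integrable fun x : ℝ => (sinh (x + (π / 2 : ℝ) * I))⁻¹ := by
    obtain ⟨C', hC', hb'⟩ := exists_global_exp_bound hd.continuousOn
      (C := 4) (δ := 1) (X := 1) (fun w _ _ hw => norm_inv_sinh_le hw)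
    exact integrable_of_exp_bound (continuous_horizontal_line hd.continuousOn
      (fun x => by simpa using hc')).aestronglyMeasurable one_pos
      (fun x => by simpa using hb' (x + (π / 2 : ℝ) * I) (by simpa using hc') (by simp))
  simp only [h1] at hline ⊢
  have hint : Integrable fun x : ℝ => (Real.cosh x)⁻¹ := by
    refine (hline.const_mul I).re.congr (Eventually.of_forall fun x => ?_)
    beta_reduce
    rw [← mul_assoc, mul_neg, I_mul_I, neg_neg, one_mul]
    exact ofReal_re _
  rw [integral_const_mul, integral_complex_ofReal, integral_of_hasDerivAt_of_tendsto hasDerivAt_arctan_exp hint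
    (m := 0) (n := π)]
  · simp; ring
  · have := (Real.continuous_arctan.tendsto 0).comp Real.tendsto_exp_atBot
    simpa using this.const_mul 2
  · have := (tendsto_nhds_of_tendsto_nhdsWithin Real.tendsto_arctan_atTop).comp Real.tendsto_exp_atTop
    have h2 := this.const_mul 2
    rwa [mul_div_cancel₀ _ two_ne_zero] at h2

theorem integral_inv_sinh_neg {c : ℝ} (hc : 0 < c) (hc' : c ≤ π / 2) :
    ∫ x : ℝ, (sinh (x + (-c : ℝ) * I))⁻¹ = π * I := by
  rw [← integral_neg_eq_self]
  have : ∀ x : ℝ, (sinh ((-x : ℝ) + (-c : ℝ) * I))⁻¹ = -(sinh (x + c * I))⁻¹ := fun x => by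
    rw [← inv_neg, ← sinh_neg]; congr 2; push_cast; ring
  simp only [this]
  rw [integral_neg, integral_inv_sinh hc hc', neg_neg]

theorem integrable_hyperKernel_line {M : ℂ} (hM : 0 < M.re) {β : ℝ} (h₁ : π / 2 < β)
    (h₂ : β < 3 * π / 2) {w : ℂ} (hw₁ : w.im < β) (hw₂ : β - 2 * π < w.im) :
    Integrable fun x : ℝ => hyperKernel M w (x + β * I) := by
  obtain ⟨C, hC0, hC⟩ := exists_norm_exp_exp_mul_le (M := M) hM h₁ h₂
  obtain ⟨c, hc, hcb⟩ := exists_le_norm_exp_sub (a := w.im - β) (b := w.im - β)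
    (by linarith) (by linarith)
  refine integrable_of_exp_bound (C := C / (c * Real.exp w.re)) (δ := M.re)
    (continuous_hyperKernel_line M hw₂ hw₁).aestronglyMeasurable hM fun x => ?_
  have h3 := hcb w (x + β * I) (by simp) (by simp)
  have h5 := hC (x + β * I) (by simp) (by simp)
  simp only [re_ofReal_add_mul_I] at h3 h5
  have h4 : c * Real.exp w.re ≤ ‖exp w - exp (x + β * I)‖ :=
    le_trans (by gcongr; linarith [exp_pos x]) h3
  rw [hyperKernel, norm_div, div_mul_eq_mul_div]
  gcongr

theorem integrable_inv_sinh_line {c : ℝ} (hc : c ≠ 0) (hc' : |c| < π) :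
    Integrable fun x : ℝ => (sinh (x + c * I))⁻¹ := by
  have hd : ContinuousOn (fun ω => (sinh ω)⁻¹) {w | c ≤ w.im ∧ w.im ≤ c} := fun ω hω => by
    have h1 : ω.im = c := le_antisymm hω.2 hω.1
    have hne : ω ≠ 0 := fun h => hc (by rw [← h1, h]; simp)
    exact (differentiable_sinh.differentiableAt.inv
      (sinh_ne_zero (by rwa [h1]) hne)).continuousAt.continuousWithinAt
  obtain ⟨C', hC', hb'⟩ := exists_global_exp_bound hd (C := 4) (δ := 1) (X := 1)
    (fun w _ _ hw => norm_inv_sinh_le hw)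
  exact integrable_of_exp_bound (continuous_horizontal_line hd
    (fun x => by simp)).aestronglyMeasurable one_pos
    (fun x => by simpa using hb' (x + c * I) (by simp) (by simp))

/-- The difference of `hyperKernel` and its principal part at `ω = w` has no singularity. -/
theorem exists_hyperKernel_regularization (M w : ℂ) : ∃ Ψ : ℂ → ℂ,
    DifferentiableOn ℂ Ψ {ω | |ω.im - w.im| < π} ∧ ∀ ω, ω ≠ w →
      |ω.im - w.im| < π → Ψ ω = hyperKernel M w ω +
        exp (exp w) * exp ((M - 1) * w) * (sinh (ω - w))⁻¹ := by
  set κ := exp (exp w) * exp ((M - 1) * w) with hκ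
  set S := {ω : ℂ | |ω.im - w.im| < π} with hS
  have hSo : IsOpen S := isOpen_lt
    (continuous_abs.comp (continuous_im.sub continuous_const)) continuous_const
  have hwS : w ∈ S := by simp [S, pi_pos]
  have hSn := hSo.mem_nhds hwS
  have hp := pi_pos
  let P : ℂ → ℂ := fun ω => exp (exp ω) * exp (M * ω)
  let E : ℂ → ℂ := dslope exp w
  let H : ℂ → ℂ := dslope (fun ω => sinh (ω - w)) w
  have hEd : DifferentiableOn ℂ E S :=
    (differentiableOn_dslope hSn).2 differentiable_exp.differentiableOn
  have hHd : DifferentiableOn ℂ H S := (differentiableOn_dslope hSn).2 (by fun_prop)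
  have hEw : E w = exp w := by simp [E]
  have hHw : H w = 1 := by
    simp only [H, dslope_same]
    have := ((hasDerivAt_sinh (w - w)).comp_sub_const w w).deriv
    rw [this]; simp
  have hE : ∀ ω, ω ≠ w → E ω = (exp ω - exp w) / (ω - w) := fun ω hω => by
    simp only [E, dslope_of_ne _ hω, slope_def_field]
  have hH : ∀ ω, ω ≠ w → H ω = sinh (ω - w) / (ω - w) := fun ω hω => by
    simp only [H, dslope_of_ne _ hω, slope_def_field]; simp
  have hexp : ∀ ω ∈ S, ω ≠ w → exp ω - exp w ≠ 0 := fun ω hω hne h => by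
    rw [sub_eq_zero, exp_eq_exp_iff_exists_int] at h
    obtain ⟨m, hm⟩ := h
    have h3 : ω.im - w.im = m * (2 * π) := by rw [hm]; simp
    have h4 : |ω.im - w.im| < π := hω
    rw [h3, abs_lt] at h4
    have h6 : (m : ℝ) < 1 := by by_contra! h7; nlinarith
    have h7 : (-1 : ℝ) < m := by by_contra! h8; nlinarith
    have h8 : m = 0 := by
      have h9 : m < 1 := by exact_mod_cast h6
      have h10 : -1 < m := by exact_mod_cast h7
      omega
    exact hne (by rw [hm, h8]; simp)
  have hsinh : ∀ ω ∈ S, ω ≠ w → sinh (ω - w) ≠ 0 := fun ω hω hne =>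
    sinh_ne_zero (by rw [sub_im]; exact hω) (sub_ne_zero.2 hne)
  have hE0 : ∀ ω ∈ S, E ω ≠ 0 := fun ω hω => by
    by_cases h : ω = w
    · rw [h, hEw]; exact exp_ne_zero _
    · rw [hE ω h]; exact div_ne_zero (hexp ω hω h) (sub_ne_zero.2 h)
  have hH0 : ∀ ω ∈ S, H ω ≠ 0 := fun ω hω => by
    by_cases h : ω = w
    · rw [h, hHw]; exact one_ne_zero
    · rw [hH ω h]; exact div_ne_zero (hsinh ω hω h) (sub_ne_zero.2 h)
  let Q : ℂ → ℂ := fun ω => κ / H ω - P ω / E ω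
  have hQd : DifferentiableOn ℂ Q S := ((differentiableOn_const κ).div hHd hH0).sub
      (DifferentiableOn.div (by fun_prop) hEd hE0)
  have hQw : Q w = 0 := by
    have : exp (M * w) = exp ((M - 1) * w) * exp w := by rw [← exp_add]; ring_nf
    simp only [Q, hHw, hEw, P, this, hκ]
    have := exp_ne_zero w
    field_simp
    ring
  refine ⟨dslope Q w, (differentiableOn_dslope hSn).2 hQd, fun ω hω hωS => ?_⟩
  rw [dslope_of_ne _ hω, slope_def_field, hQw, sub_zero, hyperKernel]
  simp only [Q]
  rw [hE ω hω, hH ω hω]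
  have h1 := hexp ω hωS hω
  have h2 := hsinh ω hωS hω
  have h3 := sub_ne_zero.2 hω
  have h4 : exp w - exp ω ≠ 0 := fun h => h1 (by linear_combination -h)
  have h5 : exp w - exp ω = -(exp ω - exp w) := by ring
  rw [h5]
  simp only [P]
  field_simp
  ring

/-- The jump of the hyperterminant. -/
theorem hyperF_sub_hyperF {M : ℂ} (hM : 0 < M.re) {w : ℂ} (h₁ : π / 2 < w.im)
    (h₂ : w.im < 3 * π / 2) : hyperF M w - hyperF M (w - 2 * π * I) =
      2 * π * I * (exp (exp w) * exp ((M - 1) * w)) := by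
  have hp := pi_pos
  obtain ⟨c, hc0, hc1, hc2, hc3⟩ : ∃ c > 0, c ≤ π / 2 ∧ w.im + c < 3 * π / 2 ∧
      π / 2 < w.im - c := by
    refine ⟨min (3 * π / 2 - w.im) (w.im - π / 2) / 2, ?_, ?_, ?_, ?_⟩
    · have := lt_min (sub_pos.2 h₂) (sub_pos.2 h₁); linarith
    all_goals
      have := min_le_left (3 * π / 2 - w.im) (w.im - π / 2)
      have := min_le_right (3 * π / 2 - w.im) (w.im - π / 2)
      linarith
  obtain ⟨Ψ, hΨd, hΨ⟩ := exists_hyperKernel_regularization M w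
  set κ := exp (exp w) * exp ((M - 1) * w) with hκ
  rw [hyperF_eq hM (β := w.im + c) (by linarith) hc2 (by linarith) (by linarith),
    hyperF_eq hM (w := w - 2 * π * I) (β := w.im - c) hc3 (by linarith)
      (by simp; linarith) (by simp; linarith)]
  have hper : hyperLine M (w.im - c) (w - 2 * π * I) =
      ∫ x : ℝ, hyperKernel M w (x + (w.im - c : ℝ) * I) := by
    rw [hyperLine]
    simp only [hyperKernel, exp_periodic.sub_eq]
  obtain ⟨C, hC0, hC⟩ := exists_norm_exp_exp_mul_le hM hc3 hc2
  set δ := min M.re 1 with hδ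
  have hδ0 : 0 < δ := lt_min hM one_pos
  have hδM : δ ≤ M.re := min_le_left _ _
  have hδ1 : δ ≤ 1 := min_le_right _ _
  have hmem : ∀ ω : ℂ, w.im - c ≤ ω.im → ω.im ≤ w.im + c → |ω.im - w.im| < π :=
    fun ω h3 h4 => by rw [abs_lt]; constructor <;> linarith
  have hshift : ∫ x : ℝ, Ψ (x + (w.im - c : ℝ) * I) = ∫ x : ℝ, Ψ (x + (w.im + c : ℝ) * I) := by
    refine integral_horizontal_line_eq (C := C * 2 / Real.exp w.re +
      ‖κ‖ * (4 * Real.exp |w.re|)) (X := |w.re| + 1) (δ := δ) (by linarith)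
      hδ0 (hΨd.mono fun ω hω => hmem ω hω.1 hω.2) fun ω h3 h4 h5 => ?_
    have hfar : 1 ≤ |(ω - w).re| := by
      rw [sub_re]
      have := abs_sub_abs_le_abs_sub ω.re w.re
      linarith
    have hne : ω ≠ w := fun h => by rw [h] at hfar; simp at hfar; linarith
    rw [hΨ ω hne (hmem ω h3 h4), add_mul]
    refine (norm_add_le _ _).trans (add_le_add ?_ ?_)
    · have h6 : Real.exp w.re / 2 ≤ ‖exp w - exp ω‖ := by
        refine le_trans ?_ (abs_norm_sub_norm_le _ _)
        rw [norm_exp, norm_exp]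
        rw [sub_re] at hfar
        have h7 := exp_pos w.re
        rcases le_total 0 (ω.re - w.re) with h8 | h8
        · rw [abs_of_nonneg h8] at hfar
          have h9 : Real.exp ω.re = Real.exp w.re * Real.exp (ω.re - w.re) := by
            rw [← Real.exp_add]; ring_nf
          have h10 := Real.add_one_le_exp (ω.re - w.re)
          rw [abs_sub_comm]
          refine le_trans ?_ (le_abs_self _)
          rw [h9]; nlinarith
        · rw [abs_of_nonpos h8] at hfar
          have h9 : Real.exp w.re = Real.exp ω.re * Real.exp (w.re - ω.re) := by
            rw [← Real.exp_add]; ring_nf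
          have h10 := Real.add_one_le_exp (w.re - ω.re)
          refine le_trans ?_ (le_abs_self _)
          have h11 := exp_pos ω.re
          nlinarith
      have h7 := hC ω h3 h4
      have h8 : Real.exp (-M.re * |ω.re|) ≤ Real.exp (-δ * |ω.re|) :=
        exp_le_exp.2 (mul_le_mul_of_nonneg_right (neg_le_neg hδM) (abs_nonneg _))
      have h9 := exp_pos w.re
      rw [hyperKernel, norm_div, div_le_iff₀ (by linarith)]
      calc _ ≤ C * Real.exp (-δ * |ω.re|) := h7.trans (mul_le_mul_of_nonneg_left h8 hC0)
        _ = C * 2 / Real.exp w.re * Real.exp (-δ * |ω.re|) * (Real.exp w.re / 2) := by field_simp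
        _ ≤ _ := mul_le_mul_of_nonneg_left h6 (by positivity)
    · rw [norm_mul, mul_assoc]
      refine mul_le_mul_of_nonneg_left ((norm_inv_sinh_le hfar).trans ?_) (norm_nonneg _)
      rw [mul_assoc, ← Real.exp_add]
      refine mul_le_mul_of_nonneg_left (exp_le_exp.2 ?_) (by norm_num)
      have h7 := abs_sub_abs_le_abs_sub ω.re w.re
      rw [← sub_re] at h7
      have h8 := mul_le_mul_of_nonneg_right hδ1 (abs_nonneg ω.re)
      linarith
  have hK₁ := integrable_hyperKernel_line hM (β := w.im + c) (w := w) (by linarith) hc2 (by linarith)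
    (by linarith)
  have hK₂ : Integrable fun x : ℝ => hyperKernel M w (x + (w.im - c : ℝ) * I) := by
    have := integrable_hyperKernel_line hM (β := w.im - c) (w := w - 2 * π * I) hc3
      (by linarith) (by simp; linarith) (by simp; linarith)
    simpa only [hyperKernel, exp_periodic.sub_eq] using this
  have hsh : ∀ (s x : ℝ), (x : ℂ) + ((w.im + s : ℝ) : ℂ) * I - w =
      ((x - w.re : ℝ) : ℂ) + (s : ℂ) * I := fun s x => by
    apply Complex.ext <;> simp
  have hS : ∀ s : ℝ, s ≠ 0 → |s| < π →
      Integrable (fun x : ℝ => (sinh (x + (w.im + s : ℝ) * I - w))⁻¹) ∧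
      ∫ x : ℝ, (sinh (x + (w.im + s : ℝ) * I - w))⁻¹ =
        ∫ x : ℝ, (sinh (x + s * I))⁻¹ := fun s hs hs' => by
    simp only [hsh]
    exact ⟨(integrable_inv_sinh_line hs hs').comp_sub_right w.re,
      integral_sub_right_eq_self (fun x : ℝ => (sinh (x + s * I))⁻¹) w.re⟩
  obtain ⟨hi₁, he₁⟩ := hS c hc0.ne' (by rw [abs_of_pos hc0]; linarith)
  obtain ⟨hi₂, he₂⟩ := hS (-c) (by linarith) (by rw [abs_neg, abs_of_pos hc0]; linarith)
  have hval : ∀ s : ℝ, s ≠ 0 → |s| < π → ∀ x : ℝ, Ψ (x + (w.im + s : ℝ) * I) =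
      hyperKernel M w (x + (w.im + s : ℝ) * I) +
        κ * (sinh (x + (w.im + s : ℝ) * I - w))⁻¹ := fun s hs hs' x => by
    refine hΨ _ (fun h => hs ?_) (by simpa using hs')
    have := congrArg Complex.im h
    simpa using this
  rw [hper, hyperLine]
  rw [sub_eq_add_neg w.im c] at hshift hK₂ ⊢
  simp only [hval c hc0.ne' (by rw [abs_of_pos hc0]; linarith),
    hval (-c) (by linarith) (by rw [abs_neg, abs_of_pos hc0]; linarith)] at hshift
  rw [integral_add hK₂ (hi₂.const_mul κ), integral_add hK₁ (hi₁.const_mul κ), integral_const_mul,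
    integral_const_mul, he₁, he₂, integral_inv_sinh hc0 hc1, integral_inv_sinh_neg hc0 hc1] at hshift
  linear_combination -hshift

theorem hyperterminantSup_lt_top {M : ℂ} (hM : 1 < M.re) {φ : ℝ} (hφ : |φ| < 3 * π / 2) :
    hyperterminantSup M φ < ⊤ := by
  obtain ⟨C, hC⟩ := exists_hyperF_bounds hM (a := φ) (b := φ) (by rw [abs_lt] at hφ; linarith)
    (by rw [abs_lt] at hφ; linarith)
  refine lt_of_le_of_lt (iSup₂_le fun r hr => ?_) (ENNReal.ofReal_lt_top (r := C))
  rw [hyperterminant_eq (by linarith) (by simpa using hφ), ← ofReal_norm,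
    ← ENNReal.ofReal_mul hr.le]
  refine ENNReal.ofReal_le_ofReal ?_
  have h1 := (hC (Real.log r + φ * I) (by simp) (by simp)).2
  rw [norm_mul, norm_exp] at h1
  simpa [Real.exp_log hr] using h1

theorem le_hyperterminantSup {M : ℂ} (hM : 1 < M.re) {w : ℂ} (hw : |w.im| < 3 * π / 2) :
    ‖exp w * hyperF M w‖ₑ ≤ hyperterminantSup M w.im := by
  have h1 := le_iSup₂ (f := fun (r : ℝ) (_ : 0 < r) =>
    ENNReal.ofReal r * ‖hyperterminant M ((Real.log r : ℂ) + w.im * I)‖ₑ)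
    (Real.exp w.re) (exp_pos _)
  beta_reduce at h1
  rw [Real.log_exp, re_add_im, hyperterminant_eq (by linarith) hw] at h1
  refine le_trans (le_of_eq ?_) h1
  rw [enorm_mul, ← ofReal_norm, norm_exp]

theorem hyperterminantSup_ne_zero {M : ℂ} (hM : 1 < M.re) {φ : ℝ} (hφ : |φ| < 3 * π / 2) :
    hyperterminantSup M φ ≠ 0 := by
  intro h0
  have hp := pi_pos
  have hM0 : 0 < M.re := by linarith
  have hzero : ∀ x : ℝ, hyperF M (x + φ * I) = 0 := fun x => by
    have h1 := le_hyperterminantSup hM (w := x + φ * I) (by simpa using hφ)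
    have h2 : ((x : ℂ) + φ * I).im = φ := by simp
    rw [h2, h0, nonpos_iff_eq_zero, enorm_eq_zero] at h1
    exact (mul_eq_zero.1 h1).resolve_left (exp_ne_zero _)
  have hconv : Convex ℝ {w : ℂ | |w.im| < 3 * π / 2} := by
    have : {w : ℂ | |w.im| < 3 * π / 2} =
        {w : ℂ | -(3 * π / 2) < w.im} ∩ {w : ℂ | w.im < 3 * π / 2} := by
      ext z; simp [abs_lt]
    rw [this]
    exact (convex_halfSpace_im_gt _).inter (convex_halfSpace_im_lt _)
  have hF : AnalyticOnNhd ℂ (hyperF M) {w | |w.im| < 3 * π / 2} := DifferentiableOn.analyticOnNhd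
      (fun z hz => (differentiableAt_hyperF hM0 hz).differentiableWithinAt)
      (isOpen_lt (continuous_abs.comp continuous_im) continuous_const)
  have hfreq : ∃ᶠ z in 𝓝[≠] (φ * I : ℂ), hyperF M z = (0 : ℂ → ℂ) z := by
    have ht : Tendsto (fun x : ℝ => (x + φ * I : ℂ)) (𝓝[≠] 0) (𝓝[≠] (φ * I)) := by
      refine tendsto_nhdsWithin_iff.2 ⟨?_, ?_⟩
      · have : Continuous fun x : ℝ => (x + φ * I : ℂ) := by fun_prop
        have h2 := this.tendsto 0
        simp only [ofReal_zero, zero_add] at h2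
        exact h2.mono_left nhdsWithin_le_nhds
      · filter_upwards [self_mem_nhdsWithin] with x hx
        simpa using hx
    exact ht.frequently (Eventually.frequently (Eventually.of_forall fun x => hzero x))
  have hall := hF.eqOn_of_preconnected_of_frequently_eq (g := 0) analyticOnNhd_const
    hconv.isPreconnected (z₀ := φ * I) (by simpa using hφ) hfreq
  have hj := hyperF_sub_hyperF hM0 (w := π * I) (by simp; linarith) (by simp; linarith)
  rw [hall (show |(π * I : ℂ).im| < 3 * π / 2 by
      simp [abs_of_pos hp]; linarith),
    hall (show |(π * I - 2 * π * I : ℂ).im| < 3 * π / 2 by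
      simp [abs_lt]; constructor <;> linarith)] at hj
  simp [exp_ne_zero] at hj

end Hyperterminant

section HalfPlanes

/-- The upper (`σ = 1`) or lower (`σ = -1`) half-plane. -/
def halfPlane (σ : ℝ) : Set ℂ := {s | 0 < σ * s.im}

theorem convex_halfPlane (σ : ℝ) : Convex ℝ (halfPlane σ) := by
  intro x hx y hy a b ha hb hab
  have hx' : 0 < σ * x.im := hx
  have hy' : 0 < σ * y.im := hy
  change 0 < σ * (a • x + b • y).im
  rw [add_im, smul_im, smul_im, smul_eq_mul, smul_eq_mul]
  rcases eq_or_lt_of_le ha with rfl | ha'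
  · rw [zero_add] at hab; subst hab; linarith
  · nlinarith [mul_pos ha' hx', mul_nonneg hb hy'.le]

theorem tendsto_halfPlane {σ : ℝ} (hσ : σ ≠ 0) (a : ℝ) :
    Tendsto (fun ε : ℝ => (a + (σ * ε : ℝ) * I : ℂ)) (𝓝[>] 0) (𝓝[halfPlane σ] a) := by
  refine tendsto_nhdsWithin_iff.2 ⟨?_, ?_⟩
  · have : Continuous fun ε : ℝ => (a + (σ * ε : ℝ) * I : ℂ) := by fun_prop
    have h := this.tendsto 0
    simp only [mul_zero, ofReal_zero, zero_mul, add_zero] at h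
    exact h.mono_left nhdsWithin_le_nhds
  · filter_upwards [self_mem_nhdsWithin] with ε hε
    have hε' : 0 < ε := hε
    change 0 < σ * _
    simp only [add_im, ofReal_im, mul_im, ofReal_re, I_im,
      I_re, mul_one, mul_zero, add_zero, zero_add]
    rw [← mul_assoc]
    exact mul_pos (mul_self_pos.2 hσ) hε'

theorem nhdsWithin_halfPlane_neBot {σ : ℝ} (hσ : σ ≠ 0) (a : ℝ) : (𝓝[halfPlane σ] (a : ℂ)).NeBot :=
  (tendsto_halfPlane hσ a).neBot

theorem nonempty_halfDisc {σ : ℝ} (hσ : σ ≠ 0) (a : ℝ) {r : ℝ} (hr : 0 < r) :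
    (ball (a : ℂ) r ∩ halfPlane σ).Nonempty := by
  have := nhdsWithin_halfPlane_neBot hσ a
  exact Filter.nonempty_of_mem (inter_mem (mem_nhdsWithin_of_mem_nhds (ball_mem_nhds _ hr))
    self_mem_nhdsWithin)

/-- The boundary value at a real point from the upper or lower half-plane. -/
noncomputable def sideLimit {E : Type*} [TopologicalSpace E] [Nonempty E] (σ : ℝ) (Z : ℂ → E)
    (a : ℝ) : E :=
  limUnder (𝓝[halfPlane σ] (a : ℂ)) Z

/-- `log (s - x) + iθ`. -/
noncomputable def rayLog (θ x : ℝ) (s : ℂ) : ℂ := log (s - x) + θ * I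

theorem exp_rayLog (θ : ℝ) {x : ℝ} {s : ℂ} (h : s - x ≠ 0) :
    exp (rayLog θ x s) = (s - x) * exp (θ * I) := by
  rw [rayLog, exp_add, exp_log h]

theorem rayLog_im (θ x : ℝ) (s : ℂ) : (rayLog θ x s).im = (s - x).arg + θ := by
  simp [rayLog, log_im]

theorem rayLog_re (θ x : ℝ) (s : ℂ) : (rayLog θ x s).re = Real.log ‖s - x‖ := by
  simp [rayLog, log_re]

theorem im_ne_zero_of_mem_halfPlane {σ : ℝ} {s : ℂ} (h : s ∈ halfPlane σ) : s.im ≠ 0 := fun h' => by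
  have : 0 < σ * s.im := h
  rw [h', mul_zero] at this; exact lt_irrefl _ this

theorem sub_ofReal_mem_slitPlane {σ : ℝ} {s : ℂ} (h : s ∈ halfPlane σ) (x : ℝ) :
    s - x ∈ slitPlane := by
  right; simpa using im_ne_zero_of_mem_halfPlane h

theorem sub_ofReal_ne_zero {σ : ℝ} {s : ℂ} (h : s ∈ halfPlane σ) (x : ℝ) : s - x ≠ 0 :=
  slitPlane_ne_zero (sub_ofReal_mem_slitPlane h x)

theorem arg_mem_of_mem_halfPlane {σ : ℝ} (hσ : σ = 1 ∨ σ = -1) {s : ℂ} (h : s ∈ halfPlane σ) :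
    0 < σ * s.arg ∧ σ * s.arg < π := by
  have h0 : 0 < σ * s.im := h
  have h1 := neg_pi_lt_arg s
  have h2 := arg_le_pi s
  rcases hσ with rfl | rfl
  · rw [one_mul] at h0
    have h3 : s.arg ≠ π := fun h4 => by
      rw [arg_eq_pi_iff] at h4; exact h0.ne' h4.2
    have h4 : 0 ≤ s.arg := arg_nonneg_iff.2 h0.le
    have h5 : s.arg ≠ 0 := fun h6 => by
      rw [arg_eq_zero_iff] at h6; exact h0.ne' h6.2
    rw [one_mul]
    exact ⟨lt_of_le_of_ne h4 h5.symm, lt_of_le_of_ne h2 h3⟩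
  · have h4 : s.arg < 0 := arg_neg_iff.2 (by linarith)
    constructor <;> linarith

theorem norm_sub_le_arg_ne_zero {σ : ℝ} {s : ℂ} (h : s ∈ halfPlane σ) (x : ℝ) : (s - x).arg ≠ 0 :=
  fun h' => by
    rw [arg_eq_zero_iff] at h'
    exact im_ne_zero_of_mem_halfPlane h (by simpa using h'.2)

/-- The limit of `rayLog` at a point before `x`. -/
theorem tendsto_rayLog_of_lt (θ : ℝ) {σ : ℝ} (hσ : σ = 1 ∨ σ = -1) {a x : ℝ} (hax : a < x) :
    Tendsto (rayLog θ x) (𝓝[halfPlane σ] a)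
      (𝓝 (Real.log (x - a) + (θ + σ * π : ℝ) * I)) := by
  have hre : ((a : ℂ) - x).re < 0 := by simpa using hax
  have him : ((a : ℂ) - x).im = 0 := by simp
  have hn : ‖(a : ℂ) - x‖ = x - a := by
    rw [← ofReal_sub, norm_real, Real.norm_of_nonpos (by linarith)]; ring
  have hsub : Tendsto (fun s : ℂ => s - x) (𝓝 (a : ℂ)) (𝓝 ((a : ℂ) - x)) :=
    (continuous_id.sub continuous_const).tendsto _
  have hlog : Tendsto (fun s : ℂ => log (s - x)) (𝓝[halfPlane σ] a)
      (𝓝 (Real.log (x - a) + (σ * π : ℝ) * I)) := by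
    rcases hσ with rfl | rfl
    · have h1 := tendsto_log_nhdsWithin_im_nonneg_of_re_neg_of_im_zero hre him
      rw [hn] at h1
      rw [one_mul]
      refine h1.comp (tendsto_nhdsWithin_iff.2 ⟨hsub.mono_left nhdsWithin_le_nhds, ?_⟩)
      filter_upwards [self_mem_nhdsWithin] with s hs
      have : 0 < 1 * s.im := hs
      simp; linarith
    · have h1 := tendsto_log_nhdsWithin_im_neg_of_re_neg_of_im_zero hre him
      rw [hn] at h1
      have h2 : (Real.log (x - a) + (-1 * π : ℝ) * I : ℂ) =
          Real.log (x - a) - π * I := by push_cast; ring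
      rw [h2]
      refine h1.comp (tendsto_nhdsWithin_iff.2 ⟨hsub.mono_left nhdsWithin_le_nhds, ?_⟩)
      filter_upwards [self_mem_nhdsWithin] with s hs
      have : 0 < -1 * s.im := hs
      simp; linarith
  have h3 : (Real.log (x - a) + (θ + σ * π : ℝ) * I : ℂ) =
      Real.log (x - a) + (σ * π : ℝ) * I + θ * I := by push_cast; ring
  rw [h3]
  exact hlog.add_const _

/-- The limit of `rayLog` at a point beyond `x`. -/
theorem tendsto_rayLog_of_gt (θ : ℝ) {a x : ℝ} (hax : x < a) :
    Tendsto (rayLog θ x) (𝓝 (a : ℂ)) (𝓝 (Real.log (a - x) + θ * I)) := by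
  have h0 : (a : ℂ) - x = ((a - x : ℝ) : ℂ) := by push_cast; ring
  have h1 : ContinuousAt (rayLog θ x) (a : ℂ) := by
    unfold rayLog
    refine ContinuousAt.add (ContinuousAt.clog (by fun_prop) ?_) continuousAt_const
    rw [h0]; exact ofReal_mem_slitPlane.2 (by linarith)
  have h2 : rayLog θ x a = Real.log (a - x) + θ * I := by rw [rayLog, h0, ofReal_log (by linarith)]
  rw [← h2]
  exact h1

end HalfPlanes

namespace InverseFactorialData

variable {n : ℕ} (D : InverseFactorialData n)

/-- The differential equation in the variable `s`, `t = λ_j + s e^{iθ}`. -/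
noncomputable def rayField (j : Fin n) (θ : ℝ) (s : ℂ) : (Fin n → ℂ) →L[ℂ] (Fin n → ℂ) :=
  exp (θ * I) • D.odeField (D.lam j + s * exp (θ * I))

/-- `s` does not correspond to one of the `λ_l`. -/
def IsRegularPoint (j : Fin n) (θ : ℝ) (s : ℂ) : Prop := ∀ l, D.lam j + s * exp (θ * I) ≠ D.lam l

theorem differentiableOn_rayField {j : Fin n} {θ : ℝ} {S : Set ℂ}
    (hS : ∀ s ∈ S, D.IsRegularPoint j θ s) : DifferentiableOn ℂ (D.rayField j θ) S := by
  have h1 : DifferentiableOn ℂ D.odeField {t | ∀ l, t ≠ D.lam l} :=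
    D.differentiableOn_odeField fun t ht => D.odeCoeff_zero_ne ht
  have h2 : Differentiable ℂ fun s : ℂ => D.lam j + s * exp (θ * I) := by fun_prop
  exact (h1.comp h2.differentiableOn fun s hs => hS s hs).const_smul
    (exp (θ * I))

theorem isOpen_isRegularPoint (j : Fin n) (θ : ℝ) : IsOpen {s : ℂ | D.IsRegularPoint j θ s} := by
  have : {s : ℂ | D.IsRegularPoint j θ s} = ⋂ l, {s : ℂ | D.lam j + s * exp (θ * I) ≠ D.lam l} := by
    ext s; simp [IsRegularPoint]
  rw [this]
  exact isOpen_iInter_of_finite fun l => isOpen_ne.preimage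
    (f := fun s : ℂ => D.lam j + s * exp (θ * I)) (by fun_prop)

/-- A solution in the variable `s` is a solution in the variable `w = log (t - λ_p)`. -/
theorem solvesLinear_comp_exp {j p : Fin n} {θ x : ℝ}
    (hp : D.lam p = D.lam j + x * exp (θ * I)) {S : Set ℂ} {Z : ℂ → Fin n → ℂ}
    (hZ : SolvesLinear (D.rayField j θ) S Z) {W : Set ℂ}
    (hW : ∀ w ∈ W, x + exp (w - θ * I) ∈ S) :
    SolvesLinear (D.logField (D.lam p)) W fun w => Z (x + exp (w - θ * I)) := by
  intro w hw
  have h1 : HasDerivAt (fun w : ℂ => (x : ℂ) + exp (w - θ * I))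
      (exp (w - θ * I)) w := by
    have := (((hasDerivAt_id w).sub_const (θ * I)).cexp).const_add (x : ℂ)
    simpa using this
  have h2 := HasDerivAt.scomp w (hZ _ (hW w hw)) h1
  refine h2.congr_deriv ?_
  have h3 : exp w = exp (w - θ * I) * exp (θ * I) := by rw [← exp_add, sub_add_cancel]
  rw [rayField, logField, hp, h3, _root_.smul_apply, _root_.smul_apply, smul_smul, add_assoc, ← add_mul]

variable [Fact (2 ≤ n)]

/-- The jet of the Borel transform `y_k` as a function of `s`, `t = λ_j + s e^{iθ}`, where
`λ_k = λ_j + |λ_k - λ_j| e^{iθ}`. -/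
noncomputable def raySol (j : Fin n) (θ : ℝ) (k : Fin n) (s : ℂ) : Fin n → ℂ :=
  D.borelSol k (rayLog θ ‖D.lam k - D.lam j‖ s)

/-- `λ_k` lies on the ray from `λ_j` in the direction `θ`. -/
def OnRay (j : Fin n) (θ : ℝ) (k : Fin n) : Prop :=
  D.lam k = D.lam j + (‖D.lam k - D.lam j‖ : ℝ) * exp (θ * I)

omit [Fact (2 ≤ n)] in
theorem onRay_self (j : Fin n) (θ : ℝ) : D.OnRay j θ j := by simp [OnRay]

theorem solvesLinear_raySol {j k : Fin n} {θ : ℝ} (hk : D.OnRay j θ k) {S : Set ℂ}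
    (h1 : ∀ s ∈ S, s - (‖D.lam k - D.lam j‖ : ℝ) ∈ slitPlane)
    (h2 : ∀ s ∈ S, rayLog θ ‖D.lam k - D.lam j‖ s ∈ D.star k) :
    SolvesLinear (D.rayField j θ) S (D.raySol j θ k) := by
  intro s hs
  set x := ‖D.lam k - D.lam j‖ with hx
  have h3 : HasDerivAt (rayLog θ x) (s - x)⁻¹ s := by
    have := ((((hasDerivAt_id s).sub_const (x : ℂ)).clog (h1 s hs))).add_const (θ * I)
    exact this.congr_deriv (one_div _)
  have h4 := HasDerivAt.scomp s (D.solvesLinear_borelSol k _ (h2 s hs)) h3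
  have h0 := slitPlane_ne_zero (h1 s hs)
  refine h4.congr_deriv ?_
  have h5 : D.lam k + (s - x) * exp (θ * I) = D.lam j + s * exp (θ * I) := by rw [hk, ← hx]; ring
  rw [rayField, logField, exp_rayLog θ h0, h5, _root_.smul_apply, _root_.smul_apply, smul_smul,
    ← mul_assoc, inv_mul_cancel₀ h0, one_mul]
  rfl

omit [Fact (2 ≤ n)] in
theorem exists_rayLog_mem_star {j k : Fin n} {θ a : ℝ} (ha : ‖D.lam k - D.lam j‖ ≤ a) :
    ∃ r > 0, ∀ σ : ℝ, ∀ s ∈ ball (a : ℂ) r ∩ halfPlane σ,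
      rayLog θ ‖D.lam k - D.lam j‖ s ∈ D.star k := by
  set x := ‖D.lam k - D.lam j‖ with hx
  rcases eq_or_lt_of_le ha with h | h
  · obtain ⟨x₀, hx₀⟩ := D.exists_gap k
    refine ⟨Real.exp x₀, exp_pos _, fun σ s hs => ?_⟩
    refine D.disc_subset_star k (D.mem_disc_of_gap hx₀ ?_)
    rw [rayLog_re, Real.log_le_iff_le_exp (norm_pos_iff.2 (sub_ofReal_ne_zero hs.2 _))]
    have := hs.1
    rw [mem_ball, dist_eq_norm] at this
    rw [h]; exact this.le
  · obtain ⟨δ, hδ, hstrip⟩ := D.exists_strip k θ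
    have hc : ContinuousAt (fun s : ℂ => (s - x).arg) (a : ℂ) := by
      refine ContinuousAt.comp (f := fun s : ℂ => s - x) (continuousAt_arg ?_) (by fun_prop)
      rw [← ofReal_sub]
      exact ofReal_mem_slitPlane.2 (by linarith)
    have h0 : ((a : ℂ) - x).arg = 0 := by
      rw [← ofReal_sub]; exact arg_ofReal_of_nonneg (by linarith)
    have hev : ∀ᶠ s : ℂ in 𝓝 (a : ℂ), |(s - x).arg| < δ := by
      have := hc.abs
      refine this.eventually_lt continuousAt_const ?_
      simpa [h0] using hδ
    obtain ⟨r, hr, hball⟩ := Metric.mem_nhds_iff.1 hev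
    refine ⟨r, hr, fun σ s hs => D.mem_star_of_not_isCutAngle (hstrip _ ?_ ?_)⟩
    · rw [rayLog_im]
      have := norm_sub_le_arg_ne_zero hs.2 x
      simpa using this
    · rw [rayLog_im, add_sub_cancel_right]; exact hball hs.1

/-- The solutions `raySol` in half discs at points that are not before `λ_k`. -/
theorem exists_solvesLinear_raySol {j k : Fin n} {θ : ℝ} (hk : D.OnRay j θ k) {a : ℝ}
    (ha : ‖D.lam k - D.lam j‖ ≤ a) : ∃ r > 0, ∀ σ : ℝ,
      SolvesLinear (D.rayField j θ) (ball (a : ℂ) r ∩ halfPlane σ) (D.raySol j θ k) := by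
  obtain ⟨r, hr, h⟩ := D.exists_rayLog_mem_star (θ := θ) ha
  exact ⟨r, hr, fun σ => D.solvesLinear_raySol hk
    (fun s hs => sub_ofReal_mem_slitPlane hs.2 _) (h σ)⟩

omit [Fact (2 ≤ n)] in
/-- Solutions in a half disc at a regular point have boundary values. -/
theorem exists_extension {j : Fin n} {θ : ℝ} {a r : ℝ} (hr : 0 < r)
    (hreg : ∀ s ∈ ball (a : ℂ) r, D.IsRegularPoint j θ s) {σ : ℝ} (hσ : σ ≠ 0)
    {Z : ℂ → Fin n → ℂ} (hZ : SolvesLinear (D.rayField j θ) (ball (a : ℂ) r ∩ halfPlane σ) Z) :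
    ∃ V : ℂ → Fin n → ℂ, SolvesLinear (D.rayField j θ) (ball (a : ℂ) r) V ∧
      (∀ s ∈ ball (a : ℂ) r ∩ halfPlane σ, Z s = V s) ∧
      ∀ b : ℝ, (b : ℂ) ∈ ball (a : ℂ) r → Tendsto Z (𝓝[halfPlane σ] b) (𝓝 (V b)) ∧
        sideLimit σ Z b = V b := by
  obtain ⟨s₀, hs₀⟩ := nonempty_halfDisc hσ a hr
  have hB := D.differentiableOn_rayField hreg
  obtain ⟨V, hV0, hV⟩ := exists_solvesLinear (convex_ball (a : ℂ) r) isOpen_ball hB hs₀.1 (Z s₀)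
  have heq : EqOn Z V (ball (a : ℂ) r ∩ halfPlane σ) :=
    SolvesLinear.eqOn ((convex_ball _ _).inter (convex_halfPlane σ))
      (hB.continuousOn.mono inter_subset_left) hZ (hV.mono inter_subset_left) hs₀ hV0.symm
  refine ⟨V, hV, heq, fun b hb => ?_⟩
  have ht : Tendsto Z (𝓝[halfPlane σ] b) (𝓝 (V b)) := by
    refine ((hV b hb).continuousAt.tendsto.mono_left nhdsWithin_le_nhds).congr' ?_
    filter_upwards [self_mem_nhdsWithin,
      mem_nhdsWithin_of_mem_nhds (isOpen_ball.mem_nhds hb)] with s h1 h2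
    exact (heq ⟨h2, h1⟩).symm
  have := nhdsWithin_halfPlane_neBot hσ b
  exact ⟨ht, ht.limUnder_eq⟩

theorem exists_localData (p : Fin n) : ∃ x₀ : ℝ, (∀ l, l ≠ p → Real.exp x₀ < ‖D.lam l - D.lam p‖) ∧
    SolvesLinear (D.logField (D.lam p)) {w | w.re < x₀} (D.borelJet p) ∧
    (∀ w : ℂ, w.re < x₀ → D.borelSol p w = D.borelJet p w) ∧
    ∀ W : Set ℂ, Convex ℝ W → W ⊆ {w | w.re < x₀} → ∀ Z : ℂ → Fin n → ℂ,
      SolvesLinear (D.logField (D.lam p)) W Z → ∃ (c : ℂ) (R : ℂ → Fin n → ℂ),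
        D.IsRegularSolution p x₀ R ∧ ∀ w ∈ W, Z w = c • D.borelJet p w + R w := by
  obtain ⟨x₁, h1, h2, h3⟩ := D.exists_decomposition p
  obtain ⟨x₂, h4, h5⟩ := D.exists_borelSol_eq p
  have hle1 : min x₁ x₂ ≤ x₁ := min_le_left _ _
  have hle2 : min x₁ x₂ ≤ x₂ := min_le_right _ _
  have hgap : ∀ l, l ≠ p → Real.exp (min x₁ x₂) < ‖D.lam l - D.lam p‖ := fun l hl =>
    (exp_le_exp.2 hle1).trans_lt (h1 l hl)
  have hY := h2.mono fun w (hw : w.re < min x₁ x₂) => (hw.trans_le hle1 : w.re < x₁)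
  refine ⟨min x₁ x₂, hgap, hY, fun w hw => h5 w (hw.trans_le hle2), fun W hW hWx Z hZ => ?_⟩
  rcases W.eq_empty_or_nonempty with rfl | ⟨w₁, hw₁⟩
  · exact ⟨0, fun _ => 0, IsRegularSolution.zero, fun w hw => absurd hw (notMem_empty w)⟩
  obtain ⟨c, R, hR, hv⟩ := h3 w₁ ((hWx hw₁ : w₁.re < _).trans_le hle1) (Z w₁)
  refine ⟨c, R, hR.mono hle1, fun w hw => ?_⟩
  exact SolvesLinear.eqOn hW ((D.continuousOn_logField hgap).mono hWx) hZ
    (((hY.smul c).add (hR.mono hle1).1).mono hWx) hw₁ hv hw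

/-- The logarithm of the radius of a disc about `λ_p` in which the local theory is valid. -/
noncomputable def localRadius (p : Fin n) : ℝ := (D.exists_localData p).choose

theorem exp_localRadius_lt (p : Fin n) :
    ∀ l, l ≠ p → Real.exp (D.localRadius p) < ‖D.lam l - D.lam p‖ :=
  (D.exists_localData p).choose_spec.1

theorem solvesLinear_borelJet (p : Fin n) :
    SolvesLinear (D.logField (D.lam p)) {w | w.re < D.localRadius p} (D.borelJet p) :=
  (D.exists_localData p).choose_spec.2.1

theorem borelSol_eq_borelJet {p : Fin n} {w : ℂ} (hw : w.re < D.localRadius p) :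
    D.borelSol p w = D.borelJet p w :=
  (D.exists_localData p).choose_spec.2.2.1 w hw

theorem exists_eq_smul_add {p : Fin n} {W : Set ℂ} (hW : Convex ℝ W)
    (hWx : W ⊆ {w | w.re < D.localRadius p}) {Z : ℂ → Fin n → ℂ}
    (hZ : SolvesLinear (D.logField (D.lam p)) W Z) : ∃ (c : ℂ) (R : ℂ → Fin n → ℂ),
      D.IsRegularSolution p (D.localRadius p) R ∧ ∀ w ∈ W, Z w = c • D.borelJet p w + R w :=
  (D.exists_localData p).choose_spec.2.2.2 W hW hWx Z hZ

/-- The half strip in the variable `w = log (t - λ_p)` that corresponds to a half disc. -/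
def halfStrip (σ θ x : ℝ) : Set ℂ := {w | w.re < x ∧ 0 < σ * (w.im - θ) ∧ σ * (w.im - θ) < π}

omit [Fact (2 ≤ n)] in
theorem convex_halfStrip (σ θ x : ℝ) : Convex ℝ (halfStrip σ θ x) := by
  have h1 : IsLinearMap ℝ fun w : ℂ => σ * w.im :=
    ⟨fun a b => by simp [mul_add], fun a b => by simp; ring⟩
  have h2 : halfStrip σ θ x = {w : ℂ | w.re < x} ∩ ({w : ℂ | σ * θ < σ * w.im} ∩
      {w : ℂ | σ * w.im < σ * θ + π}) := by
    ext w
    simp only [halfStrip, mem_inter_iff, mem_ofPred_eq, mul_sub, sub_pos, sub_lt_iff_lt_add']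
  rw [h2]
  exact (convex_halfSpace_re_lt x).inter
    ((convex_halfSpace_gt h1 (σ * θ)).inter (convex_halfSpace_lt h1 (σ * θ + π)))

omit [Fact (2 ≤ n)] in
theorem add_exp_mem_halfDisc {σ θ r x : ℝ} (hσ : σ = 1 ∨ σ = -1) (hr : 0 < r) {w : ℂ}
    (hw : w ∈ halfStrip σ θ (Real.log r)) :
    x + exp (w - θ * I) ∈ ball (x : ℂ) r ∩ halfPlane σ := by
  obtain ⟨h1, h2, h3⟩ := hw
  constructor
  · rw [mem_ball, dist_eq_norm, add_sub_cancel_left, norm_exp]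
    simpa [lt_log_iff_exp_lt hr] using h1
  · change 0 < σ * _
    have h4 : (w - θ * I).im = w.im - θ := by simp
    rw [add_im, ofReal_im, zero_add, exp_im, h4]
    have h5 : 0 < σ * Real.sin (w.im - θ) := by
      have h6 := Real.sin_pos_of_pos_of_lt_pi h2 h3
      rcases hσ with rfl | rfl
      · simpa using h6
      · rw [neg_one_mul, Real.sin_neg] at h6; linarith
    have := mul_pos (exp_pos (w - θ * I).re) h5
    linarith

omit [Fact (2 ≤ n)] in
theorem rayLog_mem_halfStrip {σ θ r x : ℝ} (hσ : σ = 1 ∨ σ = -1) {s : ℂ}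
    (hs : s ∈ ball (x : ℂ) r ∩ halfPlane σ) : rayLog θ x s ∈ halfStrip σ θ (Real.log r) := by
  have h0 := sub_ofReal_ne_zero hs.2 x
  have h1 : s - x ∈ halfPlane σ := by
    have := hs.2
    simpa [halfPlane] using this
  obtain ⟨h2, h3⟩ := arg_mem_of_mem_halfPlane hσ h1
  refine ⟨?_, ?_, ?_⟩
  · rw [rayLog_re]
    have := hs.1
    rw [mem_ball, dist_eq_norm] at this
    exact Real.log_lt_log (norm_pos_iff.2 h0) this
  · rw [rayLog_im, add_sub_cancel_right]; exact h2
  · rw [rayLog_im, add_sub_cancel_right]; exact h3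

omit [Fact (2 ≤ n)] in
theorem add_exp_rayLog {σ θ x : ℝ} {s : ℂ} (hs : s ∈ halfPlane σ) :
    (x : ℂ) + exp (rayLog θ x s - θ * I) = s := by
  rw [rayLog, add_sub_cancel_right, exp_log (sub_ofReal_ne_zero hs x)]; ring

/-- Decomposition of a solution in a half disc at `λ_p`. -/
theorem exists_sideDecomposition {j p : Fin n} {θ : ℝ} (hp : D.OnRay j θ p) {σ : ℝ}
    (hσ : σ = 1 ∨ σ = -1) {r : ℝ} (hr : 0 < r) (hr' : r ≤ Real.exp (D.localRadius p))
    {Z : ℂ → Fin n → ℂ}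
    (hZ : SolvesLinear (D.rayField j θ)
      (ball ((‖D.lam p - D.lam j‖ : ℝ) : ℂ) r ∩ halfPlane σ) Z) :
    ∃ (c : ℂ) (R : ℂ → Fin n → ℂ), D.IsRegularSolution p (D.localRadius p) R ∧
      ∀ s ∈ ball ((‖D.lam p - D.lam j‖ : ℝ) : ℂ) r ∩ halfPlane σ,
        Z s = c • D.borelJet p (rayLog θ ‖D.lam p - D.lam j‖ s) +
          R (rayLog θ ‖D.lam p - D.lam j‖ s) := by
  set x := ‖D.lam p - D.lam j‖ with hx
  have h1 := D.solvesLinear_comp_exp hp (W := halfStrip σ θ (Real.log r)) hZ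
    fun w hw => add_exp_mem_halfDisc hσ hr hw
  have hlog : Real.log r ≤ D.localRadius p := (Real.log_le_iff_le_exp hr).2 hr'
  obtain ⟨c, R, hR, h⟩ := D.exists_eq_smul_add (convex_halfStrip σ θ _)
    (fun w hw => (lt_of_lt_of_le hw.1 hlog : w.re < _)) h1
  refine ⟨c, R, hR, fun s hs => ?_⟩
  have h2 := h _ (rayLog_mem_halfStrip hσ hs)
  beta_reduce at h2
  rwa [add_exp_rayLog hs.2] at h2

theorem eventually_solvesLinear_raySol {j k : Fin n} {θ : ℝ} (hk : D.OnRay j θ k) {a : ℝ}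
    (ha : ‖D.lam k - D.lam j‖ ≤ a) : ∀ᶠ r in 𝓝[>] (0 : ℝ), ∀ σ : ℝ,
      SolvesLinear (D.rayField j θ) (ball (a : ℂ) r ∩ halfPlane σ) (D.raySol j θ k) := by
  obtain ⟨r₀, hr₀, h⟩ := D.exists_solvesLinear_raySol hk ha
  filter_upwards [Ioo_mem_nhdsGT hr₀] with r hr σ
  exact (h σ).mono (inter_subset_inter_left _ (ball_subset_ball hr.2.le))

omit [Fact (2 ≤ n)] in
theorem eventually_isRegularPoint {j : Fin n} {θ : ℝ} {a : ℂ} (ha : D.IsRegularPoint j θ a) :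
    ∀ᶠ r in 𝓝[>] (0 : ℝ), ∀ s ∈ ball a r, D.IsRegularPoint j θ s := by
  obtain ⟨r₀, hr₀, h⟩ := isOpen_iff.1 (D.isOpen_isRegularPoint j θ) a ha
  filter_upwards [Ioo_mem_nhdsGT hr₀] with r hr s hs
  exact h (ball_subset_ball hr.2.le hs)

omit [Fact (2 ≤ n)] in
theorem eventually_isRegularPoint_punctured (j : Fin n) (θ : ℝ) (a : ℂ) :
    ∀ᶠ r in 𝓝[>] (0 : ℝ), ∀ s ∈ ball a r, s ≠ a → D.IsRegularPoint j θ s := by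
  have h : ∀ᶠ s in 𝓝[≠] a, D.IsRegularPoint j θ s := by
    refine eventually_all.2 fun l => ?_
    by_cases h : D.lam j + a * exp (θ * I) = D.lam l
    · filter_upwards [self_mem_nhdsWithin] with s hs h'
      have h2 : s * exp (θ * I) = a * exp (θ * I) := add_left_cancel (h'.trans h.symm)
      exact hs (mul_right_cancel₀ (exp_ne_zero _) h2)
    · have hc : ContinuousAt (fun s : ℂ => D.lam j + s * exp (θ * I)) a := by fun_prop
      exact (hc.eventually_ne h).filter_mono nhdsWithin_le_nhds
  obtain ⟨r₀, hr₀, h⟩ := mem_nhdsWithin_iff.1 h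
  filter_upwards [Ioo_mem_nhdsGT hr₀] with r hr s hs hne
  exact h ⟨ball_subset_ball hr.2.le hs, hne⟩

/-- The boundary values of `y_j` on both sides of the ray differ by multiples of the `y_k` with `λ_k`
on the ray. -/
def JumpAt (j : Fin n) (θ : ℝ) (T : Finset (Fin n)) (γ : Fin n → ℂ) (a : ℝ) : Prop :=
  sideLimit 1 (D.raySol j θ j) a +
    ∑ k ∈ T with ‖D.lam k - D.lam j‖ < a, γ k • sideLimit 1 (D.raySol j θ k) a =
  sideLimit (-1) (D.raySol j θ j) a

theorem exists_jumpAt_iff {j : Fin n} {θ : ℝ} {T : Finset (Fin n)} {γ : Fin n → ℂ}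
    (hT : ∀ k ∈ T, D.OnRay j θ k) {a : ℝ} (ha : 0 < a) (hreg : D.IsRegularPoint j θ a) :
    ∃ r > 0, ∀ b c : ℝ, |b - a| < r → |c - a| < r → D.JumpAt j θ T γ b → D.JumpAt j θ T γ c := by
  set T' := T.filter fun k => ‖D.lam k - D.lam j‖ < a with hT'
  have hev : ∀ᶠ r in 𝓝[>] (0 : ℝ), ∀ k ∈ T', ∀ σ : ℝ,
      SolvesLinear (D.rayField j θ) (ball (a : ℂ) r ∩ halfPlane σ) (D.raySol j θ k) :=
    (Filter.eventually_all_finset T').2 fun k hk => by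
      obtain ⟨h1, h2⟩ := Finset.mem_filter.1 hk
      exact D.eventually_solvesLinear_raySol (hT k h1) h2.le
  obtain ⟨r, ⟨⟨hrT, hrj⟩, hrr⟩, hr⟩ := ((hev.and (D.eventually_solvesLinear_raySol (D.onRay_self j θ)
    (a := a) (by simpa using ha.le))).and (D.eventually_isRegularPoint hreg)).and
      self_mem_nhdsWithin |>.exists
  have hr0 : 0 < r := hr
  obtain ⟨Vp, hVp, -, hVp'⟩ := D.exists_extension hr0 hrr one_ne_zero (hrj 1)
  obtain ⟨Vm, hVm, -, hVm'⟩ := D.exists_extension hr0 hrr (by norm_num : (-1 : ℝ) ≠ 0) (hrj (-1))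
  have hVk : ∀ k : Fin n, ∃ V : ℂ → Fin n → ℂ, k ∈ T' →
      SolvesLinear (D.rayField j θ) (ball (a : ℂ) r) V ∧
      ∀ b : ℝ, (b : ℂ) ∈ ball (a : ℂ) r → sideLimit 1 (D.raySol j θ k) b = V b := fun k => by
    by_cases hk : k ∈ T'
    · obtain ⟨V, h1, -, h2⟩ := D.exists_extension hr0 hrr one_ne_zero (hrT k hk 1)
      exact ⟨V, fun _ => ⟨h1, fun b hb => (h2 b hb).2⟩⟩
    · exact ⟨0, fun h => absurd h hk⟩
  choose V hV using hVk
  have hsol : SolvesLinear (D.rayField j θ) (ball (a : ℂ) r) fun s =>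
      (Vp s + ∑ k ∈ T', γ k • V k s) - Vm s :=
    (hVp.add (SolvesLinear.sum T' fun k hk => ((hV k hk).1).smul (γ k))).sub hVm
  have hmem : ∀ b : ℝ, |b - a| < r → (b : ℂ) ∈ ball (a : ℂ) r := fun b hb => by
    rw [mem_ball, dist_eq_norm, ← ofReal_sub, norm_real]; exact hb
  have hiff : ∀ b : ℝ, |b - a| < r → (D.JumpAt j θ T γ b ↔
      (Vp b + ∑ k ∈ T', γ k • V k b) - Vm b = 0) := fun b hb => by
    have hb' := hmem b hb
    have hfil : (T.filter fun k => ‖D.lam k - D.lam j‖ < b) = T' := by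
      refine Finset.filter_congr fun k hk => ?_
      have hne : ¬ |‖D.lam k - D.lam j‖ - a| < r := fun h => hrr _ (hmem _ h) k (hT k hk).symm
      rw [abs_lt] at hne hb
      constructor
      · intro h; by_contra! h'; exact hne ⟨by linarith, by linarith⟩
      · intro h; by_contra! h'; exact hne ⟨by linarith, by linarith⟩
    rw [JumpAt, hfil, (hVp' b hb').2, (hVm' b hb').2, sub_eq_zero,
      sum_congr rfl fun k hk => by rw [(hV k hk).2 b hb']]
  refine ⟨r, hr0, fun b c hb hc h => ?_⟩
  rw [hiff b hb] at h
  rw [hiff c hc]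
  exact SolvesLinear.eqOn (convex_ball _ _) (D.differentiableOn_rayField hrr).continuousOn hsol
    SolvesLinear.zero (hmem b hb) h (hmem c hc)

theorem sideLimit_eq_of_decomposition {j p : Fin n} {θ σ : ℝ} (hσ : σ = 1 ∨ σ = -1) {r : ℝ}
    {Z R : ℂ → Fin n → ℂ} {c : ℂ} (hR : D.IsRegularSolution p (D.localRadius p) R)
    (hZ : ∀ s ∈ ball ((‖D.lam p - D.lam j‖ : ℝ) : ℂ) r ∩ halfPlane σ,
      Z s = c • D.borelJet p (rayLog θ ‖D.lam p - D.lam j‖ s) + R (rayLog θ ‖D.lam p - D.lam j‖ s))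
    {a : ℝ} (ha : |a - ‖D.lam p - D.lam j‖| < r) {w : ℂ} (hw : w.re < D.localRadius p)
    (ht : Tendsto (rayLog θ ‖D.lam p - D.lam j‖) (𝓝[halfPlane σ] a) (𝓝 w)) :
    Tendsto Z (𝓝[halfPlane σ] a) (𝓝 (c • D.borelJet p w + R w)) ∧
      sideLimit σ Z a = c • D.borelJet p w + R w := by
  have h1 : Tendsto Z (𝓝[halfPlane σ] a) (𝓝 (c • D.borelJet p w + R w)) := by
    have hY := ((D.solvesLinear_borelJet p w hw).continuousAt.tendsto.comp ht).const_smul c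
    have hR' := (hR.1 w hw).continuousAt.tendsto.comp ht
    refine (hY.add hR').congr' ?_
    have hball : (a : ℂ) ∈ ball ((‖D.lam p - D.lam j‖ : ℝ) : ℂ) r := by
      rw [mem_ball, dist_eq_norm, ← ofReal_sub, norm_real]; exact ha
    filter_upwards [self_mem_nhdsWithin,
      mem_nhdsWithin_of_mem_nhds (isOpen_ball.mem_nhds hball)] with s h1 h2
    exact (hZ s ⟨h2, h1⟩).symm
  have := nhdsWithin_halfPlane_neBot (σ := σ) (by rcases hσ with rfl | rfl <;> norm_num) a
  exact ⟨h1, h1.limUnder_eq⟩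

/-- `c` is the coefficient of the singular solution at `λ_p` in the continuation of `y_k` along one side
of the ray. -/
def IsSideCoeff (σ : ℝ) (j : Fin n) (θ : ℝ) (k p : Fin n) (c : ℂ) : Prop :=
  ∃ r > 0, ∃ R : ℂ → Fin n → ℂ, D.IsRegularSolution p (D.localRadius p) R ∧
    r ≤ Real.exp (D.localRadius p) ∧
    ∀ s ∈ ball ((‖D.lam p - D.lam j‖ : ℝ) : ℂ) r ∩ halfPlane σ,
      D.raySol j θ k s = c • D.borelJet p (rayLog θ ‖D.lam p - D.lam j‖ s) +
        R (rayLog θ ‖D.lam p - D.lam j‖ s)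

theorem exists_isSideCoeff {σ : ℝ} (hσ : σ = 1 ∨ σ = -1) {j k p : Fin n} {θ : ℝ}
    (hp : D.OnRay j θ p) (hk : D.OnRay j θ k) (hkp : ‖D.lam k - D.lam j‖ ≤ ‖D.lam p - D.lam j‖) :
    ∃ c, D.IsSideCoeff σ j θ k p c := by
  obtain ⟨r, ⟨h1, h2⟩, h3⟩ := ((D.eventually_solvesLinear_raySol hk hkp).and
    (Ioo_mem_nhdsGT (exp_pos (D.localRadius p)))).and self_mem_nhdsWithin |>.exists
  obtain ⟨c, R, hR, h⟩ := D.exists_sideDecomposition hp hσ h3 h2.2.le (h1 σ)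
  exact ⟨c, r, h3, R, hR, h2.2.le, h⟩

open Classical in
/-- The coefficient of the singular solution at `λ_p` in the continuation of `y_k` along one side of the
ray. -/
noncomputable def sideCoeff (σ : ℝ) (j : Fin n) (θ : ℝ) (k p : Fin n) : ℂ :=
  if h : ∃ c, D.IsSideCoeff σ j θ k p c then h.choose else 0

theorem isSideCoeff_sideCoeff {σ : ℝ} (hσ : σ = 1 ∨ σ = -1) {j k p : Fin n} {θ : ℝ}
    (hp : D.OnRay j θ p) (hk : D.OnRay j θ k) (hkp : ‖D.lam k - D.lam j‖ ≤ ‖D.lam p - D.lam j‖) :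
    D.IsSideCoeff σ j θ k p (D.sideCoeff σ j θ k p) := by
  have h := D.exists_isSideCoeff hσ hp hk hkp
  rw [sideCoeff, dif_pos h]
  exact h.choose_spec

open Classical in
/-- The indices of the singular points on the ray from `λ_j` in the direction `θ`. -/
noncomputable def rayFinset (j : Fin n) (θ : ℝ) : Finset (Fin n) :=
  Finset.univ.filter fun k => k ≠ j ∧ D.OnRay j θ k

omit [Fact (2 ≤ n)] in
theorem mem_rayFinset {j k : Fin n} {θ : ℝ} : k ∈ D.rayFinset j θ ↔ k ≠ j ∧ D.OnRay j θ k := by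
  simp [rayFinset]

/-- The coefficient of `y_p` in the jump of `y_j` across the ray. -/
noncomputable def jumpCoeff (j : Fin n) (θ : ℝ) (p : Fin n) : ℂ :=
  D.sideCoeff (-1) j θ j p * (1 - exp (2 * π * I * D.mu p))

/-- The jump relation at `a`. -/
abbrev IsJump (j : Fin n) (θ a : ℝ) : Prop := D.JumpAt j θ (D.rayFinset j θ) (D.jumpCoeff j θ) a

omit [Fact (2 ≤ n)] in
theorem eq_of_onRay {j k p : Fin n} {θ : ℝ} (hk : D.OnRay j θ k) (hp : D.OnRay j θ p)
    (h : ‖D.lam k - D.lam j‖ = ‖D.lam p - D.lam j‖) : k = p := by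
  apply D.lam_injective
  rw [hk, hp, h]

theorem IsSideCoeff.eventually_sideLimit {σ : ℝ} (hσ : σ = 1 ∨ σ = -1) {j k p : Fin n} {θ : ℝ} {c : ℂ}
    (h : D.IsSideCoeff σ j θ k p c) : ∃ R : ℂ → Fin n → ℂ,
      D.IsRegularSolution p (D.localRadius p) R ∧ ∀ᶠ r in 𝓝[>] (0 : ℝ),
        r < Real.exp (D.localRadius p) ∧
        (∀ s ∈ ball ((‖D.lam p - D.lam j‖ : ℝ) : ℂ) r ∩ halfPlane σ,
          D.raySol j θ k s = c • D.borelJet p (rayLog θ ‖D.lam p - D.lam j‖ s) +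
            R (rayLog θ ‖D.lam p - D.lam j‖ s)) ∧
        ∀ a : ℝ, |a - ‖D.lam p - D.lam j‖| < r → ∀ w : ℂ, w.re < D.localRadius p →
          Tendsto (rayLog θ ‖D.lam p - D.lam j‖) (𝓝[halfPlane σ] a) (𝓝 w) →
          Tendsto (D.raySol j θ k) (𝓝[halfPlane σ] a) (𝓝 (c • D.borelJet p w + R w)) ∧
          sideLimit σ (D.raySol j θ k) a = c • D.borelJet p w + R w := by
  obtain ⟨r₀, hr₀, R, hR, hle, h⟩ := h
  refine ⟨R, hR, ?_⟩
  filter_upwards [Ioo_mem_nhdsGT hr₀] with r hr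
  have h' : ∀ s ∈ ball ((‖D.lam p - D.lam j‖ : ℝ) : ℂ) r ∩ halfPlane σ,
      D.raySol j θ k s = c • D.borelJet p (rayLog θ ‖D.lam p - D.lam j‖ s) +
        R (rayLog θ ‖D.lam p - D.lam j‖ s) := fun s hs =>
    h s ⟨ball_subset_ball hr.2.le hs.1, hs.2⟩
  exact ⟨hr.2.trans_le hle, h', fun a ha w hw ht =>
    D.sideLimit_eq_of_decomposition hσ hR h' ha hw ht⟩

omit [Fact (2 ≤ n)] in
theorem eventually_rayFinset_filter (j : Fin n) (θ x : ℝ) : ∀ᶠ r in 𝓝[>] (0 : ℝ),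
    ∀ k ∈ D.rayFinset j θ, ‖D.lam k - D.lam j‖ ≠ x → r ≤ |‖D.lam k - D.lam j‖ - x| := by
  refine (Filter.eventually_all_finset _).2 fun k _ => ?_
  by_cases h : ‖D.lam k - D.lam j‖ = x
  · exact Eventually.of_forall fun r h' => absurd h h'
  · filter_upwards [Ioo_mem_nhdsGT (abs_pos.2 (sub_ne_zero.2 h))] with r hr _
    exact hr.2.le

/-- The jump relation is transported across a singular point, where it gives a relation between the
coefficients of the singular solutions. -/
theorem exists_isJump_crossing {j p : Fin n} {θ : ℝ} (hp : p ∈ D.rayFinset j θ) : ∃ r > 0,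
    ∀ b : ℝ, ‖D.lam p - D.lam j‖ - r < b → b < ‖D.lam p - D.lam j‖ → D.IsJump j θ b →
      D.sideCoeff 1 j θ j p + ∑ k ∈ D.rayFinset j θ with ‖D.lam k - D.lam j‖ < ‖D.lam p - D.lam j‖,
          D.jumpCoeff j θ k * D.sideCoeff 1 j θ k p =
        D.sideCoeff (-1) j θ j p * exp (2 * π * I * D.mu p) ∧
      ∀ c : ℝ, ‖D.lam p - D.lam j‖ < c → c < ‖D.lam p - D.lam j‖ + r → D.IsJump j θ c := by
  set x := ‖D.lam p - D.lam j‖ with hx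
  obtain ⟨hpj, hpr⟩ := D.mem_rayFinset.1 hp
  have hj : ‖D.lam j - D.lam j‖ ≤ x := by simp [hx]
  set T' := (D.rayFinset j θ).filter fun k => ‖D.lam k - D.lam j‖ < x with hT'
  obtain ⟨Rp, hRp, hp1⟩ := IsSideCoeff.eventually_sideLimit D (Or.inl rfl)
    (D.isSideCoeff_sideCoeff (σ := 1) (Or.inl rfl) hpr (D.onRay_self j θ) hj)
  obtain ⟨Rm, hRm, hm1⟩ := IsSideCoeff.eventually_sideLimit D (Or.inr rfl)
    (D.isSideCoeff_sideCoeff (σ := -1) (Or.inr rfl) hpr (D.onRay_self j θ) hj)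
  have hk : ∀ k : Fin n, ∃ R : ℂ → Fin n → ℂ, k ∈ T' →
      D.IsRegularSolution p (D.localRadius p) R ∧ ∀ᶠ r in 𝓝[>] (0 : ℝ),
        ∀ a : ℝ, |a - x| < r → ∀ w : ℂ, w.re < D.localRadius p →
          Tendsto (rayLog θ x) (𝓝[halfPlane 1] a) (𝓝 w) →
          sideLimit 1 (D.raySol j θ k) a = D.sideCoeff 1 j θ k p • D.borelJet p w + R w := fun k => by
    by_cases hk : k ∈ T'
    · obtain ⟨h1, h2⟩ := Finset.mem_filter.1 hk
      obtain ⟨R, hR, h⟩ := IsSideCoeff.eventually_sideLimit D (Or.inl rfl)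
        (D.isSideCoeff_sideCoeff (σ := 1) (Or.inl rfl) hpr (D.mem_rayFinset.1 h1).2 h2.le)
      exact ⟨R, fun _ => ⟨hR, h.mono fun r hr a ha w hw ht => (hr.2.2 a ha w hw ht).2⟩⟩
    · exact ⟨0, fun h => absurd h hk⟩
  choose Rk hRk using hk
  obtain ⟨r, ⟨⟨⟨⟨hrp, hrm⟩, hrk⟩, hrf⟩, hr⟩⟩ := (((hp1.and hm1).and
    ((Filter.eventually_all_finset T').2 fun k hk => (hRk k hk).2)).and
      (D.eventually_rayFinset_filter j θ x)).and self_mem_nhdsWithin |>.exists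
  have hr0 : 0 < r := hr
  have hlogr : Real.log r < D.localRadius p := (log_lt_iff_lt_exp hr0).2 hrp.1
  have hgap := D.exp_localRadius_lt p
  refine ⟨r, hr0, fun b hb1 hb2 hjump => ?_⟩
  -- before the singular point
  have hb : |b - x| < r := by rw [abs_lt]; constructor <;> linarith
  have hfb : ((D.rayFinset j θ).filter fun k => ‖D.lam k - D.lam j‖ < b) = T' := by
    refine Finset.filter_congr fun k hk => ⟨fun h => h.trans hb2, fun h => ?_⟩
    have h3 := hrf k hk h.ne
    rw [abs_of_neg (by linarith)] at h3
    linarith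
  set wp : ℂ := Real.log (x - b) + (θ + 1 * π : ℝ) * I with hwp
  have hwm : (Real.log (x - b) + (θ + -1 * π : ℝ) * I : ℂ) =
      wp - 2 * π * I := by rw [hwp]; push_cast; ring
  have hwre : wp.re < D.localRadius p := by
    have : wp.re = Real.log (x - b) := by simp [hwp]
    rw [this]
    exact (Real.log_lt_log (by linarith) (by linarith)).trans hlogr
  have hwre' : (wp - 2 * π * I).re < D.localRadius p := by simpa using hwre
  have ht1 := tendsto_rayLog_of_lt θ (σ := 1) (Or.inl rfl) hb2
  have ht2 := tendsto_rayLog_of_lt θ (σ := -1) (Or.inr rfl) hb2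
  rw [← hwp] at ht1
  rw [hwm] at ht2
  have e1 := (hrp.2.2 b hb wp hwre ht1).2
  have e2 := (hrm.2.2 b hb _ hwre' ht2).2
  rw [hRm.2.1 wp hwre, D.borelJet_sub_two_pi, smul_smul] at e2
  have e3 : ∑ k ∈ T', D.jumpCoeff j θ k • sideLimit 1 (D.raySol j θ k) b =
      (∑ k ∈ T', D.jumpCoeff j θ k * D.sideCoeff 1 j θ k p) • D.borelJet p wp +
        ∑ k ∈ T', D.jumpCoeff j θ k • Rk k wp := by
    rw [Finset.sum_smul, ← Finset.sum_add_distrib]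
    refine sum_congr rfl fun k hk => ?_
    rw [hrk k hk b hb wp hwre ht1, smul_add, smul_smul]
  rw [IsJump, JumpAt, hfb, e1, e2, e3] at hjump
  have hreg : D.IsRegularSolution p (D.localRadius p) fun w =>
      (Rp w + ∑ k ∈ T', D.jumpCoeff j θ k • Rk k w) + (-1 : ℂ) • Rm w :=
    (hRp.add (IsRegularSolution.sum T' fun k hk => (hRk k hk).1.smul (D.jumpCoeff j θ k))).add
      (hRm.smul (-1))
  obtain ⟨hd, hR0⟩ := D.eq_zero_of_smul_borelJet_add_eq_zero hgap (D.solvesLinear_borelJet p) hreg.1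
    hreg.2.1 (d := D.sideCoeff 1 j θ j p + ∑ k ∈ T', D.jumpCoeff j θ k * D.sideCoeff 1 j θ k p -
      D.sideCoeff (-1) j θ j p * exp (2 * π * I * D.mu p)) hwre (by
    rw [← sub_eq_zero] at hjump
    rw [sub_smul, add_smul, neg_one_smul, ← hjump]
    abel)
  rw [sub_eq_zero] at hd
  refine ⟨hd, fun c hc1 hc2 => ?_⟩
  -- beyond the singular point
  have hc : |c - x| < r := by rw [abs_lt]; constructor <;> linarith
  have hfc : ((D.rayFinset j θ).filter fun k => ‖D.lam k - D.lam j‖ < c) = insert p T' := by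
    ext k
    simp only [hT', Finset.mem_insert, Finset.mem_filter]
    constructor
    · rintro ⟨h1, h2⟩
      by_cases h : ‖D.lam k - D.lam j‖ = x
      · exact Or.inl (D.eq_of_onRay (D.mem_rayFinset.1 h1).2 hpr h)
      · refine Or.inr ⟨h1, ?_⟩
        have h3 := hrf k h1 h
        by_contra! h4
        rw [abs_of_nonneg (by linarith)] at h3
        linarith
    · rintro (rfl | ⟨h1, h2⟩)
      · exact ⟨hp, hc1⟩
      · exact ⟨h1, h2.trans hc1⟩
  set w : ℂ := Real.log (c - x) + θ * I with hw
  have hwre : w.re < D.localRadius p := by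
    have : w.re = Real.log (c - x) := by simp [hw]
    rw [this]
    exact (Real.log_lt_log (by linarith) (by linarith)).trans hlogr
  have ht := tendsto_rayLog_of_gt θ hc1
  rw [← hw] at ht
  have f1 := (hrp.2.2 c hc w hwre (ht.mono_left nhdsWithin_le_nhds)).2
  have f2 := (hrm.2.2 c hc w hwre (ht.mono_left nhdsWithin_le_nhds)).2
  have f3 : sideLimit 1 (D.raySol j θ p) c = D.borelJet p w := by
    have hcont : Tendsto (D.raySol j θ p) (𝓝[halfPlane 1] c) (𝓝 (D.borelJet p w)) := by
      have h1 := ((D.solvesLinear_borelSol p w (D.disc_subset_star p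
        (D.mem_disc_of_gap hgap hwre.le))).continuousAt.tendsto.comp ht)
      rw [D.borelSol_eq_borelJet hwre] at h1
      exact h1.mono_left nhdsWithin_le_nhds
    have := nhdsWithin_halfPlane_neBot (σ := 1) one_ne_zero c
    exact hcont.limUnder_eq
  have f4 : ∑ k ∈ T', D.jumpCoeff j θ k • sideLimit 1 (D.raySol j θ k) c =
      (∑ k ∈ T', D.jumpCoeff j θ k * D.sideCoeff 1 j θ k p) • D.borelJet p w +
        ∑ k ∈ T', D.jumpCoeff j θ k • Rk k w := by
    rw [Finset.sum_smul, ← Finset.sum_add_distrib]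
    refine sum_congr rfl fun k hk => ?_
    rw [hrk k hk c hc w hwre (ht.mono_left nhdsWithin_le_nhds), smul_add, smul_smul]
  have hpT : p ∉ T' := fun h => lt_irrefl _ (Finset.mem_filter.1 h).2
  have hRw := hR0 w hwre
  rw [IsJump, JumpAt, hfc, Finset.sum_insert hpT, f1, f2, f3, f4]
  have hd' : D.sideCoeff 1 j θ j p = D.sideCoeff (-1) j θ j p * exp (2 * π * I * D.mu p) -
        ∑ k ∈ T', D.jumpCoeff j θ k * D.sideCoeff 1 j θ k p := by rw [← hd]; ring
  rw [hd', jumpCoeff, sub_smul]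
  have h5 : Rp w + ∑ k ∈ T', D.jumpCoeff j θ k • Rk k w = Rm w := by
    have := hRw; beta_reduce at this
    rw [neg_one_smul, ← sub_eq_add_neg, sub_eq_zero] at this
    exact this
  rw [← h5, mul_sub, mul_one, sub_smul]
  abel

/-- Near `λ_j` there is no jump. -/
theorem exists_isJump_of_small (j : Fin n) (θ : ℝ) : ∃ r > 0, ∀ a : ℝ, 0 < a → a < r →
    D.IsJump j θ a := by
  have hgap := D.exp_localRadius_lt j
  refine ⟨Real.exp (D.localRadius j), exp_pos _, fun a ha har => ?_⟩
  have hf : ((D.rayFinset j θ).filter fun k => ‖D.lam k - D.lam j‖ < a) = ∅ := by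
    refine Finset.filter_eq_empty_iff.2 fun k hk h => ?_
    have := hgap k (D.mem_rayFinset.1 hk).1
    linarith
  set w : ℂ := Real.log (a - (0 : ℝ)) + θ * I with hw
  have hwre : w.re < D.localRadius j := by
    have : w.re = Real.log a := by simp [hw]
    rw [this]
    exact (log_lt_iff_lt_exp ha).2 har
  have hS := D.solvesLinear_borelSol j w (D.disc_subset_star j (D.mem_disc_of_gap hgap hwre.le))
  have ht := tendsto_rayLog_of_gt θ ha
  rw [← hw] at ht
  have h1 : Tendsto (D.raySol j θ j) (𝓝 (a : ℂ)) (𝓝 (D.borelSol j w)) := by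
    have h2 : D.raySol j θ j = D.borelSol j ∘ rayLog θ 0 := by ext s; simp [raySol]
    rw [h2]
    exact hS.continuousAt.tendsto.comp ht
  have hlim : ∀ σ : ℝ, σ ≠ 0 → sideLimit σ (D.raySol j θ j) a = D.borelSol j w := fun σ hσ => by
    have := nhdsWithin_halfPlane_neBot hσ a
    exact (h1.mono_left nhdsWithin_le_nhds).limUnder_eq
  rw [IsJump, JumpAt, hf, Finset.sum_empty, add_zero, hlim 1 one_ne_zero, hlim (-1) (by norm_num)]

omit [Fact (2 ≤ n)] in
theorem exists_mem_rayFinset_of_not_isRegularPoint {j : Fin n} {θ a : ℝ} (ha : 0 < a)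
    (h : ¬ D.IsRegularPoint j θ a) : ∃ p ∈ D.rayFinset j θ, ‖D.lam p - D.lam j‖ = a := by
  unfold IsRegularPoint at h
  push Not at h
  obtain ⟨p, hp⟩ := h
  have hn : ‖D.lam p - D.lam j‖ = a := by
    rw [← hp, add_sub_cancel_left, norm_mul, norm_exp_ofReal_mul_I, mul_one,
      norm_real, Real.norm_of_nonneg ha.le]
  refine ⟨p, D.mem_rayFinset.2 ⟨?_, ?_⟩, hn⟩
  · rintro rfl
    simp at hn; exact ha.ne hn
  · rw [OnRay, hn, hp]

theorem exists_isJump_step {j : Fin n} {θ m : ℝ} (hm : 0 < m) : ∃ r > 0, ∀ b : ℝ, m - r < b → b < m →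
    D.IsJump j θ b → ∀ c : ℝ, m ≤ c → c < m + r → D.IsRegularPoint j θ c → D.IsJump j θ c := by
  by_cases h : D.IsRegularPoint j θ m
  · obtain ⟨r, hr, h⟩ := D.exists_jumpAt_iff (T := D.rayFinset j θ) (γ := D.jumpCoeff j θ)
      (fun k hk => (D.mem_rayFinset.1 hk).2) hm h
    refine ⟨r, hr, fun b hb1 hb2 hb c hc1 hc2 _ => h b c ?_ ?_ hb⟩ <;> rw [abs_lt] <;>
      constructor <;> linarith
  · obtain ⟨p, hp, rfl⟩ := D.exists_mem_rayFinset_of_not_isRegularPoint hm h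
    obtain ⟨r, hr, hcr⟩ := D.exists_isJump_crossing hp
    refine ⟨r, hr, fun b hb1 hb2 hb c hc1 hc2 hreg => (hcr b hb1 hb2 hb).2 c ?_ hc2⟩
    refine lt_of_le_of_ne hc1 fun h' => h ?_
    rw [h']; exact hreg

/-- The jump of `y_j` across a ray. -/
theorem isJump {j : Fin n} {θ a : ℝ} (ha : 0 < a) (hreg : D.IsRegularPoint j θ a) :
    D.IsJump j θ a := by
  by_contra hbad
  set B : Set ℝ := {a | 0 < a ∧ D.IsRegularPoint j θ a ∧ ¬ D.IsJump j θ a} with hB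
  have hne : B.Nonempty := ⟨a, ha, hreg, hbad⟩
  obtain ⟨r₀, hr₀, h0⟩ := D.exists_isJump_of_small j θ
  have hlow : ∀ b ∈ B, r₀ ≤ b := fun b hb => by by_contra! h; exact hb.2.2 (h0 b hb.1 h)
  have hm : 0 < sInf B := hr₀.trans_le (le_csInf hne hlow)
  obtain ⟨r, hr, hstep⟩ := D.exists_isJump_step (j := j) (θ := θ) hm
  obtain ⟨c, hcB, hc⟩ := exists_lt_of_csInf_lt hne (lt_add_of_pos_right (sInf B) hr)
  obtain ⟨r', ⟨h1, h2⟩, h3⟩ := ((D.eventually_isRegularPoint_punctured j θ (sInf B : ℝ)).and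
    (Ioo_mem_nhdsGT (lt_min hr hm))).and self_mem_nhdsWithin |>.exists
  have h3' : 0 < r' := h3
  have h4 := lt_min_iff.1 h2.2
  have hbreg : D.IsRegularPoint j θ ((sInf B - r' / 2 : ℝ) : ℂ) := by
    refine h1 _ ?_ ?_
    · rw [mem_ball, dist_eq_norm, ← ofReal_sub, norm_real, Real.norm_eq_abs,
        sub_sub_cancel_left, abs_neg, abs_of_pos (by linarith)]
      linarith
    · intro h; rw [ofReal_inj] at h; linarith
  have hb : D.IsJump j θ (sInf B - r' / 2) := by
    by_contra h
    have : sInf B ≤ sInf B - r' / 2 := csInf_le ⟨r₀, hlow⟩ ⟨by linarith, hbreg, h⟩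
    linarith
  exact hcB.2.2 (hstep _ (by linarith) (by linarith) hb c (csInf_le ⟨r₀, hlow⟩ hcB) hc hcB.2.1)

/-- The relation between the coefficients of the singular solutions on both sides of a singular point. -/
theorem sideCoeff_add_sum {j p : Fin n} {θ : ℝ} (hp : p ∈ D.rayFinset j θ) : D.sideCoeff 1 j θ j p +
        ∑ k ∈ D.rayFinset j θ with ‖D.lam k - D.lam j‖ < ‖D.lam p - D.lam j‖,
          D.jumpCoeff j θ k * D.sideCoeff 1 j θ k p =
        D.sideCoeff (-1) j θ j p * exp (2 * π * I * D.mu p) := by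
  obtain ⟨r, hr, h⟩ := D.exists_isJump_crossing hp
  have hm : 0 < ‖D.lam p - D.lam j‖ := norm_pos_iff.2 (D.lam_sub_ne_zero (D.mem_rayFinset.1 hp).1)
  obtain ⟨r', ⟨h1, h2⟩, h3⟩ := ((D.eventually_isRegularPoint_punctured j θ
    (‖D.lam p - D.lam j‖ : ℝ)).and
    (Ioo_mem_nhdsGT (lt_min hr hm))).and self_mem_nhdsWithin |>.exists
  have h3' : 0 < r' := h3
  have h4 := lt_min_iff.1 h2.2
  refine (h (‖D.lam p - D.lam j‖ - r' / 2) (by linarith) (by linarith) (D.isJump (by linarith)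
    (h1 _ ?_ ?_))).1
  · rw [mem_ball, dist_eq_norm, ← ofReal_sub, norm_real, Real.norm_eq_abs,
      sub_sub_cancel_left, abs_neg, abs_of_pos (by linarith)]
    linarith
  · intro h; rw [ofReal_inj] at h; linarith

end InverseFactorialData

namespace InverseFactorialData

variable {n : ℕ} (D : InverseFactorialData n)

theorem exp_theta (η : ℝ) (j l : Fin n) :
    exp (D.theta η j l * I) = exp ((D.lam l - D.lam j).arg * I) := by
  have h := toIocMod_add_toIocDiv_zsmul two_pi_pos (η - 2 * π) (D.lam l - D.lam j).arg
  rw [theta]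
  set m := toIocDiv two_pi_pos (η - 2 * π) (D.lam l - D.lam j).arg
  conv_rhs => rw [← h]
  push_cast
  rw [zsmul_eq_mul, add_mul, exp_add]
  have : (m * (2 * π) * I : ℂ) = m * (2 * π * I) := by ring
  rw [this, exp_int_mul_two_pi_mul_I, mul_one]

theorem onRay_theta (η : ℝ) (j l : Fin n) : D.OnRay j (D.theta η j l) l := by
  rw [OnRay, D.exp_theta, norm_mul_exp_arg_mul_I]; ring

theorem exp_logDiff (η : ℝ) {j l : Fin n} (h : l ≠ j) :
    exp (D.logDiff η l j) = D.lam l - D.lam j := by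
  rw [logDiff, exp_add, D.exp_theta, ← ofReal_exp,
    Real.exp_log (D.norm_lam_sub_pos h), norm_mul_exp_arg_mul_I]

theorem theta_mem (η : ℝ) (j l : Fin n) : D.theta η j l ∈ Ioc (η - 2 * π) η := by
  have := toIocMod_mem_Ioc two_pi_pos (η - 2 * π) (D.lam l - D.lam j).arg
  rwa [sub_add_cancel] at this

theorem theta_lt {η : ℝ} (hη : D.Admissible η) {j l : Fin n} (h : l ≠ j) : D.theta η j l < η := by
  refine lt_of_le_of_ne (D.theta_mem η j l).2 fun h' => ?_
  have h2 := toIocMod_add_toIocDiv_zsmul two_pi_pos (η - 2 * π) (D.lam l - D.lam j).arg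
  refine hη j l h (-toIocDiv two_pi_pos (η - 2 * π) (D.lam l - D.lam j).arg) ?_
  rw [theta] at h'
  rw [h', zsmul_eq_mul] at h2
  push_cast
  linarith

/-- An angle in the window is the angle of every point on its ray. -/
theorem theta_eq_of_onRay {η θ : ℝ} (hθ : θ ∈ Ioc (η - 2 * π) η) {j k : Fin n} (hk : k ≠ j)
    (h : D.OnRay j θ k) : D.theta η j k = θ := by
  have h0 : ((‖D.lam k - D.lam j‖ : ℝ) : ℂ) ≠ 0 := by
    exact_mod_cast (norm_ne_zero_iff.2 (D.lam_sub_ne_zero hk))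
  have h1 : exp (D.theta η j k * I) = exp (θ * I) := by
    have h2 := D.onRay_theta η j k
    rw [OnRay] at h h2
    exact mul_left_cancel₀ h0 (add_left_cancel (h2.symm.trans h))
  obtain ⟨m, hm⟩ := exp_eq_exp_iff_exists_int.1 h1
  have h3 : D.theta η j k = θ + m * (2 * π) := by
    have h4 : (D.theta η j k : ℂ) * I = (θ + m * (2 * π)) * I := by rw [hm]; ring
    exact_mod_cast mul_right_cancel₀ I_ne_zero h4
  have h4 := D.theta_mem η j k
  have h5 : (m : ℝ) < 1 := by by_contra! h; nlinarith [h4.1, h4.2, hθ.1, hθ.2, pi_pos]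
  have h6 : (-1 : ℝ) < m := by by_contra! h; nlinarith [h4.1, h4.2, hθ.1, hθ.2, pi_pos]
  have h7 : m = 0 := by
    have : m < 1 := by exact_mod_cast h5
    have : -1 < m := by exact_mod_cast h6
    omega
  rw [h3, h7]; simp

variable [Fact (2 ≤ n)]

theorem borel_eq_borelJet {p : Fin n} {w : ℂ} (hw : w.re < D.localRadius p) :
    D.borel p w = D.borelJet p w 0 := by
  rw [D.borel_eq (D.disc_subset_star p (D.mem_disc_of_gap (D.exp_localRadius_lt p) hw.le)),
    D.borelSol_eq_borelJet hw]

/-- Only the zero multiple of the Borel transform is single-valued. -/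
theorem eq_zero_of_mul_borelJet_zero_eq {p : Fin n} {d : ℂ} {ρ : ℂ → ℂ} (hρ : AnalyticAt ℂ ρ 0)
    (h : ∀ x : ℝ, ∃ w₀ : ℂ, w₀.re < x ∧ ∀ᶠ w in 𝓝 w₀, d * D.borelJet p w 0 = ρ (exp w)) :
    d = 0 := by
  obtain ⟨r, hr, hball⟩ := Metric.eventually_nhds_iff_ball.1 hρ.eventually_analyticAt
  set x := min (Real.log r) (D.localRadius p) with hx
  obtain ⟨w₀, hw₀, h0⟩ := h x
  set U : Set ℂ := {w | w.re < x} with hU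
  have hUo : IsOpen U := isOpen_lt continuous_re continuous_const
  have hd1 : DifferentiableOn ℂ (fun w => d * D.borelJet p w 0) U := by
    have h1 := (D.solvesLinear_borelJet p).differentiableOn.mono
      fun w (hw : w.re < x) => (hw.trans_le (min_le_right _ _) : w.re < D.localRadius p)
    exact (differentiableOn_pi.1 h1 0).const_mul d
  have hd2 : DifferentiableOn ℂ (fun w => ρ (exp w)) U := fun w hw => by
    have h1 : AnalyticAt ℂ ρ (exp w) := by
      refine hball _ ?_
      rw [mem_ball_zero_iff, norm_exp]
      exact (lt_log_iff_exp_lt hr).1 (lt_of_lt_of_le hw (min_le_left _ _))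
    exact (h1.differentiableAt.comp w differentiable_exp.differentiableAt).differentiableWithinAt
  have heq : EqOn (fun w => d * D.borelJet p w 0) (fun w => ρ (exp w)) U :=
    (hd1.analyticOnNhd hUo).eqOn_of_preconnected_of_eventuallyEq (hd2.analyticOnNhd hUo)
      (convex_halfSpace_re_lt x).isPreconnected hw₀ h0
  obtain ⟨w, hw, hne⟩ := D.exists_borelJet_zero_ne p x
  have h1 := heq (show w ∈ U from hw)
  have h2 := heq (show w - 2 * π * I ∈ U by simpa [hU] using hw)
  beta_reduce at h1 h2
  rw [D.borelJet_sub_two_pi, exp_sub, exp_two_pi_mul_I, div_one, ← h1,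
    Pi.smul_apply, smul_eq_mul] at h2
  by_contra hd
  have h3 : exp (2 * π * I * D.mu p) * D.borelJet p w 0 = D.borelJet p w 0 := mul_left_cancel₀ hd h2
  exact D.exp_two_pi_mu_ne_one p (mul_right_cancel₀ hne (h3.trans (one_mul _).symm))

theorem mem_halfStrip_neg_one {θ x : ℝ} {w : ℂ} (h1 : w.re < x) (h2 : θ - π < w.im)
    (h3 : w.im < θ) : w ∈ halfStrip (-1) θ x :=
  ⟨h1, by linarith, by linarith⟩

omit [Fact (2 ≤ n)] in
theorem logDiff_add_log (η : ℝ) {j l : Fin n} (hl : l ≠ j) {w : ℂ}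
    (hs : ((‖D.lam l - D.lam j‖ : ℝ) : ℂ) + exp (w - D.theta η j l * I) ≠ 0) :
    D.logDiff η l j + log (1 + exp (w - D.logDiff η l j)) = rayLog (D.theta η j l) 0
        (((‖D.lam l - D.lam j‖ : ℝ) : ℂ) + exp (w - D.theta η j l * I)) := by
  have hx : 0 < ‖D.lam l - D.lam j‖ := D.norm_lam_sub_pos hl
  set x := ‖D.lam l - D.lam j‖ with hxdef
  have hx' : (x : ℂ) ≠ 0 := by exact_mod_cast hx.ne'
  have h1 : (x : ℂ) + exp (w - D.theta η j l * I) = x * (1 + exp (w - D.logDiff η l j)) := by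
    have h2 : w - D.theta η j l * I = (w - D.logDiff η l j) + Real.log x := by
      rw [logDiff, ← hxdef]; ring
    rw [h2, exp_add, ← ofReal_exp, Real.exp_log hx]; ring
  rw [h1] at hs ⊢
  rw [rayLog, ofReal_zero, sub_zero, log_ofReal_mul hx (right_ne_zero_of_mul hs), logDiff, ← hxdef]
  ring

omit [Fact (2 ≤ n)] in
theorem rayLog_add_exp {θ x : ℝ} {w : ℂ} (h1 : -π < w.im - θ) (h2 : w.im - θ ≤ π) :
    rayLog θ x ((x : ℂ) + exp (w - θ * I)) = w := by
  rw [rayLog, add_sub_cancel_left, log_exp (by simpa using h1) (by simpa using h2), sub_add_cancel]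

theorem isConnectionCoeff_sideCoeff (η : ℝ) {j l : Fin n} (hl : l ≠ j) :
    D.IsConnectionCoeff η l j (D.sideCoeff (-1) j (D.theta η j l) j l *
      ((exp (2 * π * I * D.mu j) - 1) / (2 * π * I))) := by
  set θ := D.theta η j l with hθ
  set x := ‖D.lam l - D.lam j‖ with hx
  have hj : ‖D.lam j - D.lam j‖ ≤ x := by simp [hx]
  obtain ⟨r₁, hr₁, R, ⟨-, -, ρ, hρ, hRρ⟩, hle, h⟩ := D.isSideCoeff_sideCoeff (σ := -1) (Or.inr rfl)
    (D.onRay_theta η j l) (D.onRay_self j θ) hj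
  obtain ⟨r₂, hr₂, hstar⟩ := D.exists_rayLog_mem_star (θ := θ) hj
  have hr : 0 < min r₁ r₂ := lt_min hr₁ hr₂
  refine ⟨ρ, (hρ.analyticOnNhd isOpen_ball) 0 (mem_ball_self (exp_pos _)),
    Real.log (min r₁ r₂), fun w hw1 hw2 hw3 => ?_⟩
  have hs := add_exp_mem_halfDisc (x := x) (Or.inr rfl) hr (mem_halfStrip_neg_one hw1 hw2 hw3)
  have hs1 : (x : ℂ) + exp (w - θ * I) ∈ ball (x : ℂ) r₁ ∩ halfPlane (-1) :=
    ⟨ball_subset_ball (min_le_left _ _) hs.1, hs.2⟩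
  have hs2 := hstar (-1) ((x : ℂ) + exp (w - θ * I))
    ⟨ball_subset_ball (min_le_right _ _) hs.1, hs.2⟩
  have hs0 : (x : ℂ) + exp (w - θ * I) ≠ 0 := by simpa using sub_ofReal_ne_zero hs.2 0
  have hwl : w.re < D.localRadius l := hw1.trans_le
    ((Real.log_le_iff_le_exp hr).2 ((min_le_left _ _).trans hle))
  have h1 := congrFun (h _ hs1) 0
  rw [rayLog_add_exp (by linarith) (by linarith), Pi.add_apply, Pi.smul_apply, hRρ w hwl,
    ← D.borel_eq_borelJet hwl, raySol, ← D.borel_eq hs2] at h1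
  have h2 : rayLog θ ‖D.lam j - D.lam j‖ ((x : ℂ) + exp (w - θ * I)) =
      rayLog θ 0 ((x : ℂ) + exp (w - θ * I)) := by simp
  rw [h2] at h1
  rw [D.logDiff_add_log η hl hs0]
  refine h1.trans ?_
  rw [smul_eq_mul]
  congr 2
  have h3 : exp (2 * π * I * D.mu j) - 1 ≠ 0 := sub_ne_zero.2 (D.exp_two_pi_mu_ne_one j)
  have h4 := two_pi_I_ne_zero
  field_simp
  rfl

theorem connectionCoeff_eq (η : ℝ) {j l : Fin n} (hl : l ≠ j) :
    D.connectionCoeff η l j = D.sideCoeff (-1) j (D.theta η j l) j l *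
      ((exp (2 * π * I * D.mu j) - 1) / (2 * π * I)) := by
  have hex := D.isConnectionCoeff_sideCoeff η hl
  set K' := D.sideCoeff (-1) j (D.theta η j l) j l *
      ((exp (2 * π * I * D.mu j) - 1) / (2 * π * I)) with hK'
  have hex' : ∃ K, D.IsConnectionCoeff η l j K := ⟨K', hex⟩
  rw [connectionCoeff, dif_pos hex']
  set K := hex'.choose with hK
  obtain ⟨f, hf, x₁, h1⟩ := hex'.choose_spec
  obtain ⟨g, hg, x₂, h2⟩ := hex
  set c : ℂ := 2 * π * I / (exp (2 * π * I * D.mu j) - 1) with hc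
  have hc0 : c ≠ 0 := div_ne_zero two_pi_I_ne_zero (sub_ne_zero.2 (D.exp_two_pi_mu_ne_one j))
  have hd : (K - K') * c = 0 := by
    refine D.eq_zero_of_mul_borelJet_zero_eq (p := l) (hg.sub hf) fun x => ?_
    set x' := min (min x (D.localRadius l)) (min x₁ x₂) with hx'
    have hm1 : x' ≤ x := (min_le_left _ _).trans (min_le_left _ _)
    have hm2 : x' ≤ D.localRadius l := (min_le_left _ _).trans (min_le_right _ _)
    have hm3 : x' ≤ x₁ := (min_le_right _ _).trans (min_le_left _ _)
    have hm4 : x' ≤ x₂ := (min_le_right _ _).trans (min_le_right _ _)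
    refine ⟨(x' - 1 : ℝ) + (D.theta η j l - π / 2 : ℝ) * I, ?_, ?_⟩
    · simp; linarith
    have hO : IsOpen {w : ℂ | w.re < x' ∧ D.theta η j l - π < w.im ∧ w.im < D.theta η j l} :=
      (isOpen_lt continuous_re continuous_const).inter
        ((isOpen_lt continuous_const continuous_im).inter
          (isOpen_lt continuous_im continuous_const))
    filter_upwards [hO.mem_nhds (show _ from by
      simp [pi_pos])] with w hw
    obtain ⟨hw1, hw2, hw3⟩ := hw
    have e1 := h1 w (hw1.trans_le hm3) hw2 hw3
    have e2 := h2 w (hw1.trans_le hm4) hw2 hw3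
    rw [← D.borel_eq_borelJet (hw1.trans_le hm2), Pi.sub_apply]
    linear_combination e2 - e1
  rcases mul_eq_zero.1 hd with h | h
  · exact sub_eq_zero.1 h
  · exact absurd h hc0

end InverseFactorialData

namespace InverseFactorialData

variable {n : ℕ} (D : InverseFactorialData n)

/-- The rotated coordinate that maps the cut from `λ_i` to the negative real axis. -/
noncomputable def cutCoord (η : ℝ) (i : Fin n) (t : ℂ) : ℂ := -((t - D.lam i) * exp (-(η * I)))

theorem cutCoord_mem_slitPlane_iff {η : ℝ} {i : Fin n} {t : ℂ} : D.cutCoord η i t ∈ slitPlane ↔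
      ∀ s : ℝ, 0 ≤ s → t ≠ D.lam i + s * exp (η * I) := by
  have hexp : exp (-(η * I)) * exp (η * I) = 1 := by rw [← exp_add]; simp
  constructor
  · rintro h s hs rfl
    have h1 : D.cutCoord η i (D.lam i + s * exp (η * I)) = ((-s : ℝ) : ℂ) := by
      rw [cutCoord]; push_cast; linear_combination (-(s : ℂ)) * hexp
    rw [h1, ofReal_mem_slitPlane] at h
    linarith
  · intro h
    by_contra hn
    rw [mem_slitPlane_iff, not_or, not_lt, not_not] at hn
    refine h (-(D.cutCoord η i t).re) (by linarith) ?_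
    have h1 : ((-(D.cutCoord η i t).re : ℝ) : ℂ) = (t - D.lam i) * exp (-(η * I)) := by
      have h2 : D.cutCoord η i t = (((D.cutCoord η i t).re : ℝ) : ℂ) := by
        apply Complex.ext <;> simp [hn.2]
      push_cast
      rw [← h2, cutCoord, neg_neg]
    rw [h1]
    linear_combination (-(t - D.lam i)) * hexp

theorem mem_cutPlane_iff {η : ℝ} {t : ℂ} : t ∈ D.cutPlane η ↔ ∀ i, D.cutCoord η i t ∈ slitPlane :=
  forall_congr' fun _ => D.cutCoord_mem_slitPlane_iff.symm

theorem cutCoord_lam_mem_slitPlane {η : ℝ} (hη : D.Admissible η) {i j : Fin n} (h : j ≠ i) :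
    D.cutCoord η i (D.lam j) ∈ slitPlane := by
  rw [cutCoord_mem_slitPlane_iff]
  intro s hs he
  have h0 := D.lam_sub_ne_zero h
  have h1 : D.lam j - D.lam i = s * exp (η * I) := by rw [he]; ring
  have hs0 : 0 < s := by
    refine lt_of_le_of_ne hs fun h' => h0 ?_
    rw [h1, ← h']; simp
  have h2 : exp (η * I) = exp ((D.lam j - D.lam i).arg * I) := by
    have h3 := norm_mul_exp_arg_mul_I (D.lam j - D.lam i)
    have h4 : ‖D.lam j - D.lam i‖ = s := by
      rw [h1, norm_mul, norm_exp_ofReal_mul_I, mul_one, norm_real, Real.norm_of_nonneg hs]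
    rw [h4] at h3
    refine mul_left_cancel₀ (a := (s : ℂ)) (by exact_mod_cast hs0.ne') ?_
    rw [h3, h1]
  obtain ⟨m, hm⟩ := exp_eq_exp_iff_exists_int.1 h2
  refine hη i j h m ?_
  have h4 : (η : ℂ) * I = (((D.lam j - D.lam i).arg + 2 * π * m : ℝ) : ℂ) * I := by
    rw [hm]; push_cast; ring
  exact_mod_cast mul_right_cancel₀ I_ne_zero h4

theorem exists_add_exp_mem_cutPlane {η : ℝ} (hη : D.Admissible η) (j : Fin n) : ∃ X : ℝ, ∀ w : ℂ,
    w.re < X → η - 2 * π < w.im → w.im < η → D.lam j + exp w ∈ D.cutPlane η := by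
  have hev : ∀ᶠ t in 𝓝 (D.lam j), ∀ i, i ≠ j → D.cutCoord η i t ∈ slitPlane := by
    refine eventually_all.2 fun i => ?_
    by_cases hi : i = j
    · exact Eventually.of_forall fun t h => absurd hi h
    · have hc : Continuous (D.cutCoord η i) := by unfold cutCoord; fun_prop
      filter_upwards [hc.continuousAt.eventually_mem
        (isOpen_slitPlane.mem_nhds (D.cutCoord_lam_mem_slitPlane hη (Ne.symm hi)))] with t ht _
      exact ht
  obtain ⟨r, hr, hball⟩ := Metric.eventually_nhds_iff_ball.1 hev
  refine ⟨Real.log r, fun w h1 h2 h3 => D.mem_cutPlane_iff.2 fun i => ?_⟩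
  by_cases hi : i = j
  · subst hi
    rw [cutCoord, add_sub_cancel_left, ← exp_add]
    have h4 : -exp (w + -(η * I)) = exp (w + (π - η : ℝ) * I) := by
      have : w + (π - η : ℝ) * I = (w + -(η * I)) + π * I := by push_cast; ring
      rw [this, exp_add_pi_mul_I]
    rw [h4, mem_slitPlane_iff_arg]
    refine ⟨?_, exp_ne_zero _⟩
    rw [← log_im, log_exp (by simp; linarith) (by simp; linarith)]
    simp; linarith
  · refine hball _ ?_ i hi
    rw [mem_ball, dist_eq_norm, add_sub_cancel_left, norm_exp]
    exact (lt_log_iff_exp_lt hr).1 h1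

theorem log_add_toIocMod {η : ℝ} {w : ℂ} (h1 : η - 2 * π < w.im) (h2 : w.im ≤ η) :
    (Real.log ‖exp w‖ : ℂ) + ((toIocMod two_pi_pos (η - 2 * π) (arg (exp w)) : ℝ) : ℂ) * I = w := by
  have h3 : toIocMod two_pi_pos (η - 2 * π) (arg (exp w)) = w.im := by
    rw [arg_exp]
    have h4 : toIocMod two_pi_pos (-π) w.im =
        w.im + (-toIocDiv two_pi_pos (-π) w.im) • (2 * π) := by
      rw [neg_smul, ← sub_eq_add_neg]; rfl
    rw [h4, toIocMod_add_zsmul]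
    exact (toIocMod_eq_self _).2 ⟨h1, by linarith⟩
  rw [h3, norm_exp, Real.log_exp]
  exact re_add_im w

variable [Fact (2 ≤ n)]

/-- The relation of the Borel transform on the cut plane to `borel`. -/
theorem IsBorelOnCutPlane.exists_eq {η : ℝ} (hη : D.Admissible η) {j : Fin n} {y : ℂ → ℂ}
    (hy : D.IsBorelOnCutPlane η j y) : ∃ X : ℝ, X ≤ D.localRadius j ∧ ∀ w : ℂ, w.re < X →
      η - 2 * π < w.im → w.im < η → D.lam j + exp w ∈ D.cutPlane η ∧
        y (D.lam j + exp w) = D.borelSol j w 0 := by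
  obtain ⟨X, hX⟩ := D.exists_add_exp_mem_cutPlane hη j
  obtain ⟨r, hr, hball⟩ := Metric.eventually_nhds_iff_ball.1 hy.2
  refine ⟨min (min X (Real.log r)) (D.localRadius j), min_le_right _ _, fun w h1 h2 h3 => ?_⟩
  rw [lt_min_iff, lt_min_iff] at h1
  have hc := hX w h1.1.1 h2 h3
  refine ⟨hc, ?_⟩
  have := hball (D.lam j + exp w) (by
    rw [mem_ball, dist_eq_norm, add_sub_cancel_left, norm_exp]
    exact (lt_log_iff_exp_lt hr).1 h1.1.2) hc
  rw [add_sub_cancel_left, log_add_toIocMod h2 h3.le] at this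
  rw [this, D.borelSol_zero_eq_borelSeries (D.mem_disc_of_gap (D.exp_localRadius_lt j) h1.2.le)]

/-- The Borel transform on the cut plane along a segment that meets no cut. -/
theorem IsBorelOnCutPlane.eventually_eq {η : ℝ} (hη : D.Admissible η) {j l : Fin n} (hl : l ≠ j)
    {y : ℂ → ℂ} (hy : D.IsBorelOnCutPlane η j y)
    (hseg : ∀ s : ℝ, 0 < s → s < 1 → D.lam j + s * (D.lam l - D.lam j) ∈ D.cutPlane η)
    {x : ℝ} (hx : x < Real.log ‖D.lam l - D.lam j‖) :
    ∀ᶠ w in 𝓝 ((x : ℂ) + D.theta η j l * I), y (D.lam j + exp w) = D.borelSol j w 0 := by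
  have hn := D.norm_lam_sub_pos hl
  set θ := D.theta η j l with hθ
  obtain ⟨X, -, hX⟩ := hy.exists_eq D hη
  set U : Set ℂ := {w | w.im = θ ∧ w.re < Real.log ‖D.lam l - D.lam j‖} with hU
  have hUpre : IsPreconnected U := by
    have h1 : IsLinearMap ℝ fun w : ℂ => w.im := ⟨fun a b => by simp, fun a b => by simp⟩
    exact ((convex_hyperplane h1 θ).inter (convex_halfSpace_re_lt _)).isPreconnected
  have hUc : ∀ w ∈ U, D.lam j + exp w ∈ D.cutPlane η := fun w hw => by
    have h1 : exp w = (Real.exp w.re / ‖D.lam l - D.lam j‖ : ℝ) * (D.lam l - D.lam j) := by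
      rw [exp_eq_norm_mul, hw.1]
      have h2 := D.onRay_theta η j l
      rw [OnRay, ← hθ] at h2
      have h3 : D.lam l - D.lam j = (‖D.lam l - D.lam j‖ : ℝ) * exp (θ * I) := by
        rw [sub_eq_iff_eq_add']; exact h2
      have hn' : ((‖D.lam l - D.lam j‖ : ℝ) : ℂ) ≠ 0 := by exact_mod_cast hn.ne'
      conv_rhs => rw [h3]
      push_cast
      rw [norm_mul, norm_exp_ofReal_mul_I, mul_one, norm_real, norm_norm]
      field_simp
    rw [h1]
    refine hseg _ (by positivity) ?_
    rw [div_lt_one hn]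
    exact (lt_log_iff_exp_lt hn).1 hw.2
  have hUs : ∀ w ∈ U, w ∈ D.star j := fun w hw i hi s hs he => by
    have h1 := hUc (w - Real.log s) ⟨by simpa using hw.1, by
      have := Real.log_nonneg hs
      simp; linarith [hw.2]⟩
    have hs0 : (s : ℂ) ≠ 0 := by
      have : (0:ℝ) < s := by linarith
      exact_mod_cast this.ne'
    rw [exp_sub, he, ← ofReal_exp, Real.exp_log (by linarith), mul_div_cancel_left₀ _ hs0] at h1
    exact h1 i 0 le_rfl (by simp)
  have hA : AnalyticOnNhd ℂ (fun w => y (D.lam j + exp w)) U := fun w hw =>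
    AnalyticAt.fun_comp (hy.1 _ (hUc w hw)) (by fun_prop)
  have hB : AnalyticOnNhd ℂ (fun w => D.borelSol j w 0) U := fun w hw =>
    D.analyticOnNhd_borelSol_zero j w (hUs w hw)
  have hθm := D.theta_mem η j l
  have hθl := D.theta_lt hη hl
  set X' := min X (Real.log ‖D.lam l - D.lam j‖) with hX'
  have hw₀ : ((X' - 1 : ℝ) : ℂ) + θ * I ∈ U := by
    refine ⟨by simp, ?_⟩
    simp
    have : X' ≤ Real.log ‖D.lam l - D.lam j‖ := min_le_right _ _
    linarith
  have hev : (fun w => y (D.lam j + exp w)) =ᶠ[𝓝 (((X' - 1 : ℝ) : ℂ) + θ * I)]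
      fun w => D.borelSol j w 0 := by
    have hO : IsOpen {w : ℂ | w.re < X ∧ η - 2 * π < w.im ∧ w.im < η} :=
      (isOpen_lt continuous_re continuous_const).inter
        ((isOpen_lt continuous_const continuous_im).inter
          (isOpen_lt continuous_im continuous_const))
    have hle : X' ≤ X := min_le_left _ _
    filter_upwards [hO.mem_nhds (show _ from ⟨by simp; linarith, by simpa using hθm.1,
      by simpa using hθl⟩)] with w hw
    exact (hX w hw.1 hw.2.1 hw.2.2).2
  have heq := hA.eqOn_of_preconnected_of_eventuallyEq hB hUpre hw₀ hev
  set w₁ : ℂ := (x : ℂ) + θ * I with hw₁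
  have hw₁U : w₁ ∈ U := ⟨by simp [hw₁], by simpa [hw₁] using hx⟩
  have hfreq : ∃ᶠ w in 𝓝[≠] w₁, y (D.lam j + exp w) = D.borelSol j w 0 := by
    have ht : Tendsto (fun ε : ℝ => w₁ - ε) (𝓝[>] 0) (𝓝[≠] w₁) := by
      refine tendsto_nhdsWithin_iff.2 ⟨?_, ?_⟩
      · have : Continuous fun ε : ℝ => w₁ - ε := by fun_prop
        have h := this.tendsto 0
        simp only [ofReal_zero, sub_zero] at h
        exact h.mono_left nhdsWithin_le_nhds
      · filter_upwards [self_mem_nhdsWithin] with ε hε h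
        have hε' : 0 < ε := hε
        have : (ε : ℂ) = 0 := by simpa using h
        exact hε'.ne' (by exact_mod_cast this)
    refine ht.frequently (Eventually.frequently ?_)
    filter_upwards [self_mem_nhdsWithin] with ε hε
    have hε' : 0 < ε := hε
    exact heq ⟨by simpa using hw₁U.1, by simp; linarith [hw₁U.2]⟩
  exact ((hA w₁ hw₁U).frequently_eq_iff_eventually_eq (hB w₁ hw₁U)).1 hfreq

/-- Transfer of a connection relation to the cut plane. -/
theorem isCutPlaneConnectionCoeff_of_relation {η : ℝ} (hη : D.Admissible η) {j l : Fin n} (hl : l ≠ j)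
    (hseg : ∀ s : ℝ, 0 < s → s < 1 → D.lam j + s * (D.lam l - D.lam j) ∈ D.cutPlane η)
    {κ : ℂ} {reg : ℂ → ℂ} (hreg : AnalyticAt ℂ reg 0) {φ x₀ : ℝ} (hφ₁ : η - 2 * π < φ)
    (hφ₂ : φ < η) (hexp : exp (φ * I) = -exp (D.theta η j l * I))
    (hrel : ∀ w : ℂ, w.re < x₀ → φ < w.im → w.im < φ + π →
      D.borel j (D.logDiff η l j + log (1 + exp (w - D.logDiff η l j))) = κ * (2 * π * I /
            (exp (2 * π * I * D.mu j) - 1)) * D.borel l w +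
          reg (exp w)) : D.IsCutPlaneConnectionCoeff η l j κ := by
  intro yj yl hyj hyl
  set c : ℂ := 2 * π * I / (exp (2 * π * I * D.mu j) - 1) with hc
  have hn := D.norm_lam_sub_pos hl
  set θ := D.theta η j l with hθ
  obtain ⟨X₁, hX₁l, hX₁⟩ := hyl.exists_eq D hη
  obtain ⟨r, hr, hball⟩ := Metric.eventually_nhds_iff_ball.1 hreg.eventually_analyticAt
  set X := min (min X₁ x₀) (min (Real.log r) (Real.log ‖D.lam l - D.lam j‖)) with hX
  have hm1 : X ≤ X₁ := (min_le_left _ _).trans (min_le_left _ _)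
  have hm2 : X ≤ x₀ := (min_le_left _ _).trans (min_le_right _ _)
  have hm3 : X ≤ Real.log r := (min_le_right _ _).trans (min_le_left _ _)
  have hm4 : X ≤ Real.log ‖D.lam l - D.lam j‖ := (min_le_right _ _).trans (min_le_right _ _)
  set W : Set ℂ := {w | w.re < X ∧ η - 2 * π < w.im ∧ w.im < η} with hW
  have hWpre : IsPreconnected W := ((convex_halfSpace_re_lt X).inter
    ((convex_halfSpace_im_gt _).inter (convex_halfSpace_im_lt _))).isPreconnected
  have hWr : ∀ w ∈ W, exp w ∈ ball (0 : ℂ) r := fun w hw => by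
    rw [mem_ball_zero_iff, norm_exp]
    exact (lt_log_iff_exp_lt hr).1 (hw.1.trans_le hm3)
  have hA : AnalyticOnNhd ℂ (fun w => yj (D.lam l + exp w)) W := fun w hw =>
    AnalyticAt.fun_comp (hyj.1 _ (hX₁ w (hw.1.trans_le hm1) hw.2.1 hw.2.2).1) (by fun_prop)
  have hB : AnalyticOnNhd ℂ (fun w => κ * c * yl (D.lam l + exp w) + reg (exp w)) W :=
    fun w hw => by
    have h1 : AnalyticAt ℂ (fun w => yl (D.lam l + exp w)) w :=
      AnalyticAt.fun_comp (hyl.1 _ (hX₁ w (hw.1.trans_le hm1) hw.2.1 hw.2.2).1) (by fun_prop)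
    have h2 : AnalyticAt ℂ (fun w => reg (exp w)) w :=
      AnalyticAt.fun_comp (hball _ (hWr w hw)) (by fun_prop)
    exact (analyticAt_const.mul h1).add h2
  set w₁ : ℂ := ((X - 1 : ℝ) : ℂ) + φ * I with hw₁
  have hw₁W : w₁ ∈ W := ⟨by simp [hw₁], by simpa [hw₁] using hφ₁, by simpa [hw₁] using hφ₂⟩
  set v : ℂ → ℂ := fun w => D.logDiff η l j + log (1 + exp (w - D.logDiff η l j)) with hv
  have hlt : Real.exp (X - 1) < ‖D.lam l - D.lam j‖ := (lt_log_iff_exp_lt hn).1 (by linarith)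
  have he1 : exp (w₁ - D.logDiff η l j) =
      ((-(Real.exp (X - 1) / ‖D.lam l - D.lam j‖) : ℝ) : ℂ) := by
    rw [exp_sub, hw₁, exp_add, hexp, logDiff, exp_add, ← hθ, ← ofReal_exp,
      ← ofReal_exp, Real.exp_log hn]
    push_cast
    have := exp_ne_zero (θ * I)
    field_simp
  have he2 : 1 + exp (w₁ - D.logDiff η l j) =
      ((1 - Real.exp (X - 1) / ‖D.lam l - D.lam j‖ : ℝ) : ℂ) := by rw [he1]; push_cast; ring
  have hpos : 0 < 1 - Real.exp (X - 1) / ‖D.lam l - D.lam j‖ := by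
    rw [sub_pos, div_lt_one hn]; exact hlt
  have hvc : ContinuousAt v w₁ := by
    refine continuousAt_const.add (ContinuousAt.clog (by fun_prop) ?_)
    rw [he2]; exact ofReal_mem_slitPlane.2 hpos
  have hv₁ : v w₁ = (Real.log ‖D.lam l - D.lam j‖ +
      Real.log (1 - Real.exp (X - 1) / ‖D.lam l - D.lam j‖) : ℝ) + θ * I := by
    rw [hv]; beta_reduce
    rw [he2, ← ofReal_log hpos.le, logDiff]; push_cast; ring
  have hE := hyj.eventually_eq D hη hl hseg
    (x := Real.log ‖D.lam l - D.lam j‖ + Real.log (1 - Real.exp (X - 1) / ‖D.lam l - D.lam j‖)) (by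
      have := Real.log_neg hpos (by have := div_pos (exp_pos (X - 1)) hn; linarith)
      linarith)
  rw [← hθ, ← hv₁] at hE
  have hvexp : ∀ᶠ w in 𝓝 w₁, D.lam j + exp (v w) = D.lam l + exp w := by
    have hne : ∀ᶠ w in 𝓝 w₁, 1 + exp (w - D.logDiff η l j) ≠ 0 := by
      have : ContinuousAt (fun w => 1 + exp (w - D.logDiff η l j)) w₁ := by fun_prop
      refine this.eventually_ne ?_
      rw [he2]; exact_mod_cast hpos.ne'
    filter_upwards [hne] with w hw
    rw [hv]; beta_reduce
    rw [exp_add, exp_log hw, mul_add, mul_one, ← exp_add, D.exp_logDiff η hl]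
    rw [add_sub_cancel]
    ring
  have hstar : ∀ᶠ w in 𝓝 w₁, v w ∈ D.star j := by
    refine hvc.eventually_mem ((D.isOpen_star j).mem_nhds ?_)
    intro i hi s hs he
    have h1 : v w₁ = ((Real.log ‖D.lam l - D.lam j‖ +
      Real.log (1 - Real.exp (X - 1) / ‖D.lam l - D.lam j‖) : ℝ) : ℂ) + D.logDiff η l j -
        (Real.log ‖D.lam l - D.lam j‖ : ℝ) := by
      rw [hv₁, logDiff, ← hθ]; ring
    have hs0 : (s : ℂ) ≠ 0 := by
      have : (0:ℝ) < s := by linarith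
      exact_mod_cast this.ne'
    have h2 : D.lam i - D.lam j = (((1 - Real.exp (X - 1) / ‖D.lam l - D.lam j‖) / s : ℝ) : ℂ) *
        (D.lam l - D.lam j) := by
      rw [h1, exp_sub, exp_add, D.exp_logDiff η hl, ← ofReal_exp,
        ← ofReal_exp, Real.exp_add, Real.exp_log hn, Real.exp_log hpos] at he
      have hn' : ((‖D.lam l - D.lam j‖ : ℝ) : ℂ) ≠ 0 := by exact_mod_cast hn.ne'
      refine mul_left_cancel₀ hs0 (he.symm.trans ?_)
      push_cast
      field_simp
    have h3 := hseg ((1 - Real.exp (X - 1) / ‖D.lam l - D.lam j‖) / s) (by positivity) (by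
      rw [div_lt_one (by linarith)]
      have := div_pos (exp_pos (X - 1)) hn
      linarith)
    rw [← h2] at h3
    exact h3 i 0 le_rfl (by simp)
  have hclose : ∀ᶠ w in 𝓝 w₁, φ < w.im → yj (D.lam l + exp w) =
      κ * c * yl (D.lam l + exp w) + reg (exp w) := by
    have hWn : ∀ᶠ w in 𝓝 w₁, w ∈ W := ((isOpen_lt continuous_re continuous_const).inter
        ((isOpen_lt continuous_const continuous_im).inter
          (isOpen_lt continuous_im continuous_const))).mem_nhds hw₁W
    have him : ∀ᶠ w : ℂ in 𝓝 w₁, w.im < φ + π :=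
      (isOpen_lt continuous_im continuous_const).mem_nhds (by
        simp [hw₁, pi_pos])
    filter_upwards [hvc.tendsto.eventually hE, hvexp, hstar, hWn, him] with w a1 a2 a3 a4 a5 a6
    rw [a2] at a1
    have a7 := hX₁ w (a4.1.trans_le hm1) a4.2.1 a4.2.2
    rw [a1, ← D.borel_eq a3, hrel w (a4.1.trans_le hm2) a6 a5, a7.2, ← D.borel_eq]
    exact D.disc_subset_star l (D.mem_disc_of_gap (D.exp_localRadius_lt l)
      (a4.1.le.trans (hm1.trans hX₁l)))
  have hfreq : ∃ᶠ w in 𝓝[≠] w₁, yj (D.lam l + exp w) =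
      κ * c * yl (D.lam l + exp w) + reg (exp w) := by
    have ht : Tendsto (fun ε : ℝ => w₁ + ε * I) (𝓝[>] 0) (𝓝[≠] w₁) := by
      refine tendsto_nhdsWithin_iff.2 ⟨?_, ?_⟩
      · have : Continuous fun ε : ℝ => w₁ + ε * I := by fun_prop
        have h := this.tendsto 0
        simp only [ofReal_zero, zero_mul, add_zero] at h
        exact h.mono_left nhdsWithin_le_nhds
      · filter_upwards [self_mem_nhdsWithin] with ε hε h
        have hε' : 0 < ε := hε
        have : (ε : ℂ) = 0 := by simpa using h
        exact hε'.ne' (by exact_mod_cast this)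
    refine ht.frequently (Eventually.frequently ?_)
    filter_upwards [self_mem_nhdsWithin,
      (ht.mono_right nhdsWithin_le_nhds).eventually hclose] with ε hε h
    have hε' : 0 < ε := hε
    exact h (by simpa [hw₁] using hε')
  have heq := hA.eqOn_of_preconnected_of_eventuallyEq hB hWpre hw₁W
    (((hA w₁ hw₁W).frequently_eq_iff_eventually_eq (hB w₁ hw₁W)).1 hfreq)
  refine ⟨fun t => reg (t - D.lam l), ?_, ?_⟩
  · refine AnalyticAt.fun_comp (g := reg) (f := fun t => t - D.lam l) ?_ (by fun_prop)
    rwa [sub_self]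
  · filter_upwards [ball_mem_nhds (D.lam l) (exp_pos X)] with t ht htc
    have ht0 : t - D.lam l ≠ 0 := fun h => htc l 0 le_rfl (by simp [sub_eq_zero.1 h])
    have hα := toIocMod_mem_Ioc two_pi_pos (η - 2 * π) (t - D.lam l).arg
    have hα' := toIocMod_add_toIocDiv_zsmul two_pi_pos (η - 2 * π) (t - D.lam l).arg
    set α := toIocMod two_pi_pos (η - 2 * π) (t - D.lam l).arg with hαdef
    set m := toIocDiv two_pi_pos (η - 2 * π) (t - D.lam l).arg
    have hexpα : exp (Real.log ‖t - D.lam l‖ + α * I) = t - D.lam l := by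
      conv_rhs => rw [← norm_mul_exp_arg_mul_I (t - D.lam l), ← hα']
      rw [exp_add, ← ofReal_exp, Real.exp_log (norm_pos_iff.2 ht0)]
      push_cast
      rw [zsmul_eq_mul, add_mul, exp_add]
      have : (m * (2 * π) * I : ℂ) = m * (2 * π * I) := by ring
      rw [this, exp_int_mul_two_pi_mul_I, mul_one]
    have hαη : α < η := by
      refine lt_of_le_of_ne (by linarith [hα.2]) fun h => ?_
      refine htc l ‖t - D.lam l‖ (norm_nonneg _) ?_
      have h1 := hexpα
      rw [exp_add, ← ofReal_exp, Real.exp_log (norm_pos_iff.2 ht0)] at h1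
      rw [← h, h1]; ring
    have := heq (x := Real.log ‖t - D.lam l‖ + α * I) ⟨by
      rw [mem_ball, dist_eq_norm] at ht
      simp; exact (log_lt_iff_lt_exp (norm_pos_iff.2 ht0)).2 ht, by simpa using hα.1,
      by simpa using hαη⟩
    beta_reduce at this
    rwa [hexpα, add_sub_cancel] at this

theorem isCutPlaneConnectionCoeff_connectionCoeff {η : ℝ} (hη : D.Admissible η) {j l : Fin n}
    (hl : l ≠ j)
    (hseg : ∀ s : ℝ, 0 < s → s < 1 → D.lam j + s * (D.lam l - D.lam j) ∈ D.cutPlane η) :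
    (η - π < D.theta η j l → D.IsCutPlaneConnectionCoeff η l j (D.connectionCoeff η l j)) ∧
    (D.theta η j l < η - π → D.IsCutPlaneConnectionCoeff η l j
        (exp (2 * π * I * D.mu l) * D.connectionCoeff η l j)) := by
  obtain ⟨reg, hreg, x₀, h⟩ : D.IsConnectionCoeff η l j (D.connectionCoeff η l j) := by
    rw [D.connectionCoeff_eq η hl]; exact D.isConnectionCoeff_sideCoeff η hl
  have h1 := D.theta_mem η j l
  have h2 := D.theta_lt hη hl
  have hpi := pi_pos
  constructor
  · intro hθ
    refine D.isCutPlaneConnectionCoeff_of_relation hη hl hseg hreg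
      (φ := D.theta η j l - π) (x₀ := x₀) (by linarith) (by linarith) ?_
      fun w hw1 hw2 hw3 => h w hw1 hw2 (by linarith)
    push_cast
    rw [sub_mul, exp_sub_pi_mul_I]
  · intro hθ
    refine D.isCutPlaneConnectionCoeff_of_relation hη hl hseg hreg
      (φ := D.theta η j l + π) (x₀ := min x₀ (D.localRadius l)) (by linarith [h1.1]) (by linarith)
      ?_ fun w hw1 hw2 hw3 => ?_
    · push_cast
      rw [add_mul, exp_add_pi_mul_I]
    · have hw : (w - 2 * π * I).re = w.re := by simp
      have hw' : (w - 2 * π * I).im = w.im - 2 * π := by simp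
      have hl' := hw1.trans_le (min_le_right _ _)
      have h3 := h (w - 2 * π * I) (by rw [hw]; exact hw1.trans_le (min_le_left _ _))
        (by rw [hw']; linarith) (by rw [hw']; linarith)
      have h4 : w - 2 * π * I - D.logDiff η l j = w - D.logDiff η l j - 2 * π * I := by ring
      rw [h4, exp_sub (w - D.logDiff η l j) (2 * π * I),
        exp_sub w (2 * π * I), exp_two_pi_mul_I, div_one, div_one,
        D.borel_eq_borelJet (p := l) (w := w - 2 * π * I) (by rw [hw]; exact hl'), D.borelJet_sub_two_pi,
        Pi.smul_apply, ← D.borel_eq_borelJet hl', smul_eq_mul] at h3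
      rw [h3]; ring

end InverseFactorialData

theorem integrable_indicator_rpow {m : ℝ} (hm : m < 1) {δ : ℝ} (hδ : 0 ≤ δ) :
    Integrable ((Ioo 0 δ).indicator fun y : ℝ => y ^ (-m)) := by
  rw [integrable_indicator_iff measurableSet_Ioo]
  exact (intervalIntegrable_iff_integrableOn_Ioo_of_le hδ).1
    (intervalIntegral.intervalIntegrable_rpow' (by linarith))

theorem exp_sub_one_mul_le {x y : ℝ} (h : |x - y| ≤ 1) :
    Real.exp (y - 1) * |x - y| ≤ |Real.exp x - Real.exp y| := by
  have key : ∀ a b : ℝ, a ≤ b → Real.exp a * (b - a) ≤ Real.exp b - Real.exp a := fun a b hab => by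
    have h1 := Real.add_one_le_exp (b - a)
    have h2 : Real.exp b = Real.exp a * Real.exp (b - a) := by rw [← Real.exp_add]; ring_nf
    rw [h2]
    nlinarith [exp_pos a]
  rcases le_total y x with h1 | h1
  · rw [abs_of_nonneg (sub_nonneg.2 h1), abs_of_nonneg (sub_nonneg.2 (exp_le_exp.2 h1))]
    refine le_trans ?_ (key y x h1)
    have := exp_le_exp.2 (by linarith : y - 1 ≤ y)
    nlinarith
  · rw [abs_of_nonpos (sub_nonpos.2 h1), abs_of_nonpos (sub_nonpos.2 (exp_le_exp.2 h1))]
    have h2 := key x y h1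
    rw [abs_of_nonpos (sub_nonpos.2 h1)] at h
    have := exp_le_exp.2 (by linarith : y - 1 ≤ x)
    nlinarith

theorem exp_mem_halfPlane {σ : ℝ} (hσ : σ = 1 ∨ σ = -1) (x : ℝ) {ε : ℝ} (h0 : 0 < ε) (h1 : ε < π) :
    exp (x + (σ * ε : ℝ) * I) ∈ halfPlane σ := by
  change 0 < σ * _
  have h2 := Real.sin_pos_of_pos_of_lt_pi h0 h1
  have h3 : (exp (x + (σ * ε : ℝ) * I)).im = Real.exp x * Real.sin (σ * ε) := by
    rw [exp_im]
    have h4 : ((x : ℂ) + (σ * ε : ℝ) * I).re = x := by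
      rw [add_re, re_ofReal_mul, I_re, mul_zero, add_zero, ofReal_re]
    have h5 : ((x : ℂ) + (σ * ε : ℝ) * I).im = σ * ε := by
      rw [add_im, im_ofReal_mul, I_im, mul_one, ofReal_im, zero_add]
    rw [h4, h5]
  rw [h3]
  rcases hσ with rfl | rfl
  · rw [one_mul, one_mul]; positivity
  · rw [neg_one_mul, neg_one_mul, Real.sin_neg]; have := exp_pos x; nlinarith

theorem tendsto_exp_halfPlane {σ : ℝ} (hσ : σ = 1 ∨ σ = -1) (x : ℝ) :
    Tendsto (fun ε : ℝ => exp (x + (σ * ε : ℝ) * I)) (𝓝[>] 0)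
      (𝓝[halfPlane σ] ((Real.exp x : ℝ) : ℂ)) := by
  refine tendsto_nhdsWithin_iff.2 ⟨?_, ?_⟩
  · have : Continuous fun ε : ℝ => exp (x + (σ * ε : ℝ) * I) := by fun_prop
    have h := this.tendsto 0
    simp only [mul_zero, ofReal_zero, zero_mul, add_zero] at h
    rw [ofReal_exp]
    exact h.mono_left nhdsWithin_le_nhds
  · filter_upwards [Ioo_mem_nhdsGT pi_pos] with ε hε
    exact exp_mem_halfPlane hσ x hε.1 hε.2

namespace InverseFactorialData

variable {n : ℕ} [Fact (2 ≤ n)] (D : InverseFactorialData n)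

omit [Fact (2 ≤ n)] in
theorem norm_exp_neg_mu_mul_le (p : Fin n) (B : ℝ) : ∃ C > 0, ∀ w : ℂ, |w.im| ≤ B →
    ‖exp (-D.mu p * (w + D.baseLog p))‖ ≤ C * Real.exp (-(D.mu p).re * w.re) ∧
    C⁻¹ * Real.exp (-(D.mu p).re * w.re) ≤ ‖exp (-D.mu p * (w + D.baseLog p))‖ := by
  refine ⟨Real.exp (|(D.mu p).re * (D.baseLog p).re| + |(D.mu p).im| * (B + |(D.baseLog p).im|)),
    exp_pos _, fun w hw => ?_⟩
  have h2 : |(D.mu p).im * (w.im + (D.baseLog p).im)| ≤ |(D.mu p).im| * (B + |(D.baseLog p).im|) := by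
    rw [abs_mul]
    have := abs_add_le w.im (D.baseLog p).im
    gcongr; linarith
  have h3 := abs_le.1 h2
  have h4 := abs_le.1 (le_refl |(D.mu p).re * (D.baseLog p).re|)
  rw [norm_exp, ← Real.exp_neg, ← Real.exp_add, ← Real.exp_add, exp_le_exp, exp_le_exp]
  have h5 : (-D.mu p * (w + D.baseLog p)).re = -(D.mu p).re * w.re - (D.mu p).re * (D.baseLog p).re +
      (D.mu p).im * (w.im + (D.baseLog p).im) := by
    rw [mul_re, add_re, add_im, neg_re, neg_im]; ring
  rw [h5]
  constructor <;> linarith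

theorem exists_norm_borelJet_le (p : Fin n) (B : ℝ) : ∃ X C : ℝ, 0 ≤ C ∧ ∀ w : ℂ, w.re < X →
    |w.im| ≤ B → ‖D.borelJet p w 0‖ ≤ C * Real.exp (-(D.mu p).re * w.re) := by
  obtain ⟨r, hr, hb⟩ := D.borelCoeff_geomBounded p
  obtain ⟨x₀, hx₀⟩ := exists_mul_exp_lt r 1 one_pos
  obtain ⟨M, hM⟩ := hb.norm_expSum_le hr.le (hx₀ x₀ le_rfl)
  obtain ⟨C, hC, h⟩ := D.norm_exp_neg_mu_mul_le p B
  have hM0 : 0 ≤ M := (norm_nonneg _).trans (hM x₀ (by simp))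
  refine ⟨x₀ - (D.baseLog p).re, C * M, by positivity, fun w hw hwB => ?_⟩
  rw [borelJet_zero_eq, norm_mul]
  have h1 := hM (w + D.baseLog p) (by simp; linarith)
  have h2 := (h w hwB).1
  calc _ ≤ C * Real.exp (-(D.mu p).re * w.re) * M := by gcongr
    _ = _ := by ring

theorem exists_le_norm_borelJet (p : Fin n) (B : ℝ) : ∃ X c : ℝ, 0 < c ∧ ∀ w : ℂ, w.re < X →
    |w.im| ≤ B → c * Real.exp (-(D.mu p).re * w.re) ≤ ‖D.borelJet p w 0‖ := by
  obtain ⟨r, hr, hb⟩ := D.borelCoeff_geomBounded p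
  obtain ⟨x₀, hx₀⟩ := exists_mul_exp_lt r 1 one_pos
  obtain ⟨M, hM⟩ := (hb.shift 1).norm_expSum_le hr.le (hx₀ x₀ le_rfl)
  have hM0 : 0 ≤ M := (norm_nonneg _).trans (hM x₀ (by simp))
  have hc0 := norm_pos_iff.2 (D.borelCoeff_zero_ne p)
  obtain ⟨x₁, hx₁⟩ := exists_mul_exp_lt M (‖D.borelCoeff p 0‖ / 2) (by positivity)
  obtain ⟨C, hC, h⟩ := D.norm_exp_neg_mu_mul_le p B
  refine ⟨min x₀ x₁ - (D.baseLog p).re, C⁻¹ * (‖D.borelCoeff p 0‖ / 2), by positivity,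
    fun w hw hwB => ?_⟩
  have hre : (w + D.baseLog p).re < min x₀ x₁ := by simp only [add_re]; linarith
  have hre0 := hre.le.trans (min_le_left _ _)
  have hre1 := hre.le.trans (min_le_right _ _)
  rw [borelJet_zero_eq, norm_mul, hb.expSum_eq hr.le (hx₀ _ hre0) 1]
  have h1 := hM (w + D.baseLog p) hre0
  have h2 := (h w hwB).2
  have h3 : ‖D.borelCoeff p 0‖ / 2 ≤ ‖∑ s ∈ range 1,
      D.borelCoeff p s * exp (s * (w + D.baseLog p)) +
      exp ((1 : ℕ) * (w + D.baseLog p)) *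
        expSum (fun s => D.borelCoeff p (s + 1)) (w + D.baseLog p)‖ := by
    have h4 := hx₁ _ hre1
    have h5 : ‖exp ((1 : ℕ) * (w + D.baseLog p)) *
        expSum (fun s => D.borelCoeff p (s + 1)) (w + D.baseLog p)‖ ≤ ‖D.borelCoeff p 0‖ / 2 := by
      rw [norm_mul, Nat.cast_one, one_mul, norm_exp]
      have := exp_pos (w + D.baseLog p).re
      nlinarith
    have h6 := norm_sub_le_norm_add (D.borelCoeff p 0) (exp ((1 : ℕ) * (w + D.baseLog p)) *
        expSum (fun s => D.borelCoeff p (s + 1)) (w + D.baseLog p))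
    simp only [Finset.sum_range_one, Nat.cast_zero, zero_mul, exp_zero, mul_one]
    exact le_trans (by linarith) h6
  calc _ = C⁻¹ * Real.exp (-(D.mu p).re * w.re) * (‖D.borelCoeff p 0‖ / 2) := by ring
    _ ≤ _ := by gcongr

variable {D} in
theorem IsRegularSolution.exists_norm_le {p : Fin n} {x₀ : ℝ} {R : ℂ → Fin n → ℂ}
    (hR : D.IsRegularSolution p x₀ R) : ∃ X C : ℝ, 0 ≤ C ∧ ∀ w : ℂ, w.re < X → ‖R w 0‖ ≤ C := by
  obtain ⟨-, -, ρ, hρ, h⟩ := hR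
  have hc : ContinuousAt ρ 0 := (hρ.differentiableAt (ball_mem_nhds _ (exp_pos _))).continuousAt
  obtain ⟨r, hr, hball⟩ := Metric.eventually_nhds_iff_ball.1
    (hc.norm.eventually_lt (continuousAt_const (y := ‖ρ 0‖ + 1)) (by linarith))
  refine ⟨min x₀ (Real.log r), ‖ρ 0‖ + 1, by positivity, fun w hw => ?_⟩
  rw [lt_min_iff] at hw
  rw [h w hw.1]
  refine (hball _ ?_).le
  rw [mem_ball_zero_iff, norm_exp]
  exact (lt_log_iff_exp_lt hr).1 hw.2

/-- Near a point of the ray the continuation of `y_k` has at most an integrable singularity, if its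
singular part has. -/
theorem exists_local_bound {σ : ℝ} (hσ : σ = 1 ∨ σ = -1) {j k : Fin n} {θ : ℝ} (hk : D.OnRay j θ k)
    {a : ℝ} (ha0 : 0 < a) (ha : ‖D.lam k - D.lam j‖ ≤ a)
    (hmild : ∀ p ∈ D.rayFinset j θ, ‖D.lam p - D.lam j‖ = a →
      D.sideCoeff σ j θ k p = 0 ∨ (D.mu p).re < 1) :
    ∃ r > 0, ∃ m : ℝ, 0 ≤ m ∧ m < 1 ∧ ∃ C : ℝ, 0 ≤ C ∧ ∀ s ∈ ball (a : ℂ) r ∩ halfPlane σ,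
      ‖D.raySol j θ k s 0‖ ≤ C * ‖s - a‖ ^ (-m) := by
  have hσ0 : σ ≠ 0 := by rcases hσ with rfl | rfl <;> norm_num
  by_cases hreg : D.IsRegularPoint j θ a
  · obtain ⟨r, ⟨h1, h2⟩, hr⟩ := ((D.eventually_isRegularPoint hreg).and
      (D.eventually_solvesLinear_raySol hk ha)).and self_mem_nhdsWithin |>.exists
    have hr0 : 0 < r := hr
    obtain ⟨V, hV, hVeq, -⟩ := D.exists_extension hr0 h1 hσ0 (h2 σ)
    have hc : ContinuousAt (fun s => V s 0) (a : ℂ) :=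
      (continuous_apply (0 : Fin n)).continuousAt.comp (hV a (mem_ball_self hr0)).continuousAt
    obtain ⟨r', hr', hball⟩ := Metric.eventually_nhds_iff_ball.1
      (hc.norm.eventually_lt (continuousAt_const (y := ‖V a 0‖ + 1)) (by linarith))
    refine ⟨min r r', lt_min hr0 hr', 0, le_rfl, one_pos, ‖V a 0‖ + 1, by positivity, fun s hs => ?_⟩
    rw [neg_zero, Real.rpow_zero, mul_one, hVeq s ⟨ball_subset_ball (min_le_left _ _) hs.1, hs.2⟩]
    exact (hball s (ball_subset_ball (min_le_right _ _) hs.1)).le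
  · obtain ⟨p, hp, rfl⟩ := D.exists_mem_rayFinset_of_not_isRegularPoint ha0 hreg
    set x := ‖D.lam p - D.lam j‖ with hx
    obtain ⟨r, hr, R, hR, -, h⟩ := D.isSideCoeff_sideCoeff hσ (D.mem_rayFinset.1 hp).2 hk ha
    set c := D.sideCoeff σ j θ k p with hc
    obtain ⟨X₁, C₁, hC₁, h1⟩ := D.exists_norm_borelJet_le p (π + |θ|)
    obtain ⟨X₂, C₂, hC₂, h2⟩ := hR.exists_norm_le
    have hm : ∃ m : ℝ, 0 ≤ m ∧ m < 1 ∧ (c = 0 ∨ (D.mu p).re ≤ m) := by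
      rcases hmild p hp rfl with h | h
      · exact ⟨0, le_rfl, one_pos, Or.inl h⟩
      · exact ⟨max (D.mu p).re 0, le_max_right _ _, max_lt h one_pos, Or.inr (le_max_left _ _)⟩
    obtain ⟨m, hm0, hm1, hm⟩ := hm
    set r' := min (min r 1) (min (Real.exp X₁) (Real.exp X₂)) with hr'
    refine ⟨r', by positivity, m, hm0, hm1, ‖c‖ * C₁ + C₂, by positivity, fun s hs => ?_⟩
    have hs0 := norm_pos_iff.2 (sub_ofReal_ne_zero hs.2 x)
    have hsr : ‖s - x‖ < r' := by rw [← dist_eq_norm]; exact hs.1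
    have hs1 : ‖s - x‖ < 1 := hsr.trans_le ((min_le_left _ _).trans (min_le_right _ _))
    have e1 : (rayLog θ x s).re < X₁ := by
      rw [rayLog_re, log_lt_iff_lt_exp hs0]
      exact hsr.trans_le ((min_le_right _ _).trans (min_le_left _ _))
    have e2 : (rayLog θ x s).re < X₂ := by
      rw [rayLog_re, log_lt_iff_lt_exp hs0]
      exact hsr.trans_le ((min_le_right _ _).trans (min_le_right _ _))
    have e3 : |(rayLog θ x s).im| ≤ π + |θ| := by
      rw [rayLog_im]
      exact (abs_add_le _ _).trans (by have := abs_arg_le_pi (s - x); linarith)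
    rw [h s ⟨ball_subset_ball ((min_le_left _ _).trans (min_le_left _ _)) hs.1, hs.2⟩]
    rw [Pi.add_apply, Pi.smul_apply, smul_eq_mul]
    refine (norm_add_le _ _).trans ?_
    rw [norm_mul, add_mul]
    have hone : 1 ≤ ‖s - x‖ ^ (-m) :=
      Real.one_le_rpow_of_pos_of_le_one_of_nonpos hs0 hs1.le (by linarith)
    refine add_le_add ?_ ((h2 _ e2).trans (le_mul_of_one_le_right hC₂ hone))
    rcases hm with h0 | h0
    · rw [h0]; simp
    · rw [mul_assoc]
      refine mul_le_mul_of_nonneg_left ((h1 _ e1 e3).trans (mul_le_mul_of_nonneg_left ?_ hC₁))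
        (norm_nonneg _)
      rw [rayLog_re, mul_comm, ← Real.rpow_def_of_pos hs0]
      exact Real.rpow_le_rpow_of_exponent_ge hs0 hs1.le (by linarith)

/-- An integrable majorant on compact parts of the ray. -/
theorem exists_majorant {σ : ℝ} (hσ : σ = 1 ∨ σ = -1) {j k : Fin n} {θ : ℝ} (hk : D.OnRay j θ k)
    {A X : ℝ} (hA : ‖D.lam k - D.lam j‖ ≤ Real.exp A)
    (hmild : ∀ p ∈ D.rayFinset j θ, Real.exp A ≤ ‖D.lam p - D.lam j‖ →
      D.sideCoeff σ j θ k p = 0 ∨ (D.mu p).re < 1) :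
    ∃ g : ℝ → ℝ, Integrable g ∧ (∀ x, 0 ≤ g x) ∧ ∃ ε₀ > 0, ∀ᵐ x : ℝ, x ∈ Icc A X →
      ∀ ε : ℝ, 0 < ε → ε < ε₀ → ‖D.raySol j θ k (exp (x + (σ * ε : ℝ) * I)) 0‖ ≤ g x := by
  refine isCompact_Icc.induction_on (p := fun S => ∃ g : ℝ → ℝ, Integrable g ∧ (∀ x, 0 ≤ g x) ∧
    ∃ ε₀ > 0, ∀ᵐ x : ℝ, x ∈ S → ∀ ε : ℝ, 0 < ε → ε < ε₀ →
      ‖D.raySol j θ k (exp (x + (σ * ε : ℝ) * I)) 0‖ ≤ g x) ?_ ?_ ?_ ?_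
  · exact ⟨0, integrable_zero _ _ _, fun _ => le_rfl, 1, one_pos, by simp⟩
  · rintro S T hST ⟨g, h1, h2, ε₀, h3, h4⟩
    exact ⟨g, h1, h2, ε₀, h3, h4.mono fun x hx hxS => hx (hST hxS)⟩
  · rintro S T ⟨g, h1, h2, ε₀, h3, h4⟩ ⟨g', h1', h2', ε₀', h3', h4'⟩
    refine ⟨fun x => g x + g' x, h1.add h1', fun x => add_nonneg (h2 x) (h2' x), min ε₀ ε₀',
      lt_min h3 h3', ?_⟩
    filter_upwards [h4, h4'] with x hx hx' hxST ε he1 he2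
    rw [lt_min_iff] at he2
    rcases hxST with h | h
    · exact (hx h ε he1 he2.1).trans (le_add_of_nonneg_right (h2' x))
    · exact (hx' h ε he1 he2.2).trans (le_add_of_nonneg_left (h2 x))
  · intro x₀ hx₀
    obtain ⟨r, hr, m, hm0, hm1, C, hC, h⟩ := D.exists_local_bound hσ hk (exp_pos x₀)
      (hA.trans (exp_le_exp.2 hx₀.1))
      fun p hp hpx => hmild p hp (by rw [hpx]; exact exp_le_exp.2 hx₀.1)
    have hcont : Continuous fun q : ℝ × ℝ => exp (q.1 + (σ * q.2 : ℝ) * I) := by fun_prop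
    have hev := hcont.continuousAt (x := (x₀, (0 : ℝ))).eventually_mem
      (ball_mem_nhds _ hr)
    rw [nhds_prod_eq] at hev
    obtain ⟨P, hP, Q, hQ, hPQ⟩ := eventually_prod_iff.1 hev
    obtain ⟨δ₁, hδ₁, hP⟩ := Metric.eventually_nhds_iff.1 hP
    obtain ⟨δ₂, hδ₂, hQ⟩ := Metric.eventually_nhds_iff.1 hQ
    set δ := min δ₁ 1 with hδ
    have hδ0 : 0 < δ := lt_min hδ₁ one_pos
    refine ⟨ball x₀ δ, mem_nhdsWithin_of_mem_nhds (ball_mem_nhds _ hδ0),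
      fun x => C * (Real.exp (x₀ - 1)) ^ (-m) * ((Ioo 0 δ).indicator (fun y : ℝ => y ^ (-m)) (x - x₀) +
        (Ioo 0 δ).indicator (fun y : ℝ => y ^ (-m)) (x₀ - x)), ?_, fun x => ?_, min δ₂ π,
      lt_min hδ₂ pi_pos, ?_⟩
    · have hi := integrable_indicator_rpow hm1 hδ0.le
      exact ((hi.comp_sub_right x₀).add (hi.comp_sub_left x₀)).const_mul _
    · have h0 : ∀ y : ℝ, 0 ≤ (Ioo 0 δ).indicator (fun y : ℝ => y ^ (-m)) y := fun y =>
        indicator_nonneg (fun z hz => Real.rpow_nonneg hz.1.le _) y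
      have := h0 (x - x₀)
      have := h0 (x₀ - x)
      positivity
    · have hne : ∀ᵐ x : ℝ, x ≠ x₀ := by simp [ae_iff]
      filter_upwards [hne] with x hx hxδ ε he1 he2
      rw [lt_min_iff] at he2
      rw [mem_ball, Real.dist_eq] at hxδ
      have hxδ₁ := hxδ.trans_le (min_le_left _ _)
      have hxδ₂ := hxδ.trans_le (min_le_right _ _)
      have hmem := hPQ (hP (y := x) (by rwa [Real.dist_eq]))
        (hQ (y := ε) (by rw [Real.dist_eq, sub_zero, abs_of_pos he1]; exact he2.1))
      have hcen : exp (((x₀, (0:ℝ)).1 : ℝ) + (σ * (x₀, (0 : ℝ)).2 : ℝ) * I) =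
          ((Real.exp x₀ : ℝ) : ℂ) := by simp
      rw [hcen] at hmem
      refine (h _ ⟨hmem, exp_mem_halfPlane hσ x he1 he2.2⟩).trans ?_
      rw [mul_assoc]
      refine mul_le_mul_of_nonneg_left ?_ hC
      have habs : 0 < |x - x₀| := abs_pos.2 (sub_ne_zero.2 hx)
      have hind : (Ioo 0 δ).indicator (fun y : ℝ => y ^ (-m)) (x - x₀) +
          (Ioo 0 δ).indicator (fun y : ℝ => y ^ (-m)) (x₀ - x) = |x - x₀| ^ (-m) := by
        rcases lt_or_gt_of_ne hx with h1 | h1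
        · rw [abs_of_neg (sub_neg.2 h1)] at hxδ ⊢
          rw [indicator_of_notMem (fun h => by linarith [h.1]), indicator_of_mem
            (show x₀ - x ∈ Ioo 0 δ from ⟨by linarith, by linarith⟩), zero_add, neg_sub]
        · rw [abs_of_pos (sub_pos.2 h1)] at hxδ ⊢
          rw [indicator_of_mem (show x - x₀ ∈ Ioo 0 δ from ⟨by linarith, by linarith⟩), indicator_of_notMem
            (fun h => by linarith [h.1]), add_zero]
      rw [hind, ← Real.mul_rpow (exp_pos _).le habs.le]
      refine Real.rpow_le_rpow_of_nonpos (by positivity) ?_ (by linarith)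
      refine (exp_sub_one_mul_le hxδ₂.le).trans ?_
      have h1 : Real.exp x = ‖exp (x + (σ * ε : ℝ) * I)‖ := by rw [norm_exp]; simp
      have h2 : Real.exp x₀ = ‖((Real.exp x₀ : ℝ) : ℂ)‖ := by
        rw [norm_real, Real.norm_of_nonneg (exp_pos _).le]
      have h3 := abs_norm_sub_norm_le (exp (x + (σ * ε : ℝ) * I)) ((Real.exp x₀ : ℝ) : ℂ)
      rwa [← h1, ← h2] at h3

/-- The continuation of `y_k` along the left side of the ray, in the variable `x = log s`. -/
noncomputable def raySide (j : Fin n) (θ : ℝ) (k : Fin n) (x : ℝ) : ℂ :=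
  sideLimit 1 (D.raySol j θ k) (Real.exp x) 0

omit [Fact (2 ≤ n)] in
theorem ae_isRegularPoint (j : Fin n) (θ : ℝ) :
    ∀ᵐ x : ℝ, D.IsRegularPoint j θ (Real.exp x : ℝ) := by
  have h : (Set.range fun p : Fin n => Real.log ‖D.lam p - D.lam j‖).Finite := finite_range _
  refine measure_mono_null (fun x hx => ?_) (h.measure_zero volume)
  obtain ⟨p, -, hp⟩ := D.exists_mem_rayFinset_of_not_isRegularPoint (exp_pos x) hx
  exact ⟨p, by beta_reduce; rw [hp, Real.log_exp]⟩

theorem tendsto_raySol {σ : ℝ} (hσ : σ = 1 ∨ σ = -1) {j k : Fin n} {θ : ℝ} (hk : D.OnRay j θ k) {a : ℝ}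
    (ha : ‖D.lam k - D.lam j‖ ≤ a) (hreg : D.IsRegularPoint j θ a) :
    Tendsto (fun s => D.raySol j θ k s 0) (𝓝[halfPlane σ] a)
      (𝓝 (sideLimit σ (D.raySol j θ k) a 0)) := by
  have hσ0 : σ ≠ 0 := by rcases hσ with rfl | rfl <;> norm_num
  obtain ⟨r, ⟨h1, h2⟩, hr⟩ := ((D.eventually_isRegularPoint hreg).and
    (D.eventually_solvesLinear_raySol hk ha)).and self_mem_nhdsWithin |>.exists
  obtain ⟨V, -, -, h3⟩ := D.exists_extension hr h1 hσ0 (h2 σ)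
  obtain ⟨h4, h5⟩ := h3 a (mem_ball_self hr)
  rw [h5]
  exact ((continuous_apply (0 : Fin n)).tendsto _).comp h4

/-- The factor that relates `Δ y_k` to `y_k`. -/
noncomputable def deltaFactor (k : Fin n) : ℂ := (1 - exp (2 * π * I * D.mu k)) / (2 * π * I)

omit [Fact (2 ≤ n)] in
theorem deltaFactor_ne_zero (k : Fin n) : D.deltaFactor k ≠ 0 :=
  div_ne_zero (sub_ne_zero.2 (D.exp_two_pi_mu_ne_one k).symm) two_pi_I_ne_zero

theorem delta_eq {k : Fin n} {w : ℂ} (hw : w ∈ D.star k) :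
    D.delta k w = D.deltaFactor k * D.borelSol k w 0 := by
  rw [delta, D.borel_eq hw, D.borel_eq (D.star_sub_two_pi.2 hw), D.borelSol_sub_two_pi hw,
    Pi.smul_apply, smul_eq_mul, deltaFactor]
  ring

theorem deltaRay_eq (η : ℝ) {j l : Fin n} (hl : l ≠ j) {x : ℝ} (hx : Real.log ‖D.lam l - D.lam j‖ < x)
    (hreg : D.IsRegularPoint j (D.theta η j l) (Real.exp x : ℝ)) :
    D.deltaRay η l j (Real.exp x / ‖D.lam l - D.lam j‖ - 1) =
      D.deltaFactor l * D.raySide j (D.theta η j l) l x := by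
  have hn := D.norm_lam_sub_pos hl
  set θ := D.theta η j l with hθ
  set b := ‖D.lam l - D.lam j‖ with hb
  have hbx : b < Real.exp x := (log_lt_iff_lt_exp hn).1 hx
  set t := Real.exp x / b - 1 with ht
  have ht0 : 0 < t := by rw [ht, sub_pos, one_lt_div hn]; exact hbx
  set W : ℝ → ℂ := fun ε => D.logDiff η l j + Real.log t + ε * I with hW
  have hWθ : ∀ ε : ℝ, W ε - θ * I = (Real.log (b * t) : ℝ) + (1 * ε : ℝ) * I := fun ε => by
      rw [hW, Real.log_mul hn.ne' ht0.ne']; beta_reduce; rw [logDiff, ← hθ, ← hb]; push_cast; ring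
  have hbt : Real.exp (Real.log (b * t)) = Real.exp x - b := by
    rw [Real.exp_log (by positivity), ht]; field_simp
  have hs : Tendsto (fun ε : ℝ => (b : ℂ) + exp (W ε - θ * I)) (𝓝[>] 0)
      (𝓝[halfPlane 1] ((Real.exp x : ℝ) : ℂ)) := by
    have h1 := tendsto_exp_halfPlane (σ := 1) (Or.inl rfl) (Real.log (b * t))
    rw [hbt] at h1
    have h2 := tendsto_nhdsWithin_iff.1 h1
    refine tendsto_nhdsWithin_iff.2 ⟨?_, ?_⟩
    · have h3 := h2.1.const_add (b : ℂ)
      have h4 : (b : ℂ) + ((Real.exp x - b : ℝ) : ℂ) = ((Real.exp x : ℝ) : ℂ) := by push_cast; ring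
      rw [h4] at h3
      refine h3.congr fun ε => ?_
      rw [hWθ]
    · filter_upwards [h2.2] with ε hε
      rw [hWθ]
      simpa [halfPlane] using hε
  obtain ⟨r, hr, hstar⟩ := D.exists_rayLog_mem_star (j := j) (k := l) (θ := θ) hbx.le
  have hball := hs.eventually (inter_mem (mem_nhdsWithin_of_mem_nhds (ball_mem_nhds _ hr))
    self_mem_nhdsWithin)
  have hfin : Tendsto (fun ε : ℝ => D.delta l (W ε)) (𝓝[>] 0)
      (𝓝 (D.deltaFactor l * D.raySide j θ l x)) := by
    have h1 := ((D.tendsto_raySol (σ := 1) (Or.inl rfl) (D.onRay_theta η j l) hbx.le hreg).comp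
      hs).const_mul (D.deltaFactor l)
    refine h1.congr' ?_
    filter_upwards [hball, Ioo_mem_nhdsGT pi_pos] with ε h2 h3
    have h4 := hstar 1 _ h2
    have him : (W ε).im - θ = ε := by
      have := congrArg Complex.im (hWθ ε)
      simpa using this
    have h5 : rayLog θ b ((b : ℂ) + exp (W ε - θ * I)) = W ε :=
      rayLog_add_exp (by rw [him]; linarith [h3.1, pi_pos]) (by rw [him]; exact h3.2.le)
    rw [← hb, h5] at h4
    rw [D.delta_eq h4, Function.comp_apply, raySol, ← hb, h5]
  exact hfin.limUnder_eq

theorem deltaIntegral_eq (η : ℝ) (N : ℕ) {j l : Fin n} (hl : l ≠ j) :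
    D.deltaIntegral η N l j = ∫⁻ x in Ioi (Real.log ‖D.lam l - D.lam j‖),
      ‖D.deltaFactor l * D.raySide j (D.theta η j l) l x‖ₑ *
        ENNReal.ofReal (Real.exp (-(N - (D.mu j).re) * (x - Real.log ‖D.lam l - D.lam j‖))) := by
  have hn := D.norm_lam_sub_pos hl
  set b := ‖D.lam l - D.lam j‖ with hb
  have himg : (fun x : ℝ => Real.exp x / b - 1) '' Ioi (Real.log b) = Ioi 0 := by
    ext t
    constructor
    · rintro ⟨x, hx, rfl⟩
      exact sub_pos.2 ((one_lt_div hn).2 ((log_lt_iff_lt_exp hn).1 hx))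
    · intro ht
      have ht' : 0 < t := ht
      refine ⟨Real.log (b * (1 + t)), Real.log_lt_log hn (by nlinarith), ?_⟩
      beta_reduce
      rw [Real.exp_log (by positivity)]; field_simp; ring
  rw [deltaIntegral, ← himg, lintegral_image_eq_lintegral_abs_deriv_mul measurableSet_Ioi
    (f' := fun x => Real.exp x / b)
    (fun x _ => (((Real.hasDerivAt_exp x).div_const b).sub_const 1).hasDerivWithinAt)
    (fun x _ y _ h => by
      have h2 : Real.exp x / b = Real.exp y / b := by linarith
      exact Real.exp_injective ((div_left_inj' hn.ne').1 h2))]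
  refine setLIntegral_congr_fun_ae measurableSet_Ioi ?_
  filter_upwards [D.ae_isRegularPoint j (D.theta η j l)] with x hx hxb
  rw [D.deltaRay_eq η hl hxb hx]
  have hy : Real.exp x / b = Real.exp (x - Real.log b) := by rw [Real.exp_sub, Real.exp_log hn]
  rw [add_sub_cancel, hy, abs_of_pos (exp_pos _), ← Real.exp_mul, mul_comm,
    div_eq_mul_inv, mul_assoc, mul_comm (ENNReal.ofReal _)⁻¹, ← div_eq_mul_inv,
    ← ENNReal.ofReal_div_of_pos (exp_pos _), ← Real.exp_sub]
  ring_nf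

/-- Growth of the continuation along the side of the ray. -/
theorem exists_raySide_growth {j k : Fin n} {θ : ℝ} (hk : D.OnRay j θ k) {ε : ℝ} (hε : 0 < ε) :
    ∃ X C : ℝ, 0 ≤ C ∧ ∀ x : ℝ, X ≤ x → D.IsRegularPoint j θ (Real.exp x : ℝ) →
      ‖D.raySide j θ k x‖ ≤ C * Real.exp ((D.growth + ε) * x) := by
  set b := ‖D.lam k - D.lam j‖ with hb
  obtain ⟨δ, hδ, X₁, C, hgr⟩ := D.exists_borel_growth k hε θ
  refine ⟨max (X₁ + Real.log 2 + 1) (Real.log (2 * b + 1)),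
    max C 0 * Real.exp (|D.growth + ε| * Real.log 2), by positivity, fun x hx hreg => ?_⟩
  have hb0 : 0 ≤ b := norm_nonneg _
  have hx1 := (le_max_left _ _).trans hx
  have hx2 : 2 * b + 1 ≤ Real.exp x :=
    (Real.log_le_iff_le_exp (by positivity)).1 ((le_max_right _ _).trans hx)
  have hbx : b < Real.exp x := by linarith
  have hlog1 : Real.log (Real.exp x - b) ≤ x := by
    rw [Real.log_le_iff_le_exp (by linarith)]; linarith
  have hlog2 : x - Real.log 2 ≤ Real.log (Real.exp x - b) := by
    rw [Real.le_log_iff_exp_le (by linarith), Real.exp_sub, Real.exp_log two_pos]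
    linarith
  have ht := D.tendsto_raySol (σ := 1) (Or.inl rfl) hk hbx.le hreg
  have hr := (tendsto_rayLog_of_gt θ hbx).mono_left (nhdsWithin_le_nhds (s := halfPlane 1))
  obtain ⟨r, hr0, hstar⟩ := D.exists_rayLog_mem_star (j := j) (k := k) (θ := θ) hbx.le
  have hne := nhdsWithin_halfPlane_neBot (σ := 1) one_ne_zero (Real.exp x)
  have hre := (continuous_re.tendsto _).comp hr
  have him := (continuous_im.tendsto _).comp hr
  have e1 : ((Real.log (Real.exp x - b) : ℂ) + θ * I).re = Real.log (Real.exp x - b) := by simp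
  have e2 : ((Real.log (Real.exp x - b) : ℂ) + θ * I).im = θ := by simp
  rw [e1] at hre
  rw [e2] at him
  have hbd : ‖D.raySide j θ k x‖ ≤ C * Real.exp ((D.growth + ε) * Real.log (Real.exp x - b)) := by
    refine le_of_tendsto_of_tendsto ht.norm
      (((Real.continuous_exp.tendsto _).comp (hre.const_mul (D.growth + ε))).const_mul C) ?_
    filter_upwards [mem_nhdsWithin_of_mem_nhds (ball_mem_nhds _ hr0), self_mem_nhdsWithin,
      hre.eventually (eventually_gt_nhds (by linarith : X₁ < Real.log (Real.exp x - b))),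
      him.eventually (ball_mem_nhds _ hδ)] with s h1 h2 h3 h4
    have h5 := hstar 1 s ⟨h1, h2⟩
    have := hgr _ h5 h4 (le_of_lt h3)
    rw [D.borel_eq h5] at this
    exact this
  refine hbd.trans ?_
  have h6 : (D.growth + ε) * Real.log (Real.exp x - b) ≤
      |D.growth + ε| * Real.log 2 + (D.growth + ε) * x := by
    have h7 : (D.growth + ε) * (Real.log (Real.exp x - b) - x) ≤ |D.growth + ε| * Real.log 2 := by
      refine (le_abs_self _).trans ?_
      rw [abs_mul]
      refine mul_le_mul_of_nonneg_left ?_ (abs_nonneg _)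
      rw [abs_le]; constructor <;> linarith [Real.log_pos one_lt_two]
    linarith
  rw [mul_assoc, ← Real.exp_add]
  gcongr
  exact le_max_left _ _

theorem norm_raySide_le {j k : Fin n} {θ : ℝ} (hk : D.OnRay j θ k) {x : ℝ}
    (hx : ‖D.lam k - D.lam j‖ ≤ Real.exp x) (hreg : D.IsRegularPoint j θ (Real.exp x : ℝ)) {G ε₀ : ℝ}
    (hε₀ : 0 < ε₀) (h : ∀ ε : ℝ, 0 < ε → ε < ε₀ →
      ‖D.raySol j θ k (exp (x + (1 * ε : ℝ) * I)) 0‖ ≤ G) :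
    ‖D.raySide j θ k x‖ ≤ G := by
  refine le_of_tendsto ((D.tendsto_raySol (σ := 1) (Or.inl rfl) hk hx hreg).comp
    (tendsto_exp_halfPlane (σ := 1) (Or.inl rfl) x)).norm ?_
  filter_upwards [Ioo_mem_nhdsGT hε₀] with ε hε
  exact h ε hε.1 hε.2

theorem deltaIntegral_lt_top {η : ℝ} {N : ℕ} {j l : Fin n} (hl : l ≠ j)
    (hN : max 0 D.growth < (N : ℝ) - (D.mu j).re) (hμ : (D.mu l).re < 1)
    (hbeyond : ∀ p : Fin n, p ≠ j → D.theta η j p = D.theta η j l →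
      ‖D.lam l - D.lam j‖ < ‖D.lam p - D.lam j‖ → (D.mu p).re < 1) :
    D.deltaIntegral η N l j < ⊤ := by
  have hn := D.norm_lam_sub_pos hl
  rw [D.deltaIntegral_eq η N hl]
  set θ := D.theta η j l with hθ
  set L := Real.log ‖D.lam l - D.lam j‖ with hL
  set q : ℝ := N - (D.mu j).re with hq
  rw [max_lt_iff] at hN
  have hεpos : 0 < (q - D.growth) / 2 := by linarith
  obtain ⟨X, C, hC, hgr⟩ := D.exists_raySide_growth (D.onRay_theta η j l) hεpos
  have hexpL : Real.exp L = ‖D.lam l - D.lam j‖ := Real.exp_log hn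
  obtain ⟨g, hg, hg0, ε₀, hε₀, hmaj⟩ := D.exists_majorant (σ := 1) (X := X) (Or.inl rfl)
    (D.onRay_theta η j l) hexpL.ge fun p hp hlp => by
      obtain ⟨hpj, hpr⟩ := D.mem_rayFinset.1 hp
      refine Or.inr ?_
      rw [hexpL] at hlp
      rcases eq_or_lt_of_le hlp with h | h
      · rwa [← D.eq_of_onRay (D.onRay_theta η j l) hpr h]
      · exact hbeyond p hpj (D.theta_eq_of_onRay (D.theta_mem η j l) hpj hpr) h
  have hint : IntegrableOn (fun x => ‖D.deltaFactor l‖ *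
      (g x + C * Real.exp (q * L) * Real.exp (-((q - D.growth) / 2) * x))) (Ioi L) :=
    (hg.integrableOn.add ((integrableOn_exp_mul_Ioi (neg_lt_zero.2 hεpos) L).const_mul _)).const_mul _
  refine lt_of_le_of_lt (setLIntegral_mono_ae' measurableSet_Ioi ?_) hint.lintegral_lt_top
  filter_upwards [D.ae_isRegularPoint j θ, hmaj] with x hreg hx hxL
  have hxL' : L < x := hxL
  rw [enorm_mul, ← ofReal_norm, ← ofReal_norm, ← ENNReal.ofReal_mul (norm_nonneg _),
    ← ENNReal.ofReal_mul (by positivity)]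
  refine ENNReal.ofReal_le_ofReal ?_
  rw [mul_assoc]
  refine mul_le_mul_of_nonneg_left ?_ (norm_nonneg _)
  have hbx : ‖D.lam l - D.lam j‖ ≤ Real.exp x := by rw [← hexpL]; exact exp_le_exp.2 hxL'.le
  rcases le_total x X with h | h
  · have h1 := D.norm_raySide_le (D.onRay_theta η j l) hbx hreg hε₀ (hx ⟨hxL'.le, h⟩)
    have h2 : Real.exp (-q * (x - L)) ≤ 1 := by rw [Real.exp_le_one_iff]; nlinarith
    have h3 : ‖D.raySide j θ l x‖ * Real.exp (-q * (x - L)) ≤ g x * 1 := by gcongr; exact hg0 x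
    have : 0 ≤ C * Real.exp (q * L) * Real.exp (-((q - D.growth) / 2) * x) := by positivity
    linarith
  · have h1 := hgr x h hreg
    calc _ ≤ C * Real.exp ((D.growth + (q - D.growth) / 2) * x) * Real.exp (-q * (x - L)) := by gcongr
      _ = C * Real.exp (q * L) * Real.exp (-((q - D.growth) / 2) * x) := by
        rw [mul_assoc, mul_assoc, ← Real.exp_add, ← Real.exp_add]; ring_nf
      _ ≤ _ := le_add_of_nonneg_left (hg0 x)

/-- Finiteness of the integral forces the singularities on the ray to be integrable. -/
theorem sideCoeff_eq_zero_or_of_deltaIntegral_lt_top {η : ℝ} {N : ℕ} {j k p : Fin n} (hk : k ≠ j)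
    (hfin : D.deltaIntegral η N k j < ⊤) (hp : p ∈ D.rayFinset j (D.theta η j k))
    (hkp : ‖D.lam k - D.lam j‖ < ‖D.lam p - D.lam j‖) :
    D.sideCoeff 1 j (D.theta η j k) k p = 0 ∨ (D.mu p).re < 1 := by
  by_contra! hcon
  obtain ⟨hd, hμ⟩ := hcon
  have hn : 0 < ‖D.lam k - D.lam j‖ := D.norm_lam_sub_pos hk
  rw [D.deltaIntegral_eq η N hk] at hfin
  set θ := D.theta η j k with hθ
  set d := D.sideCoeff 1 j θ k p with hd'
  set b := ‖D.lam p - D.lam j‖ with hb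
  set q : ℝ := N - (D.mu j).re with hq
  have hb0 : 0 < b := hn.trans hkp
  set L := Real.log b with hL
  have hexpL : Real.exp L = b := Real.exp_log hb0
  set L' := Real.log ‖D.lam k - D.lam j‖ with hL'
  have hLL : L' < L := Real.log_lt_log hn hkp
  obtain ⟨R, hR, hev⟩ := IsSideCoeff.eventually_sideLimit D (Or.inl rfl)
    (D.isSideCoeff_sideCoeff (σ := 1) (Or.inl rfl) (D.mem_rayFinset.1 hp).2 (D.onRay_theta η j k) hkp.le)
  obtain ⟨r, hr, hr0⟩ := (hev.and self_mem_nhdsWithin).exists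
  have hr0' : 0 < r := hr0
  obtain ⟨X₁, c, hc, hlow⟩ := D.exists_le_norm_borelJet p |θ|
  obtain ⟨X₂, C, hC, hRb⟩ := hR.exists_norm_le
  have hdn : 0 < ‖d‖ := norm_pos_iff.2 hd
  -- lower bound
  have hev1 : ∀ᶠ x in 𝓝[>] L, Real.exp x - b < min (min r 1) (min (min (Real.exp X₁) (Real.exp X₂))
      (‖d‖ * c / (2 * (C + 1)))) := by
    have h1 : Tendsto (fun x => Real.exp x - b) (𝓝[>] L) (𝓝 (Real.exp L - b)) :=
      ((Real.continuous_exp.sub continuous_const).tendsto L).mono_left nhdsWithin_le_nhds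
    rw [hexpL, sub_self] at h1
    exact h1.eventually (gt_mem_nhds (by positivity))
  obtain ⟨u, hu, hsub⟩ := mem_nhdsGT_iff_exists_Ioo_subset.1 hev1
  have hu' : L < u := hu
  set c' : ℝ := ‖D.deltaFactor k‖ * (‖d‖ * c / 2 * (Real.exp u)⁻¹) *
    Real.exp (-|q| * (u - L')) with hc'
  have hdf := norm_pos_iff.2 (D.deltaFactor_ne_zero k)
  have hc'0 : 0 < c' := by positivity
  have hbound : ∀ x ∈ Ioo L u, ENNReal.ofReal (c' * (x - L)⁻¹) ≤
      ‖D.deltaFactor k * D.raySide j θ k x‖ₑ * ENNReal.ofReal (Real.exp (-q * (x - L'))) := by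
    intro x hx
    have h1 := hsub hx
    simp only [mem_ofPred_eq, lt_min_iff] at h1
    obtain ⟨⟨h1r, h11⟩, ⟨h1a, h1b⟩, h1c⟩ := h1
    have hpos : 0 < Real.exp x - b := by rw [sub_pos, ← hexpL]; exact Real.exp_lt_exp.2 hx.1
    set w : ℂ := Real.log (Real.exp x - b) + θ * I with hw
    have hwre : w.re = Real.log (Real.exp x - b) := by simp [hw]
    have hwim : w.im = θ := by simp [hw]
    have hr1 := (hr.2.2 (Real.exp x) (by rw [abs_of_pos hpos]; exact h1r) w (by
      rw [hwre, log_lt_iff_lt_exp hpos]; exact h1r.trans hr.1)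
      ((tendsto_rayLog_of_gt θ (sub_pos.1 hpos)).mono_left nhdsWithin_le_nhds)).2
    have h2 := hlow w (by rwa [hwre, log_lt_iff_lt_exp hpos]) (by rw [hwim])
    have h3 := hRb w (by rwa [hwre, log_lt_iff_lt_exp hpos])
    have h4 : (Real.exp x - b)⁻¹ ≤ Real.exp (-(D.mu p).re * w.re) := by
      rw [hwre, mul_comm, ← Real.rpow_def_of_pos hpos, ← Real.rpow_neg_one]
      exact Real.rpow_le_rpow_of_exponent_ge hpos h11.le (by linarith)
    have h5 : ‖D.raySide j θ k x‖ ≥ ‖d‖ * c / 2 * (Real.exp x - b)⁻¹ := by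
      rw [raySide, hr1, Pi.add_apply, Pi.smul_apply, smul_eq_mul]
      have h6 := norm_sub_le_norm_add (d * D.borelJet p w 0) (R w 0)
      rw [norm_mul] at h6
      have h7 : C ≤ ‖d‖ * c / 2 * (Real.exp x - b)⁻¹ := by
        rw [lt_div_iff₀ (by positivity)] at h1c
        rw [← div_eq_mul_inv, le_div_iff₀ hpos]
        nlinarith
      have h8 : ‖d‖ * (c * (Real.exp x - b)⁻¹) ≤ ‖d‖ * ‖D.borelJet p w 0‖ :=
        mul_le_mul_of_nonneg_left (le_trans (by gcongr) h2) hdn.le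
      linarith
    have h9 : (Real.exp u)⁻¹ * (x - L)⁻¹ ≤ (Real.exp x - b)⁻¹ := by
      have hxL : 0 < x - L := by linarith [hx.1]
      rw [← mul_inv]
      refine inv_anti₀ hpos ?_
      have h10 := Real.add_one_le_exp (L - x)
      have h11 : b = Real.exp x * Real.exp (L - x) := by rw [← Real.exp_add, ← hexpL]; ring_nf
      have h12 : Real.exp x ≤ Real.exp u := exp_le_exp.2 hx.2.le
      have h13 := exp_pos x
      rw [h11]
      nlinarith
    have h10 : Real.exp (-|q| * (u - L')) ≤ Real.exp (-q * (x - L')) := by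
      rw [exp_le_exp]
      have h14 : q * (x - L') ≤ |q| * (u - L') :=
        (mul_le_mul_of_nonneg_right (le_abs_self q) (by linarith [hx.1])).trans
          (mul_le_mul_of_nonneg_left (by linarith [hx.2]) (abs_nonneg q))
      linarith
    rw [enorm_mul, ← ofReal_norm, ← ofReal_norm, ← ENNReal.ofReal_mul (norm_nonneg _),
      ← ENNReal.ofReal_mul (by positivity)]
    refine ENNReal.ofReal_le_ofReal ?_
    calc c' * (x - L)⁻¹ = ‖D.deltaFactor k‖ * (‖d‖ * c / 2 * ((Real.exp u)⁻¹ * (x - L)⁻¹)) *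
          Real.exp (-|q| * (u - L')) := by rw [hc']; ring
      _ ≤ ‖D.deltaFactor k‖ * (‖d‖ * c / 2 * (Real.exp x - b)⁻¹) * Real.exp (-q * (x - L')) := by gcongr
      _ ≤ _ := by gcongr
  have hlt : ∫⁻ x in Ioo L u, ENNReal.ofReal (c' * (x - L)⁻¹) < ⊤ := by
    refine lt_of_le_of_lt (setLIntegral_mono' measurableSet_Ioo hbound) (lt_of_le_of_lt
      (lintegral_mono_set ?_) hfin)
    exact fun x hx => hLL.trans hx.1
  have hI : IntegrableOn (fun x => c' * (x - L)⁻¹) (Ioo L u) := by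
    refine ⟨by fun_prop, ?_⟩
    rw [hasFiniteIntegral_iff_ofReal]
    · exact hlt
    · filter_upwards [ae_restrict_mem measurableSet_Ioo] with x hx
      have : 0 < x - L := by linarith [hx.1]
      positivity
  have hI' : IntervalIntegrable (fun x => (x - L)⁻¹) volume L u := by
    rw [intervalIntegrable_iff_integrableOn_Ioo_of_le hu'.le]
    have hI2 : IntegrableOn (fun x => c'⁻¹ * (c' * (x - L)⁻¹)) (Ioo L u) := hI.const_mul c'⁻¹
    refine hI2.congr_fun (fun x _ => ?_) measurableSet_Ioo
    beta_reduce
    rw [← mul_assoc, inv_mul_cancel₀ hc'0.ne', one_mul]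
  rw [intervalIntegrable_sub_inv_iff] at hI'
  rcases hI' with h | h
  · exact hu'.ne h
  · exact h left_mem_uIcc

end InverseFactorialData

namespace InverseFactorialData

variable {n : ℕ} (D : InverseFactorialData n)

/-- The first `N` terms of the expansion of `y_j`, multiplied by `(t - λ_j) ^ (μ_j - N)`. -/
noncomputable def principalPart (j : Fin n) (N : ℕ) (w : ℂ) : ℂ :=
  ∑ s ∈ range N, D.borelCoeff j s * exp ((s - D.mu j) * D.baseLog j) * exp ((s - N) * w)

/-- The remainder of the expansion of `y_j`, multiplied by `(t - λ_j) ^ (μ_j - N)`. -/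
noncomputable def scaledTail (j : Fin n) (N : ℕ) (w : ℂ) : ℂ :=
  exp ((D.mu j - N) * w) * D.borel j w - D.principalPart j N w

/-- The integrand of the representation of the remainder by a hyperterminant. -/
noncomputable def hyperIntegrand (j : Fin n) (N : ℕ) (logu w : ℂ) : ℂ :=
  exp w * D.scaledTail j N w * hyperF (N - D.mu j + 1) (w + logu)

/-- The integral of `hyperIntegrand` along the ray with angle `α`. -/
noncomputable def rayIntegral (j : Fin n) (N : ℕ) (logu : ℂ) (α : ℝ) : ℂ :=
  ∫ x : ℝ, D.hyperIntegrand j N logu (x + α * I)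

theorem differentiable_principalPart (j : Fin n) (N : ℕ) : Differentiable ℂ (D.principalPart j N) := by
  unfold principalPart; fun_prop

theorem norm_exp_mul_le (z : ℂ) {w : ℂ} {B : ℝ} (hw : |w.im| ≤ B) :
    ‖exp (z * w)‖ ≤ Real.exp (|z.im| * B) * Real.exp (z.re * w.re) := by
  rw [norm_exp, ← Real.exp_add, exp_le_exp, mul_re]
  have h1 : |z.im * w.im| ≤ |z.im| * B := by rw [abs_mul]; gcongr
  linarith [neg_abs_le (z.im * w.im)]

variable [Fact (2 ≤ n)]

theorem differentiableAt_borel {j : Fin n} {w : ℂ} (hw : w ∈ D.star j) :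
    DifferentiableAt ℂ (D.borel j) w := by
  refine (D.analyticOnNhd_borelSol_zero j w hw).differentiableAt.congr_of_eventuallyEq ?_
  filter_upwards [(D.isOpen_star j).mem_nhds hw] with z hz
  exact D.borel_eq hz

theorem differentiableAt_scaledTail {j : Fin n} (N : ℕ) {w : ℂ} (hw : w ∈ D.star j) :
    DifferentiableAt ℂ (D.scaledTail j N) w :=
  (DifferentiableAt.mul (by fun_prop) (D.differentiableAt_borel hw)).sub
    (D.differentiable_principalPart j N w)

theorem differentiableAt_hyperIntegrand {j : Fin n} {N : ℕ} (hM : 0 < ((N : ℂ) - D.mu j + 1).re)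
    {logu w : ℂ} (hw : w ∈ D.star j) (hu : |(w + logu).im| < 3 * π / 2) :
    DifferentiableAt ℂ (D.hyperIntegrand j N logu) w := by
  refine (DifferentiableAt.mul (by fun_prop) (D.differentiableAt_scaledTail N hw)).mul ?_
  exact DifferentiableAt.comp (g := hyperF (N - D.mu j + 1)) (f := fun w => w + logu) w
    (differentiableAt_hyperF hM hu) (by fun_prop)

theorem exists_norm_scaledTail_le (j : Fin n) (N : ℕ) : ∃ X C : ℝ, ∀ w : ℂ, w.re ≤ X →
    ‖D.scaledTail j N w‖ ≤ C := by
  obtain ⟨r, hr, hb⟩ := D.borelCoeff_geomBounded j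
  obtain ⟨x₀, hx₀⟩ := exists_mul_exp_lt r 1 one_pos
  obtain ⟨C, hC⟩ := (hb.shift N).norm_expSum_le hr.le (hx₀ x₀ le_rfl)
  refine ⟨min (x₀ - (D.baseLog j).re) (D.localRadius j - 1),
    ‖exp ((N - D.mu j) * D.baseLog j)‖ * C, fun w hw => ?_⟩
  rw [le_min_iff] at hw
  have hre : (w + D.baseLog j).re ≤ x₀ := by simp only [add_re]; linarith [hw.1]
  have h1 : D.scaledTail j N w = exp ((N - D.mu j) * D.baseLog j) *
      expSum (fun s => D.borelCoeff j (s + N)) (w + D.baseLog j) := by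
    rw [scaledTail, D.borel_eq_borelJet (by linarith [hw.2]), D.borelJet_zero_eq,
      hb.expSum_eq hr.le (hx₀ _ hre) N, mul_add, mul_add, mul_sum, mul_sum, principalPart,
      add_sub_right_comm, ← Finset.sum_sub_distrib, sum_eq_zero fun s _ => ?_, zero_add,
      ← mul_assoc, ← mul_assoc, ← exp_add, ← exp_add]
    · congr 2; ring
    · have e1 : exp ((D.mu j - N) * w) * (exp (-D.mu j * (w + D.baseLog j)) *
          (D.borelCoeff j s * exp (s * (w + D.baseLog j)))) =
          D.borelCoeff j s * exp ((D.mu j - N) * w + -D.mu j * (w + D.baseLog j) +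
            s * (w + D.baseLog j)) := by rw [exp_add, exp_add]; ring
      rw [e1, mul_assoc, ← exp_add, ← mul_sub]
      have e2 : (D.mu j - N) * w + -D.mu j * (w + D.baseLog j) + s * (w + D.baseLog j) =
          (s - D.mu j) * D.baseLog j + (s - N) * w := by ring
      rw [e2, sub_self, mul_zero]
  rw [h1, norm_mul]
  exact mul_le_mul_of_nonneg_left (hC _ hre) (norm_nonneg _)

theorem exists_norm_scaledTail_le_exp (j : Fin n) {N : ℕ} (hN : D.growth < (N : ℝ) - (D.mu j).re)
    (θ : ℝ) : ∃ δ > 0, ∃ X C κ : ℝ, 0 < κ ∧ κ ≤ 1 ∧ ∀ w ∈ D.star j, |w.im - θ| < δ → X ≤ w.re →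
      ‖D.scaledTail j N w‖ ≤ C * Real.exp (-κ * w.re) := by
  set q : ℝ := N - (D.mu j).re with hq
  obtain ⟨δ, hδ, X, C, hgr⟩ := D.exists_borel_growth j (ε := (q - D.growth) / 2) (by linarith) θ
  set κ := min 1 ((q - D.growth) / 2) with hκ
  have hκ0 : 0 < κ := lt_min one_pos (by linarith)
  set E := Real.exp (|(D.mu j - N).im| * (δ + |θ|)) with hE
  set P := ∑ s ∈ range N, ‖D.borelCoeff j s * exp ((s - D.mu j) * D.baseLog j)‖ with hP
  refine ⟨δ, hδ, max X 0, E * max C 0 + P, κ, hκ0, min_le_left _ _, fun w hw him hre => ?_⟩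
  rw [max_le_iff] at hre
  have hB : |w.im| ≤ δ + |θ| := by
    have := abs_add_le (w.im - θ) θ
    rw [sub_add_cancel] at this; linarith
  rw [scaledTail, add_mul]
  refine (norm_sub_le _ _).trans (add_le_add ?_ ?_)
  · rw [norm_mul]
    have h1 := norm_exp_mul_le (D.mu j - N) hB
    have h2 : ‖D.borel j w‖ ≤ max C 0 * Real.exp ((D.growth + (q - D.growth) / 2) * w.re) :=
      (hgr w hw him hre.1).trans (by gcongr; exact le_max_left _ _)
    have h3 : (D.mu j - N).re * w.re + (D.growth + (q - D.growth) / 2) * w.re ≤ -κ * w.re := by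
      have h4 : κ ≤ (q - D.growth) / 2 := min_le_right _ _
      have h5 : (D.mu j - N).re = -q := by simp [hq]
      rw [h5]; nlinarith [hre.2]
    calc _ ≤ E * Real.exp ((D.mu j - N).re * w.re) *
          (max C 0 * Real.exp ((D.growth + (q - D.growth) / 2) * w.re)) := by gcongr
      _ = E * max C 0 * Real.exp ((D.mu j - N).re * w.re + (D.growth + (q - D.growth) / 2) * w.re) := by
        rw [Real.exp_add]; ring
      _ ≤ _ := by gcongr
  · rw [principalPart, hP, sum_mul]
    refine norm_sum_le_of_le _ fun s hs => ?_
    rw [norm_mul]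
    refine mul_le_mul_of_nonneg_left ?_ (norm_nonneg _)
    rw [norm_exp, exp_le_exp]
    have h1 : ((s - N : ℂ) * w).re = ((s : ℝ) - N) * w.re := by
      have : (s - N : ℂ) = ((s - N : ℝ) : ℂ) := by push_cast; ring
      rw [this, re_ofReal_mul]
    have h2 : (s : ℝ) + 1 ≤ N := by exact_mod_cast Finset.mem_range.1 hs
    have h3 : κ ≤ 1 := min_le_left _ _
    rw [h1]; nlinarith [hre.2]

/-- Uniform decay of the integrand near a direction. -/
theorem exists_hyperIntegrand_bound {j : Fin n} {N : ℕ} (hN : max 0 D.growth < (N : ℝ) - (D.mu j).re)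
    {logu : ℂ} {θ : ℝ} (hθ : |θ + logu.im| < 3 * π / 2) : ∃ δ > 0, ∃ X C κ F : ℝ, 0 < κ ∧
      ∀ w : ℂ, |w.im - θ| < δ → |(w + logu).im| < 3 * π / 2 ∧ (w.im ≠ θ → ¬ D.IsCutAngle j w.im) ∧
        ‖exp w * hyperF (N - D.mu j + 1) (w + logu)‖ ≤ F ∧
        (w ∈ D.star j → X ≤ |w.re| → ‖D.hyperIntegrand j N logu w‖ ≤ C * Real.exp (-κ * |w.re|)) := by
  rw [max_lt_iff] at hN
  rw [abs_lt] at hθ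
  have hM : 1 < ((N : ℂ) - D.mu j + 1).re := by simp; linarith [hN.1]
  obtain ⟨δ₁, hδ₁, X₁, C₁, κ, hκ, hκ1, h1⟩ := D.exists_norm_scaledTail_le_exp j hN.2 θ
  obtain ⟨X₂, C₂, h2⟩ := D.exists_norm_scaledTail_le j N
  obtain ⟨δ₂, hδ₂, hcut⟩ := D.exists_strip j θ
  set δ₃ := min (3 * π / 2 - (θ + logu.im)) (θ + logu.im + 3 * π / 2) / 2 with hδ₃
  have hmin1 := min_le_left (3 * π / 2 - (θ + logu.im)) (θ + logu.im + 3 * π / 2)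
  have hmin2 := min_le_right (3 * π / 2 - (θ + logu.im)) (θ + logu.im + 3 * π / 2)
  have hmin0 : 0 < min (3 * π / 2 - (θ + logu.im)) (θ + logu.im + 3 * π / 2) :=
    lt_min (by linarith) (by linarith)
  have hδ₃0 : 0 < δ₃ := by positivity
  obtain ⟨C₃, h3⟩ := exists_hyperF_bounds hM (a := θ + logu.im - δ₃) (b := θ + logu.im + δ₃)
    (by linarith) (by linarith)
  have hC₃ : 0 ≤ C₃ := (norm_nonneg _).trans (h3 ((θ + logu.im : ℝ) * I)
    (by simp; linarith) (by simp; linarith)).1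
  have hC₂ : 0 ≤ C₂ := (norm_nonneg _).trans (h2 X₂ (by simp))
  set U := ‖exp (-logu)‖ with hU
  refine ⟨min (min δ₁ δ₂) δ₃, lt_min (lt_min hδ₁ hδ₂) hδ₃0, max |X₁| |X₂|,
    max (|C₁| * (U * C₃)) (C₂ * C₃), κ, U * C₃, hκ, fun w hw => ?_⟩
  rw [lt_min_iff, lt_min_iff] at hw
  obtain ⟨⟨hw1, hw2⟩, hw3⟩ := hw
  have him : (w + logu).im = w.im + logu.im := by simp
  rw [abs_lt] at hw3
  obtain ⟨hF1, hF2⟩ := h3 (w + logu) (by rw [him]; linarith) (by rw [him]; linarith)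
  have hF : ‖exp w * hyperF (N - D.mu j + 1) (w + logu)‖ ≤ U * C₃ := by
    have : exp w = exp (-logu) * exp (w + logu) := by rw [← exp_add]; congr 1; ring
    rw [this, mul_assoc, norm_mul]
    gcongr
  refine ⟨by rw [him, abs_lt]; constructor <;> linarith, fun hne => hcut _ hne hw2, hF, fun hs hX => ?_⟩
  rw [max_le_iff] at hX
  rcases le_total 0 w.re with h | h
  · rw [abs_of_nonneg h] at hX ⊢
    have h4 : ‖D.scaledTail j N w‖ ≤ |C₁| * Real.exp (-κ * w.re) :=
      (h1 w hs hw1 ((le_abs_self _).trans hX.1)).trans (by gcongr; exact le_abs_self _)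
    rw [hyperIntegrand, mul_comm (exp w), mul_assoc, norm_mul]
    calc _ ≤ |C₁| * Real.exp (-κ * w.re) * (U * C₃) := by gcongr
      _ = |C₁| * (U * C₃) * Real.exp (-κ * w.re) := by ring
      _ ≤ _ := by gcongr; exact le_max_left _ _
  · rw [abs_of_nonpos h] at hX ⊢
    have h4 := h2 w (by linarith [neg_abs_le X₂, hX.2])
    rw [hyperIntegrand, mul_assoc, norm_mul, norm_mul, norm_exp]
    have h5 : Real.exp w.re ≤ Real.exp (-κ * -w.re) := by rw [exp_le_exp]; nlinarith
    calc _ ≤ Real.exp (-κ * -w.re) * (C₂ * C₃) := by gcongr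
      _ = C₂ * C₃ * Real.exp (-κ * -w.re) := by ring
      _ ≤ _ := by gcongr; exact le_max_right _ _

/-- The integral does not change as long as no singular direction is crossed. -/
theorem exists_rayIntegral_eq {j : Fin n} {N : ℕ} (hN : max 0 D.growth < (N : ℝ) - (D.mu j).re)
    {logu : ℂ} {θ : ℝ} (hθ : |θ + logu.im| < 3 * π / 2) : ∃ δ > 0, ∀ a b : ℝ, a ≤ b →
      θ - δ < a → b < θ + δ → (θ ∈ Icc a b → ¬ D.IsCutAngle j θ) →
      Integrable (fun x : ℝ => D.hyperIntegrand j N logu (x + a * I)) ∧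
      D.rayIntegral j N logu a = D.rayIntegral j N logu b := by
  obtain ⟨δ, hδ, X, C, κ, F, hκ, h⟩ := D.exists_hyperIntegrand_bound hN hθ
  have hM : 0 < ((N : ℂ) - D.mu j + 1).re := by
    rw [max_lt_iff] at hN; simp; linarith [hN.1]
  refine ⟨δ, hδ, fun a b hab ha hb hcut => ?_⟩
  have hin : ∀ w : ℂ, a ≤ w.im → w.im ≤ b → |w.im - θ| < δ ∧ w ∈ D.star j := fun w h1 h2 => by
    have h3 : |w.im - θ| < δ := by rw [abs_lt]; constructor <;> linarith
    refine ⟨h3, D.mem_star_of_not_isCutAngle ?_⟩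
    by_cases h4 : w.im = θ
    · rw [h4]; exact hcut ⟨by linarith, by linarith⟩
    · exact (h w h3).2.1 h4
  have hd : DifferentiableOn ℂ (D.hyperIntegrand j N logu) {w | a ≤ w.im ∧ w.im ≤ b} := fun w hw => by
    obtain ⟨h1, h2⟩ := hin w hw.1 hw.2
    exact (D.differentiableAt_hyperIntegrand hM h2 (h w h1).1).differentiableWithinAt
  have hb' : ∀ w : ℂ, a ≤ w.im → w.im ≤ b → X ≤ |w.re| →
      ‖D.hyperIntegrand j N logu w‖ ≤ C * Real.exp (-κ * |w.re|) := fun w h1 h2 hX => by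
    obtain ⟨h3, h4⟩ := hin w h1 h2
    exact (h w h3).2.2.2 h4 hX
  refine ⟨?_, integral_horizontal_line_eq hab hκ hd hb'⟩
  obtain ⟨C', -, h'⟩ := exists_global_exp_bound hd.continuousOn hb'
  refine integrable_of_exp_bound (continuous_horizontal_line hd.continuousOn
    (fun x => by simpa using hab)).aestronglyMeasurable hκ (C := C') fun x => ?_
  simpa using h' (x + a * I) (by simp) (by simpa using hab)

/-- Majorant for the integrand near a singular direction. -/
theorem exists_hyperIntegrand_majorant {j : Fin n} {N : ℕ}
    (hN : max 0 D.growth < (N : ℝ) - (D.mu j).re) {logu : ℂ} {θ : ℝ}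
    (hθ : |θ + logu.im| < 3 * π / 2) {σ : ℝ} (hσ : σ = 1 ∨ σ = -1)
    (hmild : ∀ p ∈ D.rayFinset j θ, D.sideCoeff σ j θ j p = 0 ∨ (D.mu p).re < 1) :
    ∃ G : ℝ → ℝ, Integrable G ∧ ∃ ε₀ > 0, ∀ ε : ℝ, 0 < ε → ε < ε₀ → ∀ᵐ x : ℝ,
      ‖D.hyperIntegrand j N logu (x + (θ + σ * ε : ℝ) * I)‖ ≤ G x := by
  obtain ⟨δ, hδ, X, C, κ, F, hκ, h⟩ := D.exists_hyperIntegrand_bound hN hθ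
  obtain ⟨g, hg, hg0, ε₀, hε₀, hmaj⟩ := D.exists_majorant (A := -X) (X := X) hσ (D.onRay_self j θ)
    (by simp [Real.exp_nonneg]) fun p hp _ => hmild p hp
  have hK : IsCompact (Icc (-X) X ×ℂ Icc (θ - δ) (θ + δ)) := isCompact_Icc.reProdIm isCompact_Icc
  obtain ⟨E₁, hE₁⟩ := hK.exists_bound_of_continuousOn
    (f := fun w => exp ((D.mu j - N) * w)) (by fun_prop)
  obtain ⟨E₂, hE₂⟩ := hK.exists_bound_of_continuousOn
    (D.differentiable_principalPart j N).continuous.continuousOn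
  have hF0 : 0 ≤ F := (norm_nonneg _).trans (h (θ * I) (by simpa using hδ)).2.2.1
  refine ⟨fun x => |C| * Real.exp (-κ * |x|) + (Icc (-X) X).indicator
    (fun x => (|E₁| * g x + |E₂|) * F) x, ?_, min (min ε₀ δ) π,
    lt_min (lt_min hε₀ hδ) pi_pos, fun ε h0 h1 => ?_⟩
  · refine ((integrable_exp_neg_mul_abs hκ).const_mul _).add ?_
    rw [integrable_indicator_iff measurableSet_Icc]
    exact ((hg.integrableOn.const_mul _).add (integrableOn_const (by simp) (by simp))).mul_const _
  · rw [lt_min_iff, lt_min_iff] at h1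
    have hσε : |σ * ε| = ε := by rcases hσ with rfl | rfl <;> simp [h0.le]
    filter_upwards [hmaj] with x hx
    set w : ℂ := x + (θ + σ * ε : ℝ) * I with hw
    have hre : w.re = x := by rw [hw, add_re, re_ofReal_mul]; simp
    have him : w.im = θ + σ * ε := by rw [hw, add_im, im_ofReal_mul]; simp
    have hwδ : |w.im - θ| < δ := by rw [him, add_sub_cancel_left, hσε]; exact h1.1.2
    obtain ⟨-, hcut, hF, hdec⟩ := h w hwδ
    have hstar : w ∈ D.star j := D.mem_star_of_not_isCutAngle (hcut (by
      rw [him]; intro h'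
      have h2 : σ * ε = 0 := by linarith
      rw [h2, abs_zero] at hσε; linarith))
    have hpos : ∀ y, 0 ≤ (Icc (-X) X).indicator (fun x => (|E₁| * g x + |E₂|) * F) y := fun y =>
      indicator_nonneg (fun z _ => by have := hg0 z; positivity) y
    rcases le_or_gt X |x| with hX | hX
    · have h3 := hdec hstar (by rwa [hre])
      rw [hre] at h3
      have h4 := hpos x
      have h5 : C * Real.exp (-κ * |x|) ≤ |C| * Real.exp (-κ * |x|) := by gcongr; exact le_abs_self C
      linarith
    · have hxX : x ∈ Icc (-X) X := abs_le.1 hX.le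
      have hwK : w ∈ Icc (-X) X ×ℂ Icc (θ - δ) (θ + δ) := by
        rw [mem_reProdIm, hre]
        have := abs_lt.1 hwδ
        exact ⟨hxX, by constructor <;> linarith⟩
      rw [indicator_of_mem hxX]
      have hy : ‖D.borel j w‖ ≤ g x := by
        have h3 := hx hxX ε h0 h1.1.1
        rw [raySol] at h3
        have h4 : rayLog θ ‖D.lam j - D.lam j‖ (exp (x + (σ * ε : ℝ) * I)) = w := by
          have h5 := abs_lt.1 (hσε.trans_lt h1.2)
          have h6 : ((x : ℂ) + (σ * ε : ℝ) * I).im = σ * ε := by rw [add_im, im_ofReal_mul]; simp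
          rw [rayLog, sub_self, norm_zero, ofReal_zero, sub_zero,
            log_exp (by rw [h6]; exact h5.1) (by rw [h6]; exact h5.2.le), hw]
          push_cast; ring
        rwa [h4, ← D.borel_eq hstar] at h3
      have h3 : ‖D.scaledTail j N w‖ ≤ |E₁| * g x + |E₂| := by
        rw [scaledTail]
        refine (norm_sub_le _ _).trans (add_le_add ?_ ((hE₂ w hwK).trans (le_abs_self _)))
        rw [norm_mul]
        have h5 := (hE₁ w hwK).trans (le_abs_self _)
        gcongr
      rw [hyperIntegrand, mul_comm (exp w), mul_assoc, norm_mul]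
      have h6 : ‖D.scaledTail j N w‖ * ‖exp w * hyperF (N - D.mu j + 1) (w + logu)‖ ≤
        (|E₁| * g x + |E₂|) * F := by
        have := hg0 x
        gcongr
      have : 0 ≤ |C| * Real.exp (-κ * |x|) := by positivity
      linarith

/-- Boundary values of the integrand. -/
theorem tendsto_hyperIntegrand {j : Fin n} {N : ℕ} (hM : 0 < ((N : ℂ) - D.mu j + 1).re) {logu : ℂ}
    {θ : ℝ} (hθ : |θ + logu.im| < 3 * π / 2) {σ : ℝ} (hσ : σ = 1 ∨ σ = -1) {x : ℝ}
    (hreg : D.IsRegularPoint j θ (Real.exp x : ℝ)) :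
    Tendsto (fun ε : ℝ => D.hyperIntegrand j N logu (x + (θ + σ * ε : ℝ) * I)) (𝓝[>] 0)
      (𝓝 (exp (x + θ * I) * (exp ((D.mu j - N) * (x + θ * I)) *
        sideLimit σ (D.raySol j θ j) (Real.exp x) 0 - D.principalPart j N (x + θ * I)) *
        hyperF (N - D.mu j + 1) (x + θ * I + logu))) := by
  have hw : Tendsto (fun ε : ℝ => (x + (θ + σ * ε : ℝ) * I : ℂ)) (𝓝[>] 0)
      (𝓝 (x + θ * I)) := by
    have : Continuous fun ε : ℝ => (x + (θ + σ * ε : ℝ) * I : ℂ) := by fun_prop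
    have h := this.tendsto 0
    simp only [mul_zero, add_zero] at h
    exact h.mono_left nhdsWithin_le_nhds
  have hb : Tendsto (fun ε : ℝ => D.borel j (x + (θ + σ * ε : ℝ) * I)) (𝓝[>] 0)
      (𝓝 (sideLimit σ (D.raySol j θ j) (Real.exp x) 0)) := by
    obtain ⟨δ, hδ, hstrip⟩ := D.exists_strip j θ
    refine ((D.tendsto_raySol hσ (D.onRay_self j θ) (by simp [Real.exp_nonneg]) hreg).comp
      (tendsto_exp_halfPlane hσ x)).congr' ?_
    filter_upwards [Ioo_mem_nhdsGT (lt_min hδ pi_pos)] with ε hε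
    have h1 := lt_min_iff.1 hε.2
    have hσε : |σ * ε| = ε := by rcases hσ with rfl | rfl <;> simp [hε.1.le]
    have him : ((x : ℂ) + (θ + σ * ε : ℝ) * I).im = θ + σ * ε := by rw [add_im, im_ofReal_mul]; simp
    have h6 : ((x : ℂ) + (σ * ε : ℝ) * I).im = σ * ε := by rw [add_im, im_ofReal_mul]; simp
    have h5 := abs_lt.1 (hσε.trans_lt h1.2)
    have hstar : ((x : ℂ) + (θ + σ * ε : ℝ) * I) ∈ D.star j := by
      refine D.mem_star_of_not_isCutAngle (hstrip _ ?_ ?_)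
      · rw [him]; intro h'
        have h2 : σ * ε = 0 := by linarith
        rw [h2, abs_zero] at hσε; linarith [hε.1]
      · rw [him, add_sub_cancel_left, hσε]; exact h1.1
    have h7 : (x + (σ * ε : ℝ) * I + θ * I : ℂ) = x + (θ + σ * ε : ℝ) * I := by push_cast; ring
    rw [D.borel_eq hstar, Function.comp_apply, raySol, rayLog, sub_self, norm_zero, ofReal_zero,
      sub_zero, log_exp (by rw [h6]; exact h5.1) (by rw [h6]; exact h5.2.le), h7]
  have hF : ContinuousAt (fun w => hyperF (N - D.mu j + 1) (w + logu)) (x + θ * I) :=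
    (DifferentiableAt.comp (g := hyperF (N - D.mu j + 1)) (f := fun w => w + logu) (x + θ * I)
      (differentiableAt_hyperF hM (by simpa using hθ)) (by fun_prop)).continuousAt
  have hE : Continuous fun w : ℂ => exp ((D.mu j - N) * w) := by fun_prop
  exact (((continuous_exp.tendsto _).comp hw).mul ((((hE.tendsto _).comp hw).mul hb).sub
    (((D.differentiable_principalPart j N).continuous.tendsto _).comp hw))).mul (hF.tendsto.comp hw)

end InverseFactorialData

namespace InverseFactorialData

variable {n : ℕ} (D : InverseFactorialData n)

theorem IsCutAngle.exists_onRay {D : InverseFactorialData n} {j : Fin n} {α : ℝ}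
    (h : D.IsCutAngle j α) : ∃ l, l ≠ j ∧ D.OnRay j α l := by
  obtain ⟨l, hl, h⟩ := h
  have : ((‖D.lam l - D.lam j‖ : ℝ) : ℂ) ≠ 0 := by
    exact_mod_cast norm_ne_zero_iff.2 (D.lam_sub_ne_zero hl)
  exact ⟨l, hl, by rw [OnRay, h, mul_div_cancel₀ _ this]; ring⟩

theorem exists_not_isCutAngle (j : Fin n) {a b : ℝ} (h : a < b) :
    ∃ α, a < α ∧ α < b ∧ ¬ D.IsCutAngle j α := by
  obtain ⟨δ, hδ, hs⟩ := D.exists_strip j a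
  have h1 : 0 < min δ (b - a) := lt_min hδ (by linarith)
  have h2 := min_le_left δ (b - a)
  have h3 := min_le_right δ (b - a)
  refine ⟨a + min δ (b - a) / 2, by linarith, by linarith, hs _ (by linarith) ?_⟩
  rw [add_sub_cancel_left, abs_of_pos (by linarith)]; linarith

theorem Admissible.not_isCutAngle {D : InverseFactorialData n} [Fact (2 ≤ n)] {η : ℝ}
    (hη : D.Admissible η) (j : Fin n) : ¬ D.IsCutAngle j η := fun h => by
  obtain ⟨l, hl, h⟩ := h.exists_onRay
  have := D.theta_eq_of_onRay (η := η) ⟨by linarith [pi_pos], le_rfl⟩ hl h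
  exact (D.theta_lt hη hl).ne this

theorem Admissible.not_isCutAngle_sub {D : InverseFactorialData n} [Fact (2 ≤ n)] {η : ℝ}
    (hη : D.Admissible η) (j : Fin n) : ¬ D.IsCutAngle j (η - 2 * π) := fun ⟨l, hl, h⟩ => by
  refine hη.not_isCutAngle j ⟨l, hl, ?_⟩
  rw [← h, ← exp_periodic.sub_eq]
  congr 1; push_cast; ring

variable [Fact (2 ≤ n)]

/-- The factor in the relation between `y_j` and `y_l`. -/
noncomputable def jumpFactor (j : Fin n) : ℂ := (2 * π * I) ^ 2 / (exp (2 * π * I * D.mu j) - 1)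

omit [Fact (2 ≤ n)] in
theorem jumpFactor_ne_zero (j : Fin n) : D.jumpFactor j ≠ 0 :=
  div_ne_zero (pow_ne_zero _ two_pi_I_ne_zero) (sub_ne_zero.2 (D.exp_two_pi_mu_ne_one j))

theorem sideCoeff_eq (η : ℝ) {j l : Fin n} (hl : l ≠ j) :
    D.sideCoeff (-1) j (D.theta η j l) j l = D.connectionCoeff η l j *
      (2 * π * I / (exp (2 * π * I * D.mu j) - 1)) := by
  have h1 := sub_ne_zero.2 (D.exp_two_pi_mu_ne_one j)
  have h2 := two_pi_I_ne_zero
  rw [D.connectionCoeff_eq η hl]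
  field_simp

theorem jumpCoeff_eq (η : ℝ) {j l : Fin n} (hl : l ≠ j) :
    D.jumpCoeff j (D.theta η j l) l = D.jumpFactor j * D.connectionCoeff η l j * D.deltaFactor l := by
  have h2 := two_pi_I_ne_zero
  rw [jumpCoeff, D.sideCoeff_eq η hl, jumpFactor, deltaFactor]
  field_simp

/-- The boundary value of `hyperIntegrand` on a ray. -/
noncomputable def boundaryIntegrand (σ : ℝ) (j : Fin n) (N : ℕ) (logu : ℂ) (θ x : ℝ) : ℂ :=
  exp (x + θ * I) * (exp ((D.mu j - N) * (x + θ * I)) *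
    sideLimit σ (D.raySol j θ j) (Real.exp x) 0 - D.principalPart j N (x + θ * I)) *
    hyperF (N - D.mu j + 1) (x + θ * I + logu)

theorem exists_rayIntegral_eq_boundary {j : Fin n} {N : ℕ} (hN : max 0 D.growth < (N : ℝ) - (D.mu j).re)
    {logu : ℂ} {θ : ℝ} (hθ : |θ + logu.im| < 3 * π / 2) {σ : ℝ} (hσ : σ = 1 ∨ σ = -1)
    (hmild : ∀ p ∈ D.rayFinset j θ, D.sideCoeff σ j θ j p = 0 ∨ (D.mu p).re < 1) :
    Integrable (D.boundaryIntegrand σ j N logu θ) ∧ ∃ δ > 0, ∀ ε, 0 < ε → ε < δ →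
      D.rayIntegral j N logu (θ + σ * ε) = ∫ x, D.boundaryIntegrand σ j N logu θ x := by
  have hM : 0 < ((N : ℂ) - D.mu j + 1).re := by
    rw [max_lt_iff] at hN; simp; linarith [hN.1]
  obtain ⟨δ, hδ, h⟩ := D.exists_rayIntegral_eq hN hθ
  obtain ⟨G, hG, ε₀, hε₀, hmaj⟩ := D.exists_hyperIntegrand_majorant hN hθ hσ hmild
  set f : ℝ → ℝ → ℂ := fun ε x => D.hyperIntegrand j N logu (x + (θ + σ * ε : ℝ) * I) with hf
  have hside : ∀ ε, 0 < ε → ε < δ → Integrable (f ε) ∧ ∀ ε', 0 < ε' → ε' < δ →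
      D.rayIntegral j N logu (θ + σ * ε) = D.rayIntegral j N logu (θ + σ * ε') := by
    intro ε h1 h2
    have key : ∀ ε ε', 0 < ε → ε < δ → 0 < ε' → ε' < δ → θ + σ * ε ≤ θ + σ * ε' →
        Integrable (f ε) ∧ D.rayIntegral j N logu (θ + σ * ε) = D.rayIntegral j N logu (θ + σ * ε') := by
      intro ε ε' h1 h2 h3 h4 h5
      refine h _ _ h5 ?_ ?_ ?_ <;> rcases hσ with rfl | rfl
      · linarith
      · linarith
      · linarith
      · linarith
      · intro h6; linarith [h6.1]
      · intro h6; linarith [h6.2]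
    refine ⟨(key ε ε h1 h2 h1 h2 le_rfl).1, fun ε' h3 h4 => ?_⟩
    rcases le_total (θ + σ * ε) (θ + σ * ε') with h5 | h5
    · exact (key _ _ h1 h2 h3 h4 h5).2
    · exact (key _ _ h3 h4 h1 h2 h5).2.symm
  have hsmall : ∀ᶠ ε : ℝ in 𝓝[>] 0, 0 < ε ∧ ε < δ ∧ ε < ε₀ := by
    filter_upwards [Ioo_mem_nhdsGT (lt_min hδ hε₀)] with ε hε
    exact ⟨hε.1, lt_min_iff.1 hε.2⟩
  have hlim : ∀ᵐ x : ℝ, Tendsto (fun ε => f ε x) (𝓝[>] 0) (𝓝 (D.boundaryIntegrand σ j N logu θ x)) := by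
    filter_upwards [D.ae_isRegularPoint j θ] with x hx
    exact D.tendsto_hyperIntegrand hM hθ hσ hx
  have hmeas : ∀ᶠ ε : ℝ in 𝓝[>] 0, AEStronglyMeasurable (f ε) := by
    filter_upwards [hsmall] with ε hε
    exact (hside ε hε.1 hε.2.1).1.aestronglyMeasurable
  have hbound : ∀ᶠ ε : ℝ in 𝓝[>] 0, ∀ᵐ x : ℝ, ‖f ε x‖ ≤ G x := by
    filter_upwards [hsmall] with ε hε
    exact hmaj ε hε.1 hε.2.2
  have hint := tendsto_integral_filter_of_dominated_convergence G hmeas hbound hG hlim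
  refine ⟨?_, δ, hδ, fun ε h1 h2 => ?_⟩
  · obtain ⟨u, hu⟩ := exists_seq_tendsto (𝓝[>] (0 : ℝ))
    have h3 : AEStronglyMeasurable (D.boundaryIntegrand σ j N logu θ) :=
      aestronglyMeasurable_of_tendsto_ae (u := 𝓝[>] (0 : ℝ))
        (f := fun ε => (Ioo 0 δ).indicator (fun ε => f ε) ε) (fun ε => by
          by_cases h : ε ∈ Ioo 0 δ
          · rw [indicator_of_mem h]; exact (hside ε h.1 h.2).1.aestronglyMeasurable
          · rw [indicator_of_notMem h]; exact aestronglyMeasurable_const) (by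
        filter_upwards [hlim] with x hx
        refine hx.congr' ?_
        filter_upwards [Ioo_mem_nhdsGT hδ] with ε hε
        rw [indicator_of_mem hε])
    refine hG.mono' h3 ?_
    have h4 : ∀ᵐ x : ℝ, ∀ k : ℕ, 0 < u k ∧ u k < ε₀ → ‖f (u k) x‖ ≤ G x := by
      rw [ae_all_iff]
      intro k
      by_cases hk : 0 < u k ∧ u k < ε₀
      · filter_upwards [hmaj _ hk.1 hk.2] with x hx _ using hx
      · exact .of_forall fun x h => absurd h hk
    filter_upwards [hlim, h4] with x h5 h6
    refine le_of_tendsto (h5.comp hu).norm ?_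
    filter_upwards [hu.eventually hsmall] with k hk
    exact h6 k ⟨hk.1, hk.2.2⟩
  · refine tendsto_nhds_unique (tendsto_const_nhds.congr' ?_) hint
    filter_upwards [hsmall] with ε' hε'
    exact (hside ε h1 h2).2 ε' hε'.1 hε'.2.1

/-- The bound for the contribution of `λ_l`. -/
noncomputable def jumpBound (η : ℝ) (N : ℕ) (logu : ℂ) (j l : Fin n) : ℝ≥0∞ :=
  ‖D.jumpFactor j * exp (-logu)‖ₑ * (‖D.connectionCoeff η l j‖ₑ *
    ‖exp ((D.mu j - N) * D.logDiff η l j)‖ₑ * D.deltaIntegral η N l j *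
    hyperterminantSup (N - D.mu j + 1) (D.theta η j l + logu.im))

theorem lintegral_jump_le (η : ℝ) {j l : Fin n} (hl : l ≠ j) {N : ℕ}
    (hM : 1 < ((N : ℂ) - D.mu j + 1).re) {logu : ℂ}
    (hθ : |D.theta η j l + logu.im| < 3 * π / 2) :
    ∫⁻ x in Ioi (Real.log ‖D.lam l - D.lam j‖), ‖exp (x + D.theta η j l * I) *
      (exp ((D.mu j - N) * (x + D.theta η j l * I)) *
        (D.jumpCoeff j (D.theta η j l) l * D.raySide j (D.theta η j l) l x)) *
      hyperF (N - D.mu j + 1) (x + D.theta η j l * I + logu)‖ₑ ≤ D.jumpBound η N logu j l := by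
  set θ := D.theta η j l with hθdef
  set b := Real.log ‖D.lam l - D.lam j‖ with hb
  have hS := hyperterminantSup_lt_top hM hθ
  rw [jumpBound, D.deltaIntegral_eq η N hl, ← hθdef, ← hb]
  set S := hyperterminantSup (N - D.mu j + 1) (θ + logu.im) with hSdef
  set K := D.connectionCoeff η l j with hK
  have e1 : ∀ A B C E J : ℝ≥0∞, A * (B * C * J * E) = A * B * C * E * J := fun A B C E J => by ring
  rw [e1, ← lintegral_const_mul' _ _ (by finiteness)]
  refine lintegral_mono fun x => ?_
  rw [D.jumpCoeff_eq η hl]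
  set w : ℂ := x + θ * I with hw
  have h1 : ‖exp w * hyperF (N - D.mu j + 1) (w + logu)‖ₑ ≤ ‖exp (-logu)‖ₑ * S := by
    have : exp w = exp (-logu) * exp (w + logu) := by rw [← exp_add]; congr 1; ring
    have him : (w + logu).im = θ + logu.im := by simp [hw]
    have h2 := le_hyperterminantSup hM (w := w + logu) (by rwa [him])
    rw [him] at h2
    rw [this, mul_assoc, enorm_mul]
    gcongr
  have h3 : ‖exp ((D.mu j - N) * w)‖ₑ = ‖exp ((D.mu j - N) * D.logDiff η l j)‖ₑ *
      ENNReal.ofReal (Real.exp (-(N - (D.mu j).re) * (x - b))) := by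
    have h4 : (D.mu j - N) * w = (D.mu j - N) * D.logDiff η l j + (D.mu j - N) * (x - b : ℝ) := by
      rw [logDiff, hw, ← hθdef, ← hb]; push_cast; ring
    have h5 : ‖exp ((D.mu j - N) * (x - b : ℝ))‖ = Real.exp (-(N - (D.mu j).re) * (x - b)) := by
      rw [norm_exp, re_mul_ofReal]; simp
    rw [h4, exp_add, enorm_mul, ← h5, ofReal_norm]
  calc _ = ‖exp w * hyperF (N - D.mu j + 1) (w + logu)‖ₑ * ‖exp ((D.mu j - N) * w)‖ₑ *
        (‖D.jumpFactor j‖ₑ * ‖K‖ₑ * ‖D.deltaFactor l * D.raySide j θ l x‖ₑ) := by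
        simp only [enorm_mul]; ring
    _ ≤ ‖exp (-logu)‖ₑ * S * (‖exp ((D.mu j - N) * D.logDiff η l j)‖ₑ *
      ENNReal.ofReal (Real.exp (-(N - (D.mu j).re) * (x - b)))) *
        (‖D.jumpFactor j‖ₑ * ‖K‖ₑ * ‖D.deltaFactor l * D.raySide j θ l x‖ₑ) := by
        rw [h3]; gcongr
    _ = _ := by rw [enorm_mul (D.jumpFactor j)]; ring

/-- The jump of the ray integrals across a singular direction. -/
theorem exists_enorm_rayIntegral_sub_le {η : ℝ} {j : Fin n}
    (hθ : ∀ l₁ l₂ : Fin n, l₁ ≠ j → l₂ ≠ j → l₁ ≠ l₂ →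
      D.connectionCoeff η l₁ j ≠ 0 → D.connectionCoeff η l₂ j ≠ 0 → D.theta η j l₁ ≠ D.theta η j l₂)
    {N : ℕ} (hN : max 0 D.growth < (N : ℝ) - (D.mu j).re)
    (hμ : ∀ l : Fin n, l ≠ j → D.connectionCoeff η l j ≠ 0 → (D.mu l).re < 1)
    {logu : ℂ} {θ : ℝ} (hθη : θ ∈ Ioc (η - 2 * π) η) (hu : |θ + logu.im| < 3 * π / 2) :
    ∃ δ > 0, ∀ α β : ℝ, θ - δ < α → α < θ → θ < β → β < θ + δ →
      ‖D.rayIntegral j N logu β - D.rayIntegral j N logu α‖ₑ ≤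
        ∑ l with l ≠ j ∧ D.theta η j l = θ, D.jumpBound η N logu j l := by
  have hM : 1 < ((N : ℂ) - D.mu j + 1).re := by
    rw [max_lt_iff] at hN; simp; linarith [hN.1]
  have hray : ∀ {k}, k ∈ D.rayFinset j θ → k ≠ j ∧ D.theta η j k = θ := fun {k} hk => by
    rw [D.mem_rayFinset] at hk
    exact ⟨hk.1, D.theta_eq_of_onRay hθη hk.1 hk.2⟩
  by_cases hfin : ∀ l, l ≠ j → D.theta η j l = θ → D.connectionCoeff η l j ≠ 0 →
      D.deltaIntegral η N l j < ⊤
  swap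
  · push Not at hfin
    obtain ⟨l, hl, hlθ, hK, htop⟩ := hfin
    have : D.jumpBound η N logu j l = ⊤ := by
      have h1 := hyperterminantSup_ne_zero hM hu
      rw [← hlθ] at h1
      rw [jumpBound, top_le_iff.1 htop, ENNReal.mul_top, ENNReal.top_mul h1, ENNReal.mul_top]
      · simpa using D.jumpFactor_ne_zero j
      · simpa using hK
    refine ⟨1, one_pos, fun α β _ _ _ _ => le_top.trans ?_⟩
    rw [← this]
    exact Finset.single_le_sum (f := fun l => D.jumpBound η N logu j l) (fun _ _ => zero_le)
      (Finset.mem_filter.2 ⟨Finset.mem_univ _, hl, hlθ⟩)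
  have hmild1 : ∀ p ∈ D.rayFinset j θ, D.sideCoeff (-1) j θ j p = 0 ∨ (D.mu p).re < 1 := fun p hp => by
    obtain ⟨h1, h2⟩ := hray hp
    by_cases hK : D.connectionCoeff η p j = 0
    · left; rw [← h2, D.sideCoeff_eq η h1, hK, zero_mul]
    · exact Or.inr (hμ p h1 hK)
  have hmild2 : ∀ p ∈ D.rayFinset j θ, D.sideCoeff 1 j θ j p = 0 ∨ (D.mu p).re < 1 := fun p hp => by
    by_contra hbad
    push Not at hbad
    refine hbad.1 ?_
    have h3 := D.sideCoeff_add_sum hp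
    rw [(hmild1 p hp).resolve_right (not_lt.2 hbad.2), zero_mul, sum_eq_zero, add_zero] at h3
    · exact h3
    · intro k hk
      rw [Finset.mem_filter] at hk
      obtain ⟨h1, h2⟩ := hray hk.1
      by_cases hK : D.connectionCoeff η k j = 0
      · rw [← h2, D.jumpCoeff_eq η h1, hK, mul_zero, zero_mul, zero_mul]
      · have h4 := D.sideCoeff_eq_zero_or_of_deltaIntegral_lt_top h1 (hfin k h1 h2 hK)
          (by rw [h2]; exact hp) hk.2
        rw [h2] at h4
        rw [h4.resolve_right (not_lt.2 hbad.2), mul_zero]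
  obtain ⟨hi1, δ₁, hδ₁, h1⟩ := D.exists_rayIntegral_eq_boundary hN hu (Or.inr rfl) hmild1
  obtain ⟨hi2, δ₂, hδ₂, h2⟩ := D.exists_rayIntegral_eq_boundary hN hu (Or.inl rfl) hmild2
  refine ⟨min δ₁ δ₂, lt_min hδ₁ hδ₂, fun α β ha1 ha2 hb1 hb2 => ?_⟩
  have e1 := h1 (θ - α) (by linarith) (by linarith [min_le_left δ₁ δ₂])
  have e2 := h2 (β - θ) (by linarith) (by linarith [min_le_right δ₁ δ₂])
  rw [show θ + -1 * (θ - α) = α by ring] at e1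
  rw [show θ + 1 * (β - θ) = β by ring] at e2
  rw [e1, e2, ← integral_sub hi2 hi1]
  set J : Fin n → ℝ → ℂ := fun k x => exp (x + θ * I) * (exp ((D.mu j - N) * (x + θ * I)) *
        (D.jumpCoeff j θ k * D.raySide j θ k x)) *
      hyperF (N - D.mu j + 1) (x + θ * I + logu) with hJ
  have hdiff : ∀ᵐ x : ℝ, D.boundaryIntegrand 1 j N logu θ x - D.boundaryIntegrand (-1) j N logu θ x =
      -∑ k ∈ D.rayFinset j θ with ‖D.lam k - D.lam j‖ < Real.exp x, J k x := by
    filter_upwards [D.ae_isRegularPoint j θ] with x hx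
    have h3 := congrFun (D.isJump (exp_pos x) hx) 0
    rw [Pi.add_apply, Finset.sum_apply] at h3
    rw [boundaryIntegrand, boundaryIntegrand, ← h3, hJ]
    simp only [Pi.smul_apply, smul_eq_mul]
    rw [← sum_mul, ← mul_sum, ← mul_sum]
    simp only [raySide]
    ring
  have hzero : ∀ k ∈ D.rayFinset j θ, D.connectionCoeff η k j = 0 → ∀ x, J k x = 0 := fun k hk hK x => by
    obtain ⟨h3, h4⟩ := hray hk
    simp only [hJ]
    rw [← h4, D.jumpCoeff_eq η h3, hK]; simp
  by_cases hall : ∀ k ∈ D.rayFinset j θ, D.connectionCoeff η k j = 0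
  · rw [integral_eq_zero_of_ae, enorm_zero]
    · exact zero_le
    · filter_upwards [hdiff] with x hx
      rw [hx, sum_eq_zero, neg_zero]; · rfl
      intro k hk
      exact hzero k (Finset.mem_filter.1 hk).1 (hall k (Finset.mem_filter.1 hk).1) x
  push Not at hall
  obtain ⟨k, hk, hK⟩ := hall
  obtain ⟨h3, h4⟩ := hray hk
  have hsum : ∀ᵐ x : ℝ, ‖D.boundaryIntegrand 1 j N logu θ x - D.boundaryIntegrand (-1) j N logu θ x‖ₑ =
      (Ioi (Real.log ‖D.lam k - D.lam j‖)).indicator (fun x => ‖J k x‖ₑ) x := by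
    filter_upwards [hdiff] with x hx
    rw [hx, enorm_neg]
    have hiff : x ∈ Ioi (Real.log ‖D.lam k - D.lam j‖) ↔ ‖D.lam k - D.lam j‖ < Real.exp x :=
      log_lt_iff_lt_exp (D.norm_lam_sub_pos h3)
    have hother : ∀ p ∈ D.rayFinset j θ, p ≠ k → J p x = 0 := fun p hp hpk => by
      obtain ⟨h5, h6⟩ := hray hp
      by_contra hne
      exact hθ p k h5 h3 hpk (fun h7 => hne (hzero p hp h7 x)) hK (h6.trans h4.symm)
    by_cases hx' : ‖D.lam k - D.lam j‖ < Real.exp x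
    · rw [indicator_of_mem (hiff.2 hx'), Finset.sum_eq_single k]
      · intro p hp hpk; exact hother p (Finset.mem_filter.1 hp).1 hpk
      · intro hk'; exact absurd (Finset.mem_filter.2 ⟨hk, hx'⟩) hk'
    · rw [indicator_of_notMem (fun h => hx' (hiff.1 h)), sum_eq_zero, enorm_zero]
      intro p hp
      obtain ⟨h5, h6⟩ := Finset.mem_filter.1 hp
      exact hother p h5 fun h7 => hx' (h7 ▸ h6)
  refine (enorm_integral_le_lintegral_enorm _).trans ?_
  rw [lintegral_congr_ae hsum, lintegral_indicator measurableSet_Ioi]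
  refine le_trans ?_ (Finset.single_le_sum (f := fun l => D.jumpBound η N logu j l) (fun _ _ => zero_le)
    (Finset.mem_filter.2 ⟨Finset.mem_univ _, h3, h4⟩))
  have h5 := D.lintegral_jump_le η h3 hM (logu := logu) (by rwa [h4])
  rwa [h4] at h5

/-- The total jump of the ray integrals between two regular directions. -/
theorem enorm_rayIntegral_sub_le {η : ℝ} (hη : D.Admissible η) {j : Fin n}
    (hθ : ∀ l₁ l₂ : Fin n, l₁ ≠ j → l₂ ≠ j → l₁ ≠ l₂ →
      D.connectionCoeff η l₁ j ≠ 0 → D.connectionCoeff η l₂ j ≠ 0 → D.theta η j l₁ ≠ D.theta η j l₂)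
    {N : ℕ} (hN : max 0 D.growth < (N : ℝ) - (D.mu j).re)
    (hμ : ∀ l : Fin n, l ≠ j → D.connectionCoeff η l j ≠ 0 → (D.mu l).re < 1)
    {logu : ℂ} (hu : ∀ θ ∈ Icc (η - 2 * π) η, |θ + logu.im| < 3 * π / 2) :
    ‖D.rayIntegral j N logu η - D.rayIntegral j N logu (η - 2 * π)‖ₑ ≤
      ∑ l ∈ Finset.univ.erase j, D.jumpBound η N logu j l := by
  set J := D.rayIntegral j N logu
  set B : ℝ → ℝ → ℝ≥0∞ := fun α β =>
    ∑ l with l ≠ j ∧ α < D.theta η j l ∧ D.theta η j l < β, D.jumpBound η N logu j l with hB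
  have hloc : ∀ m ∈ Icc (η - 2 * π) η, ∃ δ > 0, ∀ α β : ℝ, ¬ D.IsCutAngle j α →
      ¬ D.IsCutAngle j β → α ≤ β → m - δ < α → β < m + δ → ‖J β - J α‖ₑ ≤ B α β := fun m hm => by
    obtain ⟨δ₁, hδ₁, h1⟩ := D.exists_rayIntegral_eq hN (hu m hm)
    by_cases hcut : D.IsCutAngle j m
    · have hm' : m ∈ Ioc (η - 2 * π) η := by
        refine ⟨lt_of_le_of_ne hm.1 fun h => hη.not_isCutAngle_sub j (h ▸ hcut), hm.2⟩
      obtain ⟨δ₂, hδ₂, h2⟩ := D.exists_enorm_rayIntegral_sub_le hθ hN hμ hm' (hu m hm)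
      refine ⟨min δ₁ δ₂, lt_min hδ₁ hδ₂, fun α β ha hb hab h3 h4 => ?_⟩
      have h5 := min_le_left δ₁ δ₂
      have h6 := min_le_right δ₁ δ₂
      by_cases hmem : m ∈ Icc α β
      · have h7 : α < m := lt_of_le_of_ne hmem.1 fun h => ha (h ▸ hcut)
        have h8 : m < β := lt_of_le_of_ne hmem.2 fun h => hb (h ▸ hcut)
        refine (h2 α β (by linarith) h7 h8 (by linarith)).trans ?_
        refine Finset.sum_le_sum_of_subset fun l hl => ?_
        simp only [Finset.mem_filter, Finset.mem_univ, true_and] at hl ⊢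
        rw [hl.2]; exact ⟨hl.1, h7, h8⟩
      · have h7 := (h1 α β hab (by linarith) (by linarith) fun h => absurd h hmem).2
        rw [show J β = J α from h7.symm, sub_self, enorm_zero]; exact zero_le
    · refine ⟨δ₁, hδ₁, fun α β _ _ hab h3 h4 => ?_⟩
      rw [show J β = J α from (h1 α β hab h3 h4 fun _ => hcut).2.symm, sub_self, enorm_zero]
      exact zero_le
  have htrans : ∀ α β γ : ℝ, α ≤ β → β ≤ γ → B α β + B β γ ≤ B α γ := fun α β γ h1 h2 => by
    simp only [hB]
    rw [← Finset.sum_union]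
    · refine Finset.sum_le_sum_of_subset fun l hl => ?_
      simp only [Finset.mem_union, Finset.mem_filter, Finset.mem_univ, true_and] at hl ⊢
      rcases hl with ⟨h3, h4, h5⟩ | ⟨h3, h4, h5⟩
      · exact ⟨h3, h4, h5.trans_le h2⟩
      · exact ⟨h3, h1.trans_lt h4, h5⟩
    · rw [Finset.disjoint_filter]
      rintro l - ⟨-, -, h3⟩ ⟨-, h4, -⟩
      exact lt_asymm h3 h4
  choose! δ hδ hδloc using hloc
  obtain ⟨r, hr, hleb⟩ := lebesgue_number_lemma_of_metric (s := Icc (η - 2 * π) η)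
    (c := fun m : Icc (η - 2 * π) η => ball (m : ℝ) (δ m)) isCompact_Icc
    (fun _ => isOpen_ball) fun m hm => mem_iUnion.2 ⟨⟨m, hm⟩, mem_ball_self (hδ m hm)⟩
  have hstep : ∀ α β : ℝ, ¬ D.IsCutAngle j α → ¬ D.IsCutAngle j β → η - 2 * π ≤ α → α ≤ β →
      β ≤ η → β - α < r → ‖J β - J α‖ₑ ≤ B α β := fun α β ha hb h1 h2 h3 h4 => by
    obtain ⟨m, hm⟩ := hleb α ⟨h1, h2.trans h3⟩
    have h5 := hm (mem_ball_self hr)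
    have h6 : β ∈ ball (m : ℝ) (δ m) := hm (by
      rw [mem_ball, Real.dist_eq, abs_of_nonneg (by linarith)]; exact h4)
    rw [Real.ball_eq_Ioo] at h5 h6
    exact hδloc m m.2 α β ha hb h2 h5.1 h6.2
  have hind : ∀ k : ℕ, ∀ β : ℝ, ¬ D.IsCutAngle j β → η - 2 * π ≤ β → β ≤ η →
      β - (η - 2 * π) < k * (r / 2) →
      ‖J β - J (η - 2 * π)‖ₑ ≤ B (η - 2 * π) β := by
    intro k
    induction k with
    | zero => intro β _ h1 _ h2; norm_num at h2; linarith
    | succ k ih =>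
      intro β hb h1 h2 h3
      by_cases h4 : β - (η - 2 * π) < r
      · exact hstep _ _ (hη.not_isCutAngle_sub j) hb le_rfl h1 h2 h4
      obtain ⟨γ, h5, h6, h7⟩ := D.exists_not_isCutAngle j (a := β - r) (b := β - r / 2) (by linarith)
      have h8 : η - 2 * π ≤ γ := by linarith
      push_cast at h3
      have h9 := ih γ h7 h8 (by linarith) (by linarith)
      have h10 := hstep γ β h7 hb h8 (by linarith) h2 (by linarith)
      calc _ = ‖(J γ - J (η - 2 * π)) + (J β - J γ)‖ₑ := by rw [add_comm, sub_add_sub_cancel]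
        _ ≤ _ := enorm_add_le _ _
        _ ≤ _ := add_le_add h9 h10
        _ ≤ _ := htrans _ _ _ h8 (by linarith)
  obtain ⟨k, hk⟩ := exists_nat_gt (2 * π / (r / 2))
  rw [div_lt_iff₀ (by positivity)] at hk
  refine (hind k η (hη.not_isCutAngle j) (by linarith [pi_pos]) le_rfl (by linarith)).trans ?_
  refine Finset.sum_le_sum_of_subset fun l hl => ?_
  simp only [Finset.mem_filter, Finset.mem_univ, true_and] at hl
  exact Finset.mem_erase.2 ⟨hl.1, Finset.mem_univ _⟩

end InverseFactorialData

section Hankel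

/-- The integral of `g` along the line `Im w = a` from `+∞` to `ℓ`, up to the line `Im w = b`, and
back to `+∞`. -/
noncomputable def hankel (a b ℓ : ℝ) (g : ℂ → ℂ) : ℂ :=
  -(∫ x in Ioi ℓ, g (x + a * I)) + (∫ α in a..b, g (ℓ + α * I) * I) + ∫ x in Ioi ℓ, g (x + b * I)

/-- The integrals in `hankel` exist. -/
structure HankelIntegrable (a b ℓ : ℝ) (g : ℂ → ℂ) : Prop where
  left : IntegrableOn (fun x : ℝ => g (x + a * I)) (Ioi ℓ)
  arc : IntervalIntegrable (fun α : ℝ => g (ℓ + α * I)) volume a b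
  right : IntegrableOn (fun x : ℝ => g (x + b * I)) (Ioi ℓ)

theorem hankel_const_mul (a b ℓ : ℝ) (c : ℂ) (g : ℂ → ℂ) :
    hankel a b ℓ (fun w => c * g w) = c * hankel a b ℓ g := by
  simp only [hankel, mul_assoc, integral_const_mul, intervalIntegral.integral_const_mul]
  ring

theorem HankelIntegrable.const_mul {a b ℓ : ℝ} {g : ℂ → ℂ} (h : HankelIntegrable a b ℓ g) (c : ℂ) :
    HankelIntegrable a b ℓ (fun w => c * g w) :=
  ⟨h.left.const_mul c, h.arc.const_mul c, h.right.const_mul c⟩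

theorem HankelIntegrable.add {a b ℓ : ℝ} {f g : ℂ → ℂ} (hf : HankelIntegrable a b ℓ f)
    (hg : HankelIntegrable a b ℓ g) : HankelIntegrable a b ℓ (fun w => f w + g w) :=
  ⟨hf.left.add hg.left, hf.arc.add hg.arc, hf.right.add hg.right⟩

theorem hankel_add {a b ℓ : ℝ} {f g : ℂ → ℂ} (hf : HankelIntegrable a b ℓ f)
    (hg : HankelIntegrable a b ℓ g) :
    hankel a b ℓ (fun w => f w + g w) = hankel a b ℓ f + hankel a b ℓ g := by
  simp only [hankel, add_mul]
  rw [integral_add hf.left hg.left, integral_add hf.right hg.right,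
    intervalIntegral.integral_add (hf.arc.mul_const _) (hg.arc.mul_const _)]
  ring

theorem HankelIntegrable.sum {ι : Type*} {s : Finset ι} {a b ℓ : ℝ} {f : ι → ℂ → ℂ}
    (h : ∀ i ∈ s, HankelIntegrable a b ℓ (f i)) :
    HankelIntegrable a b ℓ (fun w => ∑ i ∈ s, f i w) ∧
      hankel a b ℓ (fun w => ∑ i ∈ s, f i w) = ∑ i ∈ s, hankel a b ℓ (f i) := by
  classical
  induction s using Finset.induction_on with
  | empty => exact ⟨⟨by simp, by simp, by simp⟩, by simp [hankel]⟩
  | insert i s hi ih =>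
    obtain ⟨h1, h2⟩ := ih fun k hk => h k (Finset.mem_insert_of_mem hk)
    have h3 := h i (Finset.mem_insert_self _ _)
    simp only [Finset.sum_insert hi]
    exact ⟨h3.add h1, by rw [hankel_add h3 h1, h2]⟩

/-- The contour can be moved to the two lines if the integrand decays as `Re w → -∞`. -/
theorem hankel_eq_sub {a b ℓ C δ X : ℝ} (hab : a ≤ b) (hδ : 0 < δ) {g : ℂ → ℂ}
    (hd : DifferentiableOn ℂ g {w | a ≤ w.im ∧ w.im ≤ b ∧ w.re ≤ ℓ})
    (hb : ∀ w : ℂ, a ≤ w.im → w.im ≤ b → w.re ≤ X → ‖g w‖ ≤ C * Real.exp (δ * w.re))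
    (ha : Integrable fun x : ℝ => g (x + a * I))
    (hb' : Integrable fun x : ℝ => g (x + b * I)) :
    hankel a b ℓ g = (∫ x : ℝ, g (x + b * I)) - ∫ x : ℝ, g (x + a * I) := by
  have hlim : ∀ α, (Integrable fun x : ℝ => g (x + α * I)) →
      Tendsto (fun R : ℝ => ∫ x in (-R)..ℓ, g (x + α * I)) atTop
        (𝓝 (∫ x in Iic ℓ, g (x + α * I))) := fun α h =>
    intervalIntegral_tendsto_integral_Iic ℓ h.integrableOn tendsto_neg_atTop_atBot
  have hside : Tendsto (fun R : ℝ => ∫ y in a..b, g ((-R : ℝ) + y * I)) atTop (𝓝 0) := by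
    have h0 : Tendsto (fun R : ℝ => C * Real.exp (δ * -R) * |b - a|) atTop (𝓝 0) := by
      have : Tendsto (fun R : ℝ => Real.exp (δ * -R)) atTop (𝓝 0) :=
        Real.tendsto_exp_atBot.comp (tendsto_neg_atTop_atBot.const_mul_atBot hδ)
      simpa using (this.const_mul C).mul_const |b - a|
    refine squeeze_zero_norm' ?_ h0
    filter_upwards [eventually_ge_atTop (-X)] with R hR
    refine intervalIntegral.norm_integral_le_of_norm_le_const fun y hy => ?_
    rw [uIoc_of_le hab] at hy
    have := hb ((-R : ℝ) + y * I) (by simpa using hy.1.le) (by simpa using hy.2)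
      (by simp; linarith)
    simpa using this
  have hrect : ∀ᶠ R : ℝ in atTop, (∫ x in (-R)..ℓ, g (x + a * I)) -
      (∫ x in (-R)..ℓ, g (x + b * I)) + I * (∫ y in a..b, g (ℓ + y * I)) -
      I * (∫ y in a..b, g ((-R : ℝ) + y * I)) = 0 := by
    filter_upwards [eventually_ge_atTop (-ℓ)] with R hR
    have := integral_boundary_rect_eq_zero_of_differentiableOn g
      ((-R : ℝ) + a * I) (ℓ + b * I) (hd.mono fun w hw => ?_)
    · simpa using this
    · obtain ⟨h1, h2⟩ := mem_reProdIm.1 hw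
      rw [uIcc_of_le (by simpa using hab)] at h2
      rw [uIcc_of_le (by simp; linarith)] at h1
      have h3 := h1.2
      have h4 := h2.1
      have h5 := h2.2
      simp at h3 h4 h5
      exact ⟨h4, h5, h3⟩
  have hL := (((hlim a ha).sub (hlim b hb')).add (tendsto_const_nhds
    (x := I * ∫ y in a..b, g (ℓ + y * I)))).sub (hside.const_mul I)
  have h1 := tendsto_nhds_unique (hL.congr' hrect) tendsto_const_nhds
  have hsplit : ∀ α, (Integrable fun x : ℝ => g (x + α * I)) →
      (∫ x : ℝ, g (x + α * I)) = (∫ x in Iic ℓ, g (x + α * I)) +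
        ∫ x in Ioi ℓ, g (x + α * I) := fun α h => by
    rw [← setIntegral_univ, ← Iic_union_Ioi (a := ℓ), setIntegral_union (Iic_disjoint_Ioi le_rfl)
      measurableSet_Ioi h.integrableOn h.integrableOn]
  rw [hankel, hsplit a ha, hsplit b hb', intervalIntegral.integral_mul_const]
  linear_combination h1

theorem hankel_deriv {a b ℓ : ℝ} {f f' : ℂ → ℂ} (hf : ∀ w, HasDerivAt f (f' w) w)
    (hi : HankelIntegrable a b ℓ f')
    (ha : Tendsto (fun x : ℝ => f (x + a * I)) atTop (𝓝 0))
    (hb : Tendsto (fun x : ℝ => f (x + b * I)) atTop (𝓝 0)) : hankel a b ℓ f' = 0 := by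
  have h1 : ∀ α x : ℝ, HasDerivAt (fun x : ℝ => f (x + α * I)) (f' (x + α * I)) x := fun α x => by
      have h2 : HasDerivAt (fun x : ℝ => (x : ℂ) + α * I) 1 x := ofRealCLM.hasDerivAt.add_const _
      have h3 := (hf (x + α * I)).comp x h2
      rw [mul_one] at h3; exact h3
  have h2 : ∀ α : ℝ, HasDerivAt (fun α : ℝ => f (ℓ + α * I))
      (f' (ℓ + α * I) * I) α := fun α => by
    have h2 : HasDerivAt (fun α : ℝ => (ℓ : ℂ) + α * I) (1 * I) α :=
      (ofRealCLM.hasDerivAt.mul_const _).const_add _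
    have h3 := (hf (ℓ + α * I)).comp α h2
    rw [one_mul] at h3; exact h3
  rw [hankel, integral_Ioi_of_hasDerivAt_of_tendsto' (fun x _ => h1 a x) hi.left ha,
    integral_Ioi_of_hasDerivAt_of_tendsto' (fun x _ => h1 b x) hi.right hb,
    intervalIntegral.integral_eq_sub_of_hasDerivAt (fun α _ => h2 α) (hi.arc.mul_const _)]
  ring

/-- The integrand of Hankel's integral for `1 / Γ(z)`, as a function of the logarithm. -/
noncomputable def hankelKernel (z w : ℂ) : ℂ := exp (exp w) * exp ((1 - z) * w)

theorem continuous_hankelKernel (z : ℂ) : Continuous (hankelKernel z) := by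
  unfold hankelKernel; fun_prop

theorem hankelKernel_sub_two_pi (z w : ℂ) : hankelKernel z (w - 2 * π * I) =
    exp (2 * π * I * z) * hankelKernel z w := by
  have h : (1 - z) * (w - 2 * π * I) = 2 * π * I * z + (1 - z) * w - 2 * π * I := by ring
  rw [hankelKernel, exp_periodic.sub_eq, h, exp_periodic.sub_eq, exp_add, hankelKernel]
  ring

theorem integral_hankelKernel {z : ℂ} (hz : z.re < 1) {β : ℝ} (h₁ : π / 2 < β)
    (h₂ : β < 3 * π / 2) : (Integrable fun x : ℝ => hankelKernel z (x + β * I)) ∧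
    ∫ x : ℝ, hankelKernel z (x + β * I) = exp ((1 - z) * (π * I)) * Gamma (1 - z) := by
  have hs : 0 < (1 - z).re := by simpa using hz
  have hp := pi_pos
  have hmove : ∀ a b : ℝ, a ≤ b → π / 2 < a → b < 3 * π / 2 →
      (Integrable fun x : ℝ => hankelKernel z (x + a * I)) ∧
      ∫ x : ℝ, hankelKernel z (x + a * I) = ∫ x : ℝ, hankelKernel z (x + b * I) := by
    intro a b hab ha hb
    obtain ⟨C, -, hC⟩ := exists_norm_exp_exp_mul_le hs ha hb
    refine ⟨?_, integral_horizontal_line_eq (X := 0) hab hs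
      (fun w _ => DifferentiableAt.differentiableWithinAt (by unfold hankelKernel; fun_prop))
      fun w h1 h2 _ => hC w h1 h2⟩
    refine integrable_of_exp_bound (C := C) ?_ hs fun x => ?_
    · exact ((continuous_hankelKernel z).comp (by fun_prop)).aestronglyMeasurable
    · simpa [hankelKernel] using hC (x + a * I) (by simp) (by simpa using hab)
  refine ⟨(hmove β β le_rfl h₁ h₂).1, ?_⟩
  have hπ : ∫ x : ℝ, hankelKernel z (x + β * I) = ∫ x : ℝ, hankelKernel z (x + π * I) := by
    rcases le_total β π with h | h
    · exact (hmove β π h h₁ (by linarith)).2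
    · exact (hmove π β h (by linarith) h₂).2.symm
  have himg : Real.exp '' univ = Ioi 0 := by rw [image_univ, Real.range_exp]
  rw [hπ, Gamma_eq_integral hs, GammaIntegral, ← himg,
    integral_image_eq_integral_abs_deriv_smul MeasurableSet.univ
    (fun x _ => (Real.hasDerivAt_exp x).hasDerivWithinAt) Real.exp_injective.injOn, setIntegral_univ,
    ← integral_const_mul]
  refine integral_congr_ae (Eventually.of_forall fun x => ?_)
  have h1 : ((Real.exp x : ℝ) : ℂ) ≠ 0 := by exact_mod_cast (exp_pos x).ne'
  beta_reduce
  rw [abs_of_pos (exp_pos x), real_smul, cpow_def_of_ne_zero h1,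
    ← ofReal_log (exp_pos x).le, Real.log_exp, hankelKernel, exp_add,
    exp_pi_mul_I, ofReal_exp, ofReal_exp, mul_add, exp_add]
  have h2 : exp ((1 - z) * x) = exp x * exp (x * (1 - z - 1)) := by rw [← exp_add]; congr 1; ring
  rw [h2, mul_neg_one]
  push_cast
  ring

theorem exists_hankelKernel_bound (z : ℂ) {β : ℝ} (h₁ : π / 2 < β) (h₂ : β < 3 * π / 2) :
    ∃ C : ℝ, ∀ w : ℂ, w.im = β → 0 ≤ w.re → ‖hankelKernel z w‖ ≤ C * Real.exp (-1 * w.re) := by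
  obtain ⟨k, hk⟩ := exists_nat_gt z.re
  obtain ⟨C, hC0, hC⟩ := exists_norm_exp_exp_mul_le (M := 1 - z + k) (by simp; linarith) h₁ h₂
  refine ⟨C, fun w hw h0 => ?_⟩
  have h1 : hankelKernel z w = exp (exp w) * exp ((1 - z + k) * w) * exp ((-k : ℝ) * w) := by
    rw [hankelKernel, mul_assoc, ← exp_add ((1 - z + k) * w)]; congr 2; push_cast; ring
  have h2 : ‖exp ((-k : ℝ) * w)‖ ≤ 1 := by
    rw [norm_exp, re_ofReal_mul, Real.exp_le_one_iff]
    have : (0 : ℝ) ≤ k := Nat.cast_nonneg k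
    nlinarith
  have h3 := hC w hw.ge hw.le
  have h4 : Real.exp (-(1 - z + k).re * |w.re|) ≤ Real.exp (-1 * w.re) := by
    rw [abs_of_nonneg h0, exp_le_exp]
    have : 1 ≤ (1 - z + k).re := by simp; linarith
    nlinarith
  rw [h1, norm_mul]
  calc _ ≤ C * Real.exp (-(1 - z + k).re * |w.re|) * 1 := by gcongr
    _ ≤ _ := by rw [mul_one]; gcongr

theorem hankelKernel_line_left (z logu : ℂ) (b x : ℝ) :
    hankelKernel z (x + (b - 2 * π : ℝ) * I + logu) =
      exp (2 * π * I * z) * hankelKernel z (x + b * I + logu) := by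
  rw [← hankelKernel_sub_two_pi]; congr 1; push_cast; ring

theorem hankelKernel_line {b : ℝ} {logu : ℂ} (h₁ : π / 2 < b + logu.im)
    (h₂ : b + logu.im < 3 * π / 2) (z : ℂ) (ℓ : ℝ) :
    IntegrableOn (fun x : ℝ => hankelKernel z (x + b * I + logu)) (Ioi ℓ) ∧
      Tendsto (fun x : ℝ => hankelKernel z (x + b * I + logu)) atTop (𝓝 0) := by
  obtain ⟨C, hC⟩ := exists_hankelKernel_bound z h₁ h₂
  have hcont : Continuous fun x : ℝ => hankelKernel z (x + b * I + logu) :=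
    (continuous_hankelKernel z).comp (by fun_prop)
  have hO : (fun x : ℝ => ‖hankelKernel z (x + b * I + logu)‖) =O[atTop]
      fun x => Real.exp (-1 * x) := by
    refine Asymptotics.IsBigO.of_bound (|C| * Real.exp (-1 * logu.re)) ?_
    filter_upwards [eventually_ge_atTop (-logu.re)] with x hx
    have h3 := hC (x + b * I + logu) (by simp) (by simp; linarith)
    have h4 : (x + b * I + logu : ℂ).re = x + logu.re := by simp
    rw [h4, mul_add, Real.exp_add] at h3
    rw [norm_norm, Real.norm_of_nonneg (exp_pos _).le]
    refine h3.trans ?_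
    have := le_abs_self C
    have h5 := mul_pos (exp_pos (-1 * x)) (exp_pos (-1 * logu.re))
    nlinarith
  constructor
  · rw [IntegrableOn, ← integrable_norm_iff hcont.aestronglyMeasurable]
    exact integrable_of_isBigO_exp_neg one_pos hcont.norm.continuousOn hO
  · rw [tendsto_zero_iff_norm_tendsto_zero]
    refine hO.trans_tendsto ?_
    simpa using Real.tendsto_exp_neg_atTop_nhds_zero

theorem hankelIntegrable_hankelKernel {b : ℝ} {logu : ℂ} (h₁ : π / 2 < b + logu.im)
    (h₂ : b + logu.im < 3 * π / 2) (z : ℂ) (ℓ : ℝ) :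
    HankelIntegrable (b - 2 * π) b ℓ fun w => hankelKernel z (w + logu) := by
  have h := (hankelKernel_line h₁ h₂ z ℓ).1
  refine ⟨?_, ?_, h⟩
  · simp only [hankelKernel_line_left]
    exact h.const_mul _
  · exact ((continuous_hankelKernel z).comp (by fun_prop)).intervalIntegrable _ _

theorem hankel_hankelKernel_step {b : ℝ} {logu : ℂ} (h₁ : π / 2 < b + logu.im)
    (h₂ : b + logu.im < 3 * π / 2) (z : ℂ) (ℓ : ℝ) :
    hankel (b - 2 * π) b ℓ (fun w => hankelKernel z (w + logu)) =
      z * hankel (b - 2 * π) b ℓ (fun w => hankelKernel (z + 1) (w + logu)) := by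
  have i1 := hankelIntegrable_hankelKernel h₁ h₂ z ℓ
  have i2 := (hankelIntegrable_hankelKernel h₁ h₂ (z + 1) ℓ).const_mul (-z)
  have hlim := (hankelKernel_line h₁ h₂ (z + 1) ℓ).2
  have h := hankel_deriv (f := fun w => hankelKernel (z + 1) (w + logu))
    (f' := fun w => hankelKernel z (w + logu) + -z * hankelKernel (z + 1) (w + logu)) (fun w => by
      have h1 : HasDerivAt (fun w : ℂ => w + logu) 1 w := (hasDerivAt_id w).add_const _
      have h2 := h1.cexp.cexp.mul (h1.const_mul (1 - (z + 1))).cexp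
      refine h2.congr_deriv ?_
      have h3 : exp ((1 - z) * (w + logu)) = exp (w + logu) * exp ((1 - (z + 1)) * (w + logu)) := by
        rw [← exp_add]; congr 1; ring
      rw [hankelKernel, hankelKernel, h3]; ring)
    (i1.add i2)
    (by simp only [hankelKernel_line_left]; simpa using hlim.const_mul _) hlim
  rw [hankel_add i1 i2, hankel_const_mul] at h
  linear_combination h

/-- Hankel's integral. -/
theorem hankel_hankelKernel {b : ℝ} {logu : ℂ} (h₁ : π / 2 < b + logu.im)
    (h₂ : b + logu.im < 3 * π / 2) (ℓ : ℝ) {z : ℂ} (hz : ∀ m : ℤ, z ≠ m) :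
    hankel (b - 2 * π) b ℓ (fun w => hankelKernel z (w + logu)) = 2 * π * I / Gamma z := by
  have hind : ∀ k : ℕ, ∀ z : ℂ, (∀ m : ℤ, z ≠ m) → z.re < k + 1 →
      hankel (b - 2 * π) b ℓ (fun w => hankelKernel z (w + logu)) = 2 * π * I / Gamma z := by
    intro k
    induction k with
    | zero =>
      intro z hz hre
      rw [Nat.cast_zero, zero_add] at hre
      obtain ⟨hi, hv⟩ := integral_hankelKernel hre h₁ h₂
      have hline : ∀ x : ℝ, (x + b * I + logu : ℂ) =
          ((x + logu.re : ℝ) : ℂ) + (b + logu.im : ℝ) * I := fun x => by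
        nth_rewrite 1 [← re_add_im logu]; push_cast; ring
      have hint : Integrable fun x : ℝ => hankelKernel z (x + b * I + logu) := by
        simp only [hline]; exact hi.comp_add_right logu.re
      have hval : ∫ x : ℝ, hankelKernel z (x + b * I + logu) =
          exp ((1 - z) * (π * I)) * Gamma (1 - z) := by
        rw [← hv]; simp only [hline]
        exact integral_add_right_eq_self
          (fun x : ℝ => hankelKernel z (x + (b + logu.im : ℝ) * I)) logu.re
      have hs : 0 < (1 - z).re := by simpa using hre
      rw [hankel_eq_sub (C := Real.exp (Real.exp logu.re) * Real.exp ((1 - z).re * logu.re +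
          |(1 - z).im| * (|b - 2 * π| + |b| + |logu.im|))) (X := 0) (by linarith [pi_pos]) hs
          (fun w _ => DifferentiableAt.differentiableWithinAt (by unfold hankelKernel; fun_prop)) ?_
          (by simp only [hankelKernel_line_left]; exact hint.const_mul _) hint]
      · simp only [hankelKernel_line_left]
        rw [integral_const_mul, hval]
        have hsin : sin (π * z) ≠ 0 := fun h => by
          obtain ⟨m, hm⟩ := sin_eq_zero_iff.1 h
          have hp : (π : ℂ) ≠ 0 := by exact_mod_cast Real.pi_ne_zero
          exact hz m (mul_left_cancel₀ hp (by rw [hm]; ring))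
        have hG : Gamma z ≠ 0 := Gamma_ne_zero fun m h => hz (-m) (by
          rw [h]; push_cast; rfl)
        have hrefl := Gamma_mul_Gamma_one_sub z
        rw [eq_div_iff hsin] at hrefl
        have e1 : exp ((1 - z) * (π * I)) = -exp (-(π * z) * I) := by
          have : (1 - z) * (π * I) = -(π * z) * I + π * I := by ring
          rw [this, exp_add, exp_pi_mul_I]; ring
        have e2 : exp (2 * π * I * z) * exp (-(π * z) * I) = exp (π * z * I) := by
          rw [← exp_add]; congr 1; ring
        rw [eq_div_iff hG, e1]
        have e3 : sin (π * z) = (exp (-(π * z) * I) - exp (π * z * I)) * I / 2 := rfl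
        rw [e3] at hrefl
        linear_combination (2 * I) * hrefl + Gamma (1 - z) * Gamma z * e2 -
          Gamma z * Gamma (1 - z) * (exp (-(π * z) * I) - exp (π * z * I)) * I_sq
      · intro w h3 h4 h5
        have h6 : (w + logu).im = w.im + logu.im := by simp
        have h7 : (w + logu).re = w.re + logu.re := by simp
        rw [hankelKernel, norm_mul, mul_assoc]
        gcongr
        · rw [norm_exp, exp_le_exp]
          refine (re_le_norm _).trans ?_
          rw [norm_exp, exp_le_exp, h7]; linarith
        · rw [norm_exp, ← Real.exp_add, exp_le_exp, mul_re, h6, h7]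
          have h8 : |(1 - z).im * (w.im + logu.im)| ≤
              |(1 - z).im| * (|b - 2 * π| + |b| + |logu.im|) := by
            rw [abs_mul]
            gcongr
            refine (abs_add_le _ _).trans ?_
            gcongr
            rw [abs_le]
            constructor <;> linarith [neg_abs_le (b - 2 * π), le_abs_self b,
              abs_nonneg (b - 2 * π), abs_nonneg b]
          linarith [neg_abs_le ((1 - z).im * (w.im + logu.im))]
    | succ k ih =>
      intro z hz hre
      have hz' : ∀ m : ℤ, z - 1 ≠ m := fun m h => hz (m + 1) (by
        rw [← sub_add_cancel z 1, h]; push_cast; rfl)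
      have h3 := ih (z - 1) hz' (by push_cast at hre; simp; linarith)
      have h0 : z - 1 ≠ 0 := by simpa using hz' 0
      have hG : Gamma (z - 1) ≠ 0 := Gamma_ne_zero fun m h => hz' (-m) (by
        rw [h]; push_cast; rfl)
      have h4 := Gamma_add_one (z - 1) h0
      rw [sub_add_cancel] at h4
      rw [hankel_hankelKernel_step h₁ h₂, sub_add_cancel] at h3
      rw [h4, ← mul_right_inj' h0, h3]
      field_simp
  obtain ⟨k, hk⟩ := exists_nat_gt z.re
  exact hind k z hz (by linarith)

end Hankel

namespace InverseFactorialData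

variable {n : ℕ} (D : InverseFactorialData n)

theorem integral_Ioi_eq_integral_exp {ρ : ℝ} (hρ : 0 < ρ) (F : ℝ → ℂ) :
    ∫ x in Ioi ρ, F x = ∫ x in Ioi (Real.log ρ), Real.exp x * F (Real.exp x) := by
  have himg : Real.exp '' Ioi (Real.log ρ) = Ioi ρ := by
    ext y
    refine ⟨?_, fun hy => ⟨Real.log y, Real.log_lt_log hρ hy, Real.exp_log (hρ.trans hy)⟩⟩
    rintro ⟨x, hx, rfl⟩
    exact (log_lt_iff_lt_exp hρ).1 hx
  rw [← himg, integral_image_eq_integral_abs_deriv_smul measurableSet_Ioi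
    (fun x _ => (Real.hasDerivAt_exp x).hasDerivWithinAt) Real.exp_injective.injOn]
  simp only [abs_of_pos (exp_pos _), real_smul]

theorem Y_eq_hankel (j : Fin n) (η : ℝ) {ρ : ℝ} (hρ : 0 < ρ) (u : ℂ) :
    D.Y j η ρ u = (2 * π * I)⁻¹ * hankel (η - 2 * π) η (Real.log ρ)
      (fun w => exp (u * (D.lam j + exp w)) * D.borel j w * exp w) := by
  simp only [Y, hankel, integral_Ioi_eq_integral_exp hρ, Real.log_exp]
  refine congrArg₂ _ rfl (congrArg₂ _ (congrArg₂ _ (congrArg _ ?_) ?_) ?_)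
  · refine integral_congr_ae (Eventually.of_forall fun x => ?_)
    beta_reduce
    rw [exp_add, ofReal_exp]; ring
  · refine intervalIntegral.integral_congr fun α _ => ?_
    rw [exp_add, ← ofReal_exp, Real.exp_log hρ]; ring
  · refine integral_congr_ae (Eventually.of_forall fun x => ?_)
    beta_reduce
    rw [exp_add, ofReal_exp]; ring

/-- The integrand of `Y_j` without the first terms of the expansion of `y_j`. -/
noncomputable def tailIntegrand (j : Fin n) (N : ℕ) (logu w : ℂ) : ℂ :=
  exp (exp (w + logu)) * (exp w * exp ((N - D.mu j) * w) * D.scaledTail j N w)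

/-- The coefficients of the expansion of `Y_j`, up to a common factor. -/
noncomputable def headCoeff (j : Fin n) (logu : ℂ) (s : ℕ) : ℂ :=
  D.borelCoeff j s * exp ((s - D.mu j) * D.baseLog j) * exp ((D.mu j - s - 1) * logu)

theorem borel_integrand_eq (j : Fin n) (N : ℕ) (logu w : ℂ) :
    exp (exp logu * (D.lam j + exp w)) * D.borel j w * exp w =
      exp (D.lam j * exp logu) * (D.tailIntegrand j N logu w +
        ∑ s ∈ range N, D.headCoeff j logu s * hankelKernel (D.mu j - s) (w + logu)) := by
  have h1 : D.borel j w = exp ((N - D.mu j) * w) * D.scaledTail j N w +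
      exp ((N - D.mu j) * w) * D.principalPart j N w := by
    have : exp ((N - D.mu j) * w) * exp ((D.mu j - N) * w) = 1 := by
      rw [← exp_add, ← exp_zero]; congr 1; ring
    rw [scaledTail]; linear_combination -D.borel j w * this
  have h2 : exp (exp logu * (D.lam j + exp w)) =
      exp (D.lam j * exp logu) * exp (exp (w + logu)) := by
    rw [← exp_add, exp_add w]; congr 1; ring
  have h3 : exp (exp (w + logu)) * (exp ((N - D.mu j) * w) * D.principalPart j N w * exp w) =
      ∑ s ∈ range N, D.headCoeff j logu s * hankelKernel (D.mu j - s) (w + logu) := by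
    rw [principalPart, mul_sum, sum_mul, mul_sum]
    refine sum_congr rfl fun s _ => ?_
    have h4 : exp ((D.mu j - s - 1) * logu) * exp ((1 - (D.mu j - s)) * (w + logu)) =
        exp ((N - D.mu j) * w) * exp ((s - N) * w) * exp w := by
      rw [← exp_add, ← exp_add, ← exp_add]; congr 1; ring
    rw [headCoeff, hankelKernel]
    linear_combination -(D.borelCoeff j s * exp ((s - D.mu j) * D.baseLog j) *
      exp (exp (w + logu))) * h4
  rw [← h3, h1, h2, tailIntegrand]
  ring

theorem headCoeff_div_Gamma (j : Fin n) (logu : ℂ) (s : ℕ) :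
    D.headCoeff j logu s / Gamma (D.mu j - s) = (exp logu)⁻¹ * (D.coeff j s *
      exp ((D.mu j - s) * (D.logLam j + logu - π * I))) := by
  have hG : Gamma (D.mu j - s) ≠ 0 := Gamma_ne_zero fun m h =>
    D.mu_not_int j (s - m) (by
      rw [← mu, ← sub_add_cancel (D.mu j) s, h]; push_cast; ring)
  have h1 : exp ((s - D.mu j) * D.baseLog j) * exp ((D.mu j - s - 1) * logu) = exp (-logu) *
        exp ((D.mu j - s) * (D.logLam j + logu - π * I)) := by
    rw [← exp_add, ← exp_add, baseLog]; congr 1; ring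
  rw [div_eq_iff hG, headCoeff, borelCoeff, ← exp_neg]
  linear_combination D.coeff j s * Gamma (D.mu j - s) * h1

variable [Fact (2 ≤ n)]

theorem scaledTail_sub_two_pi {j : Fin n} (N : ℕ) {w : ℂ} (hw : w ∈ D.star j) :
    D.scaledTail j N (w - 2 * π * I) = D.scaledTail j N w := by
  have h1 : ∀ m : ℤ, ∀ z : ℂ, exp (z + m * (2 * π * I)) = exp z :=
    fun m z => by rw [exp_add, exp_int_mul_two_pi_mul_I, mul_one]
  have h2 : D.borel j (w - 2 * π * I) = exp (2 * π * I * D.mu j) * D.borel j w := by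
    rw [D.borel_eq hw, D.borel_eq (D.star_sub_two_pi.2 hw), D.borelSol_sub_two_pi hw]; rfl
  have h3 : exp ((D.mu j - N) * (w - 2 * π * I)) *
      exp (2 * π * I * D.mu j) = exp ((D.mu j - N) * w) := by
    rw [← exp_add, ← h1 N ((D.mu j - N) * w)]; congr 1; push_cast; ring
  have h4 : D.principalPart j N (w - 2 * π * I) = D.principalPart j N w := by
    refine sum_congr rfl fun s _ => ?_
    rw [← h1 (N - s) ((s - N) * w)]; congr 2; push_cast; ring
  rw [scaledTail, scaledTail, h2, h4, ← mul_assoc, h3]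

theorem tailIntegrand_sub_two_pi {j : Fin n} (N : ℕ) (logu : ℂ) {w : ℂ} (hw : w ∈ D.star j) :
    D.tailIntegrand j N logu (w - 2 * π * I) =
      exp (2 * π * I * D.mu j) * D.tailIntegrand j N logu w := by
  have h1 : exp ((N - D.mu j) * (w - 2 * π * I)) =
      exp (2 * π * I * D.mu j) * exp ((N - D.mu j) * w) := by
    rw [← exp_add, ← mul_one (exp (_ + _)), ← exp_int_mul_two_pi_mul_I (-(N : ℤ)), ← exp_add]
    congr 1; push_cast; ring
  rw [tailIntegrand, tailIntegrand, D.scaledTail_sub_two_pi N hw, h1, sub_add_eq_add_sub,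
    exp_periodic.sub_eq, exp_periodic.sub_eq]
  ring

theorem tailIntegrand_eq {j : Fin n} {N : ℕ} (hM : 0 < ((N : ℂ) - D.mu j + 1).re) {logu w : ℂ}
    (hw : w ∈ D.star j) (h₁ : π / 2 < (w + logu).im) (h₂ : (w + logu).im < 3 * π / 2) :
    D.tailIntegrand j N logu w = exp ((D.mu j - N) * logu) / (2 * π * I) *
      (D.hyperIntegrand j N logu w - D.hyperIntegrand j N logu (w - 2 * π * I)) := by
  have h := hyperF_sub_hyperF hM h₁ h₂
  have h1 : exp ((D.mu j - N) * logu) * exp ((N - D.mu j + 1 - 1) * (w + logu)) =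
      exp ((N - D.mu j) * w) := by rw [← exp_add]; congr 1; ring
  rw [hyperIntegrand, hyperIntegrand, D.scaledTail_sub_two_pi N hw, exp_periodic.sub_eq,
    sub_add_eq_add_sub w, ← mul_sub, h, tailIntegrand, ← h1]
  have := two_pi_I_ne_zero
  field_simp

/-- The remainder as a difference of two ray integrals. -/
theorem remainder_eq {η : ℝ} (hη : D.Admissible η) (j : Fin n) {ρ : ℝ} (hρ : 0 < ρ)
    (hρ' : ∀ l : Fin n, l ≠ j → ρ < ‖D.lam l - D.lam j‖) {N : ℕ}
    (hN : max 0 D.growth < (N : ℝ) - (D.mu j).re) {logu : ℂ} (hu : π / 2 - η < logu.im)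
    (hu' : logu.im < 3 * π / 2 - η) :
    D.remainder j η ρ N logu = -(D.jumpFactor j)⁻¹ * exp (D.lam j * exp logu) *
      exp ((D.mu j - N) * logu) *
        (D.rayIntegral j N logu η - D.rayIntegral j N logu (η - 2 * π)) := by
  have hp := pi_pos
  have hN0 := (max_lt_iff.1 hN).1
  have hM : 0 < ((N : ℂ) - D.mu j + 1).re := by simp; linarith
  have h₁ : π / 2 < η + logu.im := by linarith
  have h₂ : η + logu.im < 3 * π / 2 := by linarith
  have hline : ∀ x : ℝ, (x + η * I : ℂ) ∈ D.star j := fun x =>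
    D.mem_star_of_not_isCutAngle (by simpa using hη.not_isCutAngle j)
  have hleft : ∀ x : ℝ, (x + (η - 2 * π : ℝ) * I : ℂ) =
      x + η * I - 2 * π * I := fun x => by push_cast; ring
  have hray : ∀ α : ℝ, |α + logu.im| < 3 * π / 2 → ¬ D.IsCutAngle j α →
      Integrable fun x : ℝ => D.hyperIntegrand j N logu (x + α * I) := fun α h3 h4 => by
    obtain ⟨δ, hδ, h⟩ := D.exists_rayIntegral_eq hN h3
    exact (h α α le_rfl (by linarith) (by linarith) fun _ => h4).1
  have i1 := hray η (by rw [abs_lt]; constructor <;> linarith) (hη.not_isCutAngle j)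
  have i2 := hray (η - 2 * π) (by rw [abs_lt]; constructor <;> linarith)
    (hη.not_isCutAngle_sub j)
  set ℓ := Real.log ρ with hℓ
  set c := exp ((D.mu j - N) * logu) / (2 * π * I) with hc
  have htail : ∀ x : ℝ, D.tailIntegrand j N logu (x + η * I) =
      c * (D.hyperIntegrand j N logu (x + η * I) -
        D.hyperIntegrand j N logu (x + (η - 2 * π : ℝ) * I)) := fun x => by
    rw [hleft, D.tailIntegrand_eq hM (hline x) (by simpa using h₁) (by simpa using h₂)]
  have htail' : ∀ x : ℝ, D.tailIntegrand j N logu (x + (η - 2 * π : ℝ) * I) =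
      exp (2 * π * I * D.mu j) * D.tailIntegrand j N logu (x + η * I) :=
    fun x => by rw [hleft, D.tailIntegrand_sub_two_pi N logu (hline x)]
  have hint : Integrable fun x : ℝ => D.tailIntegrand j N logu (x + η * I) := by
    simp only [htail]; exact (i1.sub i2).const_mul c
  have hint' : Integrable fun x : ℝ => D.tailIntegrand j N logu (x + (η - 2 * π : ℝ) * I) := by
    simp only [htail']; exact hint.const_mul _
  have hstar : ∀ w : ℂ, w.re ≤ ℓ → w ∈ D.star j := fun w hw =>
    D.disc_subset_star j (D.mem_disc_of_gap (x₀ := ℓ)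
      (fun l hl => by rw [hℓ, Real.exp_log hρ]; exact hρ' l hl) hw)
  have hdiff : ∀ w : ℂ, w.re ≤ ℓ → DifferentiableAt ℂ (D.tailIntegrand j N logu) w := fun w hw =>
    DifferentiableAt.mul (by fun_prop) (DifferentiableAt.mul (by fun_prop)
      (D.differentiableAt_scaledTail N (hstar w hw)))
  obtain ⟨X, C, hXC⟩ := D.exists_norm_scaledTail_le j N
  have hC0 : 0 ≤ C := (norm_nonneg _).trans (hXC X (by simp))
  have hcollapse := hankel_eq_sub (ℓ := ℓ) (δ := 1) (X := min X 0)
    (C := Real.exp (Real.exp logu.re) * (Real.exp (|((N : ℂ) - D.mu j).im| *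
      (|η - 2 * π| + |η|)) * C)) (by linarith) one_pos
    (fun w hw => (hdiff w hw.2.2).differentiableWithinAt) (fun w h3 h4 h5 => by
      rw [le_min_iff] at h5
      have h6 : ‖exp (exp (w + logu))‖ ≤ Real.exp (Real.exp logu.re) := by
        rw [norm_exp, exp_le_exp]
        refine (re_le_norm _).trans ?_
        rw [norm_exp, exp_le_exp, add_re]; linarith [h5.2]
      have h7 : ‖exp w‖ = Real.exp (1 * w.re) := by rw [norm_exp, one_mul]
      have h8 : ‖exp ((N - D.mu j) * w)‖ ≤
          Real.exp (|((N : ℂ) - D.mu j).im| * (|η - 2 * π| + |η|)) := by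
        refine (norm_exp_mul_le _ (B := |η - 2 * π| + |η|) ?_).trans
          (mul_le_of_le_one_right (exp_pos _).le ?_)
        · rw [abs_le]
          constructor <;> linarith [neg_abs_le (η - 2 * π), le_abs_self η,
            abs_nonneg (η - 2 * π), abs_nonneg η]
        · rw [Real.exp_le_one_iff]
          refine mul_nonpos_of_nonneg_of_nonpos ?_ h5.2
          simp; linarith
      have h9 := hXC w h5.1
      rw [tailIntegrand, norm_mul, norm_mul, norm_mul, h7]
      calc _ ≤ Real.exp (Real.exp logu.re) * (Real.exp (1 * w.re) *
            Real.exp (|((N : ℂ) - D.mu j).im| * (|η - 2 * π| + |η|)) * C) := by gcongr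
        _ = _ := by ring) hint' hint
  have harc : IntervalIntegrable (fun α : ℝ => D.tailIntegrand j N logu (ℓ + α * I)) volume
      (η - 2 * π) η := by
    refine Continuous.intervalIntegrable ?_ _ _
    refine continuous_iff_continuousAt.2 fun α => ?_
    exact ContinuousAt.comp (g := D.tailIntegrand j N logu) (f := fun α : ℝ => (ℓ + α * I : ℂ))
      (hdiff _ (by simp)).continuousAt (by fun_prop)
  have hT : HankelIntegrable (η - 2 * π) η ℓ (D.tailIntegrand j N logu) :=
    ⟨hint'.integrableOn, harc, hint.integrableOn⟩
  obtain ⟨hS, hSval⟩ := HankelIntegrable.sum (s := range N) (a := η - 2 * π) (b := η)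
    (ℓ := ℓ) (f := fun s w => D.headCoeff j logu s * hankelKernel (D.mu j - s) (w + logu))
    fun s _ => (hankelIntegrable_hankelKernel h₁ h₂ (D.mu j - s) ℓ).const_mul _
  have hterm : ∀ s, hankel (η - 2 * π) η ℓ
      (fun w => D.headCoeff j logu s * hankelKernel (D.mu j - s) (w + logu)) =
      2 * π * I * ((exp logu)⁻¹ * (D.coeff j s *
        exp ((D.mu j - s) * (D.logLam j + logu - π * I)))) := fun s => by
    rw [hankel_const_mul, hankel_hankelKernel h₁ h₂ ℓ (fun m h => D.mu_not_int j (m + s) (by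
      rw [← mu, ← sub_add_cancel (D.mu j) s, h]; push_cast; ring)), ← D.headCoeff_div_Gamma]
    ring
  have hrays : hankel (η - 2 * π) η ℓ (D.tailIntegrand j N logu) =
      (1 - exp (2 * π * I * D.mu j)) * (c *
        (D.rayIntegral j N logu η - D.rayIntegral j N logu (η - 2 * π))) := by
    rw [hcollapse]
    simp only [htail']
    rw [integral_const_mul]
    simp only [htail]
    rw [integral_const_mul, integral_sub i1 i2, rayIntegral, rayIntegral]
    ring
  have h2π := two_pi_I_ne_zero
  have hμ := sub_ne_zero.2 (D.exp_two_pi_mu_ne_one j)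
  rw [remainder, D.Y_eq_hankel j η hρ]
  simp only [D.borel_integrand_eq j N logu]
  rw [hankel_const_mul, hankel_add hT hS, hSval, sum_congr rfl fun s _ => hterm s,
    ← mul_sum, ← mul_sum, hrays, hc, jumpFactor]
  set E := exp (2 * π * I * D.mu j)
  generalize ∑ s ∈ range N, D.coeff j s * _ = S
  field_simp
  ring

end InverseFactorialData

theorem mainTheorem4 {n : ℕ} (hn : 2 ≤ n) (D : InverseFactorialData n) (j : Fin n)
    (η : ℝ) (hη : D.Admissible η)
    (hθ : ∀ l₁ l₂ : Fin n, l₁ ≠ j → l₂ ≠ j → l₁ ≠ l₂ →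
      D.connectionCoeff η l₁ j ≠ 0 → D.connectionCoeff η l₂ j ≠ 0 →
        D.theta η j l₁ ≠ D.theta η j l₂)
    (N : ℕ) (hN : max 0 D.growth < (N : ℝ) - (D.mu j).re)
    (hμ : ∀ l : Fin n, l ≠ j → D.connectionCoeff η l j ≠ 0 → (D.mu l).re < 1)
    (ρ : ℝ) (hρ : 0 < ρ) (hρ' : ∀ l : Fin n, l ≠ j → ρ < ‖D.lam l - D.lam j‖)
    (logu : ℂ) (hu : Real.pi / 2 - η < logu.im) (hu' : logu.im < 3 * Real.pi / 2 - η) :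
    ‖D.remainder j η ρ N logu‖ₑ ≤
        ‖Complex.exp (D.lam j * Complex.exp logu) * (Complex.exp logu)⁻¹‖ₑ *
          ∑ l ∈ Finset.univ.erase j,
            ‖D.connectionCoeff η l j‖ₑ *
              ‖Complex.exp ((D.mu j - N) * (D.logDiff η l j + logu))‖ₑ *
              D.deltaIntegral η N l j *
              hyperterminantSup (N - D.mu j + 1) (D.theta η j l + logu.im) ∧
      (∀ l : Fin n, l ≠ j → D.connectionCoeff η l j ≠ 0 →
        hyperterminantSup (N - D.mu j + 1) (D.theta η j l + logu.im) < ⊤ ∧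
        ((∀ p : Fin n, p ≠ j → D.theta η j p = D.theta η j l →
            ‖D.lam l - D.lam j‖ < ‖D.lam p - D.lam j‖ → (D.mu p).re < 1) →
          D.deltaIntegral η N l j < ⊤)) ∧
      ∀ l : Fin n, l ≠ j →
        (∀ s : ℝ, 0 < s → s < 1 → D.lam j + s * (D.lam l - D.lam j) ∈ D.cutPlane η) →
          (η - Real.pi < D.theta η j l →
            D.IsCutPlaneConnectionCoeff η l j (D.connectionCoeff η l j)) ∧
          (D.theta η j l < η - Real.pi →
            D.IsCutPlaneConnectionCoeff η l j
              (Complex.exp (2 * Real.pi * Complex.I * D.mu l) * D.connectionCoeff η l j)) := by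
  have : Fact (2 ≤ n) := ⟨hn⟩
  have hu2 : ∀ θ ∈ Icc (η - 2 * π) η, |θ + logu.im| < 3 * π / 2 := fun θ h => by
    rw [abs_lt]; constructor <;> linarith [h.1, h.2]
  have hM : 1 < ((N : ℂ) - D.mu j + 1).re := by
    rw [max_lt_iff] at hN; simp; linarith [hN.1]
  refine ⟨?_, fun l hl hK => ⟨hyperterminantSup_lt_top hM (hu2 _ ?_), fun hb => ?_⟩,
    fun l hl hseg => D.isCutPlaneConnectionCoeff_connectionCoeff hη hl hseg⟩
  · rw [D.remainder_eq hη j hρ hρ' hN hu hu', enorm_mul]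
    refine (mul_le_mul_right (D.enorm_rayIntegral_sub_le hη hθ hN hμ hu2) _).trans (le_of_eq ?_)
    rw [mul_sum, mul_sum]
    refine sum_congr rfl fun l _ => ?_
    have h1 : ‖(D.jumpFactor j)⁻¹‖ₑ * ‖D.jumpFactor j‖ₑ = 1 := by
      rw [← enorm_mul, inv_mul_cancel₀ (D.jumpFactor_ne_zero j), enorm_one]
    rw [InverseFactorialData.jumpBound, mul_add, exp_add, ← exp_neg]
    simp only [enorm_mul, enorm_neg]
    rw [← one_mul (‖exp (D.lam j * exp logu)‖ₑ * ‖exp (-logu)‖ₑ * _), ← h1]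
    ring
  · exact ⟨(D.theta_mem η j l).1.le, (D.theta_mem η j l).2⟩
  · exact D.deltaIntegral_lt_top hl hN (hμ l hl hK) hb
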